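/- **Setting.** Let $d\ge 2$, let $\mathcal J$ be a (univariate wavelet) index set, and let $w_j(l)\ge 1$ be the $H^1$-norm of the $l$-th wavelet in direction $j$. Put $\boldsymbol D_j=\operatorname{diag}(w_j)$, $t_\lambda=\sum_{j}w_j(\lambda_j)^2$ and $\boldsymbol D=\operatorname{diag}(\sqrt{t_\lambda})$ on $\mathcal J^d$. Let $\boldsymbol A=\sum_n c_n\bigotimes_{j=1}^d \boldsymbol A^{(j)}_{n_j}$ be a symmetric, finite sum of tensor products of infinite matrices on $\mathcal J$. Each component $\boldsymbol A^{(j)}_\nu$ has orders $p,q\in\mathbb N_0$ of differentiation on the test and trial side, and in each term with $c_n\neq0$ the orders over all $j$ sum to at most one on each side. For $\delta\in(0,1)$, $0<h<\pi^2/(5(|\ln(\delta/2)|+4))$ and $n^+\ge h^{-1}\max\{4/\sqrt\pi,\sqrt{|\ln(\delta/2)|}\}$, let $\boldsymbol S^{-1}(\delta)$ be the diagonal matrix with entries $\sum_{k=-\infty}^{n^+}h\,\omega(kh)e^{-\ln^2(1+e^{kh})t_\lambda}$, where $\omega(x)=\frac{2}{\sqrt\pi}(1+e^{-x})^{-1}$.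 On a finite set $F$ of indices, let $\boldsymbol S^{-1}(\delta,\eta)$ be the same sum started at $k=-n$, with $n$ the least natural number such that $n\ge h^{-1}\big(\ln\frac2{\sqrt\pi}+|\ln\min\{\delta/2,\eta\}|+\frac12\ln\max_F t_\lambda\big)$. Let $\boldsymbol A^\delta=\boldsymbol S^{-1}(\delta)\boldsymbol A\boldsymbol S^{-1}(\delta)$ be bounded on $\ell_2(\mathcal J^d)$ with $\lambda_{\min}\|v\|^2\le\langle v,\boldsymbol A^\delta v\rangle$, $\|\boldsymbol A^\delta\|\le\lambda_{\max}$, $\lambda_{\min}>0$, $\kappa=\lambda_{\max}/\lambda_{\min}>1$. Let $\boldsymbol f^\delta=\boldsymbol S^{-1}(\delta)\boldsymbol f\in\ell_2$ and $\boldsymbol A^\delta\boldsymbol u^\delta=\boldsymbol f^\delta$. Let $T$ be a binary dimension tree, $|r(\cdot)|_\infty$ the maximal rank of the matricizations over the nodes of $T$ (for $\boldsymbol A$, viewed as a tensor of order $d$ over $\mathcal J\times\mathcal J$), and assume $|r(\boldsymbol A)|_\infty,|r(\boldsymbol f)|_\infty<\infty$. **Norms.** $\pi_j(v)[l]=(\sum_{\lambda_j=l}|v_\lambda|^2)^{1/2}$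 and $\operatorname{supp}_j(v)=\operatorname{supp}\pi_j(v)$; $\|x\|_{\mathcal A_s}=\sup_{\varepsilon>0}\varepsilon\,\min\{N:\exists y,\ \#\operatorname{supp}y\le N,\ \|x-y\|\le\varepsilon\}^s$; for a strictly increasing sequence $\gamma$ with $\gamma(0)=1$, $\gamma(n)\to\infty$ and $\sup_n\gamma(n+1)/\gamma(n)<\infty$, $\|v\|_{\mathcal A(\gamma)}=\|v\|+\sup_N\gamma(N)\inf_{|r(w)|_\infty\le N}\|v-w\|$ and $\gamma^{-1}(x)=\max\{n:\gamma(n)\le x\}$ (and $0$ if $x<1$). **Subroutines.** $\mathcal T(v,\varepsilon)$ is a hierarchical singular value truncation of $v$ with error at most $\varepsilon$ and smallest possible maximal rank. A truncation applies successively, from the root to the leaves of $T$, the orthogonal projections onto leading left singular vectors of the matricizations of $v$. $\mathcal C(v,\varepsilon)$ restricts $v$ to the product set obtained by keeping the fewest largest entries of all the $\pi_j(v)$ such that the $\ell_2$-norm of the discarded ones is at most $\varepsilon$. $\mathbf{EXPAND}(\Lambda,r,\alpha)$ adds to $\Lambda_1,\dots,\Lambda_d$ the one-dimensional sets kept by $\mathcal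 C(r,\sqrt{1-\alpha^2}\|r\|)$. For a tolerance $\tau'$ and a vector $v$ put $\eta(\tau',v)=\min\{\frac{1-\delta}2,\frac{\tau'(1-\delta)}{3(C_f\|\boldsymbol f^\delta\|+2\|\boldsymbol A^\delta\|\|v\|)}\}$. $\mathbf{RES}(v)$, for $v$ supported in the product set $\Lambda$, returns $\tilde r=R_{\tilde\Lambda}\boldsymbol S^{-1}(\delta,\eta)(\boldsymbol f_{\varepsilon'}-\boldsymbol A\boldsymbol S^{-1}(\delta,\eta)v)$ with $\|(\boldsymbol f^\delta-\boldsymbol A^\delta v)-\tilde r\|\le\omega_1\|\tilde r\|$. Here $\eta=\eta(\tau',v)$, $\varepsilon'=\tau'/(3(1+\delta)(2+\delta))$ and $c\,\omega_1\|\tilde r\|\le\tau'\le\omega_1\|\tilde r\|$, $\tau'>0$. Up to a fixed factor, $\tilde\Lambda$ has the smallest $\sum_j\#\tilde\Lambda_j$ among the product sets that contain $\Lambda$ and $\operatorname{supp}\boldsymbol f_{\varepsilon'}$ and satisfy $\|(I-R_{\tilde\Lambda})\boldsymbol A^\delta v\|\le(1+\delta)^2\varepsilon'$. $\mathbf{PCG}(u,\Lambda,\mathrm{tol})$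 is the truncated conjugate gradient method for the Galerkin system on $\Lambda$, stopped at the first $x^{(i)}$ with $\|r^{(i)}\|\le \mathrm{tol}$, where $r^{(i)}=R_\Lambda(\boldsymbol f^\delta-\boldsymbol A^\delta x^{(i)})$: $x^{(0)}=u$, $d^{(0)}=r^{(0)}+\varepsilon_1^{(0)}$, $\alpha_i=\frac{\langle r^{(i)},d^{(i)}\rangle}{\langle d^{(i)},\boldsymbol A^\delta d^{(i)}\rangle}$, $x^{(i+1)}=x^{(i)}+\alpha_id^{(i)}+\varepsilon_2^{(i+1)}$, $\beta_i=-\frac{\langle r^{(i+1)},\boldsymbol A^\delta d^{(i)}\rangle}{\langle d^{(i)},\boldsymbol A^\delta d^{(i)}\rangle}$, $d^{(i+1)}=r^{(i+1)}+\beta_id^{(i)}+\varepsilon_1^{(i+1)}$. The perturbation $\varepsilon_2$ is the error of a hierarchical singular value truncation. The perturbation $\varepsilon_1$ comes from such a truncation and from replacing $\boldsymbol S^{-1}(\delta)$ by $\boldsymbol S^{-1}(\delta,\eta)$ in $r^{(i)}$, with $\eta=\eta(c'\,\mathrm{tol},x^{(i)})$ for a fixed $c'>0$. They satisfy $\|\varepsilon_1^{(i)}\|\le\min\{\frac{\delta_1}2,\frac{\delta_2\|r^{(i)}\|}{2|\beta_{i-1}|\|d^{(i-1)}\|}\}\|r^{(i)}\|$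 (only the first bound for $i=0$) and $\|\varepsilon_2^{(i+1)}\|\le\theta\mu\lambda_{\max}^{-1}\|r^{(i)}\|$. **Algorithm (HT-AWGM), target tolerance $\varepsilon>0$.** Start with $\boldsymbol u^{(0,0)}=0$, a nonempty finite product set $\Lambda^{(0,0)}$, $\|\boldsymbol r^{(0,0)}\|:=\omega_0$, and put $\omega_0^{(k)}=(\omega_3+\omega_4+\omega_5)^k\omega_0$. At $(k,m)$ compute $\boldsymbol u^{(k,m+1)}=\mathbf{PCG}(\boldsymbol u^{(k,m)},\Lambda^{(k,m)},\omega_2\|\boldsymbol r^{(k,m)}\|)$ and $\boldsymbol r^{(k,m+1)}=\mathbf{RES}(\boldsymbol u^{(k,m+1)})$; stop if $(1+\omega_1)\|\boldsymbol r^{(k,m+1)}\|\le\varepsilon$. If $(1+\omega_1)\|\boldsymbol r^{(k,m+1)}\|\le\omega_3\omega_0^{(k)}$ or $m=M$, put $\boldsymbol u^{(k+1,0)}=\mathcal C(\mathcal T(\boldsymbol u^{(k,m+1)},\omega_4\lambda_{\min}^{-1}\omega_0^{(k)}),\omega_5\lambda_{\min}^{-1}\omega_0^{(k)})$, $\Lambda^{(k+1,0)}=\prod_j\operatorname{supp}_j(\boldsymbol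 u^{(k+1,0)})$, $\boldsymbol r^{(k+1,0)}=\mathbf{RES}(\boldsymbol u^{(k+1,0)})$ and go to $(k+1,0)$. Otherwise put $\Lambda^{(k,m+1)}=\mathbf{EXPAND}(\Lambda^{(k,m)},\boldsymbol r^{(k,m+1)},\alpha)$ and go to $(k,m+1)$. **Assumptions.** 1. Outer parameters: $\omega_0\ge\|\boldsymbol f^\delta\|$, $\omega_0>0$, $0<\omega_1<\alpha<1$, $0<\omega_2<\frac{(1-\omega_1)(\alpha-\omega_1)}{1+\omega_1}\kappa^{-1}$, $\omega_3>0$, $\omega_4>\sqrt{2d-3}\,\omega_3$, $\omega_5>\sqrt d(1+\sqrt{2d-3})\omega_3$, $\omega_3+\omega_4+\omega_5<1$, and $M\ge M^*=\lceil|\ln(\omega_3\kappa^{-1/2})/\ln\vartheta|\rceil$ with $\vartheta^2=1-(\frac{\alpha-\omega_1}{1+\omega_1})^2\kappa^{-1}+(\frac{\omega_2}{1-\omega_1})^2\kappa$. 2. PCG parameters: $0<\tau<(1+\kappa^2)^{-1/2}$, $\delta_1,\delta_2>0$, $0<\gamma_0<1$, $\frac32\delta_1+\delta_2\le\tau^{-2}-(1+\kappa^2)$,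 $\gamma_0\le(1-\frac{\delta_1}2)\tau$, $\theta=\sqrt{1-\gamma_0^2/(2\kappa)}$, $0\le\mu<\theta^{-1}-1$. 3. Approximability: $\|\boldsymbol u^\delta\|_{\mathcal A(\gamma)}<\infty$ and $\|\pi_j(\boldsymbol u^\delta)\|_{\mathcal A_s}<\infty$ for all $j$, with $0<s<s^*$. All scaled components $\boldsymbol D_j^{-p}\boldsymbol A^{(j)}_\nu\boldsymbol D_j^{-q}$ are bounded and $s^*$-compressible. 4. Right hand side: for every $\varepsilon>0$ there is given a finitely supported $\boldsymbol f_\varepsilon$ with $\|\boldsymbol D^{-1}(\boldsymbol f-\boldsymbol f_\varepsilon)\|\le\varepsilon$ and $\|\boldsymbol S^{-1}(\delta)\boldsymbol f_\varepsilon\|\le C_f\|\boldsymbol f^\delta\|$, $C_f\ge 1$. With $\boldsymbol f^\delta_\varepsilon=\boldsymbol S^{-1}(\delta)\boldsymbol f_\varepsilon$ and a constant independent of $\varepsilon$, $\sum_j\#\operatorname{supp}_j(\boldsymbol f_\varepsilon^\delta)\lesssim\varepsilon^{-1/s}(\sum_j\|\pi_j(\boldsymbol f^\delta)\|_{\mathcal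 A_s})^{1/s}$ and $\sum_j\|\pi_j(\boldsymbol f_\varepsilon^\delta)\|_{\mathcal A_s}\lesssim\sum_j\|\pi_j(\boldsymbol f^\delta)\|_{\mathcal A_s}$. 5. Excess regularity: for some $t>0$ and all $j$, $\|\boldsymbol D_j^{-1+t}\pi_j(\boldsymbol f_\varepsilon)\|\lesssim\|\boldsymbol D_j^{-1+t}\pi_j(\boldsymbol f)\|<\infty$ for all $\varepsilon>0$, and $\boldsymbol D_j^{-p+t}\boldsymbol A^{(j)}_\nu\boldsymbol D_j^{-q-t}$ is bounded for every component. **Conclusion.** Let $I^*=\lceil|\ln(\omega_2\kappa^{-1/2})/\ln(\theta(1+\mu))|\rceil$. There is a constant $C>0$, independent of $k$, $m$, of the target tolerance $\varepsilon$ and of the choices made within the subroutines, such that every iterate $\boldsymbol u^{(k,m)}\neq\boldsymbol u^\delta$ produced by the algorithm satisfies $$|r(\boldsymbol u^{(k,m)})|_\infty\le C\,|r(\boldsymbol A)|_\infty^{mI^*}\Big[1+\big|\ln\|\boldsymbol u^\delta-\boldsymbol u^{(k,m)}\|\big|+\max\Big\{0,\ln\sum_{j=1}^d\|\pi_j(\boldsymbol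 u^\delta)\|_{\mathcal A_s}\Big\}\Big]^{2mI^*}\Big[\gamma^{-1}\Big(C\frac{\|\boldsymbol u^\delta\|_{\mathcal A(\gamma)}}{\|\boldsymbol u^\delta-\boldsymbol u^{(k,m)}\|}\Big)+|r(\boldsymbol f)|_\infty\Big].$$ -/

import Mathlib

open scoped ENNReal

noncomputable section

namespace HTAWGM

/-! ### Sequence spaces and tensors -/

/-- Real square summable families over `ι`. -/
abbrev L2 (ι : Type*) := lp (fun _ : ι => ℝ) 2

/-- The `ℓ₂`-norm of an arbitrary real family, with values in `[0, ∞]`. -/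
def ell2 {ι : Type*} (v : ι → ℝ) : ℝ≥0∞ :=
  (∑' i, ENNReal.ofReal (v i ^ 2)) ^ (1 / 2 : ℝ)

open Classical in
/-- The family that equals `g` on the finite set `F` and vanishes outside `F`. -/
def ofFinset {ι : Type*} (F : Finset ι) (g : ι → ℝ) : L2 ι :=
  ∑ i ∈ F, lp.single 2 i (g i)

/-- Restriction of `v` to a finite index set, extended by zero. -/
def restr {ι : Type*} (F : Finset ι) (v : L2 ι) : L2 ι := ofFinset F v

open Classical in
/-- The canonical unit vector. -/
def unitVec {ι : Type*} (i : ι) : L2 ι := lp.single 2 i (1 : ℝ)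

/-- The multi-index with coordinates `μ` inside `α` and `lam` outside `α`. -/
def merge {d : ℕ} {I : Type*} (α : Finset (Fin d)) (μ : α → I) (lam : Fin d → I) : Fin d → I :=
  fun i => if h : i ∈ α then μ ⟨i, h⟩ else lam i

/-- The contraction `π_j(v)`: the `ℓ₂`-norms of the slices of `v` in direction `j`,
with values in `[0, ∞]`. -/
def econtr {d : ℕ} {J : Type*} (j : Fin d) (v : (Fin d → J) → ℝ) (l : J) : ℝ≥0∞ :=
  (∑' μ, Set.indicator {μ : Fin d → J | μ j = l} (fun μ => ENNReal.ofReal (v μ ^ 2)) μ)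
    ^ (1 / 2 : ℝ)

/-- The contraction `π_j(v)` as a real family. -/
def contr {d : ℕ} {J : Type*} (j : Fin d) (v : (Fin d → J) → ℝ) (l : J) : ℝ :=
  (econtr j v l).toReal

/-- The norm of the best `N`-term approximation class `𝒜_s`:
`sup_{ε > 0} ε (min {N : the best N-term error is at most ε})^s`. -/
def asNorm {J : Type*} (s : ℝ) (v : J → ℝ) : ℝ≥0∞ :=
  ⨆ (ε : ℝ) (_ : 0 < ε), ENNReal.ofReal ε *
    (⨅ (w : J → ℝ) (_ : ell2 (fun l => v l - w l) ≤ ENNReal.ofReal ε),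
      (((Function.support w).encard : ℕ∞) : ℝ≥0∞)) ^ s

/-! ### Hierarchical tensor format -/

/-- Binary dimension trees on `{1, …, d}`, given by their set of nodes. -/
structure IsDimTree {d : ℕ} (T : Finset (Finset (Fin d))) : Prop where
  root : Finset.univ ∈ T
  nonempty : ∀ α ∈ T, α.Nonempty
  laminar : ∀ α ∈ T, ∀ β ∈ T, α ⊆ β ∨ β ⊆ α ∨ Disjoint α β
  split : ∀ α ∈ T, 1 < α.card → ∃ β ∈ T, ∃ γ ∈ T, Disjoint β γ ∧ β ∪ γ = α

/-- Rank of the `α`-matricization of a tensor. -/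
def matRank {d : ℕ} {I : Type*} (α : Finset (Fin d)) (v : (Fin d → I) → ℝ) : ℕ∞ :=
  Cardinal.toENat (Module.rank ℝ (Submodule.span ℝ
    (Set.range fun lam : Fin d → I => fun μ : α → I => v (merge α μ lam))))

/-- The maximal hierarchical rank `|r(v)|_∞`. -/
def htRank {d : ℕ} {I : Type*} (T : Finset (Finset (Fin d))) (v : (Fin d → I) → ℝ) : ℕ∞ :=
  T.sup fun α => matRank α v

/-- The norm of the low-rank approximation class `𝒜(γ)`:
`‖v‖ + sup_N γ(N) inf {‖v - w‖ : |r(w)|_∞ ≤ N}`. -/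
def lowRankNorm {d : ℕ} {J : Type*} (T : Finset (Finset (Fin d))) (γ : ℕ → ℝ)
    (v : L2 (Fin d → J)) : ℝ≥0∞ :=
  ENNReal.ofReal ‖v‖ + ⨆ N : ℕ, ENNReal.ofReal (γ N) *
    ⨅ (w : L2 (Fin d → J)) (_ : htRank T w ≤ N), ENNReal.ofReal ‖v - w‖

/-- Inverse of a growth sequence: the largest `n` with `γ n ≤ x`
(and `0` if there is none). -/
def growthInv (γ : ℕ → ℝ) (x : ℝ) : ℕ := sSup {n : ℕ | γ n ≤ x}

/-- Singular value decomposition of the `α`-matricization of `v`, with `R` positive singular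
values in decreasing order. -/
structure IsSVD {d : ℕ} {J : Type*} (α : Finset (Fin d)) (v : (Fin d → J) → ℝ) {R : ℕ}
    (σ : Fin R → ℝ) (U : Fin R → L2 (α → J))
    (V : Fin R → L2 ((αᶜ : Finset (Fin d)) → J)) : Prop where
  pos : ∀ k, 0 < σ k
  anti : Antitone σ
  left : Orthonormal ℝ U
  right : Orthonormal ℝ V
  eq : ∀ lam : Fin d → J, v lam =
    ∑ k, σ k * U k (fun i => lam i) * V k (fun i => lam i)

/-- Application to `w`, in the coordinates in `α`, of the orthogonal projection onto the span
of the first `r` of the vectors `U`. -/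
def modeProj {d : ℕ} {J : Type*} {α : Finset (Fin d)} {R : ℕ} (U : Fin R → L2 (α → J)) (r : ℕ)
    (w : (Fin d → J) → ℝ) : (Fin d → J) → ℝ :=
  fun lam => ∑ k : Fin R, if (k : ℕ) < r then
    U k (fun i => lam i) * ∑' μ : α → J, U k μ * w (merge α μ lam) else 0

/-- `v'` is a truncation of `v` to ranks `r` by the hierarchical singular value decomposition:
the projections onto the leading left singular vectors of the matricizations of `v` are
applied successively, from the root of the tree to its leaves. -/
def IsHOSVD {d : ℕ} {J : Type*} (T : Finset (Finset (Fin d))) (v : L2 (Fin d → J))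
    (r : Finset (Fin d) → ℕ) (v' : L2 (Fin d → J)) : Prop :=
  ∃ (nodes : List (Finset (Fin d))) (R : Finset (Fin d) → ℕ)
    (U : ∀ α : Finset (Fin d), Fin (R α) → L2 (α → J)),
    nodes.Nodup ∧ (∀ α, α ∈ nodes ↔ α ∈ T ∧ α ≠ Finset.univ) ∧
    nodes.Pairwise (fun α β => ¬ α ⊂ β) ∧
    (∀ α ∈ nodes, ∃ σ V, IsSVD α v σ (U α) V) ∧
    ∀ lam, v' lam =
      nodes.foldl (fun w α => modeProj (U α) (r α) w) (fun μ => v μ) lam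

/-- Largest entry of a vector of ranks, over the nodes other than the root. -/
def maxRank {d : ℕ} (T : Finset (Finset (Fin d))) (r : Finset (Fin d) → ℕ) : ℕ :=
  (T.erase Finset.univ).sup r

/-- `v' = 𝒯(v, ε)`: a truncation with error at most `ε` and the smallest possible
maximal rank. -/
def IsTrunc {d : ℕ} {J : Type*} (T : Finset (Finset (Fin d))) (v : L2 (Fin d → J)) (ε : ℝ)
    (v' : L2 (Fin d → J)) : Prop :=
  ∃ r, IsHOSVD T v r v' ∧ ‖v - v'‖ ≤ ε ∧
    ∀ r' w, IsHOSVD T v r' w → ‖v - w‖ ≤ ε → maxRank T r ≤ maxRank T r'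

/-! ### Coarsening -/

/-- `∑_j ∑_{l ∉ Λ_j} π_j(v)[l]²`. -/
def contrTail {d : ℕ} {J : Type*} (v : (Fin d → J) → ℝ) (Λ : Fin d → Finset J) : ℝ≥0∞ :=
  ∑ j, ∑' l, Set.indicator ((Λ j : Set J)ᶜ) (fun l => econtr j v l ^ 2) l

/-- The one-dimensional index sets that are kept by the coarsening of `v` with tolerance `ε`:
the largest entries of all contractions are kept, and as few of them as possible such that
the contractions certify an error of at most `ε`. -/
structure IsCoarseSets {d : ℕ} {J : Type*} (v : (Fin d → J) → ℝ) (ε : ℝ)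
    (Λ : Fin d → Finset J) : Prop where
  accurate : contrTail v Λ ≤ ENNReal.ofReal (ε ^ 2)
  sorted : ∀ j, ∀ l ∈ Λ j, ∀ j', ∀ l' ∉ Λ j', econtr j' v l' ≤ econtr j v l
  minimal : ∀ Λ' : Fin d → Finset J, contrTail v Λ' ≤ ENNReal.ofReal (ε ^ 2) →
    ∑ j, (Λ j).card ≤ ∑ j, (Λ' j).card

/-- `v' = 𝒞(v, ε)`. -/
def IsCoarse {d : ℕ} {J : Type*} (v : L2 (Fin d → J)) (ε : ℝ) (v' : L2 (Fin d → J)) : Prop :=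
  ∃ Λ, IsCoarseSets v ε Λ ∧ v' = restr (Fintype.piFinset Λ) v

/-- `Λ' = EXPAND(Λ, r, a)`: bulk chasing with parameter `a`, realized by coarsening `r`. -/
def IsExpand {d : ℕ} {J : Type*} (Λ : Fin d → Finset J) (r : L2 (Fin d → J)) (a : ℝ)
    (Λ' : Fin d → Finset J) : Prop :=
  ∃ Λc, IsCoarseSets r (Real.sqrt (1 - a ^ 2) * ‖r‖) Λc ∧
    ∀ j, (Λ' j : Set J) = (Λ j : Set J) ∪ (Λc j : Set J)

/-! ### Infinite matrices -/

/-- The infinite matrix `B` is bounded on `ℓ₂` with norm at most `c`. -/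
def MatBound {J : Type*} (B : J → J → ℝ) (c : ℝ) : Prop :=
  ∀ (F : Finset J) (x y : J → ℝ), |∑ l ∈ F, ∑ m ∈ F, x l * B l m * y m| ≤
    c * Real.sqrt (∑ l ∈ F, x l ^ 2) * Real.sqrt (∑ m ∈ F, y m ^ 2)

/-- `s*`-compressibility of a bounded infinite matrix. -/
def IsCompressible {J : Type*} (sStar : ℝ) (B : J → J → ℝ) : Prop :=
  (∃ c, MatBound B c) ∧ ∀ s, 0 < s → s < sStar →
    ∃ (a b : ℕ → ℝ) (Bp : ℕ → J → J → ℝ), Summable a ∧ Summable b ∧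
      (∀ p, 0 ≤ a p ∧ 0 ≤ b p) ∧
      ∀ p : ℕ,
        (∀ l, {m | Bp p l m ≠ 0}.Finite ∧ ({m | Bp p l m ≠ 0}.ncard : ℝ) ≤ a p * 2 ^ p) ∧
        (∀ m, {l | Bp p l m ≠ 0}.Finite ∧ ({l | Bp p l m ≠ 0}.ncard : ℝ) ≤ a p * 2 ^ p) ∧
        MatBound (fun l m => B l m - Bp p l m) (b p * (2 : ℝ) ^ (-s * p))

/-! ### The discretized problem -/

/-- Data of the discretized problem over tensor product wavelet indices `Fin d → J`. -/
structure Problem (d K : ℕ) (J : Type*) where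
  /-- `w j l` is the `H¹`-norm of the `j`-th univariate wavelet with index `l`. -/
  w : Fin d → J → ℝ
  /-- One-dimensional components of the operator. -/
  comp : Fin d → Fin K → J → J → ℝ
  /-- Coefficients of the separable representation of the operator. -/
  coef : (Fin d → Fin K) → ℝ
  /-- Differentiation orders of the components on the test side. -/
  ordL : Fin d → Fin K → ℕ
  /-- Differentiation orders of the components on the trial side. -/
  ordR : Fin d → Fin K → ℕ
  /-- Right hand side. -/
  f : (Fin d → J) → ℝ
  /-- Approximations `f_ε` of the right hand side. -/
  fApp : ℝ → (Fin d → J) → ℝ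
  /-- Relative accuracy of the separable scaling. -/
  delta : ℝ
  /-- Step size of the exponential sum. -/
  h : ℝ
  /-- Upper summation index of the exponential sum. -/
  nPlus : ℕ

namespace Problem

variable {d K : ℕ} {J : Type*}

/-- The scaling weight; the exact scaling is `D = diag (√(weight))`. -/
def weight (P : Problem d K J) (lam : Fin d → J) : ℝ := ∑ j, P.w j (lam j) ^ 2

/-- The matrix of the (not preconditioned) operator. -/
def A (P : Problem d K J) (lam mu : Fin d → J) : ℝ :=
  ∑ n : Fin d → Fin K, P.coef n * ∏ j, P.comp j (n j) (lam j) (mu j)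

/-- The operator as a tensor of order `d` whose `j`-th index is a pair of indices. -/
def opTensor (P : Problem d K J) (q : Fin d → J × J) : ℝ :=
  P.A (fun j => (q j).1) (fun j => (q j).2)

/-- The `k`-th term of the exponential sum approximation of `1 / √t`. -/
def expTerm (P : Problem d K J) (t : ℝ) (k : ℤ) : ℝ :=
  P.h * (2 / Real.sqrt Real.pi * (1 + Real.exp (-(k * P.h)))⁻¹) *
    Real.exp (-(Real.log (1 + Real.exp (k * P.h))) ^ 2 * t)

/-- The diagonal of `S⁻¹(δ)`. -/
def sInv (P : Problem d K J) (lam : Fin d → J) : ℝ :=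
  ∑' k : Set.Iic (P.nPlus : ℤ), P.expTerm (P.weight lam) k

/-- The diagonal of the approximate scaling, with lower summation index `-n`. -/
def sInvApp (P : Problem d K J) (n : ℕ) (lam : Fin d → J) : ℝ :=
  ∑ k ∈ Finset.Icc (-(n : ℤ)) (P.nPlus : ℤ), P.expTerm (P.weight lam) k

/-- The lower summation index required for accuracy `η` of the scaling on `F`, so that
`S⁻¹(δ, η)` has the diagonal `sInvApp (numTerms η F)`; here `T` is the largest weight
occurring in `F`. -/
def numTerms (P : Problem d K J) (η : ℝ) (F : Finset (Fin d → J)) : ℕ :=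
  ⌈P.h⁻¹ * (Real.log (2 / Real.sqrt Real.pi) + |Real.log (min (P.delta / 2) η)| +
    1 / 2 * Real.log (F.fold max 1 P.weight))⌉₊

/-- `R_rows S⁻¹(δ, η) (g - A S⁻¹(δ, η) v)` for `v` supported in `cols`. -/
def approxRes (P : Problem d K J) (η : ℝ) (g : (Fin d → J) → ℝ) (rows cols : Finset (Fin d → J))
    (v : L2 (Fin d → J)) : L2 (Fin d → J) :=
  ofFinset rows fun lam => P.sInvApp (P.numTerms η rows) lam *
    (g lam - ∑ mu ∈ cols, P.A lam mu * (P.sInvApp (P.numTerms η rows) mu * v mu))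

/-- `‖D_j^a π_j(g)‖`. -/
def weightedContr (P : Problem d K J) (a : ℝ) (j : Fin d) (g : (Fin d → J) → ℝ) : ℝ≥0∞ :=
  (∑' l, (ENNReal.ofReal (P.w j l ^ a) * econtr j g l) ^ 2) ^ (1 / 2 : ℝ)

/-- Standing conditions on the discretization, and on the parameters of the scaling. -/
structure Standing (P : Problem d K J) : Prop where
  one_le_w : ∀ j l, 1 ≤ P.w j l
  symm : ∀ lam mu, P.A lam mu = P.A mu lam
  order : ∀ n, P.coef n ≠ 0 → ∑ j, P.ordL j (n j) ≤ 1 ∧ ∑ j, P.ordR j (n j) ≤ 1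
  delta_pos : 0 < P.delta
  delta_lt : P.delta < 1
  h_pos : 0 < P.h
  h_lt : P.h < Real.pi ^ 2 / (5 * (|Real.log (P.delta / 2)| + 4))
  nPlus_ge : P.h⁻¹ * max (4 / Real.sqrt Real.pi) (Real.sqrt |Real.log (P.delta / 2)|) ≤ P.nPlus

/-- `B` is the bounded operator `A^δ = S⁻¹(δ) A S⁻¹(δ)` on `ℓ₂`. -/
def IsScaledOp (P : Problem d K J) (B : L2 (Fin d → J) →L[ℝ] L2 (Fin d → J)) : Prop :=
  ∀ lam mu, B (unitVec mu) lam = P.sInv lam * P.A lam mu * P.sInv mu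

/-- The one-dimensional components, scaled according to their orders, are
`s*`-compressible. -/
def CompressibleComps (P : Problem d K J) (sStar : ℝ) : Prop :=
  ∀ j ν, IsCompressible sStar fun l m =>
    P.w j l ^ (-(P.ordL j ν : ℝ)) * P.comp j ν l m * P.w j m ^ (-(P.ordR j ν : ℝ))

/-- Efficient approximability of the right hand side. -/
structure RhsApprox (P : Problem d K J) (fδ : L2 (Fin d → J)) (cf s : ℝ) : Prop where
  finite : ∀ ε, 0 < ε → (Function.support (P.fApp ε)).Finite
  accurate : ∀ ε, 0 < ε →
    ell2 (fun lam => (Real.sqrt (P.weight lam))⁻¹ * (P.f lam - P.fApp ε lam)) ≤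
      ENNReal.ofReal ε
  stable : ∀ ε, 0 < ε →
    ell2 (fun lam => P.sInv lam * P.fApp ε lam) ≤ ENNReal.ofReal (cf * ‖fδ‖)
  sparse : ∃ C : ℝ, 0 < C ∧ ∀ ε, 0 < ε →
    ∑ j, (((Function.support fun l =>
        contr j (fun lam => P.sInv lam * P.fApp ε lam) l).encard : ℕ∞) : ℝ≥0∞) ≤
      ENNReal.ofReal (C * ε ^ (-1 / s)) * (∑ j, asNorm s (contr j fδ)) ^ (1 / s) ∧
    ∑ j, asNorm s (contr j fun lam => P.sInv lam * P.fApp ε lam) ≤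
      ENNReal.ofReal C * ∑ j, asNorm s (contr j fδ)

/-- Excess regularity of order `t` of the right hand side and of the operator. -/
structure ExcessRegular (P : Problem d K J) (t : ℝ) : Prop where
  rhs_finite : ∀ j, P.weightedContr (-1 + t) j P.f < ⊤
  rhs_stable : ∃ C : ℝ, 0 < C ∧ ∀ j ε, 0 < ε →
    P.weightedContr (-1 + t) j (P.fApp ε) ≤
      ENNReal.ofReal C * P.weightedContr (-1 + t) j P.f
  op : ∀ j ν, ∃ c, MatBound (fun l m =>
    P.w j l ^ (-(P.ordL j ν : ℝ) + t) * P.comp j ν l m * P.w j m ^ (-(P.ordR j ν : ℝ) - t)) c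

end Problem

/-! ### The algorithm -/

/-- Parameters of the algorithm. -/
structure Params where
  /-- Initial bound for the norm of the right hand side. -/
  ω0 : ℝ
  /-- Relative precision of the residual evaluation. -/
  ω1 : ℝ
  /-- Relative tolerance of the Galerkin solver. -/
  ω2 : ℝ
  /-- Error reduction before truncation and coarsening. -/
  ω3 : ℝ
  /-- Truncation tolerance. -/
  ω4 : ℝ
  /-- Coarsening tolerance. -/
  ω5 : ℝ
  /-- Bulk chasing parameter. -/
  α : ℝ
  /-- Maximal inner index. -/
  M : ℕ
  /-- Lower and upper spectral bounds of the scaled operator. -/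
  lamMin : ℝ
  lamMax : ℝ
  /-- Parameters of the truncated conjugate gradient method. -/
  τ : ℝ
  δ1 : ℝ
  δ2 : ℝ
  γcg : ℝ
  μ : ℝ
  /-- Stability constant of the approximations of the right hand side. -/
  cf : ℝ
  /-- Quasi-optimality constant of the index sets for the residual evaluation. -/
  cSet : ℝ
  /-- The absolute tolerance in the residual evaluation is at least `cRes` times the largest
  admissible one. -/
  cRes : ℝ
  /-- Accuracy of the scaling in the Galerkin solver, relative to the tolerance of the
  solver. -/
  cPre : ℝ

namespace Params

/-- Bound for the condition number. -/
def κ (Q : Params) : ℝ := Q.lamMax / Q.lamMin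

/-- `θ = √(1 - γ² / (2κ))`. -/
def θ (Q : Params) : ℝ := Real.sqrt (1 - Q.γcg ^ 2 / (2 * Q.κ))

/-- Reduction factor of the conjugate gradient method. -/
def rateCG (Q : Params) : ℝ := Q.θ * (1 + Q.μ)

/-- The bound `I*` on the number of conjugate gradient iterations. -/
def IStar (Q : Params) : ℕ := ⌈|Real.log (Q.ω2 * Q.κ ^ (-(1 / 2) : ℝ)) / Real.log Q.rateCG|⌉₊

/-- Reduction factor of the inner iteration. -/
def innerRate (Q : Params) : ℝ :=
  Real.sqrt (1 - ((Q.α - Q.ω1) / (1 + Q.ω1)) ^ 2 * Q.κ⁻¹ + (Q.ω2 / (1 - Q.ω1)) ^ 2 * Q.κ)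

/-- The number `M*` of inner iterations that suffices for the reduction by `ω3`. -/
def MStar (Q : Params) : ℕ :=
  ⌈|Real.log (Q.ω3 * Q.κ ^ (-(1 / 2) : ℝ)) / Real.log Q.innerRate|⌉₊

/-- `ω_0^{(k)}`. -/
def base (Q : Params) (k : ℕ) : ℝ := (Q.ω3 + Q.ω4 + Q.ω5) ^ k * Q.ω0

/-- Conditions on the parameters of the outer algorithm; `normF` is the norm of the scaled
right hand side. -/
structure OuterValid (Q : Params) (d : ℕ) (normF : ℝ) : Prop where
  lamMin_pos : 0 < Q.lamMin
  ω0_pos : 0 < Q.ω0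
  ω0_ge : normF ≤ Q.ω0
  ω1_pos : 0 < Q.ω1
  ω1_lt : Q.ω1 < Q.α
  α_lt : Q.α < 1
  ω2_pos : 0 < Q.ω2
  ω2_lt : Q.ω2 < (1 - Q.ω1) * (Q.α - Q.ω1) / (1 + Q.ω1) * Q.κ⁻¹
  ω3_pos : 0 < Q.ω3
  sum_lt : Q.ω3 + Q.ω4 + Q.ω5 < 1
  ω4_gt : Real.sqrt (2 * d - 3) * Q.ω3 < Q.ω4
  ω5_gt : Real.sqrt d * (1 + Real.sqrt (2 * d - 3)) * Q.ω3 < Q.ω5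
  M_ge : Q.MStar ≤ Q.M
  cf_ge : 1 ≤ Q.cf
  cSet_ge : 1 ≤ Q.cSet
  cRes_pos : 0 < Q.cRes
  cRes_lt : Q.cRes < 1
  cPre_pos : 0 < Q.cPre

/-- Conditions on the parameters of the truncated conjugate gradient method. -/
structure CGValid (Q : Params) : Prop where
  κ_gt : 1 < Q.κ
  τ_pos : 0 < Q.τ
  τ_lt : Q.τ < 1 / Real.sqrt (1 + Q.κ ^ 2)
  δ1_pos : 0 < Q.δ1
  δ2_pos : 0 < Q.δ2
  γ_pos : 0 < Q.γcg
  γ_lt : Q.γcg < 1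
  sum_le : 3 / 2 * Q.δ1 + Q.δ2 ≤ 1 / Q.τ ^ 2 - (1 + Q.κ ^ 2)
  γ_le : Q.γcg ≤ (1 - Q.δ1 / 2) * Q.τ
  μ_nonneg : 0 ≤ Q.μ
  μ_lt : Q.μ < Q.θ⁻¹ - 1

end Params

section Algorithm

variable {d K : ℕ} {J : Type*}

/-- Accuracy `η` of the scaling that is chosen for an absolute tolerance `tol` of the residual
at a vector of norm `x`. -/
def etaOf (P : Problem d K J) (Q : Params) (B : L2 (Fin d → J) →L[ℝ] L2 (Fin d → J))
    (fδ : L2 (Fin d → J)) (tol x : ℝ) : ℝ :=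
  min ((1 - P.delta) / 2) (tol * (1 - P.delta) / (3 * (Q.cf * ‖fδ‖ + 2 * ‖B‖ * x)))

/-- Galerkin residual on the product set generated by `Λ`. -/
def galRes (B : L2 (Fin d → J) →L[ℝ] L2 (Fin d → J)) (fδ : L2 (Fin d → J))
    (Λ : Fin d → Finset J) (x : L2 (Fin d → J)) : L2 (Fin d → J) :=
  restr (Fintype.piFinset Λ) (fδ - B x)

/-- Truncated conjugate gradient method for the Galerkin problem on `Λ`, with initial value `x0`,
stopped at the first iterate whose residual has norm at most `ω2 * ρ`. In the search
directions the scaling `S⁻¹(δ)` is replaced by `S⁻¹(δ, η)`. Directions and iterates may be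
truncated; the perturbation `ε₁` of a direction (by truncation and approximate scaling)
and the perturbation `ε₂` of an iterate (by truncation) obey the tolerances of the
method. -/
def IsPCG (P : Problem d K J) (Q : Params) (T : Finset (Finset (Fin d)))
    (B : L2 (Fin d → J) →L[ℝ] L2 (Fin d → J)) (fδ : L2 (Fin d → J))
    (Λ : Fin d → Finset J) (x0 : L2 (Fin d → J)) (ρ : ℝ) (xN : L2 (Fin d → J)) : Prop :=
  ∃ (N : ℕ) (x dir : ℕ → L2 (Fin d → J)),
    let F := Fintype.piFinset Λ
    let r : ℕ → L2 (Fin d → J) := fun i => galRes B fδ Λ (x i)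
    let rApp : ℕ → L2 (Fin d → J) := fun i =>
      P.approxRes (etaOf P Q B fδ (Q.cPre * (Q.ω2 * ρ)) ‖x i‖) P.f F F (x i)
    let a : ℕ → ℝ := fun i => inner ℝ (r i) (dir i) / inner ℝ (dir i) (B (dir i))
    let b : ℕ → ℝ := fun i =>
      -(inner ℝ (r (i + 1)) (B (dir i)) / inner ℝ (dir i) (B (dir i)))
    x 0 = x0 ∧ xN = x N ∧
    (∀ i < N, Q.ω2 * ρ < ‖r i‖) ∧ ‖r N‖ ≤ Q.ω2 * ρ ∧
    -- first direction
    (0 < N → (∃ rk, IsHOSVD T (rApp 0) rk (dir 0)) ∧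
      ‖dir 0 - r 0‖ ≤ Q.δ1 / 2 * ‖r 0‖) ∧
    -- further directions
    (∀ i, i + 1 < N →
      (∃ rk, IsHOSVD T (rApp (i + 1) + b i • dir i) rk (dir (i + 1))) ∧
      ‖dir (i + 1) - (r (i + 1) + b i • dir i)‖ ≤ Q.δ1 / 2 * ‖r (i + 1)‖ ∧
      2 * (|b i| * ‖dir i‖) * ‖dir (i + 1) - (r (i + 1) + b i • dir i)‖ ≤
        Q.δ2 * ‖r (i + 1)‖ ^ 2) ∧
    -- iterates
    (∀ i < N,
      (∃ rk, IsHOSVD T (x i + a i • dir i) rk (x (i + 1))) ∧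
      ‖x (i + 1) - (x i + a i • dir i)‖ ≤ Q.θ * Q.μ * Q.lamMax⁻¹ * ‖r i‖)

/-- The product set generated by `Λt` contains the one generated by `Λ` and the support of
`f_ε`, and carries the image of `v` under the scaled operator up to `(1 + δ)² ε`. -/
structure ResSets (P : Problem d K J) (B : L2 (Fin d → J) →L[ℝ] L2 (Fin d → J))
    (Λ : Fin d → Finset J) (v : L2 (Fin d → J)) (ε : ℝ) (Λt : Fin d → Finset J) : Prop where
  sub : ∀ j, Λ j ⊆ Λt j
  supp : Function.support (P.fApp ε) ⊆ Fintype.piFinset Λt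
  accurate : ‖B v - restr (Fintype.piFinset Λt) (B v)‖ ≤ (1 + P.delta) ^ 2 * ε

/-- `r` is an approximate residual at `v` (supported in the product set generated by `Λ`) with
relative precision `ω1`: it is evaluated on a quasi-minimal product set, with the
approximate right hand side `f_ε` and the approximate scaling `S⁻¹(δ, η)`. -/
def IsRes (P : Problem d K J) (Q : Params) (B : L2 (Fin d → J) →L[ℝ] L2 (Fin d → J))
    (fδ : L2 (Fin d → J)) (Λ : Fin d → Finset J) (v r : L2 (Fin d → J)) : Prop :=
  ∃ (tol ε : ℝ) (Λt : Fin d → Finset J), 0 < tol ∧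
    ε = tol / (3 * (1 + P.delta) * (2 + P.delta)) ∧
    ResSets P B Λ v ε Λt ∧
    (∀ Λ', ResSets P B Λ v ε Λ' →
      ((∑ j, (Λt j).card : ℕ) : ℝ) ≤ Q.cSet * ((∑ j, (Λ' j).card : ℕ) : ℝ)) ∧
    r = P.approxRes (etaOf P Q B fδ tol ‖v‖) (P.fApp ε) (Fintype.piFinset Λt)
      (Fintype.piFinset Λ) v ∧
    Q.cRes * (Q.ω1 * ‖r‖) ≤ tol ∧ tol ≤ Q.ω1 * ‖r‖ ∧
    ‖(fδ - B v) - r‖ ≤ Q.ω1 * ‖r‖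

/-- Criterion for leaving the inner loop `k` at index `m` with computed residual `r`. -/
def LeaveInner (Q : Params) (k m : ℕ) (r : L2 (Fin d → J)) : Prop :=
  (1 + Q.ω1) * ‖r‖ ≤ Q.ω3 * Q.base k ∨ m = Q.M

/-- From the state `(u, Λ, ρ)` at `(k, m)`, the inner loop is left without terminating the
algorithm, and truncation and coarsening yield `v = u^{(k+1, 0)}`. -/
def IsRestart (P : Problem d K J) (Q : Params) (T : Finset (Finset (Fin d)))
    (B : L2 (Fin d → J) →L[ℝ] L2 (Fin d → J)) (fδ : L2 (Fin d → J)) (tol : ℝ) (k m : ℕ)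
    (u : L2 (Fin d → J)) (Λ : Fin d → Finset J) (ρ : ℝ) (v : L2 (Fin d → J)) : Prop :=
  ∃ u' r z, IsPCG P Q T B fδ Λ u ρ u' ∧ IsRes P Q B fδ Λ u' r ∧
    tol < (1 + Q.ω1) * ‖r‖ ∧ LeaveInner Q k m r ∧
    IsTrunc T u' (Q.ω4 * Q.lamMin⁻¹ * Q.base k) z ∧
    IsCoarse z (Q.ω5 * Q.lamMin⁻¹ * Q.base k) v

/-- `Reach … tol k m u Λ ρ`: a run of the algorithm with target tolerance `tol` and initial index
sets `Λ0` arrives at the beginning of the inner step `(k, m)` with iterate `u = u^{(k,m)}`,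
index sets `Λ = Λ^{(k,m)}` and `ρ = ‖r^{(k,m)}‖`. -/
inductive Reach (P : Problem d K J) (Q : Params) (T : Finset (Finset (Fin d)))
    (B : L2 (Fin d → J) →L[ℝ] L2 (Fin d → J)) (fδ : L2 (Fin d → J)) (Λ0 : Fin d → Finset J)
    (tol : ℝ) : ℕ → ℕ → L2 (Fin d → J) → (Fin d → Finset J) → ℝ → Prop
  | start : Reach P Q T B fδ Λ0 tol 0 0 0 Λ0 Q.ω0
  | inner {k m : ℕ} {u u' r : L2 (Fin d → J)} {Λ Λ' : Fin d → Finset J} {ρ : ℝ} :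
      Reach P Q T B fδ Λ0 tol k m u Λ ρ →
      IsPCG P Q T B fδ Λ u ρ u' → IsRes P Q B fδ Λ u' r →
      tol < (1 + Q.ω1) * ‖r‖ → ¬ LeaveInner Q k m r → IsExpand Λ r Q.α Λ' →
      Reach P Q T B fδ Λ0 tol k (m + 1) u' Λ' ‖r‖
  | outer {k m : ℕ} {u v r : L2 (Fin d → J)} {Λ Λ' : Fin d → Finset J} {ρ : ℝ} :
      Reach P Q T B fδ Λ0 tol k m u Λ ρ →
      IsRestart P Q T B fδ tol k m u Λ ρ v →
      (∀ j, (Λ' j : Set J) = Function.support (contr j v)) →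
      IsRes P Q B fδ Λ' v r →
      Reach P Q T B fδ Λ0 tol (k + 1) 0 v Λ' ‖r‖

/-- `v` is the iterate `u^{(k,m)}` of some run of the algorithm with target tolerance `tol`. -/
inductive IsIterate (P : Problem d K J) (Q : Params) (T : Finset (Finset (Fin d)))
    (B : L2 (Fin d → J) →L[ℝ] L2 (Fin d → J)) (fδ : L2 (Fin d → J)) (Λ0 : Fin d → Finset J)
    (tol : ℝ) : ℕ → ℕ → L2 (Fin d → J) → Prop
  | start : IsIterate P Q T B fδ Λ0 tol 0 0 0
  | solve {k m : ℕ} {u u' : L2 (Fin d → J)} {Λ : Fin d → Finset J} {ρ : ℝ} :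
      Reach P Q T B fδ Λ0 tol k m u Λ ρ → IsPCG P Q T B fδ Λ u ρ u' →
      IsIterate P Q T B fδ Λ0 tol k (m + 1) u'
  | restart {k m : ℕ} {u v : L2 (Fin d → J)} {Λ : Fin d → Finset J} {ρ : ℝ} :
      Reach P Q T B fδ Λ0 tol k m u Λ ρ →
      IsRestart P Q T B fδ tol k m u Λ ρ v →
      IsIterate P Q T B fδ Λ0 tol (k + 1) 0 v

end Algorithm

end HTAWGM

end

/-! Two mechanisms govern the ranks. At a restart the rank is brought back to a quasi-optimal value:
the error of the vector handed to the truncation is at most a fixed multiple of `Q.base k`, and the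
tolerance with ω4 exceeds √(2d-3) times that error by a fixed margin. A low-rank approximation of
u^δ of accuracy proportional to `Q.base k` therefore competes with the computed truncation, and its
rank is controlled by γ⁻¹ (`IsTrunc.htRank_le`, `Setup.exists_htRank_restart_le`). Within an inner
loop, every step of the conjugate gradient method multiplies the quantity rank + |r(f)| by at most 4
n² |r(A)|, where n counts the terms of the exponential sum (`PCGRun.exists_htRank_last_le`). Hence N
steps have to be bounded by I* and n by a logarithm of the error. The energy error does not increase
during a solve, so a lower bound D for the final error is also one for all earlier errors of the
same inner loop, and a single D serves in the whole recursion (`Setup.exists_htRank_le`).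

Number of steps. A step whose direction keeps a good angle with the residual reduces the energy
error by the cube of the nominal factor θ(1+μ). A direction can only be spoiled by lost
orthogonality to its predecessor, which stems from the truncation of the iterate and is proportional
to the previous residual; so a spoiled direction means that the residual has just dropped sharply,
and two consecutive steps together still gain the sixth power (`CGRun.energy_step`). Convergence is
thus three times as fast as nominal. This absorbs the factors √κ and 1+ω1 and yields N ≤ I*
(`CGRun.steps_le`).

Number of terms. n is linear in the logarithms of the accuracy η and of the largest weight on the
index set. The accuracy is proportional to the tolerance, hence to the error. For the weights,
excess regularity controls the norms of w_j^t v (`Problem.WBound`), while coarsening never keeps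
entries much smaller than its tolerance divided by the number of candidate indices
(`IsCoarseSets.weight_le`). HOSVD truncation does not increase these weighted norms
(`IsHOSVD.wBound`), and cardinalities grow at most exponentially in k (`Setup.exists_totalCard_le`),
because every restart resets them by comparison with best approximations of u^δ. If the weighted
norms grow at most exponentially in k as well, logarithms of weights are linear in k, and k is at
most logarithmic in the error (`Setup.exists_index_le`).

The delicate point is the stability of the solver in weighted norms: a direction much shorter than
its residual permits arbitrarily large coefficients. The sign of `Params.stallMargin` separates two
cases. If it is positive, directions are bounded below by residuals (`CGRun.le_norm_dir`), each
solve inflates weighted norms by a bounded factor, and n = O(1+|ln D|). Otherwise the weighted norm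
is merely estimated by the largest weight present; the logarithm of that weight increases by O(k+1)
per inner step, which only gives n = O((1+|ln D|)²). But a nonpositive margin forces the tolerance
of the solver to be so mild that 2N ≤ I* (`CGRun.two_mul_steps_le`). In both cases n^(2N)
contributes at most the power 2I* of the logarithm, as recorded by `Params.growthExp` and
`PCGRun.growthExp_mul_le`. -/

open scoped ENNReal
noncomputable section
namespace HTAWGM

section

/-! ### Symmetric positive definite operators and the energy norm -/

section Energy

variable {H : Type*} [NormedAddCommGroup H] [InnerProductSpace ℝ H]

/-- `B` is symmetric with spectrum in `[a, b]`, `a > 0`. -/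
structure SpdBounds (B : H →L[ℝ] H) (a b : ℝ) : Prop where
  symm : ∀ x y, inner ℝ (B x) y = inner ℝ x (B y)
  pos : 0 < a
  lower : ∀ x, a * ‖x‖ ^ 2 ≤ inner ℝ x (B x)
  upper : ∀ x, inner ℝ x (B x) ≤ b * ‖x‖ ^ 2

/-- The energy norm of `B`. -/
def energy (B : H →L[ℝ] H) (x : H) : ℝ := Real.sqrt (inner ℝ x (B x))

namespace SpdBounds

variable {B : H →L[ℝ] H} {a b : ℝ}

lemma nonneg (h : SpdBounds B a b) (x : H) : 0 ≤ inner ℝ x (B x) :=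
  le_trans (by have := h.pos; positivity) (h.lower x)

lemma energy_sq (h : SpdBounds B a b) (x : H) : energy B x ^ 2 = inner ℝ x (B x) :=
  Real.sq_sqrt (h.nonneg x)

lemma inner_B_comm (h : SpdBounds B a b) (x y : H) : inner ℝ x (B y) = inner ℝ y (B x) := by
  rw [← h.symm, real_inner_comm]

/-- The energy of `x + t y` is a nonnegative quadratic polynomial in t, so its discriminant is not
positive. -/
lemma inner_sq_le (h : SpdBounds B a b) (x y : H) :
    inner ℝ x (B y) ^ 2 ≤ inner ℝ x (B x) * inner ℝ y (B y) := by
  have key : ∀ t : ℝ, 0 ≤ inner ℝ y (B y) * (t * t) + (2 * inner ℝ x (B y)) * t +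
      inner ℝ x (B x) := by
    intro t
    have := h.nonneg (x + t • y)
    simp only [map_add, map_smul, inner_add_left, inner_add_right, inner_smul_left,
      inner_smul_right, h.inner_B_comm y x] at this
    simp at this
    linarith
  have := discrim_le_zero key
  unfold discrim at this
  linarith

lemma abs_inner_le (h : SpdBounds B a b) (x y : H) :
    |inner ℝ x (B y)| ≤ energy B x * energy B y := by
  rw [energy, energy, ← Real.sqrt_mul (h.nonneg x), ← Real.sqrt_sq_eq_abs]
  exact Real.sqrt_le_sqrt (h.inner_sq_le x y)

lemma energy_nonneg (x : H) : 0 ≤ energy B x := Real.sqrt_nonneg _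

lemma energy_add_sq (h : SpdBounds B a b) (x y : H) :
    energy B (x + y) ^ 2 = energy B x ^ 2 + 2 * inner ℝ x (B y) + energy B y ^ 2 := by
  rw [h.energy_sq, h.energy_sq, h.energy_sq]
  simp only [map_add, inner_add_left, inner_add_right, h.inner_B_comm y x]
  ring

lemma energy_add_le (h : SpdBounds B a b) (x y : H) :
    energy B (x + y) ≤ energy B x + energy B y := by
  have h1 := h.energy_add_sq x y
  have h2 := (le_abs_self _).trans (h.abs_inner_le x y)
  have := energy_nonneg (B := B) x
  have := energy_nonneg (B := B) y
  apply le_of_sq_le_sq₀ _ (by positivity)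
  nlinarith
where le_of_sq_le_sq₀ {s t : ℝ} (h : s ^ 2 ≤ t ^ 2) (ht : 0 ≤ t) : s ≤ t :=
  (abs_le_of_sq_le_sq' h ht).2

lemma energy_sq_le (h : SpdBounds B a b) (x : H) : energy B x ^ 2 ≤ b * ‖x‖ ^ 2 := by
  rw [h.energy_sq]; exact h.upper x

lemma le_energy_sq (h : SpdBounds B a b) (x : H) : a * ‖x‖ ^ 2 ≤ energy B x ^ 2 := by
  rw [h.energy_sq]; exact h.lower x

/-- Without completeness there is no spectral theorem at hand, so the norm of the symmetric map `B -
m` is recovered from its quadratic form by polarization. That gives a bound by ‖x‖² + ‖y‖², which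
becomes a product when x is the image of p rescaled to the length of p. -/
lemma norm_sub_mid_le (h : SpdBounds B a b) (p : H) :
    ‖B p - ((a + b) / 2) • p‖ ≤ (b - a) / 2 * ‖p‖ := by
  set m := (a + b) / 2 with hm
  set w := B p - m • p with hw
  by_cases hp : p = 0
  · simp [hw, hp]
  have hp' : 0 < ‖p‖ := norm_pos_iff.2 hp
  have hab : a ≤ b := by
    have := (h.lower p).trans (h.upper p)
    exact le_of_mul_le_mul_right this (by positivity)
  have quad : ∀ x : H, |inner ℝ x (B x) - m * ‖x‖ ^ 2| ≤ (b - a) / 2 * ‖x‖ ^ 2 := by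
    intro x
    have h1 := h.lower x
    have h2 := h.upper x
    rw [abs_le, hm]
    constructor <;> nlinarith
  by_cases hw0 : w = 0
  · rw [hw0, norm_zero]
    have : 0 ≤ b - a := by linarith
    positivity
  have hw' : 0 < ‖w‖ := norm_pos_iff.2 hw0
  have pol : ∀ x y : H, inner ℝ x (B y) - m * inner ℝ x y ≤ (b - a) / 4 * (‖x‖ ^ 2 + ‖y‖ ^ 2) := by
    intro x y
    have h1 := (abs_le.1 (quad (x + y))).2
    have h2 := (abs_le.1 (quad (x - y))).1
    rw [norm_add_sq_real] at h1
    rw [norm_sub_sq_real] at h2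
    simp only [map_add, map_sub, inner_add_left, inner_add_right, inner_sub_left, inner_sub_right,
      h.inner_B_comm y x] at h1 h2
    nlinarith
  have h1 := pol ((‖p‖ / ‖w‖) • w) p
  rw [inner_smul_left, inner_smul_left, norm_smul, Real.norm_of_nonneg (by positivity)] at h1
  have h2 : inner ℝ w (B p) - m * inner ℝ w p = ‖w‖ ^ 2 := by
    rw [← real_inner_self_eq_norm_sq w]
    nth_rw 4 [hw]
    rw [inner_sub_right, inner_smul_right]
  have h3 : ‖p‖ / ‖w‖ * ‖w‖ = ‖p‖ := by field_simp
  rw [h3] at h1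
  simp only [conj_trivial] at h1
  have h4 : ‖p‖ / ‖w‖ * inner ℝ w (B p) - m * (‖p‖ / ‖w‖ * inner ℝ w p) = ‖p‖ * ‖w‖ := by
    calc _ = ‖p‖ / ‖w‖ * (inner ℝ w (B p) - m * inner ℝ w p) := by ring
      _ = ‖p‖ * ‖w‖ := by rw [h2]; field_simp
  rw [h4] at h1
  have : ‖p‖ * ‖w‖ ≤ ‖p‖ * ((b - a) / 2 * ‖p‖) := by nlinarith
  exact le_of_mul_le_mul_left this hp'

/-- Among the multiples of p, the one with the Rayleigh quotient is closest to `B p`, hence at least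
as close as the one with the midpoint of the spectrum. -/
lemma norm_sub_rayleigh_le (h : SpdBounds B a b) (p : H) (hp : p ≠ 0) :
    ‖B p - (inner ℝ p (B p) / ‖p‖ ^ 2) • p‖ ≤ (b - a) / 2 * ‖p‖ := by
  refine le_trans ?_ (h.norm_sub_mid_le p)
  have hp' : 0 < ‖p‖ := norm_pos_iff.2 hp
  refine (sq_le_sq₀ (norm_nonneg _) (norm_nonneg _)).1 ?_
  rw [norm_sub_sq_real, norm_sub_sq_real, norm_smul, norm_smul, inner_smul_right,
    inner_smul_right, real_inner_comm p (B p), mul_pow, mul_pow, Real.norm_eq_abs,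
    Real.norm_eq_abs, sq_abs, sq_abs]
  set P := inner ℝ p (B p)
  set m := (a + b) / 2
  have : (P / ‖p‖ - m * ‖p‖) ^ 2 = P / ‖p‖ ^ 2 * P - 2 * m * P + m ^ 2 * ‖p‖ ^ 2 := by
    field_simp
    ring
  have h2 : (P / ‖p‖ ^ 2) ^ 2 * ‖p‖ ^ 2 = P / ‖p‖ ^ 2 * P := by field_simp
  nlinarith [sq_nonneg (P / ‖p‖ - m * ‖p‖)]

end SpdBounds

/-- `r` is the residual on the subspace `V` of an error `e`. -/
structure IsResidual (B : H →L[ℝ] H) (V : Submodule ℝ H) (e r : H) : Prop where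
  mem : r ∈ V
  inner_eq : ∀ y ∈ V, inner ℝ r y = inner ℝ y (B e)

namespace SpdBounds

variable {B : H →L[ℝ] H} {a b : ℝ} {V : Submodule ℝ H}

/-- Testing the residual with itself gives ‖r‖² = ⟨r, B e⟩, and Cauchy–Schwarz in the energy product
finishes. Together with `energy_le_residual`, which tests with e and therefore needs e in V, it
makes residual and energy error equivalent up to √κ. -/
lemma residual_sq_le (h : SpdBounds B a b) (hb : 0 ≤ b) {e r : H} (hr : IsResidual B V e r) :
    ‖r‖ ^ 2 ≤ b * energy B e ^ 2 := by
  have h1 : ‖r‖ ^ 2 = inner ℝ r (B e) := by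
    rw [← real_inner_self_eq_norm_sq]; exact hr.inner_eq r hr.mem
  have h2 := h.inner_sq_le r e
  rw [← h1, ← h.energy_sq e] at h2
  have h3 := h.upper r
  by_cases h0 : ‖r‖ ^ 2 = 0
  · rw [h0]; positivity
  have h4 : 0 < ‖r‖ ^ 2 := lt_of_le_of_ne (by positivity) (Ne.symm h0)
  have : ‖r‖ ^ 2 * ‖r‖ ^ 2 ≤ ‖r‖ ^ 2 * (b * energy B e ^ 2) := by
    nlinarith [sq_nonneg (energy B e)]
  exact le_of_mul_le_mul_left this h4

lemma energy_le_residual (h : SpdBounds B a b) {e r : H} (he : e ∈ V)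
    (hr : IsResidual B V e r) : a * energy B e ^ 2 ≤ ‖r‖ ^ 2 := by
  have h1 : energy B e ^ 2 = inner ℝ r e := by rw [h.energy_sq]; exact (hr.inner_eq e he).symm
  have h2 := real_inner_le_norm r e
  have h3 := h.le_energy_sq e
  have h5 := h.pos
  by_cases h0 : energy B e ^ 2 = 0
  · rw [h0]; simp
  have h4 : 0 < energy B e ^ 2 := lt_of_le_of_ne (by positivity) (Ne.symm h0)
  have h6 : (energy B e ^ 2) * (energy B e ^ 2) ≤ ‖r‖ ^ 2 * ‖e‖ ^ 2 := by
    have := mul_self_le_mul_self h4.le (h1.le.trans h2)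
    nlinarith
  have h7 : (energy B e ^ 2) * (a * energy B e ^ 2) ≤ (energy B e ^ 2) * ‖r‖ ^ 2 := by
    nlinarith [sq_nonneg ‖r‖]
  exact le_of_mul_le_mul_left h7 h4

/-- The step length minimizes the quadratic polynomial in the step. A direction of zero energy is
covered by the convention for division by zero: both corrections vanish. -/
lemma lineSearch (h : SpdBounds B a b) {e r d : H} (hd : d ∈ V) (hr : IsResidual B V e r) :
    energy B (e - (inner ℝ r d / inner ℝ d (B d)) • d) ^ 2 =
      energy B e ^ 2 - inner ℝ r d ^ 2 / inner ℝ d (B d) := by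
  rw [h.energy_sq, h.energy_sq]
  simp only [map_sub, map_smul, inner_sub_left, inner_sub_right, inner_smul_left,
    inner_smul_right, conj_trivial]
  rw [h.inner_B_comm e d, ← hr.inner_eq d hd]
  by_cases h0 : inner ℝ d (B d) = 0
  · simp [h0]
  · field_simp; ring

lemma lineSearch_le (h : SpdBounds B a b) {e r d : H} (hd : d ∈ V) (hr : IsResidual B V e r) :
    energy B (e - (inner ℝ r d / inner ℝ d (B d)) • d) ^ 2 ≤ energy B e ^ 2 := by
  rw [h.lineSearch hd hr]
  have := div_nonneg (sq_nonneg (inner ℝ r d)) (h.nonneg d)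
  linarith

/-- The gain ⟨r,d⟩²/⟨d,Bd⟩ is at least c‖r‖²/b by the angle condition, and ‖r‖² is at least a times
the squared energy error. -/
lemma lineSearch_contract (h : SpdBounds B a b) (hb : 0 < b) {e r d : H} (he : e ∈ V)
    (hd : d ∈ V) (hd0 : d ≠ 0) (hr : IsResidual B V e r) {c : ℝ} (hc : 0 ≤ c)
    (hcos : c * (‖r‖ ^ 2 * ‖d‖ ^ 2) ≤ inner ℝ r d ^ 2) :
    energy B (e - (inner ℝ r d / inner ℝ d (B d)) • d) ^ 2 ≤
      (1 - c * a / b) * energy B e ^ 2 := by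
  rw [h.lineSearch hd hr]
  have hn : 0 < ‖d‖ ^ 2 := by have := norm_pos_iff.2 hd0; positivity
  have hpos : 0 < inner ℝ d (B d) := lt_of_lt_of_le (mul_pos h.pos hn) (h.lower d)
  have h1 : c * a / b * energy B e ^ 2 ≤ inner ℝ r d ^ 2 / inner ℝ d (B d) := by
    rw [le_div_iff₀ hpos]
    have h2 := h.energy_le_residual he hr
    have h3 := h.upper d
    have h0 := sq_nonneg (energy B e)
    have ha := h.pos
    calc c * a / b * energy B e ^ 2 * inner ℝ d (B d)
        ≤ c * a / b * energy B e ^ 2 * (b * ‖d‖ ^ 2) := by gcongr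
      _ = c * ((a * energy B e ^ 2) * ‖d‖ ^ 2) := by field_simp
      _ ≤ c * (‖r‖ ^ 2 * ‖d‖ ^ 2) := by gcongr
      _ ≤ _ := hcos
  linarith

/-- Bounds for a perturbed conjugate direction. -/
lemma direction_bounds (h : SpdBounds B a b) {r p d : H} {g q : ℝ}
    (hg0 : 0 ≤ g) (hg : |inner ℝ r p| ≤ g * ‖r‖ * ‖p‖)
    (hd : ‖d - (r + (-(inner ℝ r (B p) / inner ℝ p (B p))) • p)‖ ≤ q * ‖r‖) :
    (1 - q - g * (g + (b / a - 1) / 2)) * ‖r‖ ^ 2 ≤ inner ℝ r d ∧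
    ‖r‖ ^ 2 * ‖d‖ ^ 2 ≤ inner ℝ r d ^ 2 + ((g + (b / a - 1) / 2 + q) * ‖r‖ ^ 2) ^ 2 := by
  set β := -(inner ℝ r (B p) / inner ℝ p (B p)) with hβ
  set s := (b / a - 1) / 2 with hs
  have ha := h.pos
  -- `B p` is split into its Rayleigh multiple of `p`, whose product with `r` is controlled by `g`,
  -- and a remainder of norm at most (b-a)/2 ‖p‖. Division by ⟨p,Bp⟩ ≥ a‖p‖² turns the latter into
  -- `s`.
  have hβp : ‖β • p‖ ≤ (g + s) * ‖r‖ := by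
    by_cases hp : p = 0
    · rw [hp, smul_zero, norm_zero]
      by_cases hr : r = 0
      · simp [hr]
      have hab : a ≤ b := by
        have := (h.lower r).trans (h.upper r)
        have hr' := norm_pos_iff.2 hr
        exact le_of_mul_le_mul_right this (by positivity)
      have : 1 ≤ b / a := by rwa [one_le_div ha]
      have : 0 ≤ s := by rw [hs]; linarith
      positivity
    have hp' := norm_pos_iff.2 hp
    have hpos : 0 < inner ℝ p (B p) := lt_of_lt_of_le (by positivity) (h.lower p)
    have hray := h.norm_sub_rayleigh_le p hp
    set P := inner ℝ p (B p) with hP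
    have h1 : |inner ℝ r (B p)| ≤ P / ‖p‖ ^ 2 * (g * ‖r‖ * ‖p‖) + ‖r‖ * ((b - a) / 2 * ‖p‖) := by
      have : inner ℝ r (B p) = P / ‖p‖ ^ 2 * inner ℝ r p +
          inner ℝ r (B p - (P / ‖p‖ ^ 2) • p) := by
        rw [inner_sub_right, inner_smul_right]; ring
      rw [this]
      refine (abs_add_le _ _).trans (add_le_add ?_ ?_)
      · rw [abs_mul, abs_of_pos (by positivity)]; gcongr
      · exact (abs_real_inner_le_norm _ _).trans (by gcongr)
    rw [norm_smul, Real.norm_eq_abs, hβ, abs_neg, abs_div, abs_of_pos hpos, div_mul_eq_mul_div,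
      div_le_iff₀ hpos]
    have hab : a ≤ b := by
      have := (h.lower p).trans (h.upper p)
      exact le_of_mul_le_mul_right this (by positivity)
    calc |inner ℝ r (B p)| * ‖p‖
        ≤ (P / ‖p‖ ^ 2 * (g * ‖r‖ * ‖p‖) + ‖r‖ * ((b - a) / 2 * ‖p‖)) * ‖p‖ := by gcongr
      _ = g * ‖r‖ * P + s * ‖r‖ * (a * ‖p‖ ^ 2) := by rw [hs]; field_simp
      _ ≤ g * ‖r‖ * P + s * ‖r‖ * P := by
          have : 1 ≤ b / a := by rwa [one_le_div ha]
          have : 0 ≤ s := by rw [hs]; linarith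
          have := h.lower p
          gcongr
      _ = _ := by ring
  set ε := d - (r + β • p) with hε
  have hdε : d = r + (β • p + ε) := by rw [hε]; abel
  have hw : ‖β • p + ε‖ ≤ (g + s + q) * ‖r‖ := by
    refine (norm_add_le _ _).trans ?_
    linarith
  constructor
  · have h1 : inner ℝ r d = ‖r‖ ^ 2 + β * inner ℝ r p + inner ℝ r ε := by
      rw [hdε, inner_add_right, inner_add_right, inner_smul_right, real_inner_self_eq_norm_sq]
      ring
    have h2 : |β * inner ℝ r p| ≤ g * (g + s) * ‖r‖ ^ 2 := by
      rw [abs_mul]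
      calc |β| * |inner ℝ r p| ≤ |β| * (g * ‖r‖ * ‖p‖) := by gcongr
        _ = g * ‖r‖ * ‖β • p‖ := by rw [norm_smul, Real.norm_eq_abs]; ring
        _ ≤ g * ‖r‖ * ((g + s) * ‖r‖) := by gcongr
        _ = _ := by ring
    have h3 : |inner ℝ r ε| ≤ q * ‖r‖ ^ 2 := by
      refine (abs_real_inner_le_norm _ _).trans ?_
      calc ‖r‖ * ‖ε‖ ≤ ‖r‖ * (q * ‖r‖) := by gcongr
        _ = _ := by ring
    have h4 := (abs_le.1 h2).1
    have h5 := (abs_le.1 h3).1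
    rw [h1]; linarith
  -- For d = r + w the Gram determinants of (r, d) and (r, w) coincide, and the second is at most
  -- ‖r‖²‖w‖².
  · set w := β • p + ε
    have h1 : inner ℝ r d = ‖r‖ ^ 2 + inner ℝ r w := by
      rw [hdε, inner_add_right, real_inner_self_eq_norm_sq]
    have h2 : ‖d‖ ^ 2 = ‖r‖ ^ 2 + 2 * inner ℝ r w + ‖w‖ ^ 2 := by rw [hdε, norm_add_sq_real]
    have h3 : ‖w‖ ^ 2 ≤ ((g + s + q) * ‖r‖) ^ 2 := by gcongr
    rw [h1, h2]
    nlinarith [sq_nonneg (inner ℝ r w), mul_le_mul_of_nonneg_left h3 (sq_nonneg ‖r‖)]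

end SpdBounds

end Energy

end

section

/-! ### Convergence of the perturbed conjugate gradient method -/

namespace Params

variable {Q : Params}

/-- Perturbation of the iterates relative to the energy error. -/
def pert (Q : Params) : ℝ := Q.θ * Q.μ

/-- The part of a residual that a perturbed direction is guaranteed to retain. -/
def keep (Q : Params) : ℝ := 1 - Q.δ1 / 2

lemma rateCG_eq (Q : Params) : Q.rateCG = Q.θ + Q.pert := by
  rw [rateCG, pert]; ring

namespace CGValid

lemma τ_sq (h : Q.CGValid) : Q.τ ^ 2 * (1 + Q.κ ^ 2) ≤ 1 := by
  have h1 := h.τ_lt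
  have h2 : 0 < 1 + Q.κ ^ 2 := by positivity
  have h3 : Q.τ * Real.sqrt (1 + Q.κ ^ 2) ≤ 1 := by
    rw [lt_div_iff₀ (Real.sqrt_pos.2 h2)] at h1; exact h1.le
  calc Q.τ ^ 2 * (1 + Q.κ ^ 2) = (Q.τ * Real.sqrt (1 + Q.κ ^ 2)) ^ 2 := by
        rw [mul_pow, Real.sq_sqrt h2.le]
    _ ≤ 1 := pow_le_one₀ (mul_nonneg h.τ_pos.le (Real.sqrt_nonneg _)) h3

lemma keep_pos (h : Q.CGValid) : 0 < Q.keep := by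
  have h1 := h.γ_le
  have h2 := h.γ_pos
  have h3 := h.τ_pos
  by_contra hneg
  have : (1 - Q.δ1 / 2) * Q.τ ≤ 0 := mul_nonpos_of_nonpos_of_nonneg (not_lt.1 hneg) h3.le
  linarith

lemma keep_lt (h : Q.CGValid) : Q.keep < 1 := by
  have := h.δ1_pos; rw [keep]; linarith

/-- Source of all numerical facts about θ below: it makes γ²/(2κ) at most 1/4, so that θ² ≥ 3/4. -/
lemma γ_sq_le (h : Q.CGValid) : Q.γcg ^ 2 * (1 + Q.κ ^ 2) ≤ Q.keep ^ 2 := by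
  have h1 : Q.γcg ≤ Q.keep * Q.τ := h.γ_le
  have h2 := h.γ_pos
  calc Q.γcg ^ 2 * (1 + Q.κ ^ 2) ≤ (Q.keep * Q.τ) ^ 2 * (1 + Q.κ ^ 2) := by gcongr
    _ = Q.keep ^ 2 * (Q.τ ^ 2 * (1 + Q.κ ^ 2)) := by ring
    _ ≤ Q.keep ^ 2 * 1 := by have := h.τ_sq; gcongr
    _ = _ := by ring

lemma x_le (h : Q.CGValid) : Q.γcg ^ 2 / (2 * Q.κ) ≤ 1 / 4 := by
  have h1 := h.γ_sq_le
  have h2 := h.κ_gt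
  have h3 := h.keep_pos
  have h4 := h.keep_lt
  have h5 : Q.keep ^ 2 ≤ 1 := pow_le_one₀ h3.le h4.le
  rw [div_le_iff₀ (by linarith)]
  have : Q.γcg ^ 2 * 2 ≤ Q.γcg ^ 2 * (1 + Q.κ ^ 2) := by gcongr; nlinarith
  nlinarith

lemma θ_sq (h : Q.CGValid) : Q.θ ^ 2 = 1 - Q.γcg ^ 2 / (2 * Q.κ) := by
  rw [θ, Real.sq_sqrt]; have := h.x_le; linarith

lemma θ_sq_ge (h : Q.CGValid) : 3 / 4 ≤ Q.θ ^ 2 := by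
  rw [h.θ_sq]; have := h.x_le; linarith

lemma θ_ge (h : Q.CGValid) : 43 / 50 ≤ Q.θ := by
  have h1 := h.θ_sq_ge
  have h2 : 0 ≤ Q.θ := Real.sqrt_nonneg _
  nlinarith

lemma θ_pos (h : Q.CGValid) : 0 < Q.θ := by have := h.θ_ge; linarith

lemma θ_lt (h : Q.CGValid) : Q.θ < 1 := by
  have h1 := h.θ_sq
  have h2 := h.θ_pos
  have : 0 < Q.γcg ^ 2 / (2 * Q.κ) := by
    have := h.γ_pos; have := h.κ_gt; positivity
  nlinarith

lemma pert_nonneg (h : Q.CGValid) : 0 ≤ Q.pert := mul_nonneg h.θ_pos.le h.μ_nonneg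

lemma pert_lt (h : Q.CGValid) : Q.pert < 1 - Q.θ := by
  have h1 := h.θ_pos
  have := mul_lt_mul_of_pos_left h.μ_lt h1
  rw [mul_sub, mul_inv_cancel₀ h1.ne'] at this
  rw [pert]; linarith

lemma rateCG_lt (h : Q.CGValid) : Q.rateCG < 1 := by
  rw [rateCG_eq]; have := h.pert_lt; linarith

lemma θ_le_rateCG (h : Q.CGValid) : Q.θ ≤ Q.rateCG := by
  rw [rateCG_eq]; have := h.pert_nonneg; linarith

lemma rateCG_pos (h : Q.CGValid) : 0 < Q.rateCG := h.θ_pos.trans_le h.θ_le_rateCG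

/-- The threshold factor that separates productive from unproductive steps. -/
def _root_.HTAWGM.Params.xi (Q : Params) : ℝ := (1 + 2 * (Q.pert / (1 - Q.θ))) / 8

lemma f_nonneg (h : Q.CGValid) : 0 ≤ Q.pert / (1 - Q.θ) :=
  div_nonneg h.pert_nonneg (by have := h.θ_lt; linarith)

lemma f_lt (h : Q.CGValid) : Q.pert / (1 - Q.θ) < 1 := by
  rw [div_lt_one (by have := h.θ_lt; linarith)]; exact h.pert_lt

lemma xi_pos (h : Q.CGValid) : 0 < Q.xi := by
  have := h.f_nonneg; rw [xi]; linarith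

lemma xi_lt (h : Q.CGValid) : Q.xi < 1 := by
  have := h.f_lt; rw [xi]; linarith

/-- Since (1-θ)(1+θ) = γ²/(2κ), the smallness of γ makes 1-θ of order κ⁻³. As the perturbation is
below 1-θ, this is how small it is compared with powers of κ. -/
lemma one_sub_θ_le (h : Q.CGValid) :
    (1 - Q.θ) * (2 * Q.κ * (1 + Q.κ ^ 2) * (1 + Q.θ)) ≤ Q.keep ^ 2 := by
  have h1 := h.θ_sq
  have h2 := h.κ_gt
  have h3 : (1 - Q.θ) * (1 + Q.θ) = Q.γcg ^ 2 / (2 * Q.κ) := by linarith [h1]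
  calc (1 - Q.θ) * (2 * Q.κ * (1 + Q.κ ^ 2) * (1 + Q.θ))
      = ((1 - Q.θ) * (1 + Q.θ)) * (2 * Q.κ) * (1 + Q.κ ^ 2) := by ring
    _ = Q.γcg ^ 2 * (1 + Q.κ ^ 2) := by rw [h3]; field_simp
    _ ≤ _ := h.γ_sq_le

/-- Here A = ⟨r,d⟩/‖r‖² and N2 = ‖d‖²/‖r‖². A small loss of orthogonality `g` leaves A ≥ 1-v with
1-v = (1-ξ)·`keep`, while the remaining part of d is at most (κ-1)/2 + v. The ratio A²/N2 is then at
least 2(1-v)²/(1+κ²) ≥ 2(1-ξ)²γ². The factor (3-2f)/2 > 1/2 is the surplus over the plain rate θ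
from which `good_rate` profits. -/
lemma good_cos (h : Q.CGValid) {g A N2 : ℝ} (hg0 : 0 ≤ g)
    (hg : g * (Q.κ + 1) ≤ Q.xi * (2 * Q.keep))
    (hA : 1 - Q.δ1 / 2 - g * (g + (Q.κ - 1) / 2) ≤ A)
    (hN : N2 ≤ A ^ 2 + (g + (Q.κ - 1) / 2 + Q.δ1 / 2) ^ 2) :
    0 < A ∧ (3 - 2 * (Q.pert / (1 - Q.θ))) / 2 * Q.γcg ^ 2 * N2 ≤ A ^ 2 := by
  set f := Q.pert / (1 - Q.θ) with hf
  set y := Q.keep with hy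
  have hq : Q.δ1 / 2 = 1 - y := by rw [hy, keep]; ring
  have hy0 := h.keep_pos
  have hy1 := h.keep_lt
  have hκ := h.κ_gt
  have hx0 := h.xi_pos
  have hx1 := h.xi_lt
  rw [← hy] at hy0 hy1
  set k := Q.κ
  set ξ := Q.xi with hξ
  set v := 1 - y + ξ * y with hv
  have hgv : g ≤ ξ * y := by
    have : g * 2 ≤ g * (k + 1) := by gcongr; linarith
    linarith
  have h1v : 0 < 1 - v := by rw [hv]; nlinarith
  have hAv : 1 - v ≤ A := by
    have : g * (g + (k - 1) / 2) ≤ ξ * y := by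
      have : g ≤ 1 := by nlinarith
      nlinarith
    rw [hq] at hA; rw [hv]; linarith
  have hA0 : 0 < A := by linarith
  refine ⟨hA0, ?_⟩
  -- The value of `xi` is chosen such that 2 - 4ξ = (3-2f)/2; the two sides differ by 2ξ².
  have hχ : (3 - 2 * f) / 2 ≤ 2 * (1 - ξ) ^ 2 := by
    rw [hξ, xi, ← hf]; nlinarith [sq_nonneg (1 + 2 * f)]
  have hf1 := h.f_lt
  rw [← hf] at hf1
  have hdv : g + (k - 1) / 2 + Q.δ1 / 2 ≤ (k - 1) / 2 + v := by rw [hq, hv]; linarith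
  have hd0 : 0 ≤ g + (k - 1) / 2 + Q.δ1 / 2 := by have := h.δ1_pos; linarith
  have hv0 : 0 ≤ v := by rw [hv]; nlinarith
  have h2 : 2 * ((1 - v) ^ 2 + ((k - 1) / 2 + v) ^ 2) ≤ 1 + k ^ 2 := by
    nlinarith [mul_nonneg (by linarith : (0:ℝ) ≤ k - 1) (by linarith : (0:ℝ) ≤ (k + 3) / 2 - 2 * v),
      mul_nonneg hv0 h1v.le]
  have hN' : N2 ≤ A ^ 2 + ((k - 1) / 2 + v) ^ 2 := hN.trans (by gcongr)
  have hN'' : N2 * (1 - v) ^ 2 ≤ A ^ 2 * ((1 - v) ^ 2 + ((k - 1) / 2 + v) ^ 2) := by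
    have h3 : (1 - v) ^ 2 ≤ A ^ 2 := by gcongr
    calc N2 * (1 - v) ^ 2 ≤ (A ^ 2 + ((k - 1) / 2 + v) ^ 2) * (1 - v) ^ 2 := by gcongr
      _ = A ^ 2 * (1 - v) ^ 2 + ((k - 1) / 2 + v) ^ 2 * (1 - v) ^ 2 := by ring
      _ ≤ A ^ 2 * (1 - v) ^ 2 + ((k - 1) / 2 + v) ^ 2 * A ^ 2 := by gcongr
      _ = _ := by ring
  have hγ := h.γ_sq_le
  have hvy : 1 - v = (1 - ξ) * y := by rw [hv]; ring
  have hK : 0 < 1 + k ^ 2 := by positivity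
  have key : (3 - 2 * f) / 2 * Q.γcg ^ 2 * N2 * (1 + k ^ 2) ≤ A ^ 2 * (1 + k ^ 2) := by
    by_cases hNn : N2 ≤ 0
    · have : (3 - 2 * f) / 2 * Q.γcg ^ 2 * N2 ≤ 0 :=
        mul_nonpos_of_nonneg_of_nonpos (by have : 0 ≤ 3 - 2 * f := by linarith
                                           positivity) hNn
      nlinarith [sq_nonneg A]
    push Not at hNn
    calc (3 - 2 * f) / 2 * Q.γcg ^ 2 * N2 * (1 + k ^ 2)
        = (3 - 2 * f) / 2 * (Q.γcg ^ 2 * (1 + k ^ 2)) * N2 := by ring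
      _ ≤ (2 * (1 - ξ) ^ 2) * y ^ 2 * N2 := by
          have : 0 ≤ Q.γcg ^ 2 * (1 + k ^ 2) := by positivity
          gcongr
      _ = 2 * (N2 * (1 - v) ^ 2) := by rw [hvy]; ring
      _ ≤ 2 * (A ^ 2 * ((1 - v) ^ 2 + ((k - 1) / 2 + v) ^ 2)) := by gcongr
      _ = A ^ 2 * (2 * ((1 - v) ^ 2 + ((k - 1) / 2 + v) ^ 2)) := by ring
      _ ≤ _ := by gcongr
  exact le_of_mul_le_mul_right key hK

/-- With E = 1-θ, the line search leaves at most the fraction 1 - (3-2f)E and the perturbation of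
the iterate adds fE. The sum 1 - 3(1-f)E is at most the cube of the nominal rate 1 - (1-f)E. A
productive step is thus worth three nominal ones. -/
lemma good_rate (h : Q.CGValid) {s t : ℝ} (hs : 0 ≤ s)
    (hst : t ^ 2 ≤ (1 - (3 - 2 * (Q.pert / (1 - Q.θ))) / 2 * Q.γcg ^ 2 / Q.κ) * s ^ 2) :
    t + Q.pert * s ≤ Q.rateCG ^ 3 * s := by
  have hE : 0 < 1 - Q.θ := by have := h.θ_lt; linarith
  set E := 1 - Q.θ with hEdef
  have hθE : Q.θ = 1 - E := by rw [hEdef]; ring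
  have hf1 := h.f_lt
  have hf0 := h.f_nonneg
  rw [← hEdef] at hf0 hf1
  set f := Q.pert / E with hf
  have hp : Q.pert = f * E := by rw [hf]; field_simp
  have hκ := h.κ_gt
  have hx : Q.γcg ^ 2 / (2 * Q.κ) = E * (2 - E) := by
    have := h.θ_sq; rw [hθE] at this; linarith
  have hE14 : E ≤ 7 / 50 := by have := h.θ_ge; rw [hEdef]; linarith
  have hx2 : (3 - 2 * f) / 2 * Q.γcg ^ 2 / Q.κ = (3 - 2 * f) * (E * (2 - E)) := by
    rw [← hx]; field_simp
  rw [hx2] at hst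
  have h0 : 0 ≤ 1 - (3 - 2 * f) * E := by nlinarith
  have h1 : t ≤ (1 - (3 - 2 * f) * E) * s := by
    refine (abs_le_of_sq_le_sq' (hst.trans ?_) (by positivity)).2
    rw [mul_pow]
    gcongr
    have : 0 ≤ (3 - 2 * f) * (1 - f) * E ^ 2 := by
      apply mul_nonneg (mul_nonneg (by linarith) (by linarith)) (sq_nonneg _)
    nlinarith
  rw [rateCG_eq, hp, hθE]
  have h2 : (1 - (3 - 2 * f) * E) * s + f * E * s = (1 - 3 * ((1 - f) * E)) * s := by ring
  have h3 : 1 - 3 * ((1 - f) * E) ≤ (1 - E + f * E) ^ 3 := by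
    have he : 0 ≤ (1 - f) * E := by nlinarith
    have he1 : (1 - f) * E ≤ 1 := by nlinarith
    have : (1 - E + f * E) = 1 - (1 - f) * E := by ring
    rw [this]
    set η := (1 - f) * E
    nlinarith [mul_nonneg (sq_nonneg η) (by linarith : (0:ℝ) ≤ 3 - η)]
  calc t + f * E * s ≤ (1 - (3 - 2 * f) * E) * s + f * E * s := by linarith
    _ = _ := h2
    _ ≤ _ := by gcongr

/-- The reduction that must precede an unproductive step. -/
def _root_.HTAWGM.Params.jump (Q : Params) : ℝ := 2 / (3 * (1 + Q.θ))

/-- Before an unproductive step the residual has dropped by the factor `pert`(κ+1)/(2·`xi`·`keep`);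
passing from residuals to energy errors costs √κ, and the result must not exceed `jump`. The
fraction f cancels, since `pert` = f(1-θ) and `xi` ≥ 3f/8, and the smallness of 1-θ does the rest.
-/
lemma bad_ratio (h : Q.CGValid) :
    Q.κ * (Q.pert * (Q.κ + 1)) ^ 2 ≤ (Q.jump * (Q.xi * (2 * Q.keep))) ^ 2 := by
  have hE : 0 < 1 - Q.θ := by have := h.θ_lt; linarith
  have hf1 := h.f_lt
  have hf0 := h.f_nonneg
  have hκ := h.κ_gt
  have hy0 := h.keep_pos
  have hy1 := h.keep_lt
  have hθ := h.θ_pos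
  have hE2 := h.one_sub_θ_le
  obtain ⟨f, hf⟩ : ∃ f, f = Q.pert / (1 - Q.θ) := ⟨_, rfl⟩
  rw [← hf] at hf0 hf1
  have hp : Q.pert = f * (1 - Q.θ) := by rw [hf]; field_simp
  have hξ : 3 * f / 8 ≤ Q.xi := by rw [xi, ← hf]; linarith
  have h1 : Q.κ * (Q.pert * (Q.κ + 1)) ≤ Q.jump * (Q.xi * (2 * Q.keep)) := by
    have h2 : Q.jump * ((3 * f / 8) * (2 * Q.keep)) ≤ Q.jump * (Q.xi * (2 * Q.keep)) := by
      have : 0 < Q.jump := by rw [jump]; positivity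
      gcongr
    refine le_trans ?_ h2
    rw [jump, hp, div_mul_eq_mul_div, le_div_iff₀ (by positivity)]
    have h3 : (1 - Q.θ) * (2 * Q.κ * (1 + Q.κ ^ 2) * (1 + Q.θ)) ≤ Q.keep := by nlinarith
    have h4 : Q.κ * (Q.κ + 1) * (1 - Q.θ) * (2 * (1 + Q.θ)) ≤
        (1 - Q.θ) * (2 * Q.κ * (1 + Q.κ ^ 2) * (1 + Q.θ)) := by
      have : (Q.κ + 1) ≤ 1 + Q.κ ^ 2 := by nlinarith
      calc Q.κ * (Q.κ + 1) * (1 - Q.θ) * (2 * (1 + Q.θ))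
          = (1 - Q.θ) * (2 * Q.κ * (Q.κ + 1) * (1 + Q.θ)) := by ring
        _ ≤ _ := by gcongr
    nlinarith [mul_le_mul_of_nonneg_left (h4.trans h3) hf0]
  have hp0 := h.pert_nonneg
  calc Q.κ * (Q.pert * (Q.κ + 1)) ^ 2 ≤ Q.κ ^ 2 * (Q.pert * (Q.κ + 1)) ^ 2 := by
        gcongr; nlinarith
    _ = (Q.κ * (Q.pert * (Q.κ + 1))) ^ 2 := by ring
    _ ≤ _ := by gcongr

/-- A numerical comparison through (3/4)³: the left side stays below it because θ ≥ 0.86 and `pert`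
< 1-θ, and θ⁶ stays above it. -/
lemma jump_le (h : Q.CGValid) : (1 + Q.pert) * Q.jump ≤ Q.rateCG ^ 6 := by
  have h1 := h.θ_ge
  have h2 := h.pert_lt
  have h3 := h.θ_sq_ge
  have h4 : Q.θ ^ 6 ≤ Q.rateCG ^ 6 := pow_le_pow_left₀ h.θ_pos.le h.θ_le_rateCG 6
  have h5 : (3 / 4 : ℝ) ^ 3 ≤ Q.θ ^ 6 := by
    calc (3 / 4 : ℝ) ^ 3 ≤ (Q.θ ^ 2) ^ 3 := by gcongr
      _ = _ := by ring
  refine le_trans ?_ (h5.trans h4)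
  rw [jump, mul_div_assoc', div_le_iff₀ (by positivity)]
  linarith

end CGValid

end Params

section CG

variable {H : Type*} [NormedAddCommGroup H] [InnerProductSpace ℝ H]

/-- `N` steps of the perturbed conjugate gradient method on `V` for the Galerkin solution `w`,
with iterates `x`, directions `dir` and residuals `r`. -/
structure CGRun (B : H →L[ℝ] H) (V : Submodule ℝ H) (Q : Params) (w : H) (N : ℕ)
    (x dir r : ℕ → H) : Prop where
  w_mem : w ∈ V
  x_mem : ∀ i ≤ N, x i ∈ V
  d_mem : ∀ i < N, dir i ∈ V
  res : ∀ i ≤ N, IsResidual B V (w - x i) (r i)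
  res_ne : ∀ i < N, r i ≠ 0
  dir_zero : 0 < N → ‖dir 0 - r 0‖ ≤ Q.δ1 / 2 * ‖r 0‖
  dir_succ : ∀ i, i + 1 < N → ‖dir (i + 1) - (r (i + 1) +
    (-(inner ℝ (r (i + 1)) (B (dir i)) / inner ℝ (dir i) (B (dir i)))) • dir i)‖ ≤
      Q.δ1 / 2 * ‖r (i + 1)‖
  x_succ : ∀ i < N, ‖x (i + 1) - (x i + (inner ℝ (r i) (dir i) /
    inner ℝ (dir i) (B (dir i))) • dir i)‖ ≤ Q.pert * Q.lamMax⁻¹ * ‖r i‖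

namespace CGRun

variable {B : H →L[ℝ] H} {V : Submodule ℝ H} {Q : Params} {w : H} {N : ℕ} {x dir r : ℕ → H}

lemma lamMax_eq (hB : SpdBounds B Q.lamMin Q.lamMax) : Q.lamMax = Q.κ * Q.lamMin := by
  have := hB.pos; rw [Params.κ]; field_simp

lemma lamMax_pos (hB : SpdBounds B Q.lamMin Q.lamMax) (hQ : Q.CGValid) : 0 < Q.lamMax := by
  rw [lamMax_eq hB]; have := hB.pos; have := hQ.κ_gt; positivity

variable (hB : SpdBounds B Q.lamMin Q.lamMax) (hQ : Q.CGValid) (h : CGRun B V Q w N x dir r)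
include hB hQ h

lemma energy_pert_le {i : ℕ} (hi : i < N) :
    energy B (x (i + 1) - (x i + (inner ℝ (r i) (dir i) /
      inner ℝ (dir i) (B (dir i))) • dir i)) ≤ Q.pert * energy B (w - x i) := by
  have hb := lamMax_pos hB hQ
  have h1 := h.x_succ i hi
  have hp := hQ.pert_nonneg
  set z := x (i + 1) - (x i + (inner ℝ (r i) (dir i) / inner ℝ (dir i) (B (dir i))) • dir i)
  have h2 := hB.energy_sq_le z
  have h3 := hB.residual_sq_le hb.le (h.res i hi.le)
  refine (abs_le_of_sq_le_sq' ?_ (mul_nonneg hp (SpdBounds.energy_nonneg _))).2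
  calc energy B z ^ 2 ≤ Q.lamMax * ‖z‖ ^ 2 := h2
    _ ≤ Q.lamMax * (Q.pert * Q.lamMax⁻¹ * ‖r i‖) ^ 2 := by gcongr
    _ = Q.pert ^ 2 * Q.lamMax⁻¹ * ‖r i‖ ^ 2 := by field_simp
    _ ≤ Q.pert ^ 2 * Q.lamMax⁻¹ * (Q.lamMax * energy B (w - x i) ^ 2) := by gcongr
    _ = _ := by field_simp

lemma energy_succ_le {i : ℕ} (hi : i < N) :
    energy B (w - x (i + 1)) ≤ energy B (w - x i - (inner ℝ (r i) (dir i) /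
      inner ℝ (dir i) (B (dir i))) • dir i) + Q.pert * energy B (w - x i) := by
  have h1 := h.energy_pert_le hB hQ hi
  have h2 := hB.energy_add_le (w - x i - (inner ℝ (r i) (dir i) /
      inner ℝ (dir i) (B (dir i))) • dir i) (-(x (i + 1) - (x i + (inner ℝ (r i) (dir i) /
      inner ℝ (dir i) (B (dir i))) • dir i)))
  have h3 : energy B (-(x (i + 1) - (x i + (inner ℝ (r i) (dir i) /
      inner ℝ (dir i) (B (dir i))) • dir i))) = energy B (x (i + 1) - (x i + (inner ℝ (r i) (dir i) /
      inner ℝ (dir i) (B (dir i))) • dir i)) := by simp only [energy, map_neg, inner_neg_neg]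
  have h4 : w - x i - (inner ℝ (r i) (dir i) / inner ℝ (dir i) (B (dir i))) • dir i +
      -(x (i + 1) - (x i + (inner ℝ (r i) (dir i) / inner ℝ (dir i) (B (dir i))) • dir i)) =
      w - x (i + 1) := by abel
  rw [h4, h3] at h2
  linarith

lemma energy_succ_le_crude {i : ℕ} (hi : i < N) :
    energy B (w - x (i + 1)) ≤ (1 + Q.pert) * energy B (w - x i) := by
  have h1 := h.energy_succ_le hB hQ hi
  have h2 := hB.lineSearch_le (h.d_mem i hi) (h.res i hi.le)
  have h3 := (abs_le_of_sq_le_sq' h2 (SpdBounds.energy_nonneg _)).2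
  linarith

/-- An exact line search would make the next residual orthogonal to the direction. What remains is
-⟨d, B z⟩ with the perturbation z of the iterate, which is proportional to the previous residual. -/
lemma inner_res_dir_le {i : ℕ} (hi : i < N) :
    |inner ℝ (r (i + 1)) (dir i)| ≤ Q.pert * ‖r i‖ * ‖dir i‖ := by
  have hb := lamMax_pos hB hQ
  have h1 := (h.res (i + 1) hi).inner_eq _ (h.d_mem i hi)
  have h2 := (h.res i hi.le).inner_eq _ (h.d_mem i hi)
  set z := x (i + 1) - (x i + (inner ℝ (r i) (dir i) / inner ℝ (dir i) (B (dir i))) • dir i) with hz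
  have h3 : w - x (i + 1) = (w - x i) - (inner ℝ (r i) (dir i) /
      inner ℝ (dir i) (B (dir i))) • dir i - z := by rw [hz]; abel
  have h4 : inner ℝ (r (i + 1)) (dir i) = - inner ℝ (dir i) (B z) := by
    rw [h1, h3, map_sub, map_sub, map_smul, inner_sub_right, inner_sub_right, inner_smul_right,
      ← h2]
    by_cases h0 : inner ℝ (dir i) (B (dir i)) = 0
    · have h5 := hB.lower (dir i)
      have ha := hB.pos
      have : ‖dir i‖ = 0 := by
        rw [h0] at h5
        by_contra hne
        have : 0 < Q.lamMin * ‖dir i‖ ^ 2 := by positivity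
        linarith
      rw [norm_eq_zero] at this
      simp [this]
    · field_simp; ring
  rw [h4, abs_neg]
  refine (hB.abs_inner_le _ _).trans ?_
  refine (abs_le_of_sq_le_sq' ?_ (by have := hQ.pert_nonneg; positivity)).2
  have h6 := hB.energy_sq_le (dir i)
  have h7 := hB.energy_sq_le z
  have h8 := h.x_succ i hi
  have hp := hQ.pert_nonneg
  calc (energy B (dir i) * energy B z) ^ 2 = energy B (dir i) ^ 2 * energy B z ^ 2 := by ring
    _ ≤ (Q.lamMax * ‖dir i‖ ^ 2) * (Q.lamMax * ‖z‖ ^ 2) := by gcongr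
    _ ≤ (Q.lamMax * ‖dir i‖ ^ 2) * (Q.lamMax * (Q.pert * Q.lamMax⁻¹ * ‖r i‖) ^ 2) := by gcongr
    _ = _ := by field_simp

/-- Bounds for the direction in terms of its deviation from orthogonality to the previous one. -/
lemma exists_dir_bounds {i : ℕ} (hi : i < N) : ∃ g : ℝ, 0 ≤ g ∧
    (g = 0 ∨ ∃ j, i = j + 1 ∧ g * ‖r i‖ ≤ Q.pert * ‖r j‖) ∧
    (1 - Q.δ1 / 2 - g * (g + (Q.κ - 1) / 2)) * ‖r i‖ ^ 2 ≤ inner ℝ (r i) (dir i) ∧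
    ‖r i‖ ^ 2 * ‖dir i‖ ^ 2 ≤ inner ℝ (r i) (dir i) ^ 2 +
      ((g + (Q.κ - 1) / 2 + Q.δ1 / 2) * ‖r i‖ ^ 2) ^ 2 := by
  cases i with
  | zero =>
    have h1 := hB.direction_bounds (r := r 0) (p := 0) (d := dir 0) (g := 0) (q := Q.δ1 / 2) le_rfl
      (by simp) (by simpa using h.dir_zero hi)
    exact ⟨0, le_rfl, Or.inl rfl, h1⟩
  | succ j =>
    have hr := norm_pos_iff.2 (h.res_ne (j + 1) hi)
    -- A vanishing previous direction contributes nothing, exactly as for the first direction, and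
    -- deviation 0 is admissible.
    by_cases hd : dir j = 0
    · have h1 := hB.direction_bounds (r := r (j + 1)) (p := 0) (d := dir (j + 1)) (g := 0)
        (q := Q.δ1 / 2) le_rfl (by simp) (by have := h.dir_succ j hi; simpa [hd] using this)
      exact ⟨0, le_rfl, Or.inl rfl, h1⟩
    · have hd' := norm_pos_iff.2 hd
      have h1 := hB.direction_bounds (r := r (j + 1)) (p := dir j) (d := dir (j + 1))
        (g := |inner ℝ (r (j + 1)) (dir j)| / (‖r (j + 1)‖ * ‖dir j‖)) (q := Q.δ1 / 2)
        (by positivity) (by field_simp; rfl) (h.dir_succ j hi)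
      refine ⟨_, by positivity, Or.inr ⟨j, rfl, ?_⟩, h1⟩
      have h2 := h.inner_res_dir_le hB hQ (i := j) (by omega)
      rw [div_mul_eq_mul_div, div_le_iff₀ (by positivity)]
      nlinarith

/-- Either the deviation g from orthogonality lies below the threshold and the step is productive by
itself, or g is large. The bound g‖r_{j+1}‖ ≤ `pert`‖r_j‖ then shows that the previous step has
reduced the error by `jump`; even if the present step gains nothing and only adds its perturbation,
the two together gain the sixth power. -/
lemma energy_step {i : ℕ} (hi : i < N) :
    energy B (w - x (i + 1)) ≤ Q.rateCG ^ 3 * energy B (w - x i) ∨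
    ∃ j, i = j + 1 ∧ energy B (w - x (i + 1)) ≤ Q.rateCG ^ 6 * energy B (w - x j) := by
  have hb := lamMax_pos hB hQ
  have ha := hB.pos
  have hr := norm_pos_iff.2 (h.res_ne i hi)
  have hκ := hQ.κ_gt
  obtain ⟨g, hg0, hg, h1, h2⟩ := h.exists_dir_bounds hB hQ hi
  by_cases hgood : g * (Q.κ + 1) ≤ Q.xi * (2 * Q.keep)
  · left
    set A := inner ℝ (r i) (dir i) / ‖r i‖ ^ 2 with hA
    have hAr : inner ℝ (r i) (dir i) = A * ‖r i‖ ^ 2 := by rw [hA]; field_simp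
    have hA1 : 1 - Q.δ1 / 2 - g * (g + (Q.κ - 1) / 2) ≤ A := by
      rw [hA, le_div_iff₀ (by positivity)]; exact h1
    have hN : ‖dir i‖ ^ 2 / ‖r i‖ ^ 2 ≤ A ^ 2 + (g + (Q.κ - 1) / 2 + Q.δ1 / 2) ^ 2 := by
      rw [div_le_iff₀ (by positivity)]
      rw [hAr] at h2
      have : ‖r i‖ ^ 2 * ‖dir i‖ ^ 2 ≤ ‖r i‖ ^ 2 *
          ((A ^ 2 + (g + (Q.κ - 1) / 2 + Q.δ1 / 2) ^ 2) * ‖r i‖ ^ 2) := by nlinarith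
      exact le_of_mul_le_mul_left this (by positivity)
    obtain ⟨hA0, hcos⟩ := hQ.good_cos hg0 hgood hA1 hN
    have hf1 := hQ.f_lt
    set c := (3 - 2 * (Q.pert / (1 - Q.θ))) / 2 * Q.γcg ^ 2 with hc
    have hc0 : 0 ≤ c := by
      have : 0 ≤ 3 - 2 * (Q.pert / (1 - Q.θ)) := by linarith
      positivity
    have hd0 : dir i ≠ 0 := by
      intro h0
      rw [h0, inner_zero_right] at hA
      simp at hA
      linarith
    have h3 := hB.lineSearch_contract hb (V.sub_mem h.w_mem (h.x_mem i hi.le)) (h.d_mem i hi) hd0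
      (h.res i hi.le) hc0 (by
        rw [hAr]
        calc c * (‖r i‖ ^ 2 * ‖dir i‖ ^ 2)
            = c * (‖dir i‖ ^ 2 / ‖r i‖ ^ 2) * (‖r i‖ ^ 2) ^ 2 := by field_simp
          _ ≤ A ^ 2 * (‖r i‖ ^ 2) ^ 2 := by gcongr
          _ = _ := by ring)
    have h4 : c * Q.lamMin / Q.lamMax = c / Q.κ := by rw [Params.κ]; field_simp
    rw [h4] at h3
    exact (h.energy_succ_le hB hQ hi).trans
      (hQ.good_rate (SpdBounds.energy_nonneg _) h3)
  · right
    push Not at hgood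
    rcases hg with rfl | ⟨j, rfl, hg⟩
    · have := hQ.xi_pos
      have := hQ.keep_pos
      have : 0 < Q.xi * (2 * Q.keep) := by positivity
      linarith
    refine ⟨j, rfl, ?_⟩
    have h3 := h.energy_succ_le_crude hB hQ hi
    have hx0 := hQ.xi_pos
    have hy0 := hQ.keep_pos
    have hp0 := hQ.pert_nonneg
    have hθ := hQ.θ_pos
    have hj0 : 0 < Q.jump := by rw [Params.jump]; positivity
    have h4 : Q.xi * (2 * Q.keep) * ‖r (j + 1)‖ ≤ Q.pert * (Q.κ + 1) * ‖r j‖ := by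
      calc _ ≤ g * (Q.κ + 1) * ‖r (j + 1)‖ := by gcongr
        _ = g * ‖r (j + 1)‖ * (Q.κ + 1) := by ring
        _ ≤ Q.pert * ‖r j‖ * (Q.κ + 1) := by gcongr
        _ = _ := by ring
    have h5 := hB.energy_le_residual (V.sub_mem h.w_mem (h.x_mem (j + 1) hi.le))
      (h.res (j + 1) hi.le)
    have h6 := hB.residual_sq_le hb.le (h.res j (by omega))
    have h7 : energy B (w - x (j + 1)) ≤ Q.jump * energy B (w - x j) := by
      refine (abs_le_of_sq_le_sq' ?_ (mul_nonneg hj0.le (SpdBounds.energy_nonneg _))).2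
      set X := Q.xi * (2 * Q.keep) with hX
      have hX0 : 0 < X := by positivity
      have : (Q.lamMin * X ^ 2) * energy B (w - x (j + 1)) ^ 2 ≤
          (Q.lamMin * X ^ 2) * (Q.jump * energy B (w - x j)) ^ 2 := by
        calc (Q.lamMin * X ^ 2) * energy B (w - x (j + 1)) ^ 2
            = X ^ 2 * (Q.lamMin * energy B (w - x (j + 1)) ^ 2) := by ring
          _ ≤ X ^ 2 * ‖r (j + 1)‖ ^ 2 := by gcongr
          _ = (X * ‖r (j + 1)‖) ^ 2 := by ring
          _ ≤ (Q.pert * (Q.κ + 1) * ‖r j‖) ^ 2 := by gcongr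
          _ = (Q.pert * (Q.κ + 1)) ^ 2 * ‖r j‖ ^ 2 := by ring
          _ ≤ (Q.pert * (Q.κ + 1)) ^ 2 * (Q.lamMax * energy B (w - x j) ^ 2) := by gcongr
          _ = Q.lamMin * energy B (w - x j) ^ 2 * (Q.κ * (Q.pert * (Q.κ + 1)) ^ 2) := by
              rw [lamMax_eq hB]; ring
          _ ≤ Q.lamMin * energy B (w - x j) ^ 2 * (Q.jump * X) ^ 2 := by
              have := hQ.bad_ratio
              gcongr
          _ = _ := by ring
      exact le_of_mul_le_mul_left this (by positivity)
    calc _ ≤ (1 + Q.pert) * energy B (w - x (j + 1)) := h3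
      _ ≤ (1 + Q.pert) * (Q.jump * energy B (w - x j)) := by gcongr
      _ = (1 + Q.pert) * Q.jump * energy B (w - x j) := by ring
      _ ≤ _ := mul_le_mul_of_nonneg_right hQ.jump_le (SpdBounds.energy_nonneg _)

lemma energy_le_pow {i : ℕ} (hi : i ≤ N) :
    energy B (w - x i) ≤ Q.rateCG ^ (3 * i) * energy B (w - x 0) := by
  induction i using Nat.strong_induction_on with
  | _ i ih =>
    cases i with
    | zero => simp
    | succ i =>
      have hr := hQ.rateCG_pos
      rcases h.energy_step hB hQ (i := i) hi with h1 | ⟨j, rfl, h1⟩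
      · calc _ ≤ _ := h1
          _ ≤ Q.rateCG ^ 3 * (Q.rateCG ^ (3 * i) * energy B (w - x 0)) := by
              have := ih i (by omega) (by omega); gcongr
          _ = _ := by ring
      · calc _ ≤ _ := h1
          _ ≤ Q.rateCG ^ 6 * (Q.rateCG ^ (3 * j) * energy B (w - x 0)) := by
              have := ih j (by omega) (by omega); gcongr
          _ = _ := by ring

lemma energy_le {i : ℕ} (hi : i ≤ N) : energy B (w - x i) ≤ energy B (w - x 0) := by
  refine (h.energy_le_pow hB hQ hi).trans ?_
  exact mul_le_of_le_one_left (SpdBounds.energy_nonneg _)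
    (pow_le_one₀ hQ.rateCG_pos.le hQ.rateCG_lt.le)

/-- The detour from residual to energy error and back costs the factor √κ once, independently of i.
-/
lemma res_sq_le {i : ℕ} (hi : i ≤ N) :
    ‖r i‖ ^ 2 ≤ Q.κ * (Q.rateCG ^ (3 * i) * ‖r 0‖) ^ 2 := by
  have hb := lamMax_pos hB hQ
  have ha := hB.pos
  have h1 := hB.residual_sq_le hb.le (h.res i hi)
  have h2 := hB.energy_le_residual (V.sub_mem h.w_mem (h.x_mem 0 (by omega))) (h.res 0 (by omega))
  have h3 := h.energy_le_pow hB hQ hi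
  have h4 := SpdBounds.energy_nonneg (B := B) (w - x i)
  have h5 := hQ.rateCG_pos
  calc ‖r i‖ ^ 2 ≤ Q.lamMax * energy B (w - x i) ^ 2 := h1
    _ ≤ Q.lamMax * (Q.rateCG ^ (3 * i) * energy B (w - x 0)) ^ 2 := by gcongr
    _ = Q.κ * (Q.rateCG ^ (3 * i)) ^ 2 * (Q.lamMin * energy B (w - x 0) ^ 2) := by
        rw [lamMax_eq hB]; ring
    _ ≤ Q.κ * (Q.rateCG ^ (3 * i)) ^ 2 * ‖r 0‖ ^ 2 := by
        have := hQ.κ_gt; gcongr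
    _ = _ := by ring

end CGRun

end CG

end

section

/-! ### Number of conjugate gradient steps, and lower bounds for the directions -/

section Steps

namespace Params

variable {Q : Params} {d : ℕ} {nf : ℝ}

/-- Guaranteed lower bound for the norm of a direction relative to the residual. -/
def stallMargin (Q : Params) : ℝ :=
  Q.keep - Q.pert * (Real.sqrt Q.κ * (1 + Q.ω1)) / Q.ω2 * ((Q.κ + 1) / 2)

namespace OuterValid

lemma ω2_lt' (h : Q.OuterValid d nf) (hκ : 1 < Q.κ) : Q.ω2 * (1 + Q.ω1) ≤ (1 - Q.ω1) ^ 2 := by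
  have h1 := h.ω2_lt
  have h2 := h.ω1_pos
  have h3 := h.ω1_lt
  have h4 := h.α_lt
  have h5 : Q.κ⁻¹ ≤ 1 := inv_le_one_of_one_le₀ hκ.le
  have h6 : (1 - Q.ω1) * (Q.α - Q.ω1) / (1 + Q.ω1) * Q.κ⁻¹ ≤
      (1 - Q.ω1) * (Q.α - Q.ω1) / (1 + Q.ω1) * 1 := by
    have : 0 ≤ (1 - Q.ω1) * (Q.α - Q.ω1) / (1 + Q.ω1) :=
      div_nonneg (mul_nonneg (by linarith) (by linarith)) (by linarith)
    gcongr
  have h7 : Q.ω2 ≤ (1 - Q.ω1) * (Q.α - Q.ω1) / (1 + Q.ω1) := by linarith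
  rw [le_div_iff₀ (by linarith)] at h7
  nlinarith

/-- The condition on ω2 bounds ω2(1+ω1) by (1-ω1)², and (1-ω1)²(1+ω1)² = (1-ω1²)² ≤ 1. It absorbs
the powers of 1+ω1 that arise because the initial residual is only known up to this factor. -/
lemma ω2_mul_le (h : Q.OuterValid d nf) (hκ : 1 < Q.κ) : Q.ω2 * (1 + Q.ω1) ^ 3 ≤ 1 := by
  have h1 := h.ω2_lt' hκ
  have h2 := h.ω1_pos
  have h3 := h.ω1_lt
  have h4 := h.α_lt
  calc Q.ω2 * (1 + Q.ω1) ^ 3 = Q.ω2 * (1 + Q.ω1) * (1 + Q.ω1) ^ 2 := by ring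
    _ ≤ (1 - Q.ω1) ^ 2 * (1 + Q.ω1) ^ 2 := by gcongr
    _ = (1 - Q.ω1 ^ 2) ^ 2 := by ring
    _ ≤ 1 := pow_le_one₀ (by nlinarith) (by nlinarith)

end OuterValid

lemma rpow_neg_half (Q : Params) (hκ : 1 < Q.κ) : Q.κ ^ (-(1 / 2) : ℝ) = (Real.sqrt Q.κ)⁻¹ := by
  rw [Real.rpow_neg (by linarith), Real.sqrt_eq_rpow]

/-- `r ^ ⌈|log x / log r|⌉ ≤ x` for `r, x ∈ (0, 1]`. -/
lemma pow_ceil_log_le {r x : ℝ} (hr0 : 0 < r) (hr1 : r < 1) (hx0 : 0 < x) :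
    r ^ ⌈|Real.log x / Real.log r|⌉₊ ≤ x := by
  have hl : Real.log r < 0 := Real.log_neg hr0 hr1
  have h1 : Real.log x / Real.log r ≤ (⌈|Real.log x / Real.log r|⌉₊ : ℝ) :=
    (le_abs_self _).trans (Nat.le_ceil _)
  rw [div_le_iff_of_neg hl] at h1
  rw [← Real.log_le_log_iff (by positivity) hx0, Real.log_pow]
  exact h1

lemma rateCG_pow_le (h : Q.OuterValid d nf) (hQ : Q.CGValid) :
    Q.rateCG ^ Q.IStar ≤ Q.ω2 / Real.sqrt Q.κ := by
  have hκ := hQ.κ_gt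
  have h2 := h.ω2_pos
  have hs : 0 < Real.sqrt Q.κ := Real.sqrt_pos.2 (by linarith)
  rw [IStar, rpow_neg_half Q hκ, ← div_eq_mul_inv]
  exact pow_ceil_log_le hQ.rateCG_pos hQ.rateCG_lt (by positivity)

end Params

variable {H : Type*} [NormedAddCommGroup H] [InnerProductSpace ℝ H]
  {B : H →L[ℝ] H} {V : Submodule ℝ H} {Q : Params} {w : H} {N d : ℕ} {x dir r : ℕ → H} {nf ρ : ℝ}
  (hB : SpdBounds B Q.lamMin Q.lamMax) (hQ : Q.CGValid) (hω : Q.OuterValid d nf)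
  (h : CGRun B V Q w N x dir r) (h0 : ‖r 0‖ ≤ (1 + Q.ω1) * ρ) (hr : ∀ i < N, Q.ω2 * ρ < ‖r i‖)

include hB hQ hω h h0 hr

omit hB hQ hr in
lemma CGRun.ρ_pos (hN : 0 < N) : 0 < ρ := by
  have h1 := norm_pos_iff.2 (h.res_ne 0 hN)
  have h2 := hω.ω1_pos
  by_contra hneg
  push Not at hneg
  nlinarith

lemma CGRun.lt_rate_pow {i : ℕ} (hi : i < N) :
    Q.ω2 < Real.sqrt Q.κ * (1 + Q.ω1) * Q.rateCG ^ (3 * i) := by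
  have hρ := h.ρ_pos hω h0 (by omega)
  have h1 := h.res_sq_le hB hQ hi.le
  have h2 := hr i hi
  have h3 := hQ.rateCG_pos
  have h4 := hω.ω1_pos
  have h5 := hω.ω2_pos
  have hκ := hQ.κ_gt
  have h6 : (Q.ω2 * ρ) ^ 2 < (Real.sqrt Q.κ * (1 + Q.ω1) * Q.rateCG ^ (3 * i) * ρ) ^ 2 := by
    calc (Q.ω2 * ρ) ^ 2 < ‖r i‖ ^ 2 := by gcongr
      _ ≤ Q.κ * (Q.rateCG ^ (3 * i) * ‖r 0‖) ^ 2 := h1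
      _ ≤ Q.κ * (Q.rateCG ^ (3 * i) * ((1 + Q.ω1) * ρ)) ^ 2 := by gcongr
      _ = Real.sqrt Q.κ ^ 2 * (Q.rateCG ^ (3 * i) * ((1 + Q.ω1) * ρ)) ^ 2 := by
          rw [Real.sq_sqrt (by linarith)]
      _ = _ := by ring
  have h7 := lt_of_pow_lt_pow_left₀ 2 (by positivity) h6
  exact lt_of_mul_lt_mul_right h7 hρ.le

/-- By definition of I*, the nominal rate to the power I* is at most ω2/√κ. The actual convergence
provides the cube of this: one of the three factors gives the required reduction, the other two
outweigh √κ(1+ω1). -/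
lemma CGRun.steps_le : N ≤ Q.IStar := by
  by_contra hlt
  push Not at hlt
  have h1 := h.lt_rate_pow hB hQ hω h0 hr hlt
  have h2 := Params.rateCG_pow_le hω hQ
  have hκ := hQ.κ_gt
  have h3 := hQ.rateCG_pos
  have h4 := hω.ω1_pos
  have h5 := hω.ω2_pos
  have h6 := hω.ω2_mul_le hκ
  have hs : 1 ≤ Real.sqrt Q.κ := Real.one_le_sqrt.2 hκ.le
  have h7 : Q.rateCG ^ (3 * Q.IStar) ≤ (Q.ω2 / Real.sqrt Q.κ) ^ 3 := by
    rw [mul_comm, pow_mul]; gcongr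
  have h8 : Real.sqrt Q.κ * (1 + Q.ω1) * Q.rateCG ^ (3 * Q.IStar) ≤ Q.ω2 := by
    calc _ ≤ Real.sqrt Q.κ * (1 + Q.ω1) * (Q.ω2 / Real.sqrt Q.κ) ^ 3 := by gcongr
      _ = Q.ω2 * ((Q.ω2 * (1 + Q.ω1)) * Q.ω2 / Real.sqrt Q.κ ^ 2) := by field_simp
      _ ≤ Q.ω2 * 1 := by
          gcongr
          have h9 : Q.ω2 * (1 + Q.ω1) ≤ 1 := by nlinarith [sq_nonneg Q.ω1, pow_pos h4 3]
          have h10 : Q.ω2 ≤ 1 := by nlinarith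
          rw [div_le_one (by positivity)]
          nlinarith
      _ = Q.ω2 := mul_one _
  linarith

/-- A nonpositive margin means that ω2 is small compared with the perturbation times powers of κ;
since the perturbation itself is tiny, so is V = ω2/(√κ(1+ω1)). If more than I*/2 steps were taken,
the threefold speed would bring R¹² below V, whereas R¹² ≥ (3/4)⁶ exceeds 1/7. -/
lemma CGRun.two_mul_steps_le (hstall : Q.stallMargin ≤ 0) : 2 * N ≤ Q.IStar := by
  by_contra hlt
  push Not at hlt
  have hN : 0 < N := by omega
  have h1 := h.lt_rate_pow hB hQ hω h0 hr (i := N - 1) (by omega)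
  have h2 := Params.rateCG_pow_le hω hQ
  have hκ := hQ.κ_gt
  have h3 := hQ.rateCG_pos
  have h4 := hω.ω1_pos
  have h5 := hω.ω2_pos
  have h6 := hω.ω2_mul_le hκ
  have hs : 1 ≤ Real.sqrt Q.κ := Real.one_le_sqrt.2 hκ.le
  have hs2 : Real.sqrt Q.κ ^ 2 = Q.κ := Real.sq_sqrt (by linarith)
  set S := Real.sqrt Q.κ with hS
  set R := Q.rateCG with hR
  -- `V = ω2 / (S (1 + ω1))`
  obtain ⟨V, hV⟩ : ∃ V, V = Q.ω2 / (S * (1 + Q.ω1)) := ⟨_, rfl⟩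
  have hω2 : Q.ω2 = V * (S * (1 + Q.ω1)) := by rw [hV]; field_simp
  have hV0 : 0 < V := by rw [hV]; positivity
  have hVlt : V < R ^ (3 * (N - 1)) := by
    rw [hω2] at h1
    have h8 : (S * (1 + Q.ω1)) * V < (S * (1 + Q.ω1)) * R ^ (3 * (N - 1)) := by linarith
    exact lt_of_mul_lt_mul_left h8 (by positivity)
  have hVi : R ^ Q.IStar ≤ V * (1 + Q.ω1) := by
    refine h2.trans (le_of_eq ?_)
    rw [hω2]; field_simp
  have hV4 : V * (1 + Q.ω1) ^ 4 ≤ 1 := by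
    rw [hω2] at h6
    calc V * (1 + Q.ω1) ^ 4 ≤ V * (1 + Q.ω1) ^ 4 * S :=
          le_mul_of_one_le_right (by positivity) hs
      _ = V * (S * (1 + Q.ω1)) * (1 + Q.ω1) ^ 3 := by ring
      _ ≤ 1 := h6
  -- I* < 2N gives 3 I* ≤ 6(N-1) + 3. So the square of `hVlt` times R³ is compared with the cube of
  -- `hVi`.
  have hR3 : R ^ 3 < V * (1 + Q.ω1) ^ 3 := by
    have h8 : V ^ 2 < R ^ (6 * (N - 1)) := by
      calc V ^ 2 < (R ^ (3 * (N - 1))) ^ 2 := by gcongr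
        _ = _ := by rw [← pow_mul]; ring_nf
    have h9 : V ^ 2 * R ^ 3 < V ^ 2 * (V * (1 + Q.ω1) ^ 3) := by
      calc V ^ 2 * R ^ 3 < R ^ (6 * (N - 1)) * R ^ 3 := by gcongr
        _ = R ^ (6 * (N - 1) + 3) := by rw [pow_add]
        _ ≤ R ^ (Q.IStar * 3) := pow_le_pow_of_le_one h3.le hQ.rateCG_lt.le (by omega)
        _ = (R ^ Q.IStar) ^ 3 := by rw [pow_mul]
        _ ≤ (V * (1 + Q.ω1)) ^ 3 := by gcongr
        _ = _ := by ring
    exact lt_of_mul_lt_mul_left h9 (by positivity)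
  have hR12 : R ^ 12 < V := by
    calc R ^ 12 = (R ^ 3) ^ 4 := by ring
      _ < (V * (1 + Q.ω1) ^ 3) ^ 4 := by gcongr
      _ = V * (V * (1 + Q.ω1) ^ 4) ^ 3 := by ring
      _ ≤ V * 1 ^ 3 := by gcongr
      _ = V := by ring
  -- The stall condition reads 2V·`keep` ≤ `pert`(κ+1) < (1-θ)(κ+1), and `one_sub_θ_le` bounds the
  -- right side by `keep`/(2(1+θ)). Hence 4(1+θ)V ≤ 1, and θ ≥ 0.86.
  have hVle : V ≤ 1 / 7 := by
    have hy0 := hQ.keep_pos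
    have hy1 := hQ.keep_lt
    have hθ := hQ.θ_ge
    have hE := hQ.one_sub_θ_le
    have hp := hQ.pert_lt
    have h8 : V * (2 * Q.keep) ≤ Q.pert * (Q.κ + 1) := by
      rw [Params.stallMargin, ← hS, hω2] at hstall
      have : Q.pert * (S * (1 + Q.ω1)) / (V * (S * (1 + Q.ω1))) * ((Q.κ + 1) / 2) =
        Q.pert / V * ((Q.κ + 1) / 2) := by field_simp
      rw [this] at hstall
      have h9 : Q.keep * V ≤ Q.pert / V * ((Q.κ + 1) / 2) * V := by
        apply mul_le_mul_of_nonneg_right _ hV0.le; linarith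
      have h10 : Q.pert / V * ((Q.κ + 1) / 2) * V = Q.pert * ((Q.κ + 1) / 2) := by field_simp
      rw [h10] at h9
      linarith
    have h9 : V * (2 * Q.keep) ≤ (1 - Q.θ) * (Q.κ + 1) := by
      refine h8.trans ?_; gcongr
    have h10 : (1 - Q.θ) * (Q.κ + 1) * (2 * (1 + Q.θ)) ≤ Q.keep := by
      calc (1 - Q.θ) * (Q.κ + 1) * (2 * (1 + Q.θ))
          ≤ (1 - Q.θ) * (Q.κ * (1 + Q.κ ^ 2)) * (2 * (1 + Q.θ)) := by
            have := hQ.θ_lt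
            have : Q.κ + 1 ≤ Q.κ * (1 + Q.κ ^ 2) := by nlinarith [sq_nonneg (Q.κ - 1)]
            have : 0 ≤ 1 - Q.θ := by linarith
            gcongr
        _ = (1 - Q.θ) * (2 * Q.κ * (1 + Q.κ ^ 2) * (1 + Q.θ)) := by ring
        _ ≤ Q.keep ^ 2 := hE
        _ ≤ Q.keep := by nlinarith
    have h11 : Q.keep * (V * (4 * (1 + Q.θ))) ≤ Q.keep * 1 := by nlinarith
    have h12 := le_of_mul_le_mul_left h11 hy0
    nlinarith
  have hR12' : (3 / 4 : ℝ) ^ 6 ≤ R ^ 12 := by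
    calc (3 / 4 : ℝ) ^ 6 ≤ (Q.θ ^ 2) ^ 6 := by have := hQ.θ_sq_ge; gcongr
      _ = Q.θ ^ 12 := by ring
      _ ≤ R ^ 12 := by have := hQ.θ_pos; have := hQ.θ_le_rateCG; gcongr
  norm_num at hR12'
  linarith

/-- Before the method stops, residuals lie between ω2ρ and √κ(1+ω1)ρ. Their quotients are therefore
bounded, which bounds the deviation from orthogonality by a constant G; the component of the
direction along the residual then retains the fraction `stallMargin`. -/
lemma CGRun.le_norm_dir (hstall : 0 < Q.stallMargin) {i : ℕ} (hi : i < N) :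
    Q.stallMargin * ‖r i‖ ≤ ‖dir i‖ := by
  have hρ := h.ρ_pos hω h0 (by omega)
  have hκ := hQ.κ_gt
  have h4 := hω.ω1_pos
  have h5 := hω.ω2_pos
  have hp := hQ.pert_nonneg
  have hri := norm_pos_iff.2 (h.res_ne i hi)
  obtain ⟨g, hg0, hg, h1, -⟩ := h.exists_dir_bounds hB hQ hi
  set G := Q.pert * (Real.sqrt Q.κ * (1 + Q.ω1)) / Q.ω2 with hG
  have hG0 : 0 ≤ G := by rw [hG]; positivity
  have hgG : g ≤ G := by
    rcases hg with rfl | ⟨j, rfl, hg⟩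
    · exact hG0
    · have h6 := h.res_sq_le hB hQ (i := j) (by omega)
      have h7 : ‖r j‖ ≤ Real.sqrt Q.κ * ((1 + Q.ω1) * ρ) := by
        refine (abs_le_of_sq_le_sq' (h6.trans ?_) (by positivity)).2
        rw [mul_pow (Real.sqrt _), Real.sq_sqrt (by linarith)]
        have h8 : Q.rateCG ^ (3 * j) ≤ 1 := pow_le_one₀ hQ.rateCG_pos.le hQ.rateCG_lt.le
        have h9 := hQ.rateCG_pos
        have h8' : Q.rateCG ^ (3 * j) * ‖r 0‖ ≤ (1 + Q.ω1) * ρ :=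
          (mul_le_of_le_one_left (norm_nonneg _) h8).trans h0
        exact mul_le_mul_of_nonneg_left (pow_le_pow_left₀ (by positivity) h8' 2) (by linarith)
      have h10 : g * (Q.ω2 * ρ) ≤ Q.pert * (Real.sqrt Q.κ * ((1 + Q.ω1) * ρ)) := by
        calc g * (Q.ω2 * ρ) ≤ g * ‖r (j + 1)‖ := by have := (hr (j + 1) hi).le; gcongr
          _ ≤ Q.pert * ‖r j‖ := hg
          _ ≤ _ := by gcongr
      rw [hG, le_div_iff₀ h5]
      have h11 : ρ * (g * Q.ω2) ≤ ρ * (Q.pert * (Real.sqrt Q.κ * (1 + Q.ω1))) := by nlinarith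
      exact le_of_mul_le_mul_left h11 hρ
  have hm : Q.stallMargin = Q.keep - G * ((Q.κ + 1) / 2) := rfl
  have hy1 := hQ.keep_lt
  have hG1 : G ≤ 1 := by nlinarith
  have hkey : Q.stallMargin ≤ 1 - Q.δ1 / 2 - g * (g + (Q.κ - 1) / 2) := by
    have : g * (g + (Q.κ - 1) / 2) ≤ G * ((Q.κ + 1) / 2) := by
      have : g + (Q.κ - 1) / 2 ≤ (Q.κ + 1) / 2 := by linarith
      gcongr
    rw [hm, Params.keep]; linarith
  have h12 : Q.stallMargin * ‖r i‖ ^ 2 ≤ ‖r i‖ * ‖dir i‖ :=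
    (mul_le_mul_of_nonneg_right hkey (by positivity)).trans (h1.trans (real_inner_le_norm _ _))
  have h13 : ‖r i‖ * (Q.stallMargin * ‖r i‖) ≤ ‖r i‖ * ‖dir i‖ := by nlinarith
  exact le_of_mul_le_mul_left h13 hri

end Steps

/-! ### Galerkin solutions and error reduction by bulk chasing -/

section Galerkin

variable {H : Type*} [NormedAddCommGroup H] [InnerProductSpace ℝ H]
  {B : H →L[ℝ] H} {V : Submodule ℝ H} {a b : ℝ}

/-- Existence of the Galerkin solution. -/
lemma SpdBounds.exists_galerkin [FiniteDimensional ℝ V] (h : SpdBounds B a b) (u : H) :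
    ∃ w ∈ V, ∀ y ∈ V, inner ℝ y (B (u - w)) = 0 := by
  let T : V →ₗ[ℝ] Module.Dual ℝ V :=
    LinearMap.mk₂ ℝ (fun x y => inner ℝ (y : H) (B x))
      (by intros; simp [inner_add_right]) (by intros; simp [inner_smul_right])
      (by intros; simp [inner_add_left]) (by intros; simp [inner_smul_left])
  have hinj : Function.Injective T := by
    rw [injective_iff_map_eq_zero]
    intro x hx
    have h1 : inner ℝ (x : H) (B x) = 0 := by
      have := congrArg (fun g : Module.Dual ℝ V => g x) hx
      simpa [T] using this
    have h2 := h.lower x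
    rw [h1] at h2
    have h3 : ‖(x : H)‖ = 0 := by
      by_contra hne
      have : 0 < a * ‖(x : H)‖ ^ 2 := by have := h.pos; positivity
      linarith
    exact Subtype.ext (norm_eq_zero.1 h3)
  have hsurj : Function.Surjective T :=
    (LinearMap.injective_iff_surjective_of_finrank_eq_finrank
      Subspace.dual_finrank_eq.symm).1 hinj
  let φ : Module.Dual ℝ V :=
    { toFun := fun y => inner ℝ (y : H) (B u)
      map_add' := by intros; simp [inner_add_left]
      map_smul' := by intros; simp [inner_smul_left] }
  obtain ⟨w, hw⟩ := hsurj φ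
  refine ⟨w, w.2, fun y hy => ?_⟩
  have h1 := congrArg (fun g : Module.Dual ℝ V => g ⟨y, hy⟩) hw
  have h2 : inner ℝ y (B w) = inner ℝ y (B u) := h1
  rw [map_sub, inner_sub_right, h2, sub_self]

/-- Galerkin orthogonality allows the error to be replaced by its part inside V, to which
`energy_le_residual` applies. -/
lemma IsResidual.galerkin {u w x r : H} (hr : IsResidual B V (u - x) r)
    (hw : ∀ y ∈ V, inner ℝ y (B (u - w)) = 0) : IsResidual B V (w - x) r := by
  refine ⟨hr.mem, fun y hy => ?_⟩
  have h1 := hw y hy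
  have : u - x = (u - w) + (w - x) := by abel
  rw [hr.inner_eq y hy, this, map_add, inner_add_right, h1, zero_add]

lemma SpdBounds.galerkin_pythagoras (h : SpdBounds B a b) {u w x : H}
    (hwV : w ∈ V) (hx : x ∈ V) (hw : ∀ y ∈ V, inner ℝ y (B (u - w)) = 0) :
    energy B (u - x) ^ 2 = energy B (u - w) ^ 2 + energy B (w - x) ^ 2 := by
  have : u - x = (w - x) + (u - w) := by abel
  rw [this, h.energy_add_sq, hw _ (V.sub_mem hwV hx)]
  ring

/-- Error reduction by one step of the adaptive Galerkin method. -/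
lemma SpdBounds.adaptive_step {Q : Params} {d : ℕ} {nf : ℝ}
    (h : SpdBounds B Q.lamMin Q.lamMax) (hκ : 1 < Q.κ) (hω : Q.OuterValid d nf)
    {u w x x' r r₀ r' : H} (hwV : w ∈ V) (hx : x ∈ V) (hx' : x' ∈ V)
    (hw : ∀ y ∈ V, inner ℝ y (B (u - w)) = 0)
    (hr : ‖B (u - x) - r‖ ≤ Q.ω1 * ‖r‖)
    (hr₀ : IsResidual B V (u - x) r₀) (hr₀r : (Q.α - Q.ω1) * ‖r‖ ≤ ‖r₀‖)
    (hr' : IsResidual B V (u - x') r') (hr'r : ‖r'‖ ≤ Q.ω2 * ‖r‖) :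
    energy B (u - x') ≤ Q.innerRate * energy B (u - x) := by
  have ha := h.pos
  have hb : 0 < Q.lamMax := by
    have : Q.lamMax = Q.κ * Q.lamMin := by rw [Params.κ]; field_simp
    rw [this]; positivity
  have h1 := hω.ω1_pos
  have h2 := hω.ω1_lt
  have h3 := hω.α_lt
  have hω2 := hω.ω2_pos
  have hall : IsResidual B ⊤ (u - x) (B (u - x)) :=
    ⟨trivial, fun y _ => by rw [real_inner_comm]⟩
  have e1 := h.residual_sq_le hb.le hall
  have e2 := h.energy_le_residual (V := ⊤) trivial hall
  have e3 := h.residual_sq_le hb.le (hr₀.galerkin hw)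
  have e4 := h.energy_le_residual (V.sub_mem hwV hx') (hr'.galerkin hw)
  have p1 := h.galerkin_pythagoras hwV hx hw
  have p2 := h.galerkin_pythagoras hwV hx' hw
  set ϱ := B (u - x)
  have n1 : ‖ϱ‖ ≤ (1 + Q.ω1) * ‖r‖ := by
    have : ϱ = (ϱ - r) + r := by abel
    have := norm_add_le (ϱ - r) r
    rw [sub_add_cancel] at this
    linarith
  have n2 : (1 - Q.ω1) * ‖r‖ ≤ ‖ϱ‖ := by
    have := norm_sub_norm_le r ϱ
    rw [norm_sub_rev] at this
    linarith
  set X := energy B (u - x) ^ 2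
  -- Bulk chasing: the Galerkin residual carries a fixed share of the full one, so the exact
  -- Galerkin solution removes a fixed share of the error.
  have c1 : ((Q.α - Q.ω1) / (1 + Q.ω1)) ^ 2 * Q.κ⁻¹ * X ≤ energy B (w - x) ^ 2 := by
    have m1 : (Q.α - Q.ω1) / (1 + Q.ω1) * ‖ϱ‖ ≤ ‖r₀‖ := by
      refine le_trans ?_ hr₀r
      rw [div_mul_eq_mul_div, div_le_iff₀ (by linarith)]
      have : 0 ≤ Q.α - Q.ω1 := by linarith
      nlinarith
    have m2 : ((Q.α - Q.ω1) / (1 + Q.ω1) * ‖ϱ‖) ^ 2 ≤ ‖r₀‖ ^ 2 := by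
      have : 0 ≤ (Q.α - Q.ω1) / (1 + Q.ω1) := div_nonneg (by linarith) (by linarith)
      gcongr
    have m3 : ((Q.α - Q.ω1) / (1 + Q.ω1)) ^ 2 * (Q.lamMin * X) ≤
        Q.lamMax * energy B (w - x) ^ 2 := by
      calc _ ≤ ((Q.α - Q.ω1) / (1 + Q.ω1)) ^ 2 * ‖ϱ‖ ^ 2 := by gcongr
        _ = ((Q.α - Q.ω1) / (1 + Q.ω1) * ‖ϱ‖) ^ 2 := by ring
        _ ≤ _ := m2.trans e3
    rw [Params.κ, inv_div]
    have : ((Q.α - Q.ω1) / (1 + Q.ω1)) ^ 2 * (Q.lamMin / Q.lamMax) * X =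
      ((Q.α - Q.ω1) / (1 + Q.ω1)) ^ 2 * (Q.lamMin * X) / Q.lamMax := by ring
    rw [this, div_le_iff₀ hb]
    linarith
  -- The contribution of solving the Galerkin system only approximately.
  have c2 : energy B (w - x') ^ 2 ≤ (Q.ω2 / (1 - Q.ω1)) ^ 2 * Q.κ * X := by
    have m1 : ‖r'‖ ≤ Q.ω2 / (1 - Q.ω1) * ‖ϱ‖ := by
      refine hr'r.trans ?_
      rw [div_mul_eq_mul_div, le_div_iff₀ (by linarith)]
      nlinarith
    have m3 : Q.lamMin * energy B (w - x') ^ 2 ≤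
        (Q.ω2 / (1 - Q.ω1)) ^ 2 * (Q.lamMax * X) := by
      calc _ ≤ ‖r'‖ ^ 2 := e4
        _ ≤ (Q.ω2 / (1 - Q.ω1) * ‖ϱ‖) ^ 2 := by gcongr
        _ = (Q.ω2 / (1 - Q.ω1)) ^ 2 * ‖ϱ‖ ^ 2 := by ring
        _ ≤ _ := by gcongr
    rw [Params.κ]
    have : (Q.ω2 / (1 - Q.ω1)) ^ 2 * (Q.lamMax / Q.lamMin) * X =
      (Q.ω2 / (1 - Q.ω1)) ^ 2 * (Q.lamMax * X) / Q.lamMin := by ring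
    rw [this, le_div_iff₀ ha]
    linarith
  have hX : 0 ≤ X := sq_nonneg _
  have hfin : energy B (u - x') ^ 2 ≤ (1 - ((Q.α - Q.ω1) / (1 + Q.ω1)) ^ 2 * Q.κ⁻¹ +
      (Q.ω2 / (1 - Q.ω1)) ^ 2 * Q.κ) * X := by
    rw [p2]; linarith
  have h5 := Real.sqrt_le_sqrt hfin
  rw [Real.sqrt_sq (SpdBounds.energy_nonneg _), Real.sqrt_mul' _ hX,
    Real.sqrt_sq (SpdBounds.energy_nonneg _)] at h5
  exact h5

end Galerkin

end

section

/-! ### Finitely supported families -/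

section Basic

variable {ι : Type*}

lemma ofFinset_of_mem {F : Finset ι} (g : ι → ℝ) {i : ι} (hi : i ∈ F) : ofFinset F g i = g i := by
  classical
  rw [ofFinset, lp.coeFn_sum, Finset.sum_apply]
  simp only [lp.coeFn_single]
  exact (Finset.sum_eq_single i (fun j _ hj => Pi.single_eq_of_ne (Ne.symm hj) _)
    (fun h => absurd hi h)).trans (Pi.single_eq_same _ _)

lemma ofFinset_of_notMem {F : Finset ι} (g : ι → ℝ) {i : ι} (hi : i ∉ F) :
    ofFinset F g i = 0 := by
  classical
  rw [ofFinset, lp.coeFn_sum, Finset.sum_apply]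
  simp only [lp.coeFn_single]
  exact Finset.sum_eq_zero fun j hj => Pi.single_eq_of_ne (fun h => hi (by rw [h]; exact hj)) _

lemma ofFinset_apply (F : Finset ι) (g : ι → ℝ) (i : ι) :
    ofFinset F g i = (F : Set ι).indicator g i := by
  by_cases hi : i ∈ F
  · rw [ofFinset_of_mem g hi, Set.indicator_of_mem (by exact_mod_cast hi)]
  · rw [ofFinset_of_notMem g hi, Set.indicator_of_notMem (by exact_mod_cast hi)]

lemma merge_self {d : ℕ} {I : Type*} (α : Finset (Fin d)) (x : Fin d → I) :
    merge α (fun i => x i) x = x := by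
  ext i; simp [merge]

lemma merge_of_mem {d : ℕ} {I : Type*} {α : Finset (Fin d)} (μ : α → I) (x : Fin d → I)
    {i : Fin d} (hi : i ∈ α) : merge α μ x i = μ ⟨i, hi⟩ := by simp [merge, hi]

lemma merge_of_notMem {d : ℕ} {I : Type*} {α : Finset (Fin d)} (μ : α → I) (x : Fin d → I)
    {i : Fin d} (hi : i ∉ α) : merge α μ x i = x i := by simp [merge, hi]

end Basic

/-! ### Ranks of matricizations -/

section Rank

variable {d : ℕ} {I : Type*}

/-- The `α`-matricization of `v` is a sum of `n` elementary products. -/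
def HasRank (α : Finset (Fin d)) (n : ℕ) (v : (Fin d → I) → ℝ) : Prop :=
  ∃ a b : Fin n → (Fin d → I) → ℝ, (∀ k, DependsOn (a k) (α : Set (Fin d))) ∧
    (∀ k, DependsOn (b k) (α : Set (Fin d))ᶜ) ∧ ∀ x, v x = ∑ k, a k x * b k x

variable {α : Finset (Fin d)}

lemma HasRank.of_fintype {κ : Type*} [Fintype κ] {n : ℕ} (hn : Fintype.card κ ≤ n)
    {v : (Fin d → I) → ℝ} (a b : κ → (Fin d → I) → ℝ)
    (ha : ∀ k, DependsOn (a k) (α : Set (Fin d)))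
    (hb : ∀ k, DependsOn (b k) (α : Set (Fin d))ᶜ)
    (hv : ∀ x, v x = ∑ k, a k x * b k x) : HasRank α n v := by
  classical
  obtain ⟨m, rfl⟩ := Nat.exists_eq_add_of_le hn
  let e := Fintype.equivFin κ
  refine ⟨Fin.addCases (fun k => a (e.symm k)) (fun _ _ => 0),
    Fin.addCases (fun k => b (e.symm k)) (fun _ _ => 0), ?_, ?_, ?_⟩
  · intro k
    refine Fin.addCases (fun k => ?_) (fun k => ?_) k
    · simpa using ha _
    · simp only [Fin.addCases_right]; intro x y _; rfl
  · intro k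
    refine Fin.addCases (fun k => ?_) (fun k => ?_) k
    · simpa using hb _
    · simp only [Fin.addCases_right]; intro x y _; rfl
  · intro x
    rw [hv, Fin.sum_univ_add]
    simp only [Fin.addCases_left, Fin.addCases_right, mul_zero, Finset.sum_const_zero, add_zero]
    exact (e.symm.sum_comp (fun k => a k x * b k x)).symm

/-- A basis of the span of the rows, with coordinates of the rows as second factors, gives the
elementary products; conversely the first factors span all rows. From here on ranks are handled
through explicit sums of products, for which arithmetic is immediate. -/
lemma matRank_le_iff {v : (Fin d → I) → ℝ} {n : ℕ} : matRank α v ≤ n ↔ HasRank α n v := by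
  rw [matRank, Cardinal.toENat_le_natCast]
  set rows : (Fin d → I) → (α → I) → ℝ := fun lam μ => v (merge α μ lam) with hrows
  constructor
  · intro h
    set W := Submodule.span ℝ (Set.range rows)
    have hfin : Module.Finite ℝ W := by
      rw [← Module.rank_lt_aleph0_iff]
      exact h.trans_lt (Cardinal.natCast_lt_aleph0)
    let b := Module.finBasis ℝ W
    have hmem : ∀ x, rows x ∈ W := fun x => Submodule.subset_span ⟨x, rfl⟩
    refine HasRank.of_fintype (κ := Fin (Module.finrank ℝ W)) ?_
      (fun k x => (b k : (α → I) → ℝ) fun i => x i) (fun k x => b.repr ⟨rows x, hmem x⟩ k) ?_ ?_ ?_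
    · rw [Fintype.card_fin]
      have := Module.finrank_eq_rank ℝ W
      rw [← this] at h
      exact_mod_cast h
    · intro k x y hxy
      have : (fun i : α => x i) = fun i : α => y i := funext fun i => hxy i i.2
      simp only [this]
    · intro k x y hxy
      have : rows x = rows y := by
        funext μ
        simp only [hrows]
        congr 1
        ext i
        by_cases hi : i ∈ α
        · rw [merge_of_mem _ _ hi, merge_of_mem _ _ hi]
        · rw [merge_of_notMem _ _ hi, merge_of_notMem _ _ hi]; exact hxy i hi
      simp only [this]
    · intro x
      have h1 := congrArg (fun w : W => (w : (α → I) → ℝ) fun i => x i)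
        (b.sum_repr ⟨rows x, hmem x⟩)
      simp only [Submodule.coe_sum, Submodule.coe_smul, Finset.sum_apply, Pi.smul_apply,
        smul_eq_mul] at h1
      have h2 : rows x (fun i => x i) = v x := by simp only [hrows, merge_self]
      rw [← h2, ← h1]
      exact Finset.sum_congr rfl fun k _ => mul_comm _ _
  · rintro ⟨a, b, ha, hb, hv⟩
    by_cases hne : Nonempty (Fin d → I)
    · obtain ⟨x₀⟩ := hne
      let A : Fin n → (α → I) → ℝ := fun k μ => a k (merge α μ x₀)
      have hle : Submodule.span ℝ (Set.range rows) ≤ Submodule.span ℝ (Set.range A) := by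
        rw [Submodule.span_le]
        rintro _ ⟨x, rfl⟩
        have : rows x = ∑ k, b k x • A k := by
          funext μ
          simp only [hrows, hv, Finset.sum_apply, Pi.smul_apply, smul_eq_mul, A]
          refine Finset.sum_congr rfl fun k _ => ?_
          rw [mul_comm]
          congr 1
          · exact hb k fun i hi => merge_of_notMem _ _ hi
          · exact ha k fun i hi => by
              rw [merge_of_mem _ _ hi, merge_of_mem _ _ hi]
        rw [this]
        exact Submodule.sum_mem _ fun k _ =>
          Submodule.smul_mem _ _ (Submodule.subset_span ⟨k, rfl⟩)
      classical
      have hA : Set.range A = ((Finset.univ.image A : Finset _) : Set _) := by simp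
      rw [hA] at hle
      refine (Submodule.rank_mono hle).trans ((rank_span_finset_le _).trans ?_)
      have := (Finset.card_image_le (s := Finset.univ) (f := A))
      rw [Finset.card_univ, Fintype.card_fin] at this
      exact_mod_cast this
    · have : rows = fun x => (hne ⟨x⟩).elim := by funext x; exact (hne ⟨x⟩).elim
      have hemp : Set.range rows = ∅ := by
        rw [Set.range_eq_empty_iff]; exact ⟨fun x => hne ⟨x⟩⟩
      rw [hemp, Submodule.span_empty, rank_bot]
      exact zero_le

lemma htRank_le_iff {T : Finset (Finset (Fin d))} {v : (Fin d → I) → ℝ} {n : ℕ} :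
    htRank T v ≤ n ↔ ∀ α ∈ T, HasRank α n v := by
  rw [htRank, Finset.sup_le_iff]
  simp only [matRank_le_iff]

namespace HasRank

lemma zero (n : ℕ) : HasRank α n (fun _ : Fin d → I => 0) :=
  of_fintype (κ := Fin 0) (by simp) (fun _ _ => 0) (fun _ _ => 0) (fun k => k.elim0)
    (fun k => k.elim0) (fun x => by simp)

variable {n m : ℕ} {v w : (Fin d → I) → ℝ}

lemma mono (h : HasRank α n v) (hnm : n ≤ m) : HasRank α m v := by
  obtain ⟨a, b, ha, hb, hv⟩ := h
  exact of_fintype (by simpa using hnm) a b ha hb hv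

lemma congr (h : HasRank α n v) (hvw : ∀ x, w x = v x) : HasRank α n w := by
  obtain rfl : w = v := funext hvw
  exact h

lemma add (hv : HasRank α n v) (hw : HasRank α m w) : HasRank α (n + m) fun x => v x + w x := by
  obtain ⟨a, b, ha, hb, h1⟩ := hv
  obtain ⟨a', b', ha', hb', h2⟩ := hw
  refine of_fintype (κ := Fin n ⊕ Fin m) (by simp) (Sum.elim a a') (Sum.elim b b') ?_ ?_ ?_
  · rintro (k | k); exacts [ha k, ha' k]
  · rintro (k | k); exacts [hb k, hb' k]
  · intro x; simp [h1, h2, Fintype.sum_sum_type]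

lemma smul (hv : HasRank α n v) (c : ℝ) : HasRank α n fun x => c * v x := by
  obtain ⟨a, b, ha, hb, h1⟩ := hv
  refine ⟨fun k x => c * a k x, b, fun k x y hxy => ?_, hb, fun x => ?_⟩
  · simp only [ha k hxy]
  · simp only [h1, Finset.mul_sum]; exact Finset.sum_congr rfl fun k _ => by ring

lemma mul (hv : HasRank α n v) (hw : HasRank α m w) : HasRank α (n * m) fun x => v x * w x := by
  obtain ⟨a, b, ha, hb, h1⟩ := hv
  obtain ⟨a', b', ha', hb', h2⟩ := hw
  refine of_fintype (κ := Fin n × Fin m) (by simp) (fun k x => a k.1 x * a' k.2 x)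
    (fun k x => b k.1 x * b' k.2 x) (fun k x y hxy => ?_) (fun k x y hxy => ?_) fun x => ?_
  · simp only [ha _ hxy, ha' _ hxy]
  · simp only [hb _ hxy, hb' _ hxy]
  · rw [h1, h2, Finset.sum_mul_sum, Fintype.sum_prod_type]
    exact Finset.sum_congr rfl fun k _ => Finset.sum_congr rfl fun l _ => by ring

lemma sum {κ : Type*} (s : Finset κ) {f : κ → (Fin d → I) → ℝ}
    (hf : ∀ k ∈ s, HasRank α n (f k)) : HasRank α (s.card * n) fun x => ∑ k ∈ s, f k x := by
  classical
  induction s using Finset.induction_on with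
  | empty => simpa using zero 0
  | insert k s hk ih =>
    rw [Finset.card_insert_of_notMem hk, add_mul, one_mul, add_comm]
    refine ((hf k (Finset.mem_insert_self _ _)).add
      (ih fun l hl => hf l (Finset.mem_insert_of_mem hl))).congr fun x => ?_
    rw [Finset.sum_insert hk]

lemma prod (g : Fin d → I → ℝ) : HasRank α 1 fun x => ∏ j, g j (x j) := by
  classical
  refine ⟨fun _ x => ∏ j ∈ α, g j (x j), fun _ x => ∏ j ∈ αᶜ, g j (x j), fun _ x y hxy => ?_,
    fun _ x y hxy => ?_, fun x => ?_⟩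
  · exact Finset.prod_congr rfl fun j hj => by rw [hxy j hj]
  · exact Finset.prod_congr rfl fun j hj => by rw [hxy j (by simpa using hj)]
  · simp [Finset.prod_mul_prod_compl]

lemma indicator (hv : HasRank α n v) (Λ : Fin d → Finset I) :
    HasRank α n ((Fintype.piFinset Λ : Set (Fin d → I)).indicator v) := by
  classical
  have h1 := hv.mul (prod (α := α) fun j l => if l ∈ Λ j then (1 : ℝ) else 0)
  rw [mul_one] at h1
  refine h1.congr fun x => ?_
  by_cases hx : x ∈ Fintype.piFinset Λ
  · rw [Set.indicator_of_mem (by exact_mod_cast hx)]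
    rw [Fintype.mem_piFinset] at hx
    simp [hx]
  · rw [Set.indicator_of_notMem (by exact_mod_cast hx)]
    rw [Fintype.mem_piFinset] at hx
    push Not at hx
    obtain ⟨j, hj⟩ := hx
    rw [Finset.prod_eq_zero (Finset.mem_univ j) (by simp [hj]), mul_zero]

lemma ofFinset (hv : HasRank α n v) (Λ : Fin d → Finset I) :
    HasRank α n (HTAWGM.ofFinset (Fintype.piFinset Λ) v) := by
  exact (hv.indicator Λ).congr fun x => ofFinset_apply _ _ _

end HasRank

lemma piecewise_mem_box {Λ : Fin d → Finset I} {x y : Fin d → I}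
    (hx : x ∈ Fintype.piFinset Λ) (hy : y ∈ Fintype.piFinset Λ) :
    α.piecewise x y ∈ Fintype.piFinset Λ := by
  rw [Fintype.mem_piFinset] at *
  intro i
  by_cases hi : i ∈ α
  · rw [Finset.piecewise_eq_of_mem _ _ _ hi]; exact hx i
  · rw [Finset.piecewise_eq_of_notMem _ _ _ hi]; exact hy i

/-- Sums over product sets of products of functions of complementary variables factorize. -/
lemma card_mul_sum_box (Λ : Fin d → Finset I) {G H : (Fin d → I) → ℝ}
    (hG : DependsOn G (α : Set (Fin d))) (hH : DependsOn H (α : Set (Fin d))ᶜ) :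
    ((Fintype.piFinset Λ).card : ℝ) * ∑ x ∈ Fintype.piFinset Λ, G x * H x =
      (∑ x ∈ Fintype.piFinset Λ, G x) * ∑ x ∈ Fintype.piFinset Λ, H x := by
  set X := Fintype.piFinset Λ
  have h1 : (X.card : ℝ) * ∑ x ∈ X, G x * H x = ∑ p ∈ X ×ˢ X, G p.1 * H p.1 := by
    rw [Finset.sum_product_right]; simp
  rw [h1, Finset.sum_mul_sum, ← Finset.sum_product']
  have hp1 : ∀ x y : Fin d → I, α.piecewise (α.piecewise x y) (α.piecewise y x) = x := by
    intro x y; ext i; by_cases hi : i ∈ α <;> simp [hi]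
  refine Finset.sum_nbij' (fun p => (α.piecewise p.1 p.2, α.piecewise p.2 p.1))
    (fun p => (α.piecewise p.1 p.2, α.piecewise p.2 p.1)) ?_ ?_ ?_ ?_ ?_
  · intro p hp
    rw [Finset.mem_product] at hp ⊢
    exact ⟨piecewise_mem_box hp.1 hp.2, piecewise_mem_box hp.2 hp.1⟩
  · intro p hp
    rw [Finset.mem_product] at hp ⊢
    exact ⟨piecewise_mem_box hp.1 hp.2, piecewise_mem_box hp.2 hp.1⟩
  · intro p _; simp [hp1]
  · intro p _; simp [hp1]
  · intro p _
    congr 1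
    · exact hG fun i hi => by simp [Finset.piecewise_eq_of_mem _ _ _ hi]
    · exact hH fun i hi => by
        have hi' : i ∉ α := hi
        simp [hi']

lemma sum_box_eq (Λ : Fin d → Finset I) {G H : (Fin d → I) → ℝ}
    (hG : DependsOn G (α : Set (Fin d))) (hH : DependsOn H (α : Set (Fin d))ᶜ) :
    ∑ x ∈ Fintype.piFinset Λ, G x * H x = ((Fintype.piFinset Λ).card : ℝ)⁻¹ *
      ((∑ x ∈ Fintype.piFinset Λ, G x) * ∑ x ∈ Fintype.piFinset Λ, H x) := by
  rw [← card_mul_sum_box Λ hG hH]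
  by_cases h0 : (Fintype.piFinset Λ) = ∅
  · simp [h0]
  · have : ((Fintype.piFinset Λ).card : ℝ) ≠ 0 := by
      rw [Nat.cast_ne_zero, Finset.card_ne_zero]; exact Finset.nonempty_iff_ne_empty.2 h0
    field_simp

/-- Ranks under application of a matrix, restricted to a product set of columns. -/
lemma HasRank.matMul {n m : ℕ} {M : (Fin d → I) → (Fin d → I) → ℝ}
    (hM : HasRank α n fun q : Fin d → I × I => M (fun j => (q j).1) (fun j => (q j).2))
    {v : (Fin d → I) → ℝ} (hv : HasRank α m v) (Λ : Fin d → Finset I) :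
    HasRank α (n * m) fun x => ∑ y ∈ Fintype.piFinset Λ, M x y * v y := by
  obtain ⟨a, b, ha, hb, h1⟩ := hM
  obtain ⟨a', b', ha', hb', h2⟩ := hv
  refine of_fintype (κ := Fin n × Fin m) (by simp)
    -- Both factors are summed over the entire box instead of over their own coordinates; the
    -- inverse cardinality corrects the overcount, as in `sum_box_eq`.
    (fun k x => ((Fintype.piFinset Λ).card : ℝ)⁻¹ *
      ∑ y ∈ Fintype.piFinset Λ, a k.1 (fun j => (x j, y j)) * a' k.2 y)
    (fun k x => ∑ y ∈ Fintype.piFinset Λ, b k.1 (fun j => (x j, y j)) * b' k.2 y)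
    (fun k x z hxz => ?_) (fun k x z hxz => ?_) fun x => ?_
  · simp only
    congr 1
    refine Finset.sum_congr rfl fun y _ => ?_
    congr 1
    exact ha _ fun i hi => by rw [hxz i hi]
  · refine Finset.sum_congr rfl fun y _ => ?_
    congr 1
    exact hb _ fun i hi => by rw [hxz i hi]
  · have h3 : ∀ y, M x y * v y = ∑ k : Fin n × Fin m,
        (a k.1 (fun j => (x j, y j)) * a' k.2 y) * (b k.1 (fun j => (x j, y j)) * b' k.2 y) := by
      intro y
      have h4 := h1 fun j => (x j, y j)
      simp only at h4
      rw [h4, h2, Finset.sum_mul_sum, Fintype.sum_prod_type]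
      exact Finset.sum_congr rfl fun k _ => Finset.sum_congr rfl fun l _ => by ring
    simp only [h3]
    rw [Finset.sum_comm]
    refine Finset.sum_congr rfl fun k _ => ?_
    rw [sum_box_eq (α := α) Λ]
    · ring
    · intro y z hyz
      simp only
      congr 1
      · exact ha _ fun i hi => by rw [hyz i hi]
      · exact ha' _ hyz
    · intro y z hyz
      simp only
      congr 1
      · exact hb _ fun i hi => by rw [hyz i hi]
      · exact hb' _ hyz

/-- Each term of the exponential sum is the exponential of a sum over the directions, hence an
elementary product of rank one. This is the reason for replacing D⁻¹ by an exponential sum. -/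
lemma HasRank.sInvApp {K : ℕ} {J : Type*} (P : Problem d K J) (n : ℕ) :
    HasRank α (n + P.nPlus + 1) (P.sInvApp n) := by
  have h1 : HasRank α ((Finset.Icc (-(n : ℤ)) (P.nPlus : ℤ)).card * 1)
      fun x => ∑ k ∈ Finset.Icc (-(n : ℤ)) (P.nPlus : ℤ), P.expTerm (P.weight x) k := by
    refine HasRank.sum _ fun k _ => ?_
    refine ((HasRank.prod (α := α) fun j l =>
      Real.exp (-(Real.log (1 + Real.exp (k * P.h))) ^ 2 * P.w j l ^ 2)).smul
      (P.h * (2 / Real.sqrt Real.pi * (1 + Real.exp (-(k * P.h)))⁻¹))).congr fun x => ?_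
    rw [Problem.expTerm, Problem.weight, Finset.mul_sum, Real.exp_sum]
  refine (h1.mono ?_).congr fun x => rfl
  rw [Int.card_Icc]
  omega

lemma HasRank.approxRes {K : ℕ} {J : Type*} (P : Problem d K J) {rA rg rv : ℕ}
    (hA : HasRank α rA P.opTensor) {g : (Fin d → J) → ℝ} (hg : HasRank α rg g)
    {v : L2 (Fin d → J)} (hv : HasRank α rv v) (η : ℝ) (Λ Λ' : Fin d → Finset J) :
    HasRank α ((P.numTerms η (Fintype.piFinset Λ) + P.nPlus + 1) *
      (rg + rA * ((P.numTerms η (Fintype.piFinset Λ) + P.nPlus + 1) * rv)))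
      (P.approxRes η g (Fintype.piFinset Λ) (Fintype.piFinset Λ') v) := by
  rw [Problem.approxRes]
  refine HasRank.ofFinset (HasRank.mul (HasRank.sInvApp P _) ?_) Λ
  have h1 := HasRank.matMul hA
    ((HasRank.sInvApp P (P.numTerms η (Fintype.piFinset Λ))).mul hv) Λ'
  refine (hg.add (h1.smul (-1))).congr fun x => by ring

end Rank

end

section

/-! ### Inner products and norms of finitely supported vectors -/

section L2Finite

variable {ι : Type*}

lemma inner_eq_sum (F : Finset ι) {f : L2 ι} (g : L2 ι) (hf : ∀ i ∉ F, f i = 0) :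
    inner ℝ f g = ∑ i ∈ F, f i * g i := by
  rw [lp.inner_eq_tsum, tsum_eq_sum (s := F)]
  · exact Finset.sum_congr rfl fun i _ => mul_comm _ _
  · intro i hi; rw [hf i hi, inner_zero_left]

lemma norm_sq_eq_sum (F : Finset ι) {f : L2 ι} (hf : ∀ i ∉ F, f i = 0) :
    ‖f‖ ^ 2 = ∑ i ∈ F, f i ^ 2 := by
  rw [← real_inner_self_eq_norm_sq, inner_eq_sum F f hf]
  exact Finset.sum_congr rfl fun i _ => (sq _).symm

lemma norm_ofFinset_sq (F : Finset ι) (g : ι → ℝ) : ‖ofFinset F g‖ ^ 2 = ∑ i ∈ F, g i ^ 2 := by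
  rw [norm_sq_eq_sum F fun i hi => ofFinset_of_notMem g hi]
  exact Finset.sum_congr rfl fun i hi => by rw [ofFinset_of_mem g hi]

lemma inner_ofFinset (F : Finset ι) (f : L2 ι) (g : ι → ℝ) :
    inner ℝ f (ofFinset F g) = ∑ i ∈ F, f i * g i := by
  rw [real_inner_comm, inner_eq_sum F f fun i hi => ofFinset_of_notMem g hi]
  exact Finset.sum_congr rfl fun i hi => by rw [ofFinset_of_mem g hi, mul_comm]

lemma sum_sq_le_norm_sq (F : Finset ι) (f : L2 ι) : ∑ i ∈ F, f i ^ 2 ≤ ‖f‖ ^ 2 := by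
  have h := lp.sum_rpow_le_norm_rpow (p := 2) (by norm_num) f F
  simpa using h

lemma eq_ofFinset {F : Finset ι} {f : L2 ι} (hf : ∀ i ∉ F, f i = 0) : f = ofFinset F f := by
  ext i
  by_cases hi : i ∈ F
  · rw [ofFinset_of_mem _ hi]
  · rw [ofFinset_of_notMem _ hi, hf i hi]

end L2Finite

/-! ### Kernels acting in some of the coordinates, and slices -/

section Kernel

variable {d : ℕ} {J : Type*}

/-- Application of a kernel in the coordinates in `α`, on a box. -/
def kop (F : Finset J) (α : Finset (Fin d)) (p : (α → J) → (α → J) → ℝ)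
    (w : (Fin d → J) → ℝ) : (Fin d → J) → ℝ :=
  fun x => ∑ μ ∈ Fintype.piFinset fun _ : α => F, p (fun i => x i) μ * w (merge α μ x)

/-- The box generated by `F` in the coordinates in `α`. -/
abbrev bx (α : Finset (Fin d)) (F : Finset J) : Finset (α → J) := Fintype.piFinset fun _ : α => F

/-- The box generated by `F`. -/
abbrev Bx (d : ℕ) (F : Finset J) : Finset (Fin d → J) := Fintype.piFinset fun _ : Fin d => F

/-- Slice in the coordinates in `α`. -/
def slice (F : Finset J) (α : Finset (Fin d)) (w : (Fin d → J) → ℝ) (x : Fin d → J) :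
    L2 (α → J) :=
  ofFinset (bx α F) fun μ => w (merge α μ x)

/-- Weighted sum of squares over a box. -/
def nsq (F : Finset J) (φ : (Fin d → J) → ℝ) (w : (Fin d → J) → ℝ) : ℝ :=
  ∑ x ∈ Bx d F, φ x * w x ^ 2

lemma bx_card_pos {F : Finset J} (hF : F.Nonempty) (α : Finset (Fin d)) :
    (0 : ℝ) < (bx α F).card := by
  rw [Nat.cast_pos, Finset.card_pos, Fintype.piFinset_nonempty]
  exact fun _ => hF

lemma Bx_card_pos {F : Finset J} (hF : F.Nonempty) :
    (0 : ℝ) < (Bx d F).card := by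
  rw [Nat.cast_pos, Finset.card_pos, Fintype.piFinset_nonempty]
  exact fun _ => hF

lemma merge_mem_Bx {F : Finset J} {α : Finset (Fin d)} {μ : α → J} {x : Fin d → J}
    (hμ : μ ∈ bx α F) (hx : x ∈ Bx d F) : merge α μ x ∈ Bx d F := by
  rw [Fintype.mem_piFinset] at *
  intro i
  by_cases hi : i ∈ α
  · rw [merge_of_mem _ _ hi]; exact hμ _
  · rw [merge_of_notMem _ _ hi]; exact hx _

lemma restrict_merge (α : Finset (Fin d)) (μ : α → J) (x : Fin d → J) :
    (fun i : α => merge α μ x i) = μ := by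
  ext i; rw [merge_of_mem _ _ i.2]

lemma restrict_merge_disjoint {α β : Finset (Fin d)} (h : Disjoint α β) (μ : α → J)
    (x : Fin d → J) : (fun i : β => merge α μ x i) = fun i : β => x i := by
  ext i; rw [merge_of_notMem]; exact fun hi => (Finset.disjoint_left.1 h hi) i.2

lemma merge_merge (α : Finset (Fin d)) (μ ν : α → J) (x : Fin d → J) :
    merge α μ (merge α ν x) = merge α μ x := by
  ext i; by_cases hi : i ∈ α <;> simp [merge, hi]

lemma merge_comm {α β : Finset (Fin d)} (h : Disjoint α β) (μ : α → J) (ν : β → J)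
    (x : Fin d → J) : merge β ν (merge α μ x) = merge α μ (merge β ν x) := by
  ext i
  by_cases hi : i ∈ α
  · have : i ∉ β := Finset.disjoint_left.1 h hi
    simp [merge, hi, this]
  · by_cases hb : i ∈ β <;> simp [merge, hi, hb]

/-- Exchanging the α-coordinates of x with μ is an involution on pairs. Sums over slices thereby
become averages over the full box, and multi-indices never have to be split into two parts. -/
lemma average (F : Finset J) (α : Finset (Fin d)) (g : (Fin d → J) → ℝ) :
    ((bx α F).card : ℝ) * ∑ x ∈ Bx d F, g x =
      ∑ x ∈ Bx d F, ∑ μ ∈ bx α F, g (merge α μ x) := by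
  have h1 : ((bx α F).card : ℝ) * ∑ x ∈ Bx d F, g x = ∑ p ∈ Bx d F ×ˢ bx α F, g p.1 := by
    rw [Finset.sum_product_right]; simp
  rw [h1, ← Finset.sum_product']
  refine Finset.sum_nbij' (fun p => (merge α p.2 p.1, fun i => p.1 i))
    (fun p => (merge α p.2 p.1, fun i => p.1 i)) ?_ ?_ ?_ ?_ ?_
  · intro p hp
    rw [Finset.mem_product] at hp ⊢
    refine ⟨merge_mem_Bx hp.2 hp.1, ?_⟩
    rw [Fintype.mem_piFinset]; exact fun i => Fintype.mem_piFinset.1 hp.1 i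
  · intro p hp
    rw [Finset.mem_product] at hp ⊢
    refine ⟨merge_mem_Bx hp.2 hp.1, ?_⟩
    rw [Fintype.mem_piFinset]; exact fun i => Fintype.mem_piFinset.1 hp.1 i
  · intro p _; simp only [restrict_merge, merge_merge, merge_self]
  · intro p _; simp only [restrict_merge, merge_merge, merge_self]
  · intro p _; simp only [merge_merge, merge_self]

lemma sum_restrict {F : Finset J} (hF : F.Nonempty) (α : Finset (Fin d)) (g : (α → J) → ℝ) :
    ∑ x ∈ Bx d F, g (fun i => x i) =
      ((Bx d F).card : ℝ) / (bx α F).card * ∑ μ ∈ bx α F, g μ := by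
  have h := average F α fun x => g fun i => x i
  simp only [restrict_merge, Finset.sum_const, nsmul_eq_mul] at h
  have := bx_card_pos hF α
  field_simp
  linarith

lemma kop_comm (F : Finset J) {α β : Finset (Fin d)} (h : Disjoint α β)
    (p : (α → J) → (α → J) → ℝ) (q : (β → J) → (β → J) → ℝ) (w : (Fin d → J) → ℝ) :
    kop F α p (kop F β q w) = kop F β q (kop F α p w) := by
  funext x
  simp only [kop, Finset.mul_sum]
  rw [Finset.sum_comm]
  refine Finset.sum_congr rfl fun ν _ => Finset.sum_congr rfl fun μ _ => ?_
  rw [restrict_merge_disjoint h, restrict_merge_disjoint h.symm, merge_comm h]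
  ring

/-- The kernel of the orthogonal projection onto the first `r` of the vectors `U`. -/
def projKer {κ : Type*} {R : ℕ} (U : Fin R → L2 κ) (r : ℕ) (ν μ : κ) : ℝ :=
  ∑ k : Fin R, if (k : ℕ) < r then U k ν * U k μ else 0

lemma modeProj_eq_kop {F : Finset J} {α : Finset (Fin d)} {R : ℕ} {U : Fin R → L2 (α → J)}
    (hU : ∀ k, ∀ μ ∉ bx α F, U k μ = 0) (r : ℕ) (w : (Fin d → J) → ℝ) :
    modeProj U r w = kop F α (projKer U r) w := by
  funext x
  simp only [modeProj, kop, projKer, Finset.sum_mul]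
  rw [Finset.sum_comm]
  refine Finset.sum_congr rfl fun k _ => ?_
  split_ifs with hk
  · rw [tsum_eq_sum (s := bx α F) (fun μ hμ => by rw [hU k μ hμ, zero_mul]), Finset.mul_sum]
    exact Finset.sum_congr rfl fun μ _ => by ring
  · simp

/-- Orthogonal projection onto the first `r` of the orthonormal vectors `U`. -/
def firstProj {κ : Type*} {R : ℕ} (U : Fin R → L2 κ) (r : ℕ) (z : L2 κ) : L2 κ :=
  ∑ k : Fin R, (if (k : ℕ) < r then inner ℝ (U k) z else 0) • U k

lemma kop_merge {F : Finset J} {α : Finset (Fin d)} {R : ℕ} (U : Fin R → L2 (α → J)) (r : ℕ)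
    (w : (Fin d → J) → ℝ) (x : Fin d → J) (μ : α → J) :
    kop F α (projKer U r) w (merge α μ x) = firstProj U r (slice F α w x) μ := by
  simp only [kop, restrict_merge, merge_merge, firstProj, projKer, lp.coeFn_sum, Finset.sum_apply,
    lp.coeFn_smul, Pi.smul_apply, smul_eq_mul, slice, inner_ofFinset, Finset.sum_mul]
  rw [Finset.sum_comm]
  refine Finset.sum_congr rfl fun k _ => ?_
  split_ifs with hk
  · rw [Finset.sum_mul]; exact Finset.sum_congr rfl fun ν _ => by ring
  · simp

section firstProj

variable {κ : Type*} {R : ℕ} {U : Fin R → L2 κ} (hU : Orthonormal ℝ U) (r : ℕ)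
include hU

omit hU in
lemma inner_firstProj (z y : L2 κ) : inner ℝ (firstProj U r z) y =
    ∑ k : Fin R, if (k : ℕ) < r then inner ℝ (U k) z * inner ℝ (U k) y else 0 := by
  rw [firstProj, sum_inner]
  refine Finset.sum_congr rfl fun k _ => ?_
  rw [inner_smul_left]; split_ifs <;> simp

lemma inner_U_firstProj (z : L2 κ) (k : Fin R) : inner ℝ (U k) (firstProj U r z) =
    if (k : ℕ) < r then inner ℝ (U k) z else 0 := by
  rw [firstProj]
  exact hU.inner_right_fintype _ k

lemma norm_firstProj_sq (z : L2 κ) : ‖firstProj U r z‖ ^ 2 =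
    ∑ k : Fin R, if (k : ℕ) < r then inner ℝ (U k) z ^ 2 else 0 := by
  rw [← real_inner_self_eq_norm_sq, inner_firstProj]
  refine Finset.sum_congr rfl fun k _ => ?_
  rw [inner_U_firstProj hU]
  split_ifs <;> ring

lemma norm_firstProj_le (z : L2 κ) : ‖firstProj U r z‖ ^ 2 ≤ ‖z‖ ^ 2 := by
  rw [norm_firstProj_sq hU]
  have h := hU.sum_inner_products_le z (s := Finset.univ)
  refine le_trans (Finset.sum_le_sum fun k _ => ?_) h
  split_ifs
  · rw [Real.norm_eq_abs, sq_abs]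
  · positivity

lemma norm_sub_firstProj_sq (z : L2 κ) : ‖z - firstProj U r z‖ ^ 2 =
    ‖z‖ ^ 2 - ∑ k : Fin R, if (k : ℕ) < r then inner ℝ (U k) z ^ 2 else 0 := by
  rw [norm_sub_sq_real, real_inner_comm, norm_firstProj_sq hU, inner_firstProj]
  simp only [← sq]
  ring

/-- With P the projection, z - P y = (z - P z) + P(z - y) is an orthogonal decomposition. The errors
of successive projections thus add in squares. -/
lemma norm_sub_firstProj_le (z y : L2 κ) : ‖z - firstProj U r y‖ ^ 2 ≤
    ‖z - firstProj U r z‖ ^ 2 + ‖z - y‖ ^ 2 := by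
  have h1 : z - firstProj U r y = (z - firstProj U r z) + firstProj U r (z - y) := by
    have : firstProj U r (z - y) = firstProj U r z - firstProj U r y := by
      simp only [firstProj, inner_sub_right, ← Finset.sum_sub_distrib, ← sub_smul]
      refine Finset.sum_congr rfl fun k _ => ?_
      split_ifs <;> simp
    rw [this]; abel
  have h2 : inner ℝ (z - firstProj U r z) (firstProj U r (z - y)) = 0 := by
    rw [real_inner_comm, inner_firstProj]
    refine Finset.sum_eq_zero fun k _ => ?_
    split_ifs with hk
    · have : inner ℝ (U k) (z - firstProj U r z) = 0 := by
        rw [inner_sub_right, inner_U_firstProj hU, if_pos hk, sub_self]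
      rw [this, mul_zero]
    · rfl
  rw [h1, norm_add_sq_real, h2]
  have := norm_firstProj_le hU r (z - y)
  linarith

end firstProj

lemma sum_slice_sq (F : Finset J) (α : Finset (Fin d)) (w : (Fin d → J) → ℝ) (x : Fin d → J) :
    ∑ μ ∈ bx α F, w (merge α μ x) ^ 2 = ‖slice F α w x‖ ^ 2 := by
  rw [slice, norm_ofFinset_sq]

/-- Weighted sums of squares are averages of norms of slices. -/
lemma nsq_eq_slices (F : Finset J) (α : Finset (Fin d)) {φ : (Fin d → J) → ℝ}
    (hφ : DependsOn φ (α : Set (Fin d))ᶜ) (w : (Fin d → J) → ℝ) :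
    ((bx α F).card : ℝ) * nsq F φ w = ∑ x ∈ Bx d F, φ x * ‖slice F α w x‖ ^ 2 := by
  rw [nsq, average F α]
  refine Finset.sum_congr rfl fun x _ => ?_
  rw [← sum_slice_sq, Finset.mul_sum]
  refine Finset.sum_congr rfl fun μ _ => ?_
  rw [hφ fun i hi => merge_of_notMem μ x hi]

lemma slice_kop {F : Finset J} {α : Finset (Fin d)} {R : ℕ} {U : Fin R → L2 (α → J)}
    (hU : ∀ k, ∀ μ ∉ bx α F, U k μ = 0) (r : ℕ) (w : (Fin d → J) → ℝ) (x : Fin d → J) :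
    slice F α (kop F α (projKer U r) w) x = firstProj U r (slice F α w x) := by
  ext μ
  by_cases hμ : μ ∈ bx α F
  · rw [slice, ofFinset_of_mem _ hμ, kop_merge]
  · rw [slice, ofFinset_of_notMem _ hμ, firstProj, lp.coeFn_sum, Finset.sum_apply]
    refine (Finset.sum_eq_zero fun k _ => ?_).symm
    rw [lp.coeFn_smul, Pi.smul_apply, hU k μ hμ, smul_zero]

lemma slice_sub (F : Finset J) (α : Finset (Fin d)) (v w : (Fin d → J) → ℝ) (x : Fin d → J) :
    slice F α (fun y => v y - w y) x = slice F α v x - slice F α w x := by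
  ext μ
  rw [lp.coeFn_sub, Pi.sub_apply]
  by_cases hμ : μ ∈ bx α F
  · simp only [slice, ofFinset_of_mem _ hμ]
  · simp only [slice, ofFinset_of_notMem _ hμ, sub_self]

/-- A weight that does not involve the coordinates in α is constant on every slice, and on slices
the kernel is an orthogonal projection. -/
lemma nsq_kop_le {F : Finset J} (hF : F.Nonempty) {α : Finset (Fin d)} {R : ℕ}
    {U : Fin R → L2 (α → J)} (hU : ∀ k, ∀ μ ∉ bx α F, U k μ = 0) (hO : Orthonormal ℝ U) (r : ℕ)
    {φ : (Fin d → J) → ℝ} (hφ : DependsOn φ (α : Set (Fin d))ᶜ) (hφ0 : ∀ x, 0 ≤ φ x)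
    (w : (Fin d → J) → ℝ) : nsq F φ (kop F α (projKer U r) w) ≤ nsq F φ w := by
  refine le_of_mul_le_mul_left ?_ (bx_card_pos hF α)
  rw [nsq_eq_slices F α hφ, nsq_eq_slices F α hφ]
  refine Finset.sum_le_sum fun x _ => ?_
  rw [slice_kop hU]
  exact mul_le_mul_of_nonneg_left (norm_firstProj_le hO r _) (hφ0 x)

lemma dependsOn_one (s : Set (Fin d)) : DependsOn (fun _ : Fin d → J => (1 : ℝ)) s :=
  fun _ _ _ => rfl

lemma nsq_sub_kop_le {F : Finset J} (hF : F.Nonempty) {α : Finset (Fin d)} {R : ℕ}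
    {U : Fin R → L2 (α → J)} (hU : ∀ k, ∀ μ ∉ bx α F, U k μ = 0) (hO : Orthonormal ℝ U) (r : ℕ)
    (v w : (Fin d → J) → ℝ) :
    nsq F (fun _ => 1) (fun x => v x - kop F α (projKer U r) w x) ≤
      nsq F (fun _ => 1) (fun x => v x - kop F α (projKer U r) v x) +
      nsq F (fun _ => 1) (fun x => v x - w x) := by
  refine le_of_mul_le_mul_left ?_ (bx_card_pos hF α)
  rw [mul_add, nsq_eq_slices F α (dependsOn_one _), nsq_eq_slices F α (dependsOn_one _),
    nsq_eq_slices F α (dependsOn_one _), ← Finset.sum_add_distrib]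
  refine Finset.sum_le_sum fun x _ => ?_
  rw [slice_sub, slice_sub, slice_sub, slice_kop hU, slice_kop hU, one_mul, one_mul, one_mul]
  exact norm_sub_firstProj_le hO r _ _

end Kernel

/-! ### Singular value decompositions of matricizations -/

section SVD

variable {d : ℕ} {J : Type*} {F : Finset J} {α : Finset (Fin d)} {v : (Fin d → J) → ℝ} {R : ℕ}
  {σ : Fin R → ℝ} {U : Fin R → L2 (α → J)} {V : Fin R → L2 ((αᶜ : Finset (Fin d)) → J)}

namespace IsSVD

/-- Outside the box the expansion vanishes identically in the complementary variables, and linear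
independence of the right vectors forces every coefficient σ_k U_k(μ) to vanish. -/
lemma left_support (h : IsSVD α v σ U V) (hv : ∀ x ∉ Bx d F, v x = 0) (k : Fin R) (μ : α → J)
    (hμ : μ ∉ bx α F) : U k μ = 0 := by
  have h1 : ∑ k, (σ k * U k μ) • V k = 0 := by
    ext ν
    let x : Fin d → J := fun i => if hi : i ∈ α then μ ⟨i, hi⟩ else ν ⟨i, Finset.mem_compl.2 hi⟩
    have hxμ : (fun i : α => x i) = μ := by ext i; simp [x]
    have hxν : (fun i : (αᶜ : Finset (Fin d)) => x i) = ν := by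
      ext i
      have := Finset.mem_compl.1 i.2
      simp [x, this]
    have hx : x ∉ Bx d F := by
      intro hx
      apply hμ
      rw [← hxμ, Fintype.mem_piFinset]
      exact fun i => Fintype.mem_piFinset.1 hx i
    have h2 := h.eq x
    rw [hv x hx, hxμ, hxν] at h2
    rw [lp.coeFn_sum, Finset.sum_apply]
    simpa using h2.symm
  have h3 := Fintype.linearIndependent_iff.1 h.right.linearIndependent _ h1 k
  exact (mul_eq_zero.1 h3).resolve_left (h.pos k).ne'

lemma right_support (h : IsSVD α v σ U V) (hv : ∀ x ∉ Bx d F, v x = 0) (k : Fin R)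
    (ν : (αᶜ : Finset (Fin d)) → J) (hν : ν ∉ bx αᶜ F) : V k ν = 0 := by
  have h1 : ∑ k, (σ k * V k ν) • U k = 0 := by
    ext μ
    let x : Fin d → J := fun i => if hi : i ∈ α then μ ⟨i, hi⟩ else ν ⟨i, Finset.mem_compl.2 hi⟩
    have hxμ : (fun i : α => x i) = μ := by ext i; simp [x]
    have hxν : (fun i : (αᶜ : Finset (Fin d)) => x i) = ν := by
      ext i
      have := Finset.mem_compl.1 i.2
      simp [x, this]
    have hx : x ∉ Bx d F := by
      intro hx
      apply hν
      rw [← hxν, Fintype.mem_piFinset]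
      exact fun i => Fintype.mem_piFinset.1 hx i
    have h2 := h.eq x
    rw [hv x hx, hxμ, hxν] at h2
    rw [lp.coeFn_sum, Finset.sum_apply]
    simp only [lp.coeFn_smul, Pi.smul_apply, smul_eq_mul, lp.coeFn_zero, Pi.zero_apply]
    rw [h2]
    exact Finset.sum_congr rfl fun k _ => by ring
  have h3 := Fintype.linearIndependent_iff.1 h.left.linearIndependent _ h1 k
  exact (mul_eq_zero.1 h3).resolve_left (h.pos k).ne'

lemma slice_eq (h : IsSVD α v σ U V) (hv : ∀ x ∉ Bx d F, v x = 0) (x : Fin d → J) :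
    slice F α v x = ∑ k, (σ k * V k (fun i => x i)) • U k := by
  ext μ
  rw [lp.coeFn_sum, Finset.sum_apply]
  simp only [lp.coeFn_smul, Pi.smul_apply, smul_eq_mul]
  by_cases hμ : μ ∈ bx α F
  · rw [slice, ofFinset_of_mem _ hμ, h.eq]
    refine Finset.sum_congr rfl fun k _ => ?_
    rw [restrict_merge, restrict_merge_disjoint disjoint_compl_right]
    ring
  · rw [slice, ofFinset_of_notMem _ hμ]
    exact (Finset.sum_eq_zero fun k _ => by rw [h.left_support hv k μ hμ, mul_zero]).symm

lemma inner_slice (h : IsSVD α v σ U V) (hv : ∀ x ∉ Bx d F, v x = 0) (x : Fin d → J)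
    (e : L2 (α → J)) :
    inner ℝ e (slice F α v x) = ∑ k, σ k * V k (fun i => x i) * inner ℝ e (U k) := by
  rw [h.slice_eq hv, inner_sum]
  exact Finset.sum_congr rfl fun k _ => by rw [inner_smul_right]

lemma inner_U_slice (h : IsSVD α v σ U V) (hv : ∀ x ∉ Bx d F, v x = 0) (x : Fin d → J)
    (k : Fin R) : inner ℝ (U k) (slice F α v x) = σ k * V k (fun i => x i) := by
  rw [h.slice_eq hv]
  exact h.left.inner_right_fintype _ k

lemma kop_left (h : IsSVD α v σ U V) (hv : ∀ x ∉ Bx d F, v x = 0) (r : ℕ) (x : Fin d → J) :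
    kop F α (projKer U r) v x =
      ∑ k : Fin R, if (k : ℕ) < r then σ k * U k (fun i => x i) * V k (fun i => x i) else 0 := by
  have h1 := kop_merge (F := F) U r v x fun i => x i
  rw [merge_self] at h1
  rw [h1, firstProj, lp.coeFn_sum, Finset.sum_apply]
  refine Finset.sum_congr rfl fun k _ => ?_
  rw [lp.coeFn_smul, Pi.smul_apply, h.inner_U_slice hv]
  split_ifs
  · rw [smul_eq_mul]; ring
  · simp

/-- Applied to v itself, the projection on left vectors in α and that on right vectors in the
complement both cut the expansion after r terms. The freedom to exchange them is used in
`nsq_foldProj_le_aux` and in `IsHOSVD.exists_quasi_best`. -/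
lemma kop_right (h : IsSVD α v σ U V) (hv : ∀ x ∉ Bx d F, v x = 0) (r : ℕ) (x : Fin d → J) :
    kop F αᶜ (projKer V r) v x =
      ∑ k : Fin R, if (k : ℕ) < r then σ k * U k (fun i => x i) * V k (fun i => x i) else 0 := by
  have hs : slice F αᶜ v x = ∑ k, (σ k * U k (fun i => x i)) • V k := by
    ext μ
    rw [lp.coeFn_sum, Finset.sum_apply]
    simp only [lp.coeFn_smul, Pi.smul_apply, smul_eq_mul]
    by_cases hμ : μ ∈ bx αᶜ F
    · rw [slice, ofFinset_of_mem _ hμ, h.eq]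
      refine Finset.sum_congr rfl fun k _ => ?_
      rw [restrict_merge, restrict_merge_disjoint disjoint_compl_left]
    · rw [slice, ofFinset_of_notMem _ hμ]
      exact (Finset.sum_eq_zero fun k _ => by rw [h.right_support hv k μ hμ, mul_zero]).symm
  have h1 := kop_merge (F := F) V r v x fun i => x i
  rw [merge_self] at h1
  rw [h1, firstProj, lp.coeFn_sum, Finset.sum_apply]
  refine Finset.sum_congr rfl fun k _ => ?_
  rw [lp.coeFn_smul, Pi.smul_apply, hs, h.right.inner_right_fintype]
  split_ifs <;> simp

lemma sum_right_mul (hF : F.Nonempty) (h : IsSVD α v σ U V) (hv : ∀ x ∉ Bx d F, v x = 0)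
    (k l : Fin R) : ∑ x ∈ Bx d F, V k (fun i => x i) * V l (fun i => x i) =
      ((Bx d F).card : ℝ) / (bx αᶜ F).card * if k = l then 1 else 0 := by
  rw [sum_restrict hF αᶜ fun ν => V k ν * V l ν,
    ← inner_eq_sum (bx αᶜ F) (V l) (h.right_support hv k)]
  rw [orthonormal_iff_ite.1 h.right]

lemma sum_inner_slice_sq (hF : F.Nonempty) (h : IsSVD α v σ U V) (hv : ∀ x ∉ Bx d F, v x = 0)
    (e : L2 (α → J)) : ∑ x ∈ Bx d F, inner ℝ e (slice F α v x) ^ 2 =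
      ((Bx d F).card : ℝ) / (bx αᶜ F).card * ∑ k, σ k ^ 2 * inner ℝ e (U k) ^ 2 := by
  simp only [h.inner_slice hv, sq, Finset.sum_mul_sum]
  rw [Finset.sum_comm, Finset.mul_sum]
  refine Finset.sum_congr rfl fun k _ => ?_
  rw [Finset.sum_comm, Finset.sum_eq_single k]
  · have := h.sum_right_mul hF hv k k
    rw [if_pos rfl, mul_one] at this
    rw [← this, Finset.sum_mul]
    exact Finset.sum_congr rfl fun x _ => by ring
  · intro l _ hl
    have := h.sum_right_mul hF hv k l
    rw [if_neg (Ne.symm hl), mul_zero] at this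
    calc _ = (σ k * σ l * inner ℝ e (U k) * inner ℝ e (U l)) *
          ∑ x ∈ Bx d F, V k (fun i => x i) * V l (fun i => x i) := by
          rw [Finset.mul_sum]; exact Finset.sum_congr rfl fun x _ => by ring
      _ = 0 := by rw [this, mul_zero]
  · simp

lemma error_eq (hF : F.Nonempty) (h : IsSVD α v σ U V) (hv : ∀ x ∉ Bx d F, v x = 0) (r : ℕ) :
    ((bx α F).card : ℝ) * nsq F (fun _ => 1) (fun x => v x - kop F α (projKer U r) v x) =
      ∑ x ∈ Bx d F, ‖slice F α v x‖ ^ 2 - ((Bx d F).card : ℝ) / (bx αᶜ F).card *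
        ∑ k : Fin R, if (k : ℕ) < r then σ k ^ 2 else 0 := by
  rw [nsq_eq_slices F α (dependsOn_one _)]
  simp only [slice_sub, slice_kop (h.left_support hv), norm_sub_firstProj_sq h.left, one_mul]
  rw [Finset.sum_sub_distrib]
  congr 1
  rw [Finset.sum_comm, Finset.mul_sum]
  refine Finset.sum_congr rfl fun k _ => ?_
  split_ifs
  · rw [h.sum_inner_slice_sq hF hv, Finset.sum_eq_single k]
    · rw [real_inner_self_eq_norm_sq, h.left.1]; ring
    · intro l _ hl; rw [h.left.2 (Ne.symm hl)]; ring
    · simp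
  · simp

lemma sum_slice (hF : F.Nonempty) (h : IsSVD α v σ U V) (hv : ∀ x ∉ Bx d F, v x = 0) :
    ∑ x ∈ Bx d F, ‖slice F α v x‖ ^ 2 =
      ((Bx d F).card : ℝ) / (bx αᶜ F).card * ∑ k, σ k ^ 2 := by
  have h1 := h.error_eq hF hv R
  have h2 : ∀ x, v x - kop F α (projKer U R) v x = 0 := by
    intro x
    rw [h.kop_left hv]
    simp only [Fin.is_lt, if_true]
    rw [h.eq x, sub_self]
  have h3 : nsq F (fun _ => 1) (fun x => v x - kop F α (projKer U R) v x) = 0 := by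
    simp only [h2, nsq]; simp
  rw [h3, mul_zero] at h1
  simp only [Fin.is_lt, if_true] at h1
  linarith

/-- Best approximation property of singular value truncation. -/
lemma error_le (hF : F.Nonempty) (h : IsSVD α v σ U V) (hv : ∀ x ∉ Bx d F, v x = 0) {r : ℕ}
    {w : (Fin d → J) → ℝ} (hw : HasRank α r w) :
    nsq F (fun _ => 1) (fun x => v x - kop F α (projKer U r) v x) ≤
      nsq F (fun _ => 1) (fun x => v x - w x) := by
  refine le_of_mul_le_mul_left ?_ (bx_card_pos hF α)
  rw [h.error_eq hF hv, nsq_eq_slices F α (dependsOn_one _)]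
  simp only [slice_sub, one_mul]
  obtain ⟨a, b, ha, hb, hw⟩ := hw
  obtain ⟨x₀, hx₀⟩ : (Bx d F).Nonempty := by
    rw [Fintype.piFinset_nonempty]; exact fun _ => hF
  let A : Fin r → L2 (α → J) := fun k => slice F α (a k) x₀
  -- The slices of w lie in a space of dimension at most r, so the error is at least the sum of
  -- squared distances of the slices of v from it.
  let W := Submodule.span ℝ (Set.range A)
  have hfin : FiniteDimensional ℝ W := FiniteDimensional.span_of_finite ℝ (Set.finite_range A)
  have hmem : ∀ x, slice F α w x ∈ W := by
    intro x
    have : slice F α w x = ∑ k, b k x • A k := by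
      ext μ
      rw [lp.coeFn_sum, Finset.sum_apply]
      simp only [lp.coeFn_smul, Pi.smul_apply, smul_eq_mul, A, slice]
      by_cases hμ : μ ∈ bx α F
      · simp only [ofFinset_of_mem _ hμ, hw]
        refine Finset.sum_congr rfl fun k _ => ?_
        rw [mul_comm]
        congr 1
        · exact hb k fun i hi => merge_of_notMem _ _ hi
        · exact ha k fun i hi => by
            rw [merge_of_mem _ _ (by exact_mod_cast hi), merge_of_mem _ _ (by exact_mod_cast hi)]
      · simp only [ofFinset_of_notMem _ hμ, mul_zero, Finset.sum_const_zero]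
    rw [this]
    exact W.sum_mem fun k _ => W.smul_mem _ (Submodule.subset_span ⟨k, rfl⟩)
  let B := stdOrthonormalBasis ℝ W
  set m := Module.finrank ℝ W
  have hm : m ≤ r := by
    have := finrank_range_le_card (R := ℝ) A
    rw [Fintype.card_fin] at this
    exact this
  let e : Fin m → L2 (α → J) := fun i => (B i : L2 (α → J))
  have he : Orthonormal ℝ e := B.orthonormal.comp_linearIsometry W.subtypeₗᵢ
  have hx : ∀ x, ‖slice F α v x‖ ^ 2 - ∑ i, inner ℝ (e i) (slice F α v x) ^ 2 ≤
      ‖slice F α v x - slice F α w x‖ ^ 2 := by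
    intro x
    have hz : slice F α w x = ∑ i, inner ℝ (e i) (slice F α w x) • e i := by
      have := congrArg Subtype.val (B.sum_repr' ⟨_, hmem x⟩)
      rw [Submodule.coe_sum] at this
      simpa using this.symm
    set z := slice F α w x
    set y := slice F α v x
    have h1 : inner ℝ y z = ∑ i, inner ℝ (e i) z * inner ℝ (e i) y := by
      conv_lhs => rw [hz]
      rw [inner_sum]
      exact Finset.sum_congr rfl fun i _ => by
        rw [inner_smul_right, real_inner_comm (e i) y]
    have h2 : ‖z‖ ^ 2 = ∑ i, inner ℝ (e i) z * inner ℝ (e i) z := by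
      rw [← real_inner_self_eq_norm_sq]
      conv_lhs => rw [hz]
      rw [sum_inner]
      refine Finset.sum_congr rfl fun i _ => ?_
      rw [← hz, inner_smul_left]; simp
    rw [norm_sub_sq_real, h1, h2]
    have : 0 ≤ ∑ i, (inner ℝ (e i) z - inner ℝ (e i) y) ^ 2 :=
      Finset.sum_nonneg fun i _ => sq_nonneg _
    simp only [sub_sq, Finset.sum_add_distrib, Finset.sum_sub_distrib] at this
    have h3 : ∑ i, 2 * inner ℝ (e i) z * inner ℝ (e i) y =
        2 * ∑ i, inner ℝ (e i) z * inner ℝ (e i) y := by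
      rw [Finset.mul_sum]; exact Finset.sum_congr rfl fun i _ => by ring
    rw [h3] at this
    simp only [sq] at this ⊢
    linarith
  have hsum := Finset.sum_le_sum fun x (_ : x ∈ Bx d F) => hx x
  rw [Finset.sum_sub_distrib, Finset.sum_comm] at hsum
  simp only [h.sum_inner_slice_sq hF hv] at hsum
  rw [← Finset.mul_sum, Finset.sum_comm] at hsum
  refine le_trans ?_ hsum
  have hc : (0 : ℝ) ≤ ((Bx d F).card : ℝ) / (bx αᶜ F).card := by positivity
  refine sub_le_sub_left (mul_le_mul_of_nonneg_left ?_ hc) _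
  simp only [← Finset.mul_sum]
  set t : Fin R → ℝ := fun k => ∑ i, inner ℝ (e i) (U k) ^ 2 with ht
  have ht0 : ∀ k, 0 ≤ t k := fun k => Finset.sum_nonneg fun i _ => sq_nonneg _
  have ht1 : ∀ k, t k ≤ 1 := by
    intro k
    have h1 := he.sum_inner_products_le (U k) (s := Finset.univ)
    rw [h.left.1 k] at h1
    simpa using h1
  have htm : ∑ k, t k ≤ m := by
    simp only [ht]
    rw [Finset.sum_comm]
    calc _ ≤ ∑ i : Fin m, (1 : ℝ) := by
          refine Finset.sum_le_sum fun i _ => ?_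
          have h1 := h.left.sum_inner_products_le (e i) (s := Finset.univ)
          rw [he.1 i] at h1
          simp only [Real.norm_eq_abs, sq_abs, one_pow] at h1
          refine le_trans (le_of_eq (Finset.sum_congr rfl fun k _ => ?_)) h1
          rw [real_inner_comm]
      _ = m := by simp
  -- It remains to maximize ∑ σ_k² t_k over weights in [0,1] of total at most r. The threshold s
  -- between kept and dropped squares is the first dropped one, σ_r² when counting from 0, and 0 if
  -- nothing is dropped.
  have key : ∃ s : ℝ, 0 ≤ s ∧ (∀ k : Fin R, (k : ℕ) < r → s ≤ σ k ^ 2) ∧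
      (∀ k : Fin R, ¬ (k : ℕ) < r → σ k ^ 2 ≤ s) ∧
      s * m ≤ s * ∑ k : Fin R, if (k : ℕ) < r then (1 : ℝ) else 0 := by
    by_cases hR : r < R
    · refine ⟨σ ⟨r, hR⟩ ^ 2, sq_nonneg _, fun k hk => ?_, fun k hk => ?_, ?_⟩
      · have := h.anti (show k ≤ ⟨r, hR⟩ from hk.le)
        have := h.pos ⟨r, hR⟩
        gcongr
      · have := h.anti (show (⟨r, hR⟩ : Fin R) ≤ k from not_lt.1 hk)
        have := h.pos k
        gcongr
      · refine mul_le_mul_of_nonneg_left ?_ (sq_nonneg _)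
        rw [Finset.sum_boole]
        have : (Finset.univ.filter fun k : Fin R => (k : ℕ) < r).card = r := by
          rw [Fin.card_filter_val_lt]; omega
        rw [this]; exact_mod_cast hm
    · exact ⟨0, le_rfl, fun k _ => sq_nonneg _, fun k hk => absurd (k.2.trans_le (not_lt.1 hR)) hk,
        by simp⟩
  obtain ⟨s, hs0, hs1, hs2, hs3⟩ := key
  have hk : ∀ k : Fin R, σ k ^ 2 * t k - (if (k : ℕ) < r then σ k ^ 2 else 0) ≤
      s * t k - s * (if (k : ℕ) < r then (1 : ℝ) else 0) := by
    intro k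
    split_ifs with hk
    · nlinarith [hs1 k hk, ht1 k]
    · nlinarith [hs2 k hk, ht0 k]
  have := Finset.sum_le_sum fun k (_ : k ∈ Finset.univ) => hk k
  rw [Finset.sum_sub_distrib, Finset.sum_sub_distrib, ← Finset.mul_sum, ← Finset.mul_sum] at this
  have := mul_le_mul_of_nonneg_left htm hs0
  linarith

/-- With more than r positive singular values, truncation after r terms would leave a positive
error, whereas v itself competes in `error_le` with error 0. -/
lemma card_le (hF : F.Nonempty) (h : IsSVD α v σ U V) (hv : ∀ x ∉ Bx d F, v x = 0) {r : ℕ}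
    (hr : HasRank α r v) : R ≤ r := by
  by_contra hlt
  push Not at hlt
  have h1 := h.error_le hF hv hr
  have h2 := h.error_eq hF hv r
  have h3 := h.sum_slice hF hv
  have h4 : nsq F (fun _ : Fin d → J => 1) (fun x => v x - v x) = 0 := by simp [nsq]
  rw [h4] at h1
  rw [h3, ← mul_sub, ← Finset.sum_sub_distrib] at h2
  have hc : (0 : ℝ) < ((Bx d F).card : ℝ) / (bx αᶜ F).card :=
    div_pos (Bx_card_pos hF) (bx_card_pos hF _)
  have h5 : 0 < ∑ k : Fin R, (σ k ^ 2 - if (k : ℕ) < r then σ k ^ 2 else 0) := by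
    refine Finset.sum_pos' (fun k _ => ?_) ⟨⟨r, hlt⟩, Finset.mem_univ _, ?_⟩
    · split_ifs
      · simp
      · simpa using sq_nonneg (σ k)
    · simpa using pow_pos (h.pos ⟨r, hlt⟩) 2
  have h6 := mul_pos hc h5
  rw [← h2] at h6
  have := bx_card_pos hF α
  nlinarith

end IsSVD

end SVD

end

section

/-! ### Successive projections along the dimension tree -/

section HOSVD

variable {d : ℕ} {J : Type*} {F : Finset J}

/-- Successive application of the projections onto leading singular vectors, on a box. -/
def foldProj (F : Finset J) (R : Finset (Fin d) → ℕ)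
    (U : ∀ α : Finset (Fin d), Fin (R α) → L2 (α → J)) (r : Finset (Fin d) → ℕ)
    (l : List (Finset (Fin d))) (w : (Fin d → J) → ℝ) : (Fin d → J) → ℝ :=
  l.foldl (fun w α => kop F α (projKer (U α) (r α)) w) w

/-- All matrices of vectors that occur are the left factors of decompositions of `v`. -/
def AreSVDs (R : Finset (Fin d) → ℕ) (U : ∀ α : Finset (Fin d), Fin (R α) → L2 (α → J))
    (v : (Fin d → J) → ℝ) (l : List (Finset (Fin d))) : Prop :=
  ∀ α ∈ l, ∃ (σ : Fin (R α) → ℝ) (V : Fin (R α) → L2 ((αᶜ : Finset (Fin d)) → J)),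
    IsSVD α v σ (U α) V

variable {R : Finset (Fin d) → ℕ} {U : ∀ α : Finset (Fin d), Fin (R α) → L2 (α → J)}
  {r : Finset (Fin d) → ℕ} {v : (Fin d → J) → ℝ} {l : List (Finset (Fin d))}

lemma foldl_modeProj (hv : ∀ x ∉ Bx d F, v x = 0) (hU : AreSVDs R U v l) (w : (Fin d → J) → ℝ) :
    l.foldl (fun w α => modeProj (U α) (r α) w) w = foldProj F R U r l w := by
  induction l generalizing w with
  | nil => rfl
  | cons α l ih =>
    obtain ⟨σ, V, h⟩ := hU α (by simp)
    rw [List.foldl_cons, modeProj_eq_kop (h.left_support hv),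
      ih fun β hβ => hU β (List.mem_cons_of_mem _ hβ)]
    rfl

lemma kop_support {α : Finset (Fin d)} {R : ℕ} {U : Fin R → L2 (α → J)}
    (hU : ∀ k, ∀ μ ∉ bx α F, U k μ = 0) (r : ℕ) {w : (Fin d → J) → ℝ}
    (hw : ∀ x ∉ Bx d F, w x = 0) (x : Fin d → J) (hx : x ∉ Bx d F) :
    kop F α (projKer U r) w x = 0 := by
  refine Finset.sum_eq_zero fun μ hμ => ?_
  by_cases h : (fun i : α => x i) ∈ bx α F
  · rw [hw, mul_zero]
    contrapose! hx
    rw [Fintype.mem_piFinset] at hx h ⊢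
    intro i
    by_cases hi : i ∈ α
    · exact h ⟨i, hi⟩
    · have := hx i; rwa [merge_of_notMem _ _ hi] at this
  · rw [projKer, Finset.sum_eq_zero, zero_mul]
    intro k _
    rw [hU k _ h, zero_mul, ite_self]

lemma foldProj_support (hv : ∀ x ∉ Bx d F, v x = 0) (hU : AreSVDs R U v l)
    {w : (Fin d → J) → ℝ} (hw : ∀ x ∉ Bx d F, w x = 0) (x : Fin d → J) (hx : x ∉ Bx d F) :
    foldProj F R U r l w x = 0 := by
  induction l generalizing w with
  | nil => exact hw x hx
  | cons α l ih =>
    obtain ⟨σ, V, h⟩ := hU α (by simp)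
    exact ih (fun β hβ => hU β (List.mem_cons_of_mem _ hβ))
      (kop_support (h.left_support hv) _ hw)

/-- A projection in a node containing j does not commute with a weight in coordinate j. The remedy
is to exchange it, on v, with the projection on right singular vectors in the complement, which
leaves coordinate j alone. `O` collects the operators applied so far, all acting away from j. It
commutes with every later node containing j: by the order from root to leaves and by laminarity,
such a node lies inside each earlier node that contains j (hence is disjoint from its complement)
and is disjoint from each earlier node that does not. -/
lemma nsq_foldProj_le_aux (hF : F.Nonempty) (hv : ∀ x ∉ Bx d F, v x = 0) (hU : AreSVDs R U v l)
    (hnd : l.Nodup) (hpw : l.Pairwise fun α β => ¬ α ⊂ β)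
    (hlam : ∀ α ∈ l, ∀ β ∈ l, α ⊆ β ∨ β ⊆ α ∨ Disjoint α β) (j : Fin d)
    {φ : (Fin d → J) → ℝ} (hφ : DependsOn φ {j}) (hφ0 : ∀ x, 0 ≤ φ x)
    (O : ((Fin d → J) → ℝ) → (Fin d → J) → ℝ) (hO : ∀ w, nsq F φ (O w) ≤ nsq F φ w)
    (hcomm : ∀ α ∈ l, j ∈ α → ∀ (p : (α → J) → (α → J) → ℝ) (w : (Fin d → J) → ℝ),
      kop F α p (O w) = O (kop F α p w)) :
    nsq F φ (foldProj F R U r l (O v)) ≤ nsq F φ v := by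
  induction l generalizing O with
  | nil => exact hO v
  | cons α l ih =>
    obtain ⟨σ, V, h⟩ := hU α (by simp)
    rw [List.pairwise_cons] at hpw
    rw [List.nodup_cons] at hnd
    have hrest : ∀ β ∈ l, ¬ α ⊆ β := fun β hβ hab => hpw.1 β hβ
      (lt_of_le_of_ne hab fun hne => hnd.1 (hne ▸ hβ))
    have step := ih (fun β hβ => hU β (List.mem_cons_of_mem _ hβ)) hnd.2 hpw.2
      (fun β hβ γ hγ => hlam β (List.mem_cons_of_mem _ hβ) γ (List.mem_cons_of_mem _ hγ))
    by_cases hj : j ∈ α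
    · have h1 : kop F α (projKer (U α) (r α)) (O v) = O (kop F αᶜ (projKer V (r α)) v) := by
        rw [hcomm α (by simp) hj]
        congr 1
        funext x
        rw [h.kop_left hv, h.kop_right hv]
      have h2 := step (fun w => O (kop F αᶜ (projKer V (r α)) w))
        (fun w => (hO _).trans (nsq_kop_le hF (h.right_support hv) h.right _
          (fun x y hxy => hφ fun i hi => hxy i (by
            rw [Set.mem_singleton_iff.1 hi]; simpa using hj)) hφ0 w))
        (fun β hβ hjβ p w => by
          rw [hcomm β (List.mem_cons_of_mem _ hβ) hjβ]
          congr 1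
          refine kop_comm F ?_ _ _ _
          have hβα : β ⊆ α := by
            rcases hlam α (by simp) β (List.mem_cons_of_mem _ hβ) with h' | h' | h'
            · exact absurd h' (hrest β hβ)
            · exact h'
            · exact absurd hjβ (Finset.disjoint_left.1 h' hj)
          exact disjoint_compl_right.mono_left hβα)
      rw [← h1] at h2
      exact h2
    · exact step (fun w => kop F α (projKer (U α) (r α)) (O w))
        (fun w => (nsq_kop_le hF (h.left_support hv) h.left _
          (fun x y hxy => hφ fun i hi => hxy i (by
            rw [Set.mem_singleton_iff.1 hi]; simpa using hj)) hφ0 _).trans (hO w))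
        (fun β hβ hjβ p w => by
          rw [← hcomm β (List.mem_cons_of_mem _ hβ) hjβ]
          refine kop_comm F ?_ _ _ _
          rcases hlam α (by simp) β (List.mem_cons_of_mem _ hβ) with h' | h' | h'
          · exact absurd h' (hrest β hβ)
          · exact absurd (h' hjβ) hj
          · exact h'.symm)

/-- Truncation does not increase weighted norms, for weights in one coordinate. -/
lemma nsq_foldProj_le (hF : F.Nonempty) (hv : ∀ x ∉ Bx d F, v x = 0) (hU : AreSVDs R U v l)
    (hnd : l.Nodup) (hpw : l.Pairwise fun α β => ¬ α ⊂ β)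
    (hlam : ∀ α ∈ l, ∀ β ∈ l, α ⊆ β ∨ β ⊆ α ∨ Disjoint α β) (j : Fin d)
    {φ : (Fin d → J) → ℝ} (hφ : DependsOn φ {j}) (hφ0 : ∀ x, 0 ≤ φ x) :
    nsq F φ (foldProj F R U r l v) ≤ nsq F φ v :=
  nsq_foldProj_le_aux hF hv hU hnd hpw hlam j hφ hφ0 (fun w => w) (fun _ => le_rfl)
    fun _ _ _ _ _ => rfl

/-- A kernel in coordinates inside α, or disjoint from α, acts on only one of the two factors of
each elementary product. -/
lemma HasRank.kop {α β : Finset (Fin d)} (hαβ : β ⊆ α ∨ Disjoint α β) {n : ℕ}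
    {w : (Fin d → J) → ℝ} (hw : HasRank α n w) (p : (β → J) → (β → J) → ℝ) :
    HasRank α n (kop F β p w) := by
  obtain ⟨a, b, ha, hb, hw⟩ := hw
  have hmerge : ∀ (s : Set (Fin d)) (g : (Fin d → J) → ℝ), DependsOn g s →
      (∀ i ∈ s, i ∉ β) → ∀ μ x, g (merge β μ x) = g x :=
    fun s g hg hs μ x => hg fun i hi => merge_of_notMem _ _ (hs i hi)
  have hkop : ∀ (s : Set (Fin d)) (g : (Fin d → J) → ℝ), DependsOn g s →
      (∀ i ∈ β, i ∈ s) → DependsOn (HTAWGM.kop F β p g) s := by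
    intro s g hg hs x y hxy
    refine Finset.sum_congr rfl fun μ _ => ?_
    have h1 : (fun i : β => x i) = fun i : β => y i := funext fun i => hxy i (hs i i.2)
    rw [h1]
    congr 1
    refine hg fun i hi => ?_
    by_cases hib : i ∈ β
    · rw [merge_of_mem _ _ hib, merge_of_mem _ _ hib]
    · rw [merge_of_notMem _ _ hib, merge_of_notMem _ _ hib, hxy i hi]
  rcases hαβ with h | h
  · refine ⟨fun k => HTAWGM.kop F β p (a k), b, fun k => hkop _ _ (ha k) fun i hi => h hi, hb,
      fun x => ?_⟩
    simp only [HTAWGM.kop, hw, Finset.mul_sum, Finset.sum_mul]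
    rw [Finset.sum_comm]
    refine Finset.sum_congr rfl fun k _ => Finset.sum_congr rfl fun μ _ => ?_
    rw [hmerge _ _ (hb k) fun i hi hib => hi (h hib)]
    ring
  · refine ⟨a, fun k => HTAWGM.kop F β p (b k), ha,
      fun k => hkop _ _ (hb k) fun i hi => Finset.disjoint_right.1 h hi, fun x => ?_⟩
    simp only [HTAWGM.kop, hw, Finset.mul_sum]
    rw [Finset.sum_comm]
    refine Finset.sum_congr rfl fun k _ => Finset.sum_congr rfl fun μ _ => ?_
    rw [hmerge _ _ (ha k) fun i hi => Finset.disjoint_left.1 h hi]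
    ring

lemma hasRank_kop_projKer {α : Finset (Fin d)} {R : ℕ} (U : Fin R → L2 (α → J)) (r : ℕ)
    (w : (Fin d → J) → ℝ) : HasRank α (min r R) (kop F α (projKer U r) w) := by
  have hc : Fintype.card {k : Fin R // (k : ℕ) < r} ≤ min r R := by
    rw [Fintype.card_subtype, Fin.card_filter_val_lt, min_comm]
  refine HasRank.of_fintype hc (fun k x => U k.1 fun i => x i)
    (fun k x => ∑ μ ∈ bx α F, U k.1 μ * w (merge α μ x)) (fun k x y hxy => ?_)
    (fun k x y hxy => ?_) fun x => ?_
  · have : (fun i : α => x i) = fun i : α => y i := funext fun i => hxy i i.2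
    simp only [this]
  · refine Finset.sum_congr rfl fun μ _ => ?_
    congr 2
    funext i
    by_cases hi : i ∈ α
    · rw [merge_of_mem _ _ hi, merge_of_mem _ _ hi]
    · rw [merge_of_notMem _ _ hi, merge_of_notMem _ _ hi]; exact hxy i (by simpa using hi)
  · simp only [kop, projKer, Finset.sum_mul]
    rw [Finset.sum_comm]
    have h1 : ∀ k : Fin R, (∑ μ ∈ bx α F, (if (k : ℕ) < r then U k (fun i => x i) * U k μ else 0) *
        w (merge α μ x)) = if (k : ℕ) < r then
          U k (fun i => x i) * ∑ μ ∈ bx α F, U k μ * w (merge α μ x) else 0 := by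
      intro k
      split_ifs
      · rw [Finset.mul_sum]; exact Finset.sum_congr rfl fun μ _ => by ring
      · simp
    simp only [h1]
    rw [← Finset.sum_filter]
    exact (Finset.sum_subtype (p := fun k : Fin R => (k : ℕ) < r) _ (by simp) _)

lemma HasRank.foldProj {α : Finset (Fin d)} (hl : ∀ β ∈ l, β ⊆ α ∨ Disjoint α β) {n : ℕ}
    {w : (Fin d → J) → ℝ} (hw : HasRank α n w) : HasRank α n (foldProj F R U r l w) := by
  induction l generalizing w with
  | nil => exact hw
  | cons β l ih =>
    exact ih (fun γ hγ => hl γ (List.mem_cons_of_mem _ hγ)) (hw.kop (hl β (by simp)) _)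

/-- The projection at α creates the rank bound at α. Nodes treated afterwards are contained in α or
disjoint from it, so they preserve the bound. -/
lemma hasRank_foldProj (hnd : l.Nodup) (hpw : l.Pairwise fun α β => ¬ α ⊂ β)
    (hlam : ∀ α ∈ l, ∀ β ∈ l, α ⊆ β ∨ β ⊆ α ∨ Disjoint α β) {α : Finset (Fin d)} (hα : α ∈ l)
    (w : (Fin d → J) → ℝ) : HasRank α (min (r α) (R α)) (foldProj F R U r l w) := by
  induction l generalizing w with
  | nil => simp at hα
  | cons β l ih =>
    rw [List.pairwise_cons] at hpw
    rw [List.nodup_cons] at hnd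
    by_cases h : α ∈ l
    · exact ih hnd.2 hpw.2 (fun β hβ γ hγ => hlam β (List.mem_cons_of_mem _ hβ) γ
        (List.mem_cons_of_mem _ hγ)) h _
    · obtain rfl : α = β := (List.mem_cons.1 hα).resolve_right h
      refine (hasRank_kop_projKer _ _ w).foldProj fun γ hγ => ?_
      rcases hlam α (by simp) γ (List.mem_cons_of_mem _ hγ) with h' | h' | h'
      · exact absurd (lt_of_le_of_ne h' fun hne => hnd.1 (hne ▸ hγ)) (hpw.1 γ hγ)
      · exact Or.inl h'
      · exact Or.inr h'

/-- By `nsq_sub_kop_le`, every projection adds at most its own best approximation error on v, and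
that is at most the error of w. -/
lemma nsq_sub_foldProj_le (hF : F.Nonempty) (hv : ∀ x ∉ Bx d F, v x = 0) (hU : AreSVDs R U v l)
    {w : (Fin d → J) → ℝ} (hw : ∀ α ∈ l, HasRank α (r α) w) (z : (Fin d → J) → ℝ) :
    nsq F (fun _ => 1) (fun x => v x - foldProj F R U r l z x) ≤
      l.length * nsq F (fun _ => 1) (fun x => v x - w x) +
      nsq F (fun _ => 1) (fun x => v x - z x) := by
  induction l generalizing z with
  | nil => simp [foldProj]
  | cons α l ih =>
    obtain ⟨σ, V, h⟩ := hU α (by simp)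
    have h1 := ih (fun β hβ => hU β (List.mem_cons_of_mem _ hβ))
      (fun β hβ => hw β (List.mem_cons_of_mem _ hβ)) (kop F α (projKer (U α) (r α)) z)
    have h2 := nsq_sub_kop_le hF (h.left_support hv) h.left (r α) v z
    have h3 := h.error_le hF hv (hw α (by simp))
    rw [List.length_cons, Nat.cast_add, Nat.cast_one, add_mul, one_mul]
    refine h1.trans ?_
    linarith

lemma firstProj_idem {κ : Type*} {R : ℕ} {U : Fin R → L2 κ} (hO : Orthonormal ℝ U) (r : ℕ)
    (z : L2 κ) : firstProj U r (firstProj U r z) = firstProj U r z := by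
  conv_lhs => rw [firstProj]
  rw [firstProj]
  refine Finset.sum_congr rfl fun k _ => ?_
  have h := inner_U_firstProj hO r z k
  rw [firstProj] at h
  rw [h]
  split_ifs <;> rfl

lemma kop_projKer_idem {α : Finset (Fin d)} {R : ℕ} {U : Fin R → L2 (α → J)}
    (hU : ∀ k, ∀ μ ∉ bx α F, U k μ = 0) (hO : Orthonormal ℝ U) (r : ℕ) (w : (Fin d → J) → ℝ) :
    kop F α (projKer U r) (kop F α (projKer U r) w) = kop F α (projKer U r) w := by
  funext x
  rw [← merge_self α x, kop_merge, kop_merge, slice_kop hU, firstProj_idem hO]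

end HOSVD

/-! ### Contractions of finitely supported tensors -/

section Contractions

variable {d : ℕ} {J : Type*} {F : Finset J}

lemma econtr_eq {v : (Fin d → J) → ℝ} {X : Finset (Fin d → J)} (hv : ∀ x ∉ X, v x = 0)
    (j : Fin d) (l : J) [DecidableEq J] :
    econtr j v l = ENNReal.ofReal (√(∑ x ∈ X, (if x j = l then 1 else 0) * v x ^ 2)) := by
  rw [econtr, tsum_eq_sum (s := X), Real.sqrt_eq_rpow,
    ← ENNReal.ofReal_rpow_of_nonneg (Finset.sum_nonneg fun x _ => by positivity) (by norm_num),
    ENNReal.ofReal_sum_of_nonneg fun x _ => by positivity]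
  · congr 1
    refine Finset.sum_congr rfl fun x _ => ?_
    by_cases h : x j = l <;> simp [h]
  · intro x hx
    simp [Set.indicator_apply, hv x hx]

lemma econtr_eq_zero_iff {v : (Fin d → J) → ℝ} {j : Fin d} {l : J} :
    econtr j v l = 0 ↔ ∀ x : Fin d → J, x j = l → v x = 0 := by
  rw [econtr, ENNReal.rpow_eq_zero_iff_of_pos (by norm_num), ENNReal.tsum_eq_zero]
  refine forall_congr' fun x => ?_
  by_cases h : x j = l <;> simp [h]

end Contractions

/-! ### Combinatorics of dimension trees -/

section Tree

variable {d : ℕ} {T : Finset (Finset (Fin d))}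

namespace IsDimTree

/-- A full binary tree with n leaves has at most 2n-1 nodes. By laminarity, a node below α is α
itself or lies below one of the two parts into which α splits, and induction on the cardinality
applies. -/
lemma card_filter_subset_le (hT : IsDimTree T) {α : Finset (Fin d)} (hα : α ∈ T) :
    (T.filter (· ⊆ α)).card + 1 ≤ 2 * α.card := by
  induction hn : α.card using Nat.strong_induction_on generalizing α with
  | _ n ih =>
    have hα1 : 1 ≤ α.card := Finset.card_pos.2 (hT.nonempty α hα)
    rcases hα1.eq_or_lt with h1 | h1
    · have : T.filter (· ⊆ α) ⊆ {α} := by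
        intro β hβ
        rw [Finset.mem_filter] at hβ
        rw [Finset.mem_singleton]
        refine Finset.eq_of_subset_of_card_le hβ.2 ?_
        rw [← h1]; exact Finset.card_pos.2 (hT.nonempty β hβ.1)
      have := Finset.card_le_card this
      rw [Finset.card_singleton] at this
      omega
    · obtain ⟨β, hβ, γ, hγ, hdis, hun⟩ := hT.split α hα h1
      have hcard : β.card + γ.card = α.card := by
        rw [← hun, Finset.card_union_of_disjoint hdis]
      have hβ1 := Finset.card_pos.2 (hT.nonempty β hβ)
      have hγ1 := Finset.card_pos.2 (hT.nonempty γ hγ)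
      have h2 := ih β.card (by omega) hβ rfl
      have h3 := ih γ.card (by omega) hγ rfl
      have : T.filter (· ⊆ α) ⊆ insert α (T.filter (· ⊆ β) ∪ T.filter (· ⊆ γ)) := by
        intro δ hδ
        rw [Finset.mem_filter] at hδ
        rw [Finset.mem_insert, Finset.mem_union, Finset.mem_filter, Finset.mem_filter]
        have hne := hT.nonempty δ hδ.1
        have hsub : δ ⊆ β ∪ γ := by rw [hun]; exact hδ.2
        rcases hT.laminar δ hδ.1 β hβ with h | h | h
        · exact Or.inr (Or.inl ⟨hδ.1, h⟩)
        · rcases hT.laminar δ hδ.1 γ hγ with h' | h' | h'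
          · exfalso
            obtain ⟨b, hb⟩ := hT.nonempty β hβ
            exact Finset.disjoint_left.1 hdis hb (h' (h hb))
          · left
            refine hδ.2.antisymm ?_
            rw [← hun]
            exact Finset.union_subset h h'
          · refine Or.inr (Or.inl ⟨hδ.1, fun i hi => ?_⟩)
            exact (Finset.mem_union.1 (hsub hi)).resolve_right (Finset.disjoint_left.1 h' hi)
        · refine Or.inr (Or.inr ⟨hδ.1, fun i hi => ?_⟩)
          exact (Finset.mem_union.1 (hsub hi)).resolve_left (Finset.disjoint_left.1 h hi)
      have h4 := (Finset.card_le_card this).trans (Finset.card_insert_le _ _)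
      have h5 := Finset.card_union_le (T.filter (· ⊆ β)) (T.filter (· ⊆ γ))
      omega

lemma card_le (hT : IsDimTree T) : T.card + 1 ≤ 2 * d := by
  have h := hT.card_filter_subset_le hT.root
  simpa using h

/-- The two children of the root. -/
lemma exists_children (hT : IsDimTree T) (hd : 2 ≤ d) : ∃ β ∈ T, βᶜ ∈ T ∧ β ≠ Finset.univ ∧
    βᶜ ≠ Finset.univ ∧ ∀ α ∈ T, α ≠ Finset.univ → ¬ β ⊂ α ∧ ¬ βᶜ ⊂ α := by
  obtain ⟨β, hβ, γ, hγ, hdis, hun⟩ := hT.split _ hT.root (by simp; omega)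
  obtain rfl : γ = βᶜ := by
    refine (IsCompl.compl_eq ⟨hdis, ?_⟩).symm
    rw [codisjoint_iff]; exact hun
  have hmax : ∀ β ∈ T, βᶜ ∈ T → ∀ α ∈ T, α ≠ Finset.univ → ¬ β ⊂ α := by
    intro β hβ hγ α hα hne hlt
    rcases hT.laminar α hα βᶜ hγ with h | h | h
    · obtain ⟨b, hb⟩ := hT.nonempty β hβ
      exact (Finset.mem_compl.1 (h (hlt.1 hb))) hb
    · refine hne (Finset.eq_univ_of_forall fun i => ?_)
      by_cases hi : i ∈ β
      · exact hlt.1 hi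
      · exact h (Finset.mem_compl.2 hi)
    · exact hlt.2 fun i hi => by
        by_contra hb
        exact Finset.disjoint_left.1 h hi (Finset.mem_compl.2 hb)
  obtain ⟨b, hb⟩ := hT.nonempty β hβ
  obtain ⟨c, hc⟩ := hT.nonempty _ hγ
  refine ⟨β, hβ, hγ, fun h => ?_, fun h => ?_, fun α hα hne => ⟨hmax β hβ hγ α hα hne,
    hmax βᶜ hγ (by rwa [compl_compl]) α hα hne⟩⟩
  · rw [h] at hc; simp at hc
  · have := h ▸ Finset.mem_univ b
    exact Finset.mem_compl.1 this hb

end IsDimTree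

end Tree

/-! ### Ranks, quasi-optimality and stability of truncations -/

section Truncation

variable {d : ℕ} {J : Type*} {F : Finset J} {T : Finset (Finset (Fin d))} {v v' : L2 (Fin d → J)}
  {r : Finset (Fin d) → ℕ}

lemma HasRank.univ (w : (Fin d → J) → ℝ) : HasRank Finset.univ 1 w :=
  ⟨fun _ => w, fun _ _ => 1, fun _ x y hxy => congrArg w (funext fun i => hxy i (by simp)),
    fun _ _ _ _ => rfl, fun x => by simp⟩

lemma HasRank.eq_zero {α : Finset (Fin d)} {w : (Fin d → J) → ℝ} (h : HasRank α 0 w) (x) :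
    w x = 0 := by
  obtain ⟨a, b, -, -, h⟩ := h
  rw [h x]; simp

/-- A tensor has hierarchical rank at most `N` if this holds at the nodes below the root. -/
lemma htRank_le_of_nodes (hT : IsDimTree T) (hd : 2 ≤ d) {N : ℕ} {w : (Fin d → J) → ℝ}
    (h : ∀ α ∈ T, α ≠ Finset.univ → HasRank α N w) : htRank T w ≤ N := by
  rw [htRank_le_iff]
  intro α hα
  by_cases hu : α = Finset.univ
  · subst hu
    -- At the root every tensor has rank at most one. For N = 0 the tensor vanishes because it has
    -- rank 0 at a child of the root.
    rcases Nat.eq_zero_or_pos N with rfl | hN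
    · obtain ⟨β, hβ, -, hne, -⟩ := hT.exists_children hd
      exact (HasRank.zero 0).congr (h β hβ hne).eq_zero
    · exact (HasRank.univ w).mono hN
  · exact h α hα hu

lemma IsHOSVD.htRank_le_maxRank (hT : IsDimTree T) (hd : 2 ≤ d)
    (hv : ∀ x ∉ Bx d F, v x = 0) (h : IsHOSVD T v r v') : htRank T v' ≤ maxRank T r := by
  obtain ⟨nodes, R, U, hnd, hmem, hpw, hU, hv'⟩ := h
  refine htRank_le_of_nodes hT hd fun α hα hne => ?_
  have hl : ∀ α ∈ nodes, ∀ β ∈ nodes, α ⊆ β ∨ β ⊆ α ∨ Disjoint α β := fun α hα β hβ =>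
    hT.laminar α ((hmem α).1 hα).1 β ((hmem β).1 hβ).1
  rw [foldl_modeProj hv hU] at hv'
  refine ((hasRank_foldProj (F := F) (r := r) (U := U) hnd hpw hl ((hmem α).2 ⟨hα, hne⟩) _).mono
    ?_).congr hv'
  exact (min_le_left _ _).trans (Finset.le_sup (Finset.mem_erase.2 ⟨hne, hα⟩))

/-- No node of the truncation uses more singular vectors than there are positive singular values of
v, whatever target ranks are prescribed. -/
lemma IsHOSVD.htRank_le (hT : IsDimTree T) (hd : 2 ≤ d) (hF : F.Nonempty)
    (hv : ∀ x ∉ Bx d F, v x = 0) (h : IsHOSVD T v r v') {N : ℕ} (hN : htRank T v ≤ N) :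
    htRank T v' ≤ N := by
  obtain ⟨nodes, R, U, hnd, hmem, hpw, hU, hv'⟩ := h
  refine htRank_le_of_nodes hT hd fun α hα hne => ?_
  have hl : ∀ α ∈ nodes, ∀ β ∈ nodes, α ⊆ β ∨ β ⊆ α ∨ Disjoint α β := fun α hα β hβ =>
    hT.laminar α ((hmem α).1 hα).1 β ((hmem β).1 hβ).1
  rw [foldl_modeProj hv hU] at hv'
  refine ((hasRank_foldProj (F := F) (r := r) (U := U) hnd hpw hl ((hmem α).2 ⟨hα, hne⟩) _).mono
    ?_).congr hv'
  obtain ⟨σ, V, hs⟩ := hU α ((hmem α).2 ⟨hα, hne⟩)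
  exact (min_le_right _ _).trans (hs.card_le hF hv (htRank_le_iff.1 hN α hα))

lemma IsHOSVD.econtr_le (hT : IsDimTree T) (hF : F.Nonempty) (hv : ∀ x ∉ Bx d F, v x = 0)
    (h : IsHOSVD T v r v') (j : Fin d) (l : J) : econtr j v' l ≤ econtr j v l := by
  classical
  obtain ⟨nodes, R, U, hnd, hmem, hpw, hU, hv'⟩ := h
  have hl : ∀ α ∈ nodes, ∀ β ∈ nodes, α ⊆ β ∨ β ⊆ α ∨ Disjoint α β := fun α hα β hβ =>
    hT.laminar α ((hmem α).1 hα).1 β ((hmem β).1 hβ).1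
  rw [foldl_modeProj hv hU] at hv'
  have hv'0 : ∀ x ∉ Bx d F, v' x = 0 := fun x hx => by
    rw [hv' x]; exact foldProj_support hv hU hv x hx
  rw [econtr_eq hv'0, econtr_eq hv]
  refine ENNReal.ofReal_le_ofReal (Real.sqrt_le_sqrt ?_)
  have := nsq_foldProj_le (r := r) hF hv hU hnd hpw hl j
    (φ := fun x => if x j = l then 1 else 0) (fun x y hxy => by simp [hxy j rfl])
    (fun x => by split_ifs <;> norm_num)
  simp only [hv']
  exact this

/-- Transposition of the matricization. The left vectors have to be carried over to the double
complement, which equals α only propositionally. -/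
lemma IsSVD.exists_symm {α : Finset (Fin d)} {w : (Fin d → J) → ℝ} {R : ℕ}
    {σ : Fin R → ℝ} {U : Fin R → L2 (α → J)} {V : Fin R → L2 ((αᶜ : Finset (Fin d)) → J)}
    (h : IsSVD α w σ U V) : ∃ U' : Fin R → L2 ((αᶜᶜ : Finset (Fin d)) → J), IsSVD αᶜ w σ V U' := by
  have aux : ∀ α' : Finset (Fin d), α' = α → ∃ U' : Fin R → L2 (α' → J), Orthonormal ℝ U' ∧
      ∀ k (x : Fin d → J), U' k (fun i => x i) = U k (fun i => x i) := by
    rintro _ rfl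
    exact ⟨U, h.left, fun _ _ => rfl⟩
  obtain ⟨U', hO, hU'⟩ := aux _ (compl_compl α)
  refine ⟨U', h.pos, h.anti, h.right, hO, fun x => ?_⟩
  rw [h.eq x]
  exact Finset.sum_congr rfl fun k _ => by rw [hU']; ring

/-- The truncation of `v` is as good, up to the factor `√(2d - 3)`, as any approximation of
lower or equal rank. -/
lemma IsHOSVD.exists_quasi_best (hT : IsDimTree T) (hd : 2 ≤ d) (hF : F.Nonempty)
    (hv : ∀ x ∉ Bx d F, v x = 0) (h : IsHOSVD T v r v') {N : ℕ} {w : L2 (Fin d → J)}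
    (hw : htRank T w ≤ N) :
    ∃ v'', IsHOSVD T v (fun _ => N) v'' ∧ ‖v - v''‖ ^ 2 ≤ (2 * d - 3) * ‖v - w‖ ^ 2 := by
  obtain ⟨nodes, R, U, hnd, hmem, hpw, hU, -⟩ := h
  obtain ⟨β, hβ, hγ, hβu, hγu, hmax⟩ := hT.exists_children hd
  have hβm : β ∈ nodes := (hmem β).2 ⟨hβ, hβu⟩
  have hγm : βᶜ ∈ nodes := (hmem _).2 ⟨hγ, hγu⟩
  have hne : βᶜ ≠ β := by
    obtain ⟨b, hb⟩ := hT.nonempty β hβ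
    intro h; rw [← h] at hb
    exact Finset.mem_compl.1 hb (h ▸ hb)
  obtain ⟨σ, V, hs⟩ := hU β hβm
  obtain ⟨U', hs'⟩ := hs.exists_symm
  -- Singular vectors are not unique. Taking the right vectors at β as left vectors at its
  -- complement makes the projections at the two children of the root agree on v, which saves one of
  -- the 2d-2 projections.
  let G : ∀ α : Finset (Fin d), Σ R : ℕ, Fin R → L2 (α → J) :=
    Function.update (fun α => ⟨R α, U α⟩) βᶜ ⟨R β, V⟩
  have hGγ : G βᶜ = ⟨R β, V⟩ := Function.update_self _ _ _
  have hG : ∀ α, α ≠ βᶜ → G α = ⟨R α, U α⟩ := fun α hα => Function.update_of_ne hα _ _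
  have hgood : ∀ α ∈ nodes, ∃ (σ : Fin (G α).1 → ℝ)
      (V : Fin (G α).1 → L2 ((αᶜ : Finset (Fin d)) → J)), IsSVD α v σ (G α).2 V := by
    intro α hα
    by_cases h : α = βᶜ
    · subst h; rw [hGγ]; exact ⟨σ, U', hs'⟩
    · rw [hG α h]; exact hU α hα
  -- Both children of the root are maximal among the remaining nodes, so they may be moved to the
  -- front without violating the order from root to leaves.
  let rest := (nodes.erase β).erase βᶜ
  let nodes' := β :: βᶜ :: rest
  have hperm : nodes'.Perm nodes := by
    have h1 := List.perm_cons_erase hβm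
    have h2 : βᶜ ∈ nodes.erase β := (List.mem_erase_of_ne hne).2 hγm
    exact ((List.perm_cons_erase h2).symm.cons β).trans h1.symm
  have hrest : ∀ α ∈ rest, α ∈ nodes := fun α hα => hperm.subset (by simp [nodes', hα])
  have hnd' : nodes'.Nodup := hperm.nodup_iff.2 hnd
  have hsvd : AreSVDs (fun α => (G α).1) (fun α => (G α).2) v nodes' :=
    fun α hα => hgood α (hperm.subset hα)
  let z := foldProj F (fun α => (G α).1) (fun α => (G α).2) (fun _ => N) nodes' v
  have hz0 : ∀ x ∉ Bx d F, z x = 0 := foldProj_support hv hsvd hv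
  have hz : ∀ x, ofFinset (Bx d F) z x = z x := by
    intro x
    by_cases hx : x ∈ Bx d F
    · exact ofFinset_of_mem _ hx
    · rw [ofFinset_of_notMem _ hx, hz0 x hx]
  refine ⟨ofFinset (Bx d F) z, ⟨nodes', fun α => (G α).1, fun α => (G α).2, hnd',
    fun α => hperm.mem_iff.trans (hmem α), ?_, hsvd, ?_⟩, ?_⟩
  · refine List.pairwise_cons.2 ⟨fun α hα => ?_, List.pairwise_cons.2 ⟨fun α hα => ?_, ?_⟩⟩
    · obtain ⟨h1, h2⟩ := (hmem α).1 (hperm.subset (List.mem_cons_of_mem _ hα))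
      exact (hmax α h1 h2).1
    · obtain ⟨h1, h2⟩ := (hmem α).1 (hrest α hα)
      exact (hmax α h1 h2).2
    · exact hpw.sublist (List.erase_sublist.trans List.erase_sublist)
  · intro x
    rw [hz, foldl_modeProj hv hsvd]
  -- There are at most 2d-2 nodes below the root; the two children count as one.
  · have hlen : (rest.length : ℝ) + 1 ≤ 2 * d - 3 := by
      have h1 : nodes.length + 1 ≤ T.card := by
        have h2 : nodes.toFinset ⊆ T.erase Finset.univ := by
          intro α hα
          obtain ⟨h1, h2⟩ := (hmem α).1 (List.mem_toFinset.1 hα)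
          exact Finset.mem_erase.2 ⟨h2, h1⟩
        have h3 := Finset.card_le_card h2
        rw [List.toFinset_card_of_nodup hnd] at h3
        have h4 := Finset.card_erase_add_one hT.root
        omega
      have h2 := hperm.length_eq
      have h3 := hT.card_le
      simp only [nodes', List.length_cons] at h2
      have h4 : rest.length + 4 ≤ 2 * d := by omega
      have : ((rest.length + 4 : ℕ) : ℝ) ≤ (2 * d : ℕ) := by exact_mod_cast h4
      push_cast at this
      linarith
    have hw' := htRank_le_iff.1 hw
    have hfold : z = foldProj F (fun α => (G α).1) (fun α => (G α).2) (fun _ => N) rest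
        (kop F β (projKer (U β) N) v) := by
      have hcr : kop F β (projKer (U β) N) v = kop F βᶜ (projKer V N) v := by
        funext x; rw [hs.kop_left hv, hs.kop_right hv]
      have h1 : kop F β (projKer (G β).2 N) v = kop F β (projKer (U β) N) v := by
        rw [hG β hne.symm]
      have h2 : ∀ y, kop F βᶜ (projKer (G βᶜ).2 N) y = kop F βᶜ (projKer V N) y := by
        intro y; rw [hGγ]
      change foldProj F (fun α => (G α).1) (fun α => (G α).2) (fun _ => N) rest
        (kop F βᶜ (projKer (G βᶜ).2 N) (kop F β (projKer (G β).2 N) v)) = _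
      rw [h1, h2, hcr, kop_projKer_idem (hs'.left_support hv) hs.right]
    have h1 := nsq_sub_foldProj_le (r := fun _ => N) hF hv
      (fun α hα => hgood α (hrest α hα)) (l := rest) (w := w)
      (fun α hα => hw' α ((hmem α).1 (hrest α hα)).1) (kop F β (projKer (U β) N) v)
    rw [← hfold] at h1
    have h2 := hs.error_le hF hv (hw' β hβ)
    have h3 : nsq F (fun _ => 1) (fun x => v x - w x) ≤ ‖v - w‖ ^ 2 := by
      have := sum_sq_le_norm_sq (Bx d F) (v - w)
      simpa [nsq] using this
    have h4 : ‖v - ofFinset (Bx d F) z‖ ^ 2 = nsq F (fun _ => 1) (fun x => v x - z x) := by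
      rw [norm_sq_eq_sum (Bx d F)]
      · simp [nsq, hz]
      · intro x hx
        rw [lp.coeFn_sub, Pi.sub_apply, hz, hz0 x hx, hv x hx, sub_zero]
    rw [h4]
    have h5 : 0 ≤ nsq F (fun _ => 1) (fun x => v x - w x) :=
      Finset.sum_nonneg fun x _ => by positivity
    nlinarith [norm_nonneg (v - w)]

/-- The quasi-best truncation to ranks N meets the tolerance and is itself an admissible truncation,
so minimality of the maximal rank compares it with the computed one. -/
lemma IsTrunc.htRank_le (hT : IsDimTree T) (hd : 2 ≤ d) (hF : F.Nonempty)
    (hv : ∀ x ∉ Bx d F, v x = 0) {ε : ℝ} (h : IsTrunc T v ε v') {N : ℕ} {w : L2 (Fin d → J)}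
    (hw : htRank T w ≤ N) (hε : √(2 * d - 3) * ‖v - w‖ ≤ ε) : htRank T v' ≤ N := by
  obtain ⟨r, hr, -, hmin⟩ := h
  obtain ⟨v'', hv'', herr⟩ := hr.exists_quasi_best hT hd hF hv hw
  have hd' : (0 : ℝ) ≤ 2 * d - 3 := by
    have : (2 : ℝ) ≤ d := by exact_mod_cast hd
    linarith
  have h1 : ‖v - v''‖ ≤ ε := by
    refine le_trans (abs_le_of_sq_le_sq' ?_ (by positivity)).2 hε
    rw [mul_pow, Real.sq_sqrt hd']; exact herr
  have h2 := hmin _ _ hv'' h1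
  have h3 : maxRank T (fun _ => N) ≤ N := Finset.sup_le fun _ _ => le_rfl
  exact (hr.htRank_le_maxRank hT hd hv).trans (by exact_mod_cast h2.trans h3)

end Truncation

end

section

/-! ### Bounded infinite matrices and their tensor products -/

section MatBound

variable {J : Type*} {M N : J → J → ℝ} {c c' : ℝ}

namespace MatBound

lemma mono (h : MatBound M c) (hc : c ≤ c') : MatBound M c' := fun F x y =>
  (h F x y).trans (by gcongr)

lemma zero : MatBound (fun _ _ : J => (0 : ℝ)) 0 := fun F x y => by simp

lemma add (h : MatBound M c) (h' : MatBound N c') :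
    MatBound (fun l m => M l m + N l m) (c + c') := fun F x y => by
  have : ∑ l ∈ F, ∑ m ∈ F, x l * (M l m + N l m) * y m =
      ∑ l ∈ F, ∑ m ∈ F, x l * M l m * y m + ∑ l ∈ F, ∑ m ∈ F, x l * N l m * y m := by
    simp only [mul_add, add_mul, Finset.sum_add_distrib]
  rw [this]
  refine (abs_add_le _ _).trans ((add_le_add (h F x y) (h' F x y)).trans (le_of_eq (by ring)))

lemma scale (h : MatBound M c) (hc : 0 ≤ c) {a b : J → ℝ} {α β : ℝ} (hα : 0 ≤ α)
    (ha : ∀ l, |a l| ≤ α) (hb : ∀ l, |b l| ≤ β) :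
    MatBound (fun l m => a l * M l m * b m) (α * c * β) := fun F x y => by
  have h1 := h F (fun l => x l * a l) fun m => b m * y m
  have h2 : ∀ (a x : J → ℝ) (α : ℝ), (∀ l, |a l| ≤ α) →
      √(∑ l ∈ F, (x l * a l) ^ 2) ≤ |α| * √(∑ l ∈ F, x l ^ 2) := by
    intro a x α ha
    rw [← Real.sqrt_sq_eq_abs, ← Real.sqrt_mul (sq_nonneg _), Finset.mul_sum]
    refine Real.sqrt_le_sqrt (Finset.sum_le_sum fun l _ => ?_)
    rw [mul_pow, mul_comm]
    have := sq_le_sq' (by linarith [ha l, neg_abs_le (a l), (abs_le.1 (ha l)).1])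
      ((le_abs_self _).trans (ha l))
    exact mul_le_mul_of_nonneg_right this (sq_nonneg _)
  have h3 : ∑ l ∈ F, ∑ m ∈ F, x l * (a l * M l m * b m) * y m =
      ∑ l ∈ F, ∑ m ∈ F, x l * a l * M l m * (b m * y m) :=
    Finset.sum_congr rfl fun l _ => Finset.sum_congr rfl fun m _ => by ring
  rw [h3]
  refine h1.trans ?_
  have h4 := h2 a x α ha
  have h5 := h2 b y β hb
  rw [abs_of_nonneg hα] at h4
  rcases F.eq_empty_or_nonempty with rfl | ⟨l₀, -⟩
  · simp
  have hβ : 0 ≤ β := (abs_nonneg _).trans (hb l₀)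
  rw [abs_of_nonneg hβ] at h5
  simp only [mul_comm (b _)]
  calc _ ≤ c * (α * √(∑ l ∈ F, x l ^ 2)) * (β * √(∑ l ∈ F, y l ^ 2)) := by gcongr
    _ = _ := by ring

lemma smul (h : MatBound M c) (a : ℝ) : MatBound (fun l m => a * M l m) (|a| * c) :=
  fun F x y => by
    have : ∑ l ∈ F, ∑ m ∈ F, x l * (a * M l m) * y m =
        a * ∑ l ∈ F, ∑ m ∈ F, x l * M l m * y m := by
      simp only [Finset.mul_sum]
      exact Finset.sum_congr rfl fun l _ => Finset.sum_congr rfl fun m _ => by ring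
    rw [this, abs_mul, mul_assoc |a|, mul_assoc |a|]
    exact mul_le_mul_of_nonneg_left (h F x y) (abs_nonneg a)

lemma sum {κ : Type*} (s : Finset κ) {G : κ → J → J → ℝ} {b : κ → ℝ}
    (h : ∀ k ∈ s, MatBound (G k) (b k)) :
    MatBound (fun l m => ∑ k ∈ s, G k l m) (∑ k ∈ s, b k) := by
  classical
  induction s using Finset.induction_on with
  | empty => simpa using zero
  | insert k s hk ih =>
    simp only [Finset.sum_insert hk]
    exact (h k (by simp)).add (ih fun j hj => h j (Finset.mem_insert_of_mem hj))

/-- Testing the bilinear bound with the image itself; `of_sum_sq_le` is the converse by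
Cauchy–Schwarz. The constant may be negative here, in which case the form vanishes. -/
lemma sum_sq_le (h : MatBound M c) (F : Finset J) (w : J → ℝ) :
    ∑ l ∈ F, (∑ m ∈ F, M l m * w m) ^ 2 ≤ c ^ 2 * ∑ m ∈ F, w m ^ 2 := by
  set z : J → ℝ := fun l => ∑ m ∈ F, M l m * w m with hz
  have h1 := (le_abs_self _).trans (h F z w)
  have h2 : ∑ l ∈ F, ∑ m ∈ F, z l * M l m * w m = ∑ l ∈ F, z l ^ 2 := by
    refine Finset.sum_congr rfl fun l _ => ?_
    rw [sq]; conv_rhs => rw [hz]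
    rw [Finset.mul_sum]
    exact Finset.sum_congr rfl fun m _ => by ring
  rw [h2] at h1
  set a := ∑ l ∈ F, z l ^ 2
  set b := ∑ l ∈ F, w l ^ 2
  have ha : 0 ≤ a := Finset.sum_nonneg fun _ _ => sq_nonneg _
  have hb : 0 ≤ b := Finset.sum_nonneg fun _ _ => sq_nonneg _
  have h3 : √a ≤ |c| * √b := by
    rcases (Real.sqrt_nonneg a).eq_or_lt with h0 | h0
    · rw [← h0]; positivity
    · refine le_of_mul_le_mul_right ?_ h0
      rw [Real.mul_self_sqrt ha]
      refine h1.trans ?_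
      calc c * √a * √b ≤ |c| * √a * √b := by gcongr; exact le_abs_self c
        _ = _ := by ring
  have h4 := pow_le_pow_left₀ (Real.sqrt_nonneg a) h3 2
  rwa [Real.sq_sqrt ha, mul_pow, sq_abs, Real.sq_sqrt hb] at h4

lemma of_sum_sq_le (hc : 0 ≤ c) (h : ∀ (F : Finset J) (w : J → ℝ),
    ∑ l ∈ F, (∑ m ∈ F, M l m * w m) ^ 2 ≤ c ^ 2 * ∑ m ∈ F, w m ^ 2) : MatBound M c := by
  intro F x y
  have h1 : ∑ l ∈ F, ∑ m ∈ F, x l * M l m * y m = ∑ l ∈ F, x l * ∑ m ∈ F, M l m * y m := by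
    simp only [Finset.mul_sum]
    exact Finset.sum_congr rfl fun l _ => Finset.sum_congr rfl fun m _ => by ring
  rw [h1]
  have h2 := Finset.sum_mul_sq_le_sq_mul_sq F x fun l => ∑ m ∈ F, M l m * y m
  have h3 := h2.trans (mul_le_mul_of_nonneg_left (h F y)
    (Finset.sum_nonneg fun l _ => sq_nonneg (x l)))
  have h4 := Real.abs_le_sqrt h3
  rwa [Real.sqrt_mul (Finset.sum_nonneg fun l _ => sq_nonneg (x l)),
    Real.sqrt_mul (sq_nonneg c), Real.sqrt_sq hc, ← mul_assoc, mul_comm (√_) c] at h4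

/-- Bound for the image of a vector with support in a finite set. -/
lemma sum_sq_le' (h : MatBound M c) (F G : Finset J) (w : J → ℝ) :
    ∑ l ∈ G, (∑ m ∈ F, M l m * w m) ^ 2 ≤ c ^ 2 * ∑ m ∈ F, w m ^ 2 := by
  classical
  have h1 := h.sum_sq_le (F ∪ G) fun m => if m ∈ F then w m else 0
  have h2 : ∀ g : J → ℝ → ℝ, (∀ m, g m 0 = 0) →
      ∑ m ∈ F ∪ G, g m (if m ∈ F then w m else 0) = ∑ m ∈ F, g m (w m) := by
    intro g hg
    rw [← Finset.sum_subset (Finset.subset_union_left : F ⊆ F ∪ G)]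
    · exact Finset.sum_congr rfl fun m hm => by rw [if_pos hm]
    · intro m _ hm; rw [if_neg hm, hg]
  rw [h2 (fun _ y => y ^ 2) (by simp)] at h1
  refine le_trans ?_ h1
  refine (Finset.sum_le_sum_of_subset_of_nonneg Finset.subset_union_right
    fun _ _ _ => sq_nonneg _).trans (le_of_eq (Finset.sum_congr rfl fun l _ => ?_))
  rw [h2 (fun m y => M l m * y) (by simp)]

end MatBound

/-- Multiplication with a matrix in one direction, on a box. -/
def opAt {d : ℕ} (F : Finset J) (i : Fin d) (M : J → J → ℝ) (w : (Fin d → J) → ℝ)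
    (x : Fin d → J) : ℝ :=
  ∑ m ∈ F, M (x i) m * w (Function.update x i m)

lemma card_mul_sum_box_update {d : ℕ} (F : Finset J) (i : Fin d) (g : (Fin d → J) → ℝ) :
    (F.card : ℝ) * ∑ x ∈ Bx d F, g x = ∑ x ∈ Bx d F, ∑ m ∈ F, g (Function.update x i m) := by
  have h1 : (F.card : ℝ) * ∑ x ∈ Bx d F, g x = ∑ p ∈ Bx d F ×ˢ F, g p.1 := by
    rw [Finset.sum_product_right]; simp
  rw [h1, ← Finset.sum_product']
  have hmem : ∀ p ∈ Bx d F ×ˢ F, ((Function.update p.1 i p.2, p.1 i) : _ × _) ∈ Bx d F ×ˢ F := by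
    intro p hp
    rw [Finset.mem_product, Fintype.mem_piFinset] at hp ⊢
    refine ⟨fun k => ?_, hp.1 i⟩
    by_cases hk : k = i
    · subst hk; simpa using hp.2
    · simpa [hk] using hp.1 k
  refine Finset.sum_nbij' (fun p => (Function.update p.1 i p.2, p.1 i))
    (fun p => (Function.update p.1 i p.2, p.1 i)) hmem hmem ?_ ?_ ?_
  · intro p _; simp
  · intro p _; simp
  · intro p _; simp

lemma sum_opAt_sq_le {d : ℕ} {F : Finset J} (hF : F.Nonempty) (i : Fin d) (h : MatBound M c)
    (w : (Fin d → J) → ℝ) :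
    ∑ x ∈ Bx d F, opAt F i M w x ^ 2 ≤ c ^ 2 * ∑ x ∈ Bx d F, w x ^ 2 := by
  have hc : (0 : ℝ) < F.card := by exact_mod_cast hF.card_pos
  refine le_of_mul_le_mul_left ?_ hc
  rw [card_mul_sum_box_update F i, mul_left_comm, card_mul_sum_box_update F i, Finset.mul_sum]
  refine Finset.sum_le_sum fun x _ => ?_
  simp only [opAt, Function.update_self, Function.update_idem]
  exact h.sum_sq_le F fun m => w (Function.update x i m)

open Classical in
/-- Kernel of a tensor product of matrices, with identities outside `s`. -/
def tensorKer {d : ℕ} (M : Fin d → J → J → ℝ) (s : Finset (Fin d)) (x y : Fin d → J) : ℝ :=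
  ∏ k, if k ∈ s then M k (x k) (y k) else if x k = y k then 1 else 0

lemma tensorKer_insert {d : ℕ} {F : Finset J} (M : Fin d → J → J → ℝ) {s : Finset (Fin d)}
    {i : Fin d} (hi : i ∉ s) (x : Fin d → J) {y : Fin d → J} (hy : y ∈ Bx d F) :
    ∑ m ∈ F, M i (x i) m * tensorKer M s (Function.update x i m) y =
      tensorKer M (insert i s) x y := by
  classical
  have h1 : ∀ m, tensorKer M s (Function.update x i m) y =
      (if m = y i then 1 else 0) * ∏ k ∈ Finset.univ.erase i,
        if k ∈ insert i s then M k (x k) (y k) else if x k = y k then 1 else 0 := by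
    intro m
    rw [tensorKer, ← Finset.mul_prod_erase _ _ (Finset.mem_univ i), if_neg hi,
      Function.update_self]
    congr 1
    refine Finset.prod_congr rfl fun k hk => ?_
    have hk' := Finset.ne_of_mem_erase hk
    simp [hk', Function.update_of_ne]
  simp only [h1, ← mul_assoc, ← Finset.sum_mul]
  rw [tensorKer, ← Finset.mul_prod_erase _ _ (Finset.mem_univ i), if_pos (by simp)]
  congr 1
  simp [Fintype.mem_piFinset.1 hy i]

/-- The tensor product is a composition of matrices acting in one direction each. Directions are
added to s one at a time, starting from the identity, and each contributes its own bound. -/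
lemma MatBound.tensorKer_sum_sq_le {d : ℕ} {F : Finset J} (hF : F.Nonempty)
    {M : Fin d → J → J → ℝ} {c : Fin d → ℝ} (h : ∀ i, MatBound (M i) (c i)) (s : Finset (Fin d))
    (w : (Fin d → J) → ℝ) :
    ∑ x ∈ Bx d F, (∑ y ∈ Bx d F, tensorKer M s x y * w y) ^ 2 ≤
      (∏ i ∈ s, c i) ^ 2 * ∑ x ∈ Bx d F, w x ^ 2 := by
  classical
  induction s using Finset.induction_on with
  | empty =>
    rw [Finset.prod_empty, one_pow, one_mul]
    refine le_of_eq (Finset.sum_congr rfl fun x hx => ?_)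
    congr 1
    rw [Finset.sum_eq_single x]
    · simp [tensorKer]
    · intro y _ hne
      obtain ⟨k, hk⟩ := Function.ne_iff.1 hne
      rw [tensorKer, Finset.prod_eq_zero (Finset.mem_univ k), zero_mul]
      simp [hk.symm]
    · intro h; exact absurd hx h
  | insert i s hi ih =>
    have h1 : ∀ x, ∑ y ∈ Bx d F, tensorKer M (insert i s) x y * w y =
        opAt F i (M i) (fun x => ∑ y ∈ Bx d F, tensorKer M s x y * w y) x := by
      intro x
      simp only [opAt, Finset.mul_sum]
      rw [Finset.sum_comm]
      refine Finset.sum_congr rfl fun y hy => ?_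
      rw [← tensorKer_insert M hi x hy, Finset.sum_mul]
      exact Finset.sum_congr rfl fun m _ => by ring
    simp only [h1]
    refine (sum_opAt_sq_le hF i (h i) _).trans ?_
    rw [Finset.prod_insert hi, mul_pow, mul_assoc]
    exact mul_le_mul_of_nonneg_left ih (sq_nonneg _)

/-- Tensor products of bounded matrices are bounded. -/
lemma MatBound.tensor {d : ℕ} {M : Fin d → J → J → ℝ} {c : Fin d → ℝ}
    (h : ∀ i, MatBound (M i) (c i)) (hc : ∀ i, 0 ≤ c i) :
    MatBound (fun x y : Fin d → J => ∏ i, M i (x i) (y i)) (∏ i, c i) := by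
  classical
  refine MatBound.of_sum_sq_le (Finset.prod_nonneg fun i _ => hc i) fun X w => ?_
  rcases X.eq_empty_or_nonempty with rfl | ⟨x₀, hx₀⟩
  · simp
  rcases Nat.eq_zero_or_pos d with rfl | hd
  · have h0 : ∀ x : Fin 0 → J, x = x₀ := fun x => Subsingleton.elim _ _
    have : X = {x₀} := by
      ext x; rw [h0 x]; simp [hx₀]
    subst this
    simp
  let F : Finset J := X.biUnion fun x => Finset.univ.image x
  have hXF : X ⊆ Bx d F := fun x hx => by
    rw [Fintype.mem_piFinset]
    exact fun i => Finset.mem_biUnion.2 ⟨x, hx, Finset.mem_image.2 ⟨i, by simp, rfl⟩⟩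
  have hF : F.Nonempty := ⟨x₀ ⟨0, hd⟩, Fintype.mem_piFinset.1 (hXF hx₀) _⟩
  have h1 := tensorKer_sum_sq_le hF h Finset.univ fun y => if y ∈ X then w y else 0
  have h2 : ∀ g : (Fin d → J) → ℝ → ℝ, (∀ m, g m 0 = 0) →
      ∑ m ∈ Bx d F, g m (if m ∈ X then w m else 0) = ∑ m ∈ X, g m (w m) := by
    intro g hg
    rw [← Finset.sum_subset hXF]
    · exact Finset.sum_congr rfl fun m hm => by rw [if_pos hm]
    · intro m _ hm; rw [if_neg hm, hg]
  rw [h2 (fun _ y => y ^ 2) (by simp)] at h1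
  refine le_trans ?_ h1
  refine (Finset.sum_le_sum_of_subset_of_nonneg hXF
    fun _ _ _ => sq_nonneg _).trans (le_of_eq (Finset.sum_congr rfl fun x _ => ?_))
  rw [h2 (fun m y => tensorKer M Finset.univ x m * y) (by simp)]
  simp [tensorKer]

end MatBound

end

section

namespace Problem

variable {d K : ℕ} {J : Type*} {P : Problem d K J}

/-! ### The separable scaling -/

namespace Standing

lemma w_pos (hP : P.Standing) (j : Fin d) (l : J) : 0 < P.w j l :=
  zero_lt_one.trans_le (hP.one_le_w j l)

lemma w_sq_le_weight (j : Fin d) (x : Fin d → J) : P.w j (x j) ^ 2 ≤ P.weight x :=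
  Finset.single_le_sum (f := fun j => P.w j (x j) ^ 2) (fun _ _ => sq_nonneg _)
    (Finset.mem_univ j)

lemma w_le_sqrt_weight (j : Fin d) (x : Fin d → J) : P.w j (x j) ≤ √(P.weight x) :=
  Real.le_sqrt_of_sq_le (w_sq_le_weight j x)

lemma one_le_weight (hP : P.Standing) (hd : 2 ≤ d) (x : Fin d → J) : 1 ≤ P.weight x :=
  (one_le_pow₀ (hP.one_le_w ⟨0, by omega⟩ _)).trans (w_sq_le_weight ⟨0, by omega⟩ x)

lemma one_le_sqrt_weight (hP : P.Standing) (hd : 2 ≤ d) (x : Fin d → J) : 1 ≤ √(P.weight x) :=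
  Real.one_le_sqrt.2 (hP.one_le_weight hd x)

end Standing

lemma expTerm_pos (hP : P.Standing) (t : ℝ) (k : ℤ) : 0 < P.expTerm t k := by
  have := hP.h_pos
  have := Real.exp_pos (-(k * P.h))
  unfold expTerm
  positivity

/-- Upper bound for the constant in `S⁻¹(δ) ≤ C D⁻¹`. -/
def sConst (P : Problem d K J) : ℝ :=
  2 * P.h * (2 / √Real.pi) * (1 + Real.exp (P.nPlus * P.h)) * Real.exp P.h / (Real.exp P.h - 1)

lemma sConst_pos (hP : P.Standing) : 0 < P.sConst := by
  have h := hP.h_pos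
  have : 0 < Real.exp P.h - 1 := by
    have := Real.add_one_lt_exp h.ne'
    linarith
  unfold sConst
  positivity

/-- The bump y/(1+y²) is dominated by the increment of the bounded function y/(1+y) from y to ρy, so
sums of bumps over a geometric grid telescope. -/
lemma div_one_add_sq_le {y ρ : ℝ} (hy : 0 < y) (hρ : 1 < ρ) :
    y / (1 + y ^ 2) ≤ 2 * ρ / (ρ - 1) * (ρ * y / (1 + ρ * y) - y / (1 + y)) := by
  have h0 : 0 < ρ * y := by positivity
  have h1 : ρ * y / (1 + ρ * y) - y / (1 + y) = (ρ - 1) * y / ((1 + y) * (1 + ρ * y)) := by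
    field_simp; ring
  have h3 : 0 < ρ - 1 := by linarith
  have h2 : 2 * ρ / (ρ - 1) * (ρ * y / (1 + ρ * y) - y / (1 + y)) =
      2 * ρ * y / ((1 + y) * (1 + ρ * y)) := by
    rw [h1]; field_simp
  rw [h2, div_le_div_iff₀ (by positivity) (by positivity)]
  have : (1 + y) * (1 + ρ * y) ≤ 2 * ρ * (1 + y ^ 2) := by
    nlinarith [sq_nonneg (1 - y), mul_pos hy hy]
  nlinarith

/-- Values whose differences dominate the terms of the exponential sum. -/
def telescopeVal (P : Problem d K J) (t : ℝ) (k : ℤ) : ℝ :=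
  (Real.exp (k * P.h) * √t / (1 + Real.exp (P.nPlus * P.h))) /
    (1 + Real.exp (k * P.h) * √t / (1 + Real.exp (P.nPlus * P.h)))

/-- With x = e^{kh}, bounded by X = e^{n⁺h}, one has ln(1+x) ≥ x/(1+X), and e^{-z} ≤ 1/(1+z) makes
the term at most a multiple of t^{-1/2} times the bump at y = x√t/(1+X). The grid in y is geometric
with ratio e^h. -/
lemma expTerm_le (hP : P.Standing) {t : ℝ} (ht : 0 < t) {k : ℤ} (hk : k ≤ P.nPlus) :
    P.expTerm t k ≤ P.sConst / √t *
      (P.telescopeVal t (k + 1) -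
      P.telescopeVal t k) := by
  have hh := hP.h_pos
  have hst : 0 < √t := Real.sqrt_pos.2 ht
  set x := Real.exp (k * P.h) with hx
  set X := Real.exp (P.nPlus * P.h) with hX
  have hx0 : 0 < x := Real.exp_pos _
  have hX0 : 0 < X := Real.exp_pos _
  have hxX : x ≤ X := Real.exp_le_exp.2 (by
    have : (k : ℝ) ≤ P.nPlus := by exact_mod_cast hk
    gcongr)
  set ρ := Real.exp P.h with hρ
  have hρ1 : 1 < ρ := Real.one_lt_exp_iff.2 hh
  have hx1 : Real.exp (((k + 1 : ℤ) : ℝ) * P.h) = ρ * x := by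
    rw [hx, hρ, ← Real.exp_add]; congr 1; push_cast; ring
  set y := x * √t / (1 + X) with hy
  have hy0 : 0 < y := by positivity
  have hy1 : ρ * x * √t / (1 + X) = ρ * y := by rw [hy]; ring
  simp only [telescopeVal, ← hX, hx1, hy1, ← hx, ← hy]
  have h1 : (1 + Real.exp (-(k * P.h)))⁻¹ ≤ x := by
    rw [Real.exp_neg, ← hx]
    have : (1 + x⁻¹)⁻¹ = x / (1 + x) := by field_simp; ring
    rw [this, div_le_iff₀ (by positivity)]
    nlinarith
  have hlog : x / (1 + X) ≤ Real.log (1 + x) := by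
    have h2 := Real.one_sub_inv_le_log_of_pos (show 0 < 1 + x by positivity)
    have h3 : 1 - (1 + x)⁻¹ = x / (1 + x) := by
      rw [eq_div_iff (by positivity), sub_mul, inv_mul_cancel₀ (by positivity)]; ring
    rw [h3] at h2
    refine le_trans ?_ h2
    gcongr
  have h2 : Real.exp (-(Real.log (1 + x)) ^ 2 * t) ≤ 1 / (1 + y ^ 2) := by
    have hle : y ^ 2 ≤ (Real.log (1 + x)) ^ 2 * t := by
      have : y = x / (1 + X) * √t := by rw [hy]; ring
      rw [this, mul_pow, Real.sq_sqrt ht.le]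
      gcongr
    rw [neg_mul, Real.exp_neg, ← one_div]
    refine one_div_le_one_div_of_le (by positivity) ?_
    have := Real.add_one_le_exp (Real.log (1 + x) ^ 2 * t)
    linarith
  have h3 := div_one_add_sq_le hy0 hρ1
  have hinv0 : 0 ≤ (1 + Real.exp (-(k * P.h)))⁻¹ := by positivity
  calc P.expTerm t k ≤ P.h * (2 / √Real.pi * x) * (1 / (1 + y ^ 2)) := by
        unfold expTerm
        rw [← hx]
        gcongr
    _ = P.h * (2 / √Real.pi) * (1 + X) / √t * (y / (1 + y ^ 2)) := by
        rw [hy]; field_simp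
    _ ≤ P.h * (2 / √Real.pi) * (1 + X) / √t *
        (2 * ρ / (ρ - 1) * (ρ * y / (1 + ρ * y) - y / (1 + y))) := by gcongr
    _ = _ := by rw [sConst]; ring

lemma sum_Icc_int_telescope (G : ℤ → ℝ) {a b : ℤ} (hab : a ≤ b) :
    ∑ k ∈ Finset.Icc a b, (G (k + 1) - G k) = G (b + 1) - G a := by
  induction b, hab using Int.leInduction with
  | base => simp
  | succ n hn ih =>
    have : Finset.Icc a (n + 1) = insert (n + 1) (Finset.Icc a n) := by
      ext k; simp only [Finset.mem_Icc, Finset.mem_insert]; omega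
    rw [this, Finset.sum_insert (by simp), ih]
    ring

lemma sInvApp_le_const (hP : P.Standing) (n : ℕ) {x : Fin d → J} (hx : 0 < P.weight x) :
    P.sInvApp n x ≤ P.sConst / √(P.weight x) := by
  refine (Finset.sum_le_sum fun k hk => expTerm_le hP hx (Finset.mem_Icc.1 hk).2).trans ?_
  rw [← Finset.mul_sum, sum_Icc_int_telescope (P.telescopeVal (P.weight x)) (by omega)]
  have hc := sConst_pos hP
  refine mul_le_of_le_one_right (by positivity) ?_
  have h1 : ∀ y : ℝ, 0 ≤ y → y / (1 + y) ≤ 1 := fun y hy => by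
    rw [div_le_one (by positivity)]; linarith
  have h2 : ∀ y : ℝ, 0 ≤ y → 0 ≤ y / (1 + y) := fun y hy => by positivity
  have h3 : P.telescopeVal (P.weight x) (P.nPlus + 1) ≤ 1 := h1 _ (by positivity)
  have h4 : 0 ≤ P.telescopeVal (P.weight x) (-(n : ℤ)) := h2 _ (by positivity)
  linarith

lemma sInvApp_nonneg (hP : P.Standing) (n : ℕ) (x : Fin d → J) : 0 ≤ P.sInvApp n x :=
  Finset.sum_nonneg fun k _ => (expTerm_pos hP _ k).le

lemma sum_indicator_expTerm_le (hP : P.Standing) {x : Fin d → J} (hx : 0 < P.weight x)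
    (s : Finset ℤ) : ∑ k ∈ s, (Set.Iic (P.nPlus : ℤ)).indicator (P.expTerm (P.weight x)) k ≤
      P.sConst / √(P.weight x) := by
  classical
  obtain ⟨n, hn⟩ : ∃ n : ℕ, ∀ k ∈ s, -(n : ℤ) ≤ k := by
    refine ⟨s.sup Int.natAbs, fun k hk => ?_⟩
    have := Finset.le_sup (f := Int.natAbs) hk
    omega
  refine le_trans ?_ (sInvApp_le_const hP n hx)
  rw [Finset.sum_indicator_eq_sum_filter]
  refine Finset.sum_le_sum_of_subset_of_nonneg (fun k hk => ?_)
    fun k _ _ => (expTerm_pos hP _ k).le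
  rw [Finset.mem_filter] at hk
  exact Finset.mem_Icc.2 ⟨hn k hk.1, hk.2⟩

lemma summable_expTerm (hP : P.Standing) {x : Fin d → J} (hx : 0 < P.weight x) :
    Summable ((Set.Iic (P.nPlus : ℤ)).indicator (P.expTerm (P.weight x))) :=
  summable_of_sum_le (Set.indicator_nonneg fun k _ => (expTerm_pos hP _ k).le)
    (sum_indicator_expTerm_le hP hx)

lemma sInv_eq (x : Fin d → J) :
    P.sInv x = ∑' k, (Set.Iic (P.nPlus : ℤ)).indicator (P.expTerm (P.weight x)) k :=
  tsum_subtype (Set.Iic (P.nPlus : ℤ)) (P.expTerm (P.weight x))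

lemma sInv_le_const (hP : P.Standing) {x : Fin d → J} (hx : 0 < P.weight x) :
    P.sInv x ≤ P.sConst / √(P.weight x) := by
  rw [sInv_eq]
  exact Real.tsum_le_of_sum_le (Set.indicator_nonneg fun k _ => (expTerm_pos hP _ k).le)
    (sum_indicator_expTerm_le hP hx)

lemma sInv_nonneg (hP : P.Standing) (x : Fin d → J) : 0 ≤ P.sInv x :=
  tsum_nonneg fun _ => (expTerm_pos hP _ _).le

lemma numTerms_le (hP : P.Standing) {η W : ℝ} (hW : 1 ≤ W) {X : Finset (Fin d → J)}
    (hX : ∀ x ∈ X, P.weight x ≤ W) : (P.numTerms η X : ℝ) ≤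
      P.h⁻¹ * (Real.log (2 / √Real.pi) + (|Real.log (P.delta / 2)| + |Real.log η|) +
        1 / 2 * Real.log W) + 1 := by
  have hh := hP.h_pos
  have h1 : X.fold max 1 P.weight ≤ W := (Finset.fold_max_le _).2 ⟨hW, hX⟩
  have h2 : 1 ≤ X.fold max 1 P.weight := (Finset.le_fold_max _).2 (Or.inl le_rfl)
  have h3 : |Real.log (min (P.delta / 2) η)| ≤ |Real.log (P.delta / 2)| + |Real.log η| := by
    rcases min_choice (P.delta / 2) η with h | h <;> rw [h]
    · linarith [abs_nonneg (Real.log η)]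
    · linarith [abs_nonneg (Real.log (P.delta / 2))]
  have h4 : 0 ≤ Real.log (2 / √Real.pi) := by
    refine Real.log_nonneg ?_
    rw [le_div_iff₀ (Real.sqrt_pos.2 Real.pi_pos), one_mul]
    refine Real.sqrt_le_iff.2 ⟨by norm_num, ?_⟩
    linarith [Real.pi_lt_d2]
  have h5 := Real.log_nonneg h2
  have h6 := Real.log_le_log (by linarith) h1
  refine (Nat.ceil_lt_add_one (by positivity)).le.trans ?_
  gcongr

/-! ### Bounds for the scaled operator -/

/-- Every w_i is at most √(weight), and at most one factor in total occurs. This is where total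
order at most one on each side matches the scaling by D⁻¹. -/
lemma prod_w_pow_le (hP : P.Standing) (hd : 2 ≤ d) {p : Fin d → ℕ} (hp : ∑ i, p i ≤ 1)
    (x : Fin d → J) : ∏ i, P.w i (x i) ^ p i ≤ √(P.weight x) := by
  calc ∏ i, P.w i (x i) ^ p i ≤ ∏ i, √(P.weight x) ^ p i :=
        Finset.prod_le_prod (fun i _ => pow_nonneg (hP.w_pos _ _).le _) fun i _ =>
          pow_le_pow_left₀ (hP.w_pos _ _).le (Standing.w_le_sqrt_weight i x) _
    _ = √(P.weight x) ^ ∑ i, p i := Finset.prod_pow_eq_pow_sum _ _ _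
    _ ≤ √(P.weight x) ^ 1 := pow_le_pow_right₀ (hP.one_le_sqrt_weight hd x) hp
    _ = _ := pow_one _

/-- One-dimensional components, scaled according to their orders. -/
def scaledComp (P : Problem d K J) (i : Fin d) (ν : Fin K) (l m : J) : ℝ :=
  P.w i l ^ (-(P.ordL i ν : ℝ)) * P.comp i ν l m * P.w i m ^ (-(P.ordR i ν : ℝ))

lemma w_pow_mul_scaledComp (hP : P.Standing) (i : Fin d) (ν : Fin K) (l m : J) :
    P.w i l ^ P.ordL i ν * P.scaledComp i ν l m * P.w i m ^ P.ordR i ν = P.comp i ν l m := by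
  have h1 := hP.w_pos i l
  have h2 := hP.w_pos i m
  rw [scaledComp, Real.rpow_neg h1.le, Real.rpow_neg h2.le, Real.rpow_natCast, Real.rpow_natCast]
  field_simp

/-- Kernel with the coefficients and orders of the operator and scaled components `G`. -/
def kernelOf (P : Problem d K J) (G : (Fin d → Fin K) → Fin d → J → J → ℝ)
    (S S' : (Fin d → J) → ℝ) (x y : Fin d → J) : ℝ :=
  S x * (∑ n, P.coef n * ∏ i, (P.w i (x i) ^ P.ordL i (n i) * G n i (x i) (y i) *
    P.w i (y i) ^ P.ordR i (n i))) * S' y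

lemma kernelOf_scaledComp (hP : P.Standing) (S S' : (Fin d → J) → ℝ) (x y : Fin d → J) :
    P.kernelOf (fun n i => P.scaledComp i (n i)) S S' x y = S x * P.A x y * S' y := by
  simp only [kernelOf, w_pow_mul_scaledComp hP]
  rfl

lemma kernelOf_sub (G G' : (Fin d → Fin K) → Fin d → J → J → ℝ) (S S' : (Fin d → J) → ℝ)
    (x y : Fin d → J) : P.kernelOf G S S' x y - P.kernelOf G' S S' x y =
      S x * (∑ n, P.coef n * ((∏ i, P.w i (x i) ^ P.ordL i (n i)) *
        (∏ i, G n i (x i) (y i) - ∏ i, G' n i (x i) (y i)) *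
        ∏ i, P.w i (y i) ^ P.ordR i (n i))) * S' y := by
  simp only [kernelOf, Finset.prod_mul_distrib]
  rw [← sub_mul, ← mul_sub, ← Finset.sum_sub_distrib]
  congr 2
  exact Finset.sum_congr rfl fun n _ => by ring

/-- The scalings absorb the factors w^p on either side by `prod_w_pow_le`, so only the kernels with
scaled components remain. The kernels `H n` are arbitrary, so that differences of tensor products
can be inserted in the analysis of compression. -/
lemma matBound_scaled (hP : P.Standing) (hd : 2 ≤ d)
    {H : (Fin d → Fin K) → (Fin d → J) → (Fin d → J) → ℝ} {c : (Fin d → Fin K) → ℝ}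
    (hc : ∀ n, 0 ≤ c n) (hH : ∀ n, MatBound (H n) (c n)) {S S' : (Fin d → J) → ℝ} {b : ℝ}
    (hb : 0 ≤ b) (hS : ∀ x, |S x| ≤ b / √(P.weight x)) (hS' : ∀ x, |S' x| ≤ b / √(P.weight x)) :
    MatBound (fun x y => S x * (∑ n, P.coef n * ((∏ i, P.w i (x i) ^ P.ordL i (n i)) * H n x y *
        ∏ i, P.w i (y i) ^ P.ordR i (n i))) * S' y) (b * b * ∑ n, |P.coef n| * c n) := by
  have h1 : ∀ n, MatBound (fun x y => P.coef n * ((S x * ∏ i, P.w i (x i) ^ P.ordL i (n i)) *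
      H n x y * ((∏ i, P.w i (y i) ^ P.ordR i (n i)) * S' y))) (|P.coef n| * (b * c n * b)) := by
    intro n
    by_cases hn : P.coef n = 0
    · simpa [hn] using MatBound.zero
    · obtain ⟨hL, hR⟩ := hP.order n hn
      have aux : ∀ (S : (Fin d → J) → ℝ) (p : Fin d → ℕ), (∀ x, |S x| ≤ b / √(P.weight x)) →
          ∑ i, p i ≤ 1 → ∀ x, |S x * ∏ i, P.w i (x i) ^ p i| ≤ b := by
        intro S p hS hp x
        have h0 : 0 ≤ ∏ i, P.w i (x i) ^ p i :=
          Finset.prod_nonneg fun i _ => pow_nonneg (hP.w_pos _ _).le _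
        have hw : 0 < √(P.weight x) := zero_lt_one.trans_le (hP.one_le_sqrt_weight hd x)
        rw [abs_mul, abs_of_nonneg h0]
        calc |S x| * ∏ i, P.w i (x i) ^ p i ≤ b / √(P.weight x) * √(P.weight x) :=
              mul_le_mul (hS x) (prod_w_pow_le hP hd hp x) h0 (by positivity)
          _ = b := div_mul_cancel₀ b hw.ne'
      refine ((hH n).scale (hc n) hb (aux S _ hS hL) fun y => ?_).smul _
      rw [mul_comm]; exact aux S' _ hS' hR y
  have h2 := MatBound.sum Finset.univ fun n _ => h1 n
  have h3 : ∑ n, |P.coef n| * (b * c n * b) = b * b * ∑ n, |P.coef n| * c n := by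
    rw [Finset.mul_sum]; exact Finset.sum_congr rfl fun n _ => by ring
  rw [h3] at h2
  convert h2 using 3 with x y
  rw [Finset.mul_sum, Finset.sum_mul]
  exact Finset.sum_congr rfl fun n _ => by ring

lemma matBound_kernelOf (hP : P.Standing) (hd : 2 ≤ d)
    {G : (Fin d → Fin K) → Fin d → J → J → ℝ} {c : (Fin d → Fin K) → Fin d → ℝ}
    (hc : ∀ n i, 0 ≤ c n i) (hG : ∀ n i, MatBound (G n i) (c n i))
    {S S' : (Fin d → J) → ℝ} {b : ℝ} (hb : 0 ≤ b) (hS : ∀ x, |S x| ≤ b / √(P.weight x))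
    (hS' : ∀ x, |S' x| ≤ b / √(P.weight x)) :
    MatBound (P.kernelOf G S S') (b * b * ∑ n, |P.coef n| * ∏ i, c n i) := by
  have := matBound_scaled hP hd (fun n => Finset.prod_nonneg fun i _ => hc n i)
    (fun n => MatBound.tensor (hG n) (hc n)) hb hS hS'
  convert this using 3 with x y
  simp only [kernelOf, Finset.prod_mul_distrib]

/-! ### Weighted norms -/

/-- Uniform bound for the norms of `w_j ^ t • v`. -/
def WBound (P : Problem d K J) (t c : ℝ) (v : (Fin d → J) → ℝ) : Prop :=
  ∀ (j : Fin d) (X : Finset (Fin d → J)), ∑ x ∈ X, (P.w j (x j) ^ t * v x) ^ 2 ≤ c ^ 2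

namespace WBound

variable {t c c' : ℝ} {v v' : (Fin d → J) → ℝ}

lemma mono (h : P.WBound t c v) (hc : 0 ≤ c) (hcc : c ≤ c') : P.WBound t c' v := fun j X =>
  (h j X).trans (by gcongr)

lemma of_abs_le (h : P.WBound t c v) (hv : ∀ x, |v' x| ≤ |v x|) :
    P.WBound t c v' := fun j X => by
  refine le_trans (Finset.sum_le_sum fun x _ => ?_) (h j X)
  rw [mul_pow, mul_pow]
  exact mul_le_mul_of_nonneg_left (sq_le_sq.2 (hv x)) (sq_nonneg _)

lemma add (hc : 0 ≤ c) (hc' : 0 ≤ c') (h : P.WBound t c v) (h' : P.WBound t c' v') :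
    P.WBound t (2 * (c + c')) fun x => v x + v' x := fun j X => by
  calc ∑ x ∈ X, (P.w j (x j) ^ t * (v x + v' x)) ^ 2
      ≤ ∑ x ∈ X, (2 * (P.w j (x j) ^ t * v x) ^ 2 + 2 * (P.w j (x j) ^ t * v' x) ^ 2) := by
        refine Finset.sum_le_sum fun x _ => ?_
        nlinarith [sq_nonneg (P.w j (x j) ^ t * v x - P.w j (x j) ^ t * v' x)]
    _ ≤ 2 * c ^ 2 + 2 * c' ^ 2 := by
        rw [Finset.sum_add_distrib, ← Finset.mul_sum, ← Finset.mul_sum]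
        linarith [h j X, h' j X]
    _ ≤ _ := by nlinarith [mul_nonneg hc hc']

lemma smul (h : P.WBound t c v) (a : ℝ) : P.WBound t (|a| * c) fun x => a * v x := fun j X => by
  have : ∀ x, (P.w j (x j) ^ t * (a * v x)) ^ 2 = a ^ 2 * (P.w j (x j) ^ t * v x) ^ 2 :=
    fun x => by ring
  simp only [this]
  rw [← Finset.mul_sum, mul_pow, sq_abs]
  exact mul_le_mul_of_nonneg_left (h j X) (sq_nonneg _)

lemma zero : P.WBound t 0 fun _ => 0 := fun j X => by simp

/-- On a set with bounded weights. -/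
lemma of_norm (hP : P.Standing) (ht : 0 ≤ t) {W : ℝ} {v : L2 (Fin d → J)}
    {X : Finset (Fin d → J)} (hv : ∀ x ∉ X, v x = 0) (hW : ∀ x ∈ X, ∀ j, P.w j (x j) ≤ W) :
    P.WBound t (W ^ t * ‖v‖) v := fun j Y => by
  classical
  calc ∑ x ∈ Y, (P.w j (x j) ^ t * v x) ^ 2 ≤ ∑ x ∈ Y, (W ^ t) ^ 2 * v x ^ 2 := by
        refine Finset.sum_le_sum fun x _ => ?_
        by_cases hx : x ∈ X
        · rw [mul_pow]
          have := (hP.w_pos j (x j)).le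
          have := hW x hx j
          gcongr
        · rw [hv x hx]; simp
    _ ≤ _ := by
        rw [← Finset.mul_sum, mul_pow]
        exact mul_le_mul_of_nonneg_left (sum_sq_le_norm_sq Y v) (sq_nonneg _)

end WBound

/-- Conjugation by w_j^t changes only the j-th factor of each tensor product, and turns it into the
matrix that is bounded by excess regularity. Scalings enter only through their bound by D⁻¹, so the
constant is the same for all truncated exponential sums. -/
lemma WBound.opApply (hP : P.Standing) (hd : 2 ≤ d) {t : ℝ} (hexc : P.ExcessRegular t)
    (hcomp : ∀ i ν, ∃ c, MatBound (P.scaledComp i ν) c) :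
    ∃ C, 0 ≤ C ∧ ∀ (S S' : (Fin d → J) → ℝ), (∀ x, |S x| ≤ P.sConst / √(P.weight x)) →
      (∀ x, |S' x| ≤ P.sConst / √(P.weight x)) → ∀ (X : Finset (Fin d → J)) (c : ℝ)
      (v : (Fin d → J) → ℝ), P.WBound t c v →
      P.WBound t (C * c) fun x => S x * ∑ y ∈ X, P.A x y * (S' y * v y) := by
  classical
  choose c hc using hcomp
  choose b hb using hexc.op
  let G : Fin d → (Fin d → Fin K) → Fin d → J → J → ℝ := fun j n i l m =>
    if i = j then P.w j l ^ t * P.scaledComp j (n j) l m * P.w j m ^ (-t)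
    else P.scaledComp i (n i) l m
  let cb : Fin d → Fin K → ℝ := fun i ν => |c i ν| + |b i ν|
  have hcb : ∀ i ν, 0 ≤ cb i ν := fun i ν => by positivity
  have hG : ∀ j n i, MatBound (G j n i) (cb i (n i)) := by
    intro j n i
    by_cases hij : i = j
    · subst hij
      refine MatBound.mono ?_ (show b i (n i) ≤ cb i (n i) from
        (le_abs_self _).trans (le_add_of_nonneg_left (abs_nonneg _)))
      convert hb i (n i) using 3 with l m
      have h1 := hP.w_pos i l
      have h2 := hP.w_pos i m
      simp only [G, if_true, scaledComp]
      rw [Real.rpow_add h1, sub_eq_add_neg, Real.rpow_add h2]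
      ring
    · refine MatBound.mono ?_ (show c i (n i) ≤ cb i (n i) from
        (le_abs_self _).trans (le_add_of_nonneg_right (abs_nonneg _)))
      simp only [G, if_neg hij]
      exact hc i (n i)
  set C := P.sConst * P.sConst * ∑ n, |P.coef n| * ∏ i, cb i (n i)
  have hC : 0 ≤ C := by
    have := (sConst_pos hP).le
    exact mul_nonneg (by positivity) (Finset.sum_nonneg fun n _ => mul_nonneg (abs_nonneg _)
      (Finset.prod_nonneg fun i _ => hcb _ _))
  refine ⟨C, hC, fun S S' hS hS' X c₀ v hv j Y => ?_⟩
  have h1 := matBound_kernelOf hP hd (fun n i => hcb i (n i)) (hG j) (sConst_pos hP).le hS hS'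
  have h2 := h1.sum_sq_le' X Y fun y => P.w j (y j) ^ t * v y
  have h3 : ∀ x y, P.kernelOf (G j) S S' x y =
      P.w j (x j) ^ t * (S x * P.A x y * S' y) * P.w j (y j) ^ (-t) := by
    intro x y
    rw [← kernelOf_scaledComp hP, kernelOf, kernelOf]
    have : ∀ n : Fin d → Fin K, ∏ i, (P.w i (x i) ^ P.ordL i (n i) * G j n i (x i) (y i) *
        P.w i (y i) ^ P.ordR i (n i)) = P.w j (x j) ^ t * (∏ i, (P.w i (x i) ^ P.ordL i (n i) *
          P.scaledComp i (n i) (x i) (y i) * P.w i (y i) ^ P.ordR i (n i))) *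
          P.w j (y j) ^ (-t) := by
      intro n
      rw [← Finset.mul_prod_erase _ _ (Finset.mem_univ j),
        ← Finset.mul_prod_erase Finset.univ (fun i => P.w i (x i) ^ P.ordL i (n i) *
          P.scaledComp i (n i) (x i) (y i) * P.w i (y i) ^ P.ordR i (n i)) (Finset.mem_univ j)]
      have : ∀ i ∈ Finset.univ.erase j, P.w i (x i) ^ P.ordL i (n i) * G j n i (x i) (y i) *
          P.w i (y i) ^ P.ordR i (n i) = P.w i (x i) ^ P.ordL i (n i) *
          P.scaledComp i (n i) (x i) (y i) * P.w i (y i) ^ P.ordR i (n i) := by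
        intro i hi
        simp only [G, if_neg (Finset.ne_of_mem_erase hi)]
      rw [Finset.prod_congr rfl this]
      simp only [G, if_true]
      ring
    simp only [this]
    have h5 : ∀ f : (Fin d → Fin K) → ℝ, ∑ n, P.coef n * (P.w j (x j) ^ t * f n *
        P.w j (y j) ^ (-t)) = P.w j (x j) ^ t * (∑ n, P.coef n * f n) * P.w j (y j) ^ (-t) := by
      intro f
      rw [Finset.mul_sum, Finset.sum_mul]
      exact Finset.sum_congr rfl fun n _ => by ring
    rw [h5]
    ring
  have h4 : ∀ x, ∑ y ∈ X, P.kernelOf (G j) S S' x y * (P.w j (y j) ^ t * v y) =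
      P.w j (x j) ^ t * (S x * ∑ y ∈ X, P.A x y * (S' y * v y)) := by
    intro x
    rw [Finset.mul_sum, Finset.mul_sum]
    refine Finset.sum_congr rfl fun y _ => ?_
    have h6 : P.w j (y j) ^ (-t) * P.w j (y j) ^ t = 1 := by
      rw [← Real.rpow_add (hP.w_pos _ _)]; simp
    rw [h3]
    linear_combination (P.w j (x j) ^ t * (S x * P.A x y * S' y) * v y) * h6
  simp only [h4] at h2
  refine h2.trans ?_
  rw [mul_pow C]
  exact mul_le_mul_of_nonneg_left (hv j X) (sq_nonneg _)

/-- The scaling is at most a multiple of w_j⁻¹ for every single j, so w_j^t S g is dominated by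
w_j^{-1+t} g. Grouping by the j-th coordinate then yields the weighted contraction. -/
lemma WBound.of_weightedContr (hP : P.Standing) {t : ℝ} {g : (Fin d → J) → ℝ} {c : ℝ}
    (hc : 0 ≤ c) (hg : ∀ j, P.weightedContr (-1 + t) j g ≤ ENNReal.ofReal c)
    {S : (Fin d → J) → ℝ} (hS : ∀ x, |S x| ≤ P.sConst / √(P.weight x)) :
    P.WBound t (P.sConst * c) fun x => S x * g x := by
  classical
  intro j X
  have hs := (sConst_pos hP).le
  have h1 : ∀ x, (P.w j (x j) ^ t * (S x * g x)) ^ 2 ≤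
      P.sConst ^ 2 * (P.w j (x j) ^ (-1 + t) * g x) ^ 2 := by
    intro x
    have hw := hP.w_pos j (x j)
    have h2 : |S x| ≤ P.sConst * P.w j (x j) ^ (-1 : ℝ) := by
      refine (hS x).trans ?_
      rw [Real.rpow_neg_one, div_eq_mul_inv]
      gcongr
      exact Standing.w_le_sqrt_weight j x
    have h3 : S x ^ 2 ≤ (P.sConst * P.w j (x j) ^ (-1 : ℝ)) ^ 2 := by
      rw [← sq_abs]; gcongr
    rw [Real.rpow_add hw]
    calc _ = S x ^ 2 * (P.w j (x j) ^ t * g x) ^ 2 := by ring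
      _ ≤ (P.sConst * P.w j (x j) ^ (-1 : ℝ)) ^ 2 * (P.w j (x j) ^ t * g x) ^ 2 := by gcongr
      _ = _ := by ring
  refine (Finset.sum_le_sum fun x _ => h1 x).trans ?_
  rw [← Finset.mul_sum, mul_pow]
  refine mul_le_mul_of_nonneg_left ?_ (sq_nonneg _)
  have h2 := hg j
  rw [weightedContr] at h2
  have h3 := ENNReal.rpow_le_rpow h2 (show (0 : ℝ) ≤ 2 by norm_num)
  rw [← ENNReal.rpow_mul, ENNReal.ofReal_rpow_of_nonneg hc (by norm_num)] at h3
  norm_num at h3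
  have h4 : ∑ l ∈ X.image (fun x => x j), (ENNReal.ofReal (P.w j l ^ (-1 + t)) * econtr j g l) ^ 2
      ≤ ENNReal.ofReal (c ^ 2) := by
    refine (ENNReal.sum_le_tsum _).trans (le_trans (le_of_eq ?_) h3)
    rfl
  rw [← ENNReal.ofReal_le_ofReal_iff (sq_nonneg _)]
  refine le_trans ?_ h4
  rw [ENNReal.ofReal_sum_of_nonneg fun x _ => sq_nonneg _,
    ← Finset.sum_fiberwise_of_maps_to (g := fun x => x j) (t := X.image fun x => x j)
      fun x hx => Finset.mem_image_of_mem _ hx]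
  refine Finset.sum_le_sum fun l _ => ?_
  have h5 : econtr j g l ^ 2 = ∑' μ, Set.indicator {μ : Fin d → J | μ j = l}
      (fun μ => ENNReal.ofReal (g μ ^ 2)) μ := by
    rw [econtr, ← ENNReal.rpow_natCast, ← ENNReal.rpow_mul]; norm_num
  rw [mul_pow, h5, ← ENNReal.ofReal_pow (Real.rpow_nonneg (hP.w_pos j l).le _)]
  refine le_trans ?_ (mul_le_mul_right (ENNReal.sum_le_tsum (X.filter fun x => x j = l)) _)
  rw [Finset.mul_sum]
  refine le_of_eq (Finset.sum_congr rfl fun x hx => ?_)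
  obtain rfl := (Finset.mem_filter.1 hx).2
  rw [Set.indicator_of_mem (by rfl), ← ENNReal.ofReal_mul (sq_nonneg _), mul_pow]

end Problem

end

section

/-! ### Contractions, restriction errors and approximation classes -/

section Contractions

variable {d : ℕ} {J : Type*}

lemma econtr_sq (j : Fin d) (v : (Fin d → J) → ℝ) (l : J) : econtr j v l ^ 2 =
    ∑' μ, Set.indicator {μ : Fin d → J | μ j = l} (fun μ => ENNReal.ofReal (v μ ^ 2)) μ := by
  rw [econtr, ← ENNReal.rpow_natCast, ← ENNReal.rpow_mul]; norm_num

lemma tsum_econtr_sq (j : Fin d) (v : (Fin d → J) → ℝ) (S : Set J) :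
    ∑' l, S.indicator (fun l => econtr j v l ^ 2) l =
      ∑' μ, Set.indicator {μ : Fin d → J | μ j ∈ S} (fun μ => ENNReal.ofReal (v μ ^ 2)) μ := by
  classical
  have h1 : ∀ l, S.indicator (fun l => econtr j v l ^ 2) l = ∑' μ : Fin d → J,
      if μ j = l then (if μ j ∈ S then ENNReal.ofReal (v μ ^ 2) else 0) else 0 := by
    intro l
    by_cases hl : l ∈ S
    · rw [Set.indicator_of_mem hl, econtr_sq]
      refine tsum_congr fun μ => ?_
      by_cases h : μ j = l
      · subst h; simp [hl]
      · simp [h]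
    · rw [Set.indicator_of_notMem hl]
      refine (ENNReal.tsum_eq_zero.2 fun μ => ?_).symm
      by_cases h : μ j = l
      · subst h; simp [hl]
      · simp [h]
  simp only [h1]
  rw [ENNReal.tsum_comm]
  refine tsum_congr fun μ => ?_
  rw [tsum_eq_single (μ j)]
  · simp [Set.indicator_apply]
  · intro l hl; rw [if_neg hl.symm]

lemma ofReal_norm_sq {ι : Type*} (v : L2 ι) :
    ENNReal.ofReal (‖v‖ ^ 2) = ∑' i, ENNReal.ofReal (v i ^ 2) := by
  have h := lp.hasSum_norm (p := 2) (by norm_num) v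
  have h1 : HasSum (fun i => v i ^ 2) (‖v‖ ^ 2) := by simpa using h
  rw [← h1.tsum_eq, ENNReal.ofReal_tsum_of_nonneg (fun i => sq_nonneg _) h1.summable]

lemma econtr_sq_le (j : Fin d) (v : L2 (Fin d → J)) (l : J) :
    econtr j v l ^ 2 ≤ ENNReal.ofReal (‖v‖ ^ 2) := by
  rw [econtr_sq, ofReal_norm_sq]
  exact ENNReal.tsum_le_tsum fun μ => Set.indicator_le_self _ _ μ

lemma econtr_ne_top (j : Fin d) (v : L2 (Fin d → J)) (l : J) : econtr j v l ≠ ⊤ := by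
  intro h
  have := econtr_sq_le j v l
  rw [h] at this
  simp at this

lemma ofReal_contr_sq (j : Fin d) (v : L2 (Fin d → J)) (l : J) :
    ENNReal.ofReal (contr j v l ^ 2) = econtr j v l ^ 2 := by
  rw [contr, ENNReal.ofReal_pow ENNReal.toReal_nonneg, ENNReal.ofReal_toReal (econtr_ne_top j v l)]

/-- The tails of the contractions control the error of restriction to a product set. -/
lemma norm_sub_restr_sq_le (v : L2 (Fin d → J)) (Λ : Fin d → Finset J) :
    ENNReal.ofReal (‖v - restr (Fintype.piFinset Λ) v‖ ^ 2) ≤ contrTail v Λ := by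
  classical
  rw [ofReal_norm_sq, contrTail]
  simp only [tsum_econtr_sq]
  rw [← Summable.tsum_finsetSum fun _ _ => ENNReal.summable]
  refine ENNReal.tsum_le_tsum fun μ => ?_
  by_cases hμ : μ ∈ Fintype.piFinset Λ
  · rw [lp.coeFn_sub, Pi.sub_apply, restr, ofFinset_of_mem _ hμ, sub_self]
    simp
  · rw [lp.coeFn_sub, Pi.sub_apply, restr, ofFinset_of_notMem _ hμ, sub_zero]
    rw [Fintype.mem_piFinset] at hμ
    push Not at hμ
    obtain ⟨j, hj⟩ := hμ
    refine le_trans (le_of_eq ?_) (Finset.single_le_sum (f := fun j => Set.indicator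
      {μ : Fin d → J | μ j ∈ ((Λ j : Set J)ᶜ)} (fun μ => ENNReal.ofReal (v μ ^ 2)) μ)
      (fun _ _ => zero_le) (Finset.mem_univ j))
    simp [hj]

lemma tail_le_norm_sub_sq (j : Fin d) (v z : L2 (Fin d → J)) {Λ : Finset J}
    (hz : ∀ x : Fin d → J, x j ∉ Λ → z x = 0) :
    ∑' l, Set.indicator ((Λ : Set J)ᶜ) (fun l => econtr j v l ^ 2) l ≤
      ENNReal.ofReal (‖v - z‖ ^ 2) := by
  rw [tsum_econtr_sq, ofReal_norm_sq]
  refine ENNReal.tsum_le_tsum fun μ => ?_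
  by_cases h : μ j ∈ Λ
  · simp [h]
  · rw [lp.coeFn_sub, Pi.sub_apply, hz μ h, sub_zero]
    simp [h]

lemma norm_sub_restr_le {ι : Type*} (X : Finset ι) (v : L2 ι) {z : L2 ι}
    (hz : ∀ x ∉ X, z x = 0) : ‖v - restr X v‖ ≤ ‖v - z‖ := by
  refine (abs_le_of_sq_le_sq' ?_ (norm_nonneg _)).2
  rw [← ENNReal.ofReal_le_ofReal_iff (sq_nonneg _), ofReal_norm_sq, ofReal_norm_sq]
  refine ENNReal.tsum_le_tsum fun x => ?_
  by_cases hx : x ∈ X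
  · rw [lp.coeFn_sub, Pi.sub_apply, restr, ofFinset_of_mem _ hx, sub_self]; simp
  · rw [lp.coeFn_sub, Pi.sub_apply, restr, ofFinset_of_notMem _ hx, lp.coeFn_sub, Pi.sub_apply,
      hz x hx]

lemma norm_le_of_sum_sq_le {ι : Type*} {v : L2 ι} {c : ℝ} (hc : 0 ≤ c)
    (h : ∀ X : Finset ι, ∑ x ∈ X, v x ^ 2 ≤ c ^ 2) : ‖v‖ ≤ c :=
  lp.norm_le_of_forall_sum_le (p := 2) (by norm_num) hc fun X => by simpa using h X

/-- Extraction of index sets from the norm of an approximation class. -/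
lemma exists_finset_of_asNorm {s : ℝ} (hs : 0 < s) {j : Fin d} {v : L2 (Fin d → J)}
    (h : asNorm s (contr j v) ≠ ⊤) : ∃ A, 0 ≤ A ∧ ∀ ε, 0 < ε → ∃ Λ : Finset J,
      (Λ.card : ℝ) ≤ A * ε ^ (-1 / s) + 1 ∧
      ∑' l, Set.indicator ((Λ : Set J)ᶜ) (fun l => econtr j v l ^ 2) l ≤
        ENNReal.ofReal (ε ^ 2) := by
  set N := (asNorm s (contr j v)).toReal with hN
  refine ⟨N ^ (1 / s), by positivity, fun ε hε => ?_⟩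
  set n : ℝ≥0∞ := ⨅ (w : J → ℝ) (_ : ell2 (fun l => contr j v l - w l) ≤ ENNReal.ofReal ε),
      (((Function.support w).encard : ℕ∞) : ℝ≥0∞) with hn
  have h1 : ENNReal.ofReal ε * n ^ s ≤ ENNReal.ofReal N := by
    rw [hN, ENNReal.ofReal_toReal h]
    exact le_iSup₂ (f := fun (ε : ℝ) (_ : 0 < ε) => ENNReal.ofReal ε *
      (⨅ (w : J → ℝ) (_ : ell2 (fun l => contr j v l - w l) ≤ ENNReal.ofReal ε),
      (((Function.support w).encard : ℕ∞) : ℝ≥0∞)) ^ s) ε hε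
  have h2 : n ≤ ENNReal.ofReal (N ^ (1 / s) * ε ^ (-1 / s)) := by
    have h3 : n ^ s ≤ ENNReal.ofReal (N / ε) := by
      rw [ENNReal.ofReal_div_of_pos hε]
      rw [ENNReal.le_div_iff_mul_le (Or.inl (by simpa using hε)) (Or.inl ENNReal.ofReal_ne_top),
        mul_comm]
      exact h1
    have h4 := ENNReal.rpow_le_rpow h3 (show 0 ≤ 1 / s by positivity)
    rw [← ENNReal.rpow_mul, mul_one_div_cancel hs.ne', ENNReal.rpow_one,
      ENNReal.ofReal_rpow_of_nonneg (by positivity) (by positivity)] at h4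
    refine h4.trans (ENNReal.ofReal_le_ofReal (le_of_eq ?_))
    rw [Real.div_rpow (by positivity) hε.le, neg_div, Real.rpow_neg hε.le, div_eq_mul_inv]
  -- The summand 1 provides strict inequality, from which an actual competitor in the infimum is
  -- obtained.
  have h3 : n < ENNReal.ofReal (N ^ (1 / s) * ε ^ (-1 / s) + 1) :=
    h2.trans_lt ((ENNReal.ofReal_lt_ofReal_iff (by positivity)).2 (lt_add_one _))
  rw [hn] at h3
  simp only [iInf_lt_iff] at h3
  obtain ⟨w, hw, hcard⟩ := h3
  have hfin : (Function.support w).Finite := by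
    rw [← Set.encard_lt_top_iff]
    by_contra htop
    rw [not_lt, top_le_iff] at htop
    rw [htop] at hcard
    simp at hcard
  refine ⟨hfin.toFinset, ?_, ?_⟩
  · rw [hfin.encard_eq_coe_toFinset_card] at hcard
    have h4 : ENNReal.ofReal (hfin.toFinset.card : ℝ) <
        ENNReal.ofReal (N ^ (1 / s) * ε ^ (-1 / s) + 1) := by
      rw [ENNReal.ofReal_natCast]; simpa using hcard
    exact ((ENNReal.ofReal_lt_ofReal_iff (by positivity)).1 h4).le
  · rw [ell2] at hw
    have h5 := ENNReal.rpow_le_rpow hw (show (0 : ℝ) ≤ 2 by norm_num)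
    rw [← ENNReal.rpow_mul, ENNReal.ofReal_rpow_of_nonneg hε.le (by norm_num)] at h5
    norm_num at h5
    refine le_trans (ENNReal.tsum_le_tsum fun l => ?_) h5
    by_cases hl : w l = 0
    · simp [hl, ofReal_contr_sq]
    · simp [hl]

/-- Only tolerances below ‖v‖ need attention, since the empty set serves for all larger ones. -/
lemma asNorm_ne_top_of_finset {s : ℝ} (hs : 0 < s) {j : Fin d} {v : L2 (Fin d → J)} {A : ℝ}
    (hA : 0 ≤ A) (h : ∀ ε, 0 < ε → ε < ‖v‖ → ∃ Λ : Finset J, (Λ.card : ℝ) ≤ A * ε ^ (-1 / s) ∧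
      ∑' l, Set.indicator ((Λ : Set J)ᶜ) (fun l => econtr j v l ^ 2) l ≤
        ENNReal.ofReal (ε ^ 2)) : asNorm s (contr j v) ≠ ⊤ := by
  classical
  have key : ∀ ε, 0 < ε → ∃ Λ : Finset J, (Λ.card : ℝ) ≤ A * ε ^ (-1 / s) ∧
      ∑' l, Set.indicator ((Λ : Set J)ᶜ) (fun l => econtr j v l ^ 2) l ≤
        ENNReal.ofReal (ε ^ 2) := by
    intro ε hε
    rcases lt_or_ge ε ‖v‖ with h' | h'
    · exact h ε hε h'
    · refine ⟨∅, by simp; positivity, ?_⟩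
      refine (tail_le_norm_sub_sq j v 0 fun _ _ => rfl).trans (ENNReal.ofReal_le_ofReal ?_)
      rw [sub_zero]
      gcongr
  refine ne_top_of_le_ne_top (ENNReal.ofReal_ne_top (r := A ^ s)) (iSup₂_le fun ε hε => ?_)
  obtain ⟨Λ, hcard, htail⟩ := key ε hε
  have h1 : (⨅ (w : J → ℝ) (_ : ell2 (fun l => contr j v l - w l) ≤ ENNReal.ofReal ε),
      (((Function.support w).encard : ℕ∞) : ℝ≥0∞)) ≤ Λ.card := by
    refine iInf₂_le_of_le ((Λ : Set J).indicator (contr j v)) ?_ ?_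
    · rw [ell2]
      have h2 : ∑' l, ENNReal.ofReal ((contr j v l - (Λ : Set J).indicator (contr j v) l) ^ 2) =
          ∑' l, Set.indicator ((Λ : Set J)ᶜ) (fun l => econtr j v l ^ 2) l := by
        refine tsum_congr fun l => ?_
        by_cases hl : l ∈ Λ
        · simp [hl]
        · simp [hl, ofReal_contr_sq]
      rw [h2]
      refine (ENNReal.rpow_le_rpow htail (by norm_num)).trans (le_of_eq ?_)
      rw [ENNReal.ofReal_rpow_of_nonneg (sq_nonneg _) (by norm_num), ← Real.sqrt_eq_rpow,
        Real.sqrt_sq hε.le]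
    · have h3 : (Function.support ((Λ : Set J).indicator (contr j v))).encard ≤ Λ.card := by
        refine (Set.encard_le_encard Set.support_indicator_subset).trans ?_
        rw [Set.encard_coe_eq_coe_finsetCard]
      calc _ ≤ (((Λ.card : ℕ∞)) : ℝ≥0∞) := by exact_mod_cast h3
        _ = _ := by simp
  calc _ ≤ ENNReal.ofReal ε * (Λ.card : ℝ≥0∞) ^ s := by gcongr
    _ ≤ ENNReal.ofReal ε * ENNReal.ofReal (A * ε ^ (-1 / s)) ^ s := by
        gcongr
        rw [← ENNReal.ofReal_natCast]
        exact ENNReal.ofReal_le_ofReal hcard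
    _ = _ := by
        rw [ENNReal.ofReal_rpow_of_nonneg (by positivity) hs.le, ← ENNReal.ofReal_mul hε.le,
          Real.mul_rpow hA (by positivity), ← Real.rpow_mul hε.le, div_mul_cancel₀ _ hs.ne',
          Real.rpow_neg_one]
        congr 1
        field_simp

end Contractions

/-! ### The scaled operator: symmetry and compression -/

section Operator

variable {d K : ℕ} {J : Type*} {P : Problem d K J} {B : L2 (Fin d → J) →L[ℝ] L2 (Fin d → J)}

open Classical in
lemma ofFinset_eq_sum {ι : Type*} (X : Finset ι) (g : ι → ℝ) :
    ofFinset X g = ∑ i ∈ X, g i • unitVec i := by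
  refine Finset.sum_congr rfl fun i _ => ?_
  rw [unitVec, ← lp.single_smul]
  simp

lemma inner_unitVec {ι : Type*} (i : ι) (v : L2 ι) : inner ℝ (unitVec i) v = v i := by
  classical
  rw [unitVec, lp.inner_single_left]
  simp

lemma hasSum_unitVec {ι : Type*} (v : L2 ι) : HasSum (fun i => v i • unitVec i) v := by
  classical
  have h := lp.hasSum_single (p := 2) (by norm_num) v
  have h1 : (fun i => v i • unitVec i) = fun i => lp.single 2 i (v i) := by
    funext i
    rw [unitVec, ← lp.single_smul, smul_eq_mul, mul_one]
  rwa [h1]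

lemma Problem.IsScaledOp.apply_eq_sum (hA : P.IsScaledOp B) {X : Finset (Fin d → J)}
    {v : L2 (Fin d → J)} (hv : ∀ x ∉ X, v x = 0) (x : Fin d → J) :
    B v x = P.sInv x * ∑ y ∈ X, P.A x y * (P.sInv y * v y) := by
  rw [eq_ofFinset hv, ofFinset_eq_sum, map_sum, lp.coeFn_sum, Finset.sum_apply, Finset.mul_sum]
  refine Finset.sum_congr rfl fun y hy => ?_
  rw [map_smul, lp.coeFn_smul, Pi.smul_apply, hA, ← ofFinset_eq_sum, ofFinset_of_mem _ hy,
    smul_eq_mul]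
  ring

/-- Only matrix entries are known to be symmetric. Continuous functionals that agree on unit vectors
are equal, and this is applied in each argument in turn. -/
lemma Problem.IsScaledOp.symm (hP : P.Standing) (hA : P.IsScaledOp B) (x y : L2 (Fin d → J)) :
    inner ℝ (B x) y = inner ℝ x (B y) := by
  have hext : ∀ f g : L2 (Fin d → J) →L[ℝ] ℝ, (∀ i, f (unitVec i) = g (unitVec i)) → f = g := by
    intro f g h
    ext v
    have h1 := (hasSum_unitVec v).mapL f
    have h2 := (hasSum_unitVec v).mapL g
    simp only [map_smul, h] at h1 h2
    exact h1.unique h2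
  have h1 : ∀ i y, inner ℝ (B (unitVec i)) y = inner ℝ (unitVec i) (B y) := by
    intro i y
    have := hext (innerSL ℝ (B (unitVec i))) ((innerSL ℝ (unitVec i)).comp B) fun k => by
      rw [ContinuousLinearMap.comp_apply, innerSL_apply_apply, innerSL_apply_apply, inner_unitVec,
        real_inner_comm, inner_unitVec, hA, hA, hP.symm]
      ring
    simpa using congrArg (fun f => f y) this
  have := hext ((innerSL ℝ y).comp B) (innerSL ℝ (B y)) fun k => by
    rw [ContinuousLinearMap.comp_apply, innerSL_apply_apply, innerSL_apply_apply,
      real_inner_comm, h1, real_inner_comm]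
  have h2 := congrArg (fun f => f x) this
  simp only [ContinuousLinearMap.comp_apply, innerSL_apply_apply] at h2
  rw [real_inner_comm, h2, real_inner_comm]

lemma Problem.IsScaledOp.spdBounds (hP : P.Standing) (hA : P.IsScaledOp B) {a b : ℝ} (ha : 0 < a)
    (hmin : ∀ v, a * ‖v‖ ^ 2 ≤ inner ℝ v (B v)) (hmax : ‖B‖ ≤ b) : SpdBounds B a b where
  symm := hA.symm hP
  pos := ha
  lower := hmin
  upper v := by
    refine (real_inner_le_norm _ _).trans ?_
    have := (B.le_opNorm v).trans (mul_le_mul_of_nonneg_right hmax (norm_nonneg v))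
    nlinarith [norm_nonneg v]

/-- Telescoping bound for differences of tensor products. -/
lemma MatBound.tensor_sub {X Y : Fin d → J → J → ℝ} {β : Fin d → ℝ} {q : ℝ} (hβ : ∀ i, 0 ≤ β i)
    (hq : 0 ≤ q) (hX : ∀ i, MatBound (X i) (β i)) (hY : ∀ i, MatBound (Y i) (β i))
    (hXY : ∀ i, MatBound (fun l m => X i l m - Y i l m) (β i * q)) :
    MatBound (fun x y : Fin d → J => ∏ i, X i (x i) (y i) - ∏ i, Y i (x i) (y i))
      (d * (q * ∏ i, β i)) := by
  classical
  -- The i-th telescoping term has Y before i, the difference at i, and X after i.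
  let Z : Fin d → Fin d → J → J → ℝ := fun i k l m =>
    if k = i then X k l m - Y k l m else if k < i then Y k l m else X k l m
  have hZ : ∀ i k, MatBound (Z i k) (β k * if k = i then q else 1) := by
    intro i k
    by_cases h1 : k = i
    · simp only [Z, if_pos h1]; exact hXY k
    · by_cases h2 : k < i
      · simp only [Z, if_neg h1, if_pos h2, mul_one]; exact hY k
      · simp only [Z, if_neg h1, if_neg h2, mul_one]; exact hX k
  have h1 : ∀ x y : Fin d → J, ∏ i, X i (x i) (y i) - ∏ i, Y i (x i) (y i) =
      ∑ i, ∏ k, Z i k (x k) (y k) := by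
    intro x y
    have h2 := Finset.prod_sub_ordered Finset.univ (fun i => X i (x i) (y i))
      fun i => X i (x i) (y i) - Y i (x i) (y i)
    simp only [sub_sub_cancel] at h2
    rw [h2, sub_sub_cancel]
    refine Finset.sum_congr rfl fun i _ => ?_
    rw [← Finset.mul_prod_erase _ _ (Finset.mem_univ i), mul_assoc]
    have h3 : Finset.univ.erase i = (Finset.univ.filter (· < i)) ∪
        (Finset.univ.filter (i < ·)) := by
      ext k; simp
    rw [h3, Finset.prod_union (Finset.disjoint_filter.2 fun k _ h => h.not_gt)]
    simp only [Z, if_true]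
    congr 2
    · exact Finset.prod_congr rfl fun k hk => by
        have := (Finset.mem_filter.1 hk).2
        rw [if_neg this.ne, if_pos this]
    · exact Finset.prod_congr rfl fun k hk => by
        have := (Finset.mem_filter.1 hk).2
        rw [if_neg this.ne', if_neg this.not_gt]
  have h2 := MatBound.sum Finset.univ fun i _ => MatBound.tensor (hZ i) fun k => by
    have := hβ k
    split_ifs <;> positivity
  simp only [h1]
  refine h2.mono (le_of_eq ?_)
  have h3 : ∀ i, ∏ k, (β k * if k = i then q else 1) = q * ∏ k, β k := fun i => by
    rw [Finset.prod_mul_distrib, Finset.prod_ite_eq' Finset.univ i fun _ => q,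
      if_pos (Finset.mem_univ i), mul_comm]
  simp only [h3]
  simp

/-- Compression: images of vectors supported in product sets are supported in slightly larger
product sets up to a small error. -/
lemma Problem.IsScaledOp.exists_compression (hP : P.Standing) (hd : 2 ≤ d) (hA : P.IsScaledOp B)
    {s sStar : ℝ} (hs : 0 < s) (hsS : s < sStar)
    (hcomp : ∀ i ν, IsCompressible sStar (P.scaledComp i ν)) :
    ∃ (a : ℕ → ℝ) (C : ℝ), Summable a ∧ (∀ p, 0 ≤ a p) ∧ 0 ≤ C ∧
      ∀ (p : ℕ) (Λ : Fin d → Finset J) (v : L2 (Fin d → J)),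
        (∀ x ∉ Fintype.piFinset Λ, v x = 0) → ∃ Λ' : Fin d → Finset J, (∀ j, Λ j ⊆ Λ' j) ∧
          (∀ j, ((Λ' j).card : ℝ) ≤ (1 + a p * 2 ^ p) * (Λ j).card) ∧
          ‖B v - restr (Fintype.piFinset Λ') (B v)‖ ≤ C * (2 : ℝ) ^ (-s * p) * ‖v‖ := by
  classical
  choose c hc using fun i ν => (hcomp i ν).1
  choose a b Y ha hb hab hY using fun i ν => (hcomp i ν).2 s hs hsS
  -- A common bound for a component and all its compressions, so that the constant does not depend
  -- on the level p.
  let β : Fin d → Fin K → ℝ := fun i ν => |c i ν| + ∑' p, b i ν p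
  have hb0 : ∀ i ν, 0 ≤ ∑' p, b i ν p := fun i ν => tsum_nonneg fun p => (hab i ν p).2
  have hβ : ∀ i ν, 0 ≤ β i ν := fun i ν => add_nonneg (abs_nonneg _) (hb0 i ν)
  have hq0 : ∀ p : ℕ, (0 : ℝ) ≤ 2 ^ (-s * p) := fun p => by positivity
  have hq1 : ∀ p : ℕ, (2 : ℝ) ^ (-s * p) ≤ 1 := fun p =>
    Real.rpow_le_one_of_one_le_of_nonpos (by norm_num)
      (mul_nonpos_of_nonpos_of_nonneg (neg_nonpos.2 hs.le) (Nat.cast_nonneg p))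
  have hbp : ∀ i ν p, b i ν p ≤ ∑' p, b i ν p := fun i ν p =>
    (hb i ν).le_tsum p fun k _ => (hab i ν k).2
  have hX : ∀ i ν, MatBound (P.scaledComp i ν) (β i ν) := fun i ν => (hc i ν).mono
    ((le_abs_self _).trans (le_add_of_nonneg_right (hb0 i ν)))
  have hXY : ∀ i ν p, MatBound (fun l m => P.scaledComp i ν l m - Y i ν p l m)
      (β i ν * 2 ^ (-s * p : ℝ)) := fun i ν p => (hY i ν p).2.2.mono
    (mul_le_mul_of_nonneg_right ((hbp i ν p).trans (le_add_of_nonneg_left (abs_nonneg _))) (hq0 p))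
  have hY' : ∀ i ν p, MatBound (Y i ν p) (β i ν) := fun i ν p => by
    have h1 := (hc i ν).add ((hY i ν p).2.2.smul (-1))
    have h2 : (fun l m => P.scaledComp i ν l m + -1 * (P.scaledComp i ν l m - Y i ν p l m)) =
        Y i ν p := by funext l m; ring
    rw [h2] at h1
    refine h1.mono (add_le_add (le_abs_self _) ?_)
    rw [abs_neg, abs_one, one_mul]
    exact (mul_le_of_le_one_right (hab i ν p).2 (hq1 p)).trans (hbp i ν p)
  refine ⟨fun p => ∑ i, ∑ ν, a i ν p, P.sConst * P.sConst * ∑ n, |P.coef n| *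
    (d * ∏ i, β i (n i)), summable_sum fun i _ => summable_sum fun ν _ => ha i ν,
    fun p => Finset.sum_nonneg fun i _ => Finset.sum_nonneg fun ν _ => (hab i ν p).1, ?_, ?_⟩
  · have := (sConst_pos hP).le
    exact mul_nonneg (by positivity) (Finset.sum_nonneg fun n _ => mul_nonneg (abs_nonneg _)
      (mul_nonneg (by positivity) (Finset.prod_nonneg fun i _ => hβ _ _)))
  intro p Λ v hv
  -- In every direction all rows are added that some compressed component reaches from Λ. The
  -- compressed operator then maps into the enlarged box, and the error outside is that of
  -- compression.
  let Λ' : Fin d → Finset J := fun i => Λ i ∪ Finset.univ.biUnion fun ν =>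
    (Λ i).biUnion fun m => ((hY i ν p).2.1 m).1.toFinset
  refine ⟨Λ', fun j => Finset.subset_union_left, fun j => ?_, ?_⟩
  · have h1 : ((Λ' j).card : ℝ) ≤ (Λ j).card + ∑ ν, ∑ m ∈ Λ j, a j ν p * 2 ^ p := by
      have h2 : (Λ' j).card ≤ (Λ j).card +
          ∑ ν, ∑ m ∈ Λ j, (((hY j ν p).2.1 m).1.toFinset).card :=
        (Finset.card_union_le _ _).trans (Nat.add_le_add_left (Finset.card_biUnion_le.trans
          (Finset.sum_le_sum fun ν _ => Finset.card_biUnion_le)) _)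
      refine (Nat.cast_le.2 h2).trans ?_
      push_cast
      gcongr with ν _ m _
      have := ((hY j ν p).2.1 m).2
      rwa [Set.ncard_eq_toFinset_card _ ((hY j ν p).2.1 m).1] at this
    refine h1.trans ?_
    have h3 : ∑ ν, a j ν p ≤ ∑ i, ∑ ν, a i ν p :=
      Finset.single_le_sum (f := fun i => ∑ ν, a i ν p)
        (fun i _ => Finset.sum_nonneg fun ν _ => (hab i ν p).1) (Finset.mem_univ j)
    simp only [Finset.sum_const, nsmul_eq_mul, ← Finset.mul_sum, ← Finset.sum_mul]
    have h4 : (0 : ℝ) ≤ (Λ j).card * 2 ^ p := by positivity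
    nlinarith [mul_le_mul_of_nonneg_left h3 h4]
  · have hS : ∀ x, |P.sInv x| ≤ P.sConst / √(P.weight x) := fun x => by
      rw [abs_of_nonneg (sInv_nonneg hP x)]
      exact sInv_le_const hP (zero_lt_one.trans_le (hP.one_le_weight hd x))
    have hH := matBound_scaled (K := K) hP hd
      (H := fun n x y => ∏ i, P.scaledComp i (n i) (x i) (y i) - ∏ i, Y i (n i) p (x i) (y i))
      (c := fun n => d * (2 ^ (-s * p : ℝ) * ∏ i, β i (n i)))
      (fun n => mul_nonneg (by positivity) (mul_nonneg (hq0 p)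
        (Finset.prod_nonneg fun i _ => hβ _ _)))
      (fun n => MatBound.tensor_sub (fun i => hβ _ _) (hq0 p) (fun i => hX _ _)
        (fun i => hY' _ _ p) fun i => hXY _ _ p) (sConst_pos hP).le hS hS
    simp only [← kernelOf_sub] at hH
    have hC : P.sConst * P.sConst * ∑ n, |P.coef n| * (d * (2 ^ (-s * p : ℝ) * ∏ i, β i (n i))) =
        P.sConst * P.sConst * (∑ n, |P.coef n| * (d * ∏ i, β i (n i))) * 2 ^ (-s * p : ℝ) := by
      rw [mul_assoc _ (∑ n, _), Finset.sum_mul]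
      congr 1
      exact Finset.sum_congr rfl fun n _ => by ring
    rw [hC] at hH
    have hn : 0 ≤ P.sConst * P.sConst * (∑ n, |P.coef n| * (d * ∏ i, β i (n i))) *
        2 ^ (-s * p : ℝ) := by
      have := (sConst_pos hP).le
      exact mul_nonneg (mul_nonneg (by positivity) (Finset.sum_nonneg fun n _ =>
        mul_nonneg (abs_nonneg _) (mul_nonneg (by positivity)
          (Finset.prod_nonneg fun i _ => hβ _ _)))) (hq0 p)
    refine norm_le_of_sum_sq_le (mul_nonneg hn (norm_nonneg v)) fun Z => ?_
    have h1 := hH.sum_sq_le' (Fintype.piFinset Λ) Z v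
    rw [mul_pow]
    refine le_trans (Finset.sum_le_sum fun x _ => ?_) (h1.trans
      (mul_le_mul_of_nonneg_left (sum_sq_le_norm_sq _ v) (sq_nonneg _)))
    by_cases hx : x ∈ Fintype.piFinset Λ'
    · rw [lp.coeFn_sub, Pi.sub_apply, restr, ofFinset_of_mem _ hx, sub_self,
        zero_pow two_ne_zero]
      exact sq_nonneg _
    · rw [lp.coeFn_sub, Pi.sub_apply, restr, ofFinset_of_notMem _ hx, sub_zero,
        hA.apply_eq_sum hv]
      refine le_of_eq (congrArg (· ^ 2) ?_)
      rw [Finset.mul_sum]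
      refine Finset.sum_congr rfl fun y hy => ?_
      have h2 : P.kernelOf (fun n i => Y i (n i) p) P.sInv P.sInv x y = 0 := by
        rw [Fintype.mem_piFinset] at hx
        push Not at hx
        obtain ⟨i, hi⟩ := hx
        rw [kernelOf, Finset.sum_eq_zero, mul_zero, zero_mul]
        intro n _
        rw [Finset.prod_eq_zero (Finset.mem_univ i), mul_zero]
        have : Y i (n i) p (x i) (y i) = 0 := by
          by_contra h
          refine hi (Finset.mem_union_right _ (Finset.mem_biUnion.2 ⟨n i, Finset.mem_univ _,
            Finset.mem_biUnion.2 ⟨y i, Fintype.mem_piFinset.1 hy i, ?_⟩⟩))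
          simpa using h
        rw [this]; ring
      rw [h2, sub_zero, kernelOf_scaledComp hP]
      ring

end Operator

end

/-! ### Sparse approximability of images under the operator -/

section

variable {d K : ℕ} {J : Type*} {P : Problem d K J} {B : L2 (Fin d → J) →L[ℝ] L2 (Fin d → J)}

lemma restr_of_notMem {ι : Type*} {X : Finset ι} (v : L2 ι) {x : ι} (hx : x ∉ X) :
    restr X v x = 0 := ofFinset_of_notMem _ hx

lemma exists_two_pow_near (X : ℝ) : ∃ n : ℕ, X ≤ 2 ^ n ∧ (2 : ℝ) ^ n ≤ 2 * max X 0 + 1 := by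
  rcases le_or_gt X 1 with h | h
  · exact ⟨0, by simpa using h, by simp⟩
  · obtain ⟨n, h1, h2⟩ := exists_nat_pow_near h.le (show (1 : ℝ) < 2 by norm_num)
    refine ⟨n + 1, h2.le, ?_⟩
    rw [pow_succ, max_eq_left (by linarith)]
    linarith

lemma sum_range_sub_index (f : ℕ → ℝ) (Q : ℕ) :
    ∑ q ∈ Finset.range (Q + 1), f (Q - q) = ∑ q ∈ Finset.range (Q + 1), f q := by
  simpa using Finset.sum_range_reflect f (Q + 1)

/-- Restrictions of a vector with contractions in `𝒜_s` to small product sets. -/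
lemma exists_restr_of_asNorm {s : ℝ} (hs : 0 < s) {u : L2 (Fin d → J)}
    (h : ∀ j, asNorm s (contr j u) ≠ ⊤) : ∃ A, 0 ≤ A ∧ ∀ ε, 0 < ε → ∃ Λ : Fin d → Finset J,
      (∀ j, ((Λ j).card : ℝ) ≤ A * ε ^ (-1 / s) + 1) ∧
      contrTail u Λ ≤ ENNReal.ofReal (d * ε ^ 2) := by
  choose A hA hΛ using fun j => exists_finset_of_asNorm hs (h j)
  refine ⟨∑ j, A j, Finset.sum_nonneg fun j _ => hA j, fun ε hε => ?_⟩
  choose Λ h1 h2 using fun j => hΛ j ε hε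
  refine ⟨Λ, fun j => (h1 j).trans ?_, ?_⟩
  · gcongr
    exact Finset.single_le_sum (f := A) (fun i _ => hA i) (Finset.mem_univ j)
  · refine (Finset.sum_le_sum fun j _ => h2 j).trans ?_
    rw [Finset.sum_const, nsmul_eq_mul, Finset.card_univ, Fintype.card_fin,
      ENNReal.ofReal_mul (Nat.cast_nonneg d), ENNReal.ofReal_natCast]

lemma norm_sub_restr_le_of_tail {u : L2 (Fin d → J)} {Λ : Fin d → Finset J} {ε : ℝ} (hε : 0 ≤ ε)
    (h : contrTail u Λ ≤ ENNReal.ofReal (ε ^ 2)) :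
    ‖u - restr (Fintype.piFinset Λ) u‖ ≤ ε := by
  have h1 := (norm_sub_restr_sq_le u Λ).trans h
  rw [ENNReal.ofReal_le_ofReal_iff (sq_nonneg _)] at h1
  exact (abs_le_of_sq_le_sq' h1 hε).2

/-- Images under the scaled operator inherit sparse approximability. -/
lemma Problem.IsScaledOp.asNorm_ne_top (hP : P.Standing) (hd : 2 ≤ d) (hA : P.IsScaledOp B)
    {s sStar : ℝ} (hs : 0 < s) (hsS : s < sStar)
    (hcomp : ∀ i ν, IsCompressible sStar (P.scaledComp i ν)) {u : L2 (Fin d → J)}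
    (hu : ∀ j, asNorm s (contr j u) ≠ ⊤) (j : Fin d) : asNorm s (contr j (B u)) ≠ ⊤ := by
  classical
  obtain ⟨A, hA0, hu⟩ := exists_restr_of_asNorm hs hu
  -- Compression at a rate strictly above s leaves the ratio 2^{-(s'-s)} < 1, which makes the sum
  -- over levels geometric.
  set s' := (s + sStar) / 2 with hs'
  have hss' : s < s' := by rw [hs']; linarith
  obtain ⟨a, C, ha, ha0, hC, hcp⟩ := hA.exists_compression hP hd (hs.trans hss')
    (show s' < sStar by rw [hs']; linarith) hcomp
  -- level `q` approximations of `u`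
  let e : ℕ → ℝ := fun q => (2 : ℝ) ^ (-s * q)
  have he0 : ∀ q, 0 < e q := fun q => by positivity
  choose Λ hΛ htail using fun q => hu (e q) (he0 q)
  have heq : ∀ q, e q ^ (-1 / s) = 2 ^ q := fun q => by
    rw [← Real.rpow_mul (by norm_num), ← Real.rpow_natCast]
    congr 1; field_simp
  have hcard : ∀ q j, ((Λ q j).card : ℝ) ≤ (A + 1) * 2 ^ q := fun q j => by
    have := hΛ q j
    rw [heq] at this
    have h1 : (1 : ℝ) ≤ 2 ^ q := one_le_pow₀ (by norm_num)
    linarith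
  have herr : ∀ q, ‖u - restr (Fintype.piFinset (Λ q)) u‖ ≤ √d * e q := fun q => by
    refine norm_sub_restr_le_of_tail (by have := he0 q; positivity) ?_
    rw [mul_pow, Real.sq_sqrt (Nat.cast_nonneg d)]
    exact htail q
  let y : ℕ → L2 (Fin d → J) := fun q => restr (Fintype.piFinset (Λ q)) u
  let w : ℕ → L2 (Fin d → J) := fun q => if q = 0 then y 0 else y q - y (q - 1)
  let Γ : ℕ → Fin d → Finset J := fun q j => Λ q j ∪ Λ (q - 1) j
  have hwΓ : ∀ q, ∀ x ∉ Fintype.piFinset (Γ q), w q x = 0 := by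
    intro q x hx
    have h1 : ∀ q', (∀ j, Λ q' j ⊆ Γ q j) → y q' x = 0 := fun q' hq' =>
      restr_of_notMem _ fun hx' => hx (Fintype.mem_piFinset.2 fun i =>
        hq' i (Fintype.mem_piFinset.1 hx' i))
    by_cases hq : q = 0
    · simp only [w, if_pos hq]
      exact h1 0 (by subst hq; exact fun j => Finset.subset_union_left)
    · simp only [w, if_neg hq]
      rw [lp.coeFn_sub, Pi.sub_apply, h1 q fun j => Finset.subset_union_left,
        h1 (q - 1) fun j => Finset.subset_union_right, sub_zero]
  have hΓcard : ∀ q j, ((Γ q j).card : ℝ) ≤ 2 * (A + 1) * 2 ^ q := by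
    intro q j
    have h1 : ((Γ q j).card : ℝ) ≤ (Λ q j).card + (Λ (q - 1) j).card := by
      exact_mod_cast Finset.card_union_le _ _
    have h2 : (2 : ℝ) ^ (q - 1) ≤ 2 ^ q := pow_le_pow_right₀ (by norm_num) (by omega)
    have h3 := hcard q j
    have h4 := hcard (q - 1) j
    nlinarith
  set D := ‖u‖ + √d * (1 + 2 ^ s) with hD
  have hDn : 0 ≤ D := by positivity
  have hw : ∀ q, ‖w q‖ ≤ D * e q := by
    intro q
    by_cases hq : q = 0
    · subst hq
      simp only [w, if_true]
      have h1 : ‖y 0‖ ≤ ‖u‖ + √d * e 0 := by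
        have : y 0 = u - (u - y 0) := by abel
        rw [this]
        exact (norm_sub_le _ _).trans (by gcongr; exact herr 0)
      have h2 : e 0 = 1 := by simp [e]
      rw [h2] at h1 ⊢
      have : 0 ≤ √d * 2 ^ s := by positivity
      rw [hD]; linarith
    · simp only [w, if_neg hq]
      have h1 : y q - y (q - 1) = (u - y (q - 1)) - (u - y q) := by abel
      rw [h1]
      have h2 : e (q - 1) = 2 ^ s * e q := by
        simp only [e]
        rw [← Real.rpow_add (by norm_num)]
        congr 1
        have : ((q - 1 : ℕ) : ℝ) = q - 1 := by
          rw [Nat.cast_sub (Nat.one_le_iff_ne_zero.2 hq)]; simp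
        rw [this]; ring
      have h3 := (norm_sub_le (u - y (q - 1)) (u - y q)).trans
        (add_le_add (herr (q - 1)) (herr q))
      rw [h2] at h3
      refine h3.trans ?_
      have := mul_nonneg (norm_nonneg u) (he0 q).le
      rw [hD]
      linarith
  have hysum : ∀ Q, y Q = ∑ q ∈ Finset.range (Q + 1), w q := by
    intro Q
    induction Q with
    | zero => simp [w]
    | succ Q ih =>
      rw [Finset.sum_range_succ, ← ih]
      simp [w]
  set r := (2 : ℝ) ^ (-(s' - s)) with hr
  have hr0 : 0 < r := by positivity
  have hr1 : r < 1 := Real.rpow_lt_one_of_one_lt_of_neg (by norm_num) (by linarith)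
  set E := ‖B‖ * √d + C * D * (1 - r)⁻¹ + 1 with hE
  have hr1' : 0 < 1 - r := by linarith
  have hE0 : 0 < E := by positivity
  set A' := 2 * (A + 1) * (2 + ∑' p, a p) with hA'
  have hA'0 : 0 ≤ A' := by
    have : 0 ≤ ∑' p, a p := tsum_nonneg ha0
    positivity
  have hlevel : ∀ Q : ℕ, ∃ Λ' : Finset J, (Λ'.card : ℝ) ≤ A' * 2 ^ Q ∧
      ∑' l, Set.indicator ((Λ' : Set J)ᶜ) (fun l => econtr j (B u) l ^ 2) l ≤
        ENNReal.ofReal ((E * e Q) ^ 2) := by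
    intro Q
    -- The increment at level q has size 2^{-sq} and about 2^q indices per direction, and is
    -- compressed at level Q-q. Large increments are thus treated accurately and small ones roughly.
    -- The index counts sum to O(2^Q) because a is summable, and the errors sum to O(2^{-sQ}).
    choose Λ' hsub hc hz using fun q => hcp (Q - q) (Γ q) (w q) (hwΓ q)
    let z : L2 (Fin d → J) :=
      ∑ q ∈ Finset.range (Q + 1), restr (Fintype.piFinset (Λ' q)) (B (w q))
    refine ⟨(Finset.range (Q + 1)).biUnion fun q => Λ' q j, ?_, ?_⟩
    · calc (((Finset.range (Q + 1)).biUnion fun q => Λ' q j).card : ℝ)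
          ≤ ∑ q ∈ Finset.range (Q + 1), ((Λ' q j).card : ℝ) := by
            exact_mod_cast Finset.card_biUnion_le
        _ ≤ ∑ q ∈ Finset.range (Q + 1), 2 * (A + 1) * (2 ^ q + a (Q - q) * 2 ^ Q) := by
            refine Finset.sum_le_sum fun q hq => (hc q j).trans ?_
            have hqQ : q ≤ Q := Nat.lt_succ_iff.1 (Finset.mem_range.1 hq)
            have h1 : (2 : ℝ) ^ Q = 2 ^ (Q - q) * 2 ^ q := by
              rw [← pow_add, Nat.sub_add_cancel hqQ]
            have h2 : 0 ≤ 1 + a (Q - q) * 2 ^ (Q - q) := by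
              have := ha0 (Q - q); positivity
            refine (mul_le_mul_of_nonneg_left (hΓcard q j) h2).trans (le_of_eq ?_)
            rw [h1]; ring
        _ = 2 * (A + 1) * (∑ q ∈ Finset.range (Q + 1), (2 : ℝ) ^ q +
            (∑ q ∈ Finset.range (Q + 1), a (Q - q)) * 2 ^ Q) := by
            rw [← Finset.mul_sum, Finset.sum_add_distrib, Finset.sum_mul]
        _ ≤ A' * 2 ^ Q := by
            have h1 : ∑ q ∈ Finset.range (Q + 1), (2 : ℝ) ^ q ≤ 2 * 2 ^ Q := by
              rw [geom_sum_eq (by norm_num)]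
              norm_num
              rw [pow_succ]; linarith
            have h2 : ∑ q ∈ Finset.range (Q + 1), a (Q - q) ≤ ∑' p, a p := by
              rw [sum_range_sub_index a Q]
              exact ha.sum_le_tsum _ fun p _ => ha0 p
            rw [hA', mul_assoc (2 * (A + 1)), add_mul]
            gcongr
    · have hzs : ∀ x : Fin d → J, x j ∉ (Finset.range (Q + 1)).biUnion (fun q => Λ' q j) →
          z x = 0 := by
        intro x hx
        simp only [z]
        rw [lp.coeFn_sum, Finset.sum_apply]
        refine Finset.sum_eq_zero fun q hq => restr_of_notMem _ fun hx' => hx ?_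
        exact Finset.mem_biUnion.2 ⟨q, hq, Fintype.mem_piFinset.1 hx' j⟩
      refine (tail_le_norm_sub_sq j (B u) z hzs).trans (ENNReal.ofReal_le_ofReal ?_)
      refine pow_le_pow_left₀ (norm_nonneg _) ?_ 2
      have h1 : B u - z = B (u - y Q) + ∑ q ∈ Finset.range (Q + 1),
          (B (w q) - restr (Fintype.piFinset (Λ' q)) (B (w q))) := by
        rw [Finset.sum_sub_distrib, map_sub, hysum Q, map_sum]
        abel
      have h2 : ∀ q ∈ Finset.range (Q + 1),
          ‖B (w q) - restr (Fintype.piFinset (Λ' q)) (B (w q))‖ ≤ C * D * e Q * r ^ (Q - q) := by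
        intro q hq
        have hqQ : q ≤ Q := Nat.lt_succ_iff.1 (Finset.mem_range.1 hq)
        refine (hz q).trans ?_
        have h3 : (2 : ℝ) ^ (-s' * (Q - q : ℕ)) * e q = e Q * r ^ (Q - q) := by
          simp only [e, hr]
          rw [← Real.rpow_natCast, ← Real.rpow_mul (by norm_num), ← Real.rpow_add (by norm_num),
            ← Real.rpow_add (by norm_num), Nat.cast_sub hqQ]
          congr 1; ring
        calc C * (2 : ℝ) ^ (-s' * (Q - q : ℕ)) * ‖w q‖
            ≤ C * (2 : ℝ) ^ (-s' * (Q - q : ℕ)) * (D * e q) := by gcongr; exact hw q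
          _ = C * D * ((2 : ℝ) ^ (-s' * (Q - q : ℕ)) * e q) := by ring
          _ = _ := by rw [h3]; ring
      have h4 : ∑ q ∈ Finset.range (Q + 1), r ^ (Q - q) ≤ (1 - r)⁻¹ := by
        rw [sum_range_sub_index (fun p => r ^ p) Q, ← tsum_geometric_of_lt_one hr0.le hr1]
        exact (summable_geometric_of_lt_one hr0.le hr1).sum_le_tsum _ fun p _ => by positivity
      rw [h1]
      calc _ ≤ ‖B‖ * (√d * e Q) + ∑ q ∈ Finset.range (Q + 1), C * D * e Q * r ^ (Q - q) := by
            refine (norm_add_le _ _).trans (add_le_add ?_ ?_)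
            · exact (B.le_opNorm _).trans (by gcongr; exact herr Q)
            · exact (norm_sum_le _ _).trans (Finset.sum_le_sum h2)
        _ ≤ ‖B‖ * (√d * e Q) + C * D * e Q * (1 - r)⁻¹ := by
            rw [← Finset.mul_sum]
            have := (he0 Q).le
            gcongr
        _ ≤ E * e Q := by
            rw [hE]
            have := (he0 Q).le
            linarith
  refine asNorm_ne_top_of_finset hs (A := A' * (2 * E ^ (1 / s) + ‖B u‖ ^ (1 / s)))
    (by positivity) fun ε hε hεu => ?_
  obtain ⟨Q, hQ1, hQ2⟩ := exists_two_pow_near ((E / ε) ^ (1 / s))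
  obtain ⟨Λ', h1, h2⟩ := hlevel Q
  have hX : 0 < (E / ε) ^ (1 / s) := by positivity
  rw [max_eq_left hX.le] at hQ2
  have hεs : 0 < ε ^ (-1 / s) := by positivity
  refine ⟨Λ', h1.trans ?_, h2.trans (ENNReal.ofReal_le_ofReal ?_)⟩
  · rw [mul_assoc A']
    refine mul_le_mul_of_nonneg_left (hQ2.trans ?_) hA'0
    have h3 : (E / ε) ^ (1 / s) = E ^ (1 / s) * ε ^ (-1 / s) := by
      rw [Real.div_rpow hE0.le hε.le, neg_div, Real.rpow_neg hε.le, div_eq_mul_inv]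
    -- As ε stays below ‖B u‖, the additive constant from rounding to a power of two can be
    -- absorbed.
    have h4 : 1 ≤ ‖B u‖ ^ (1 / s) * ε ^ (-1 / s) := by
      rw [neg_div, Real.rpow_neg hε.le, ← div_eq_mul_inv, one_le_div (by positivity)]
      exact Real.rpow_le_rpow hε.le hεu.le (by positivity)
    rw [h3, add_mul]
    linarith
  · refine pow_le_pow_left₀ (mul_nonneg hE0.le (he0 Q).le) ?_ 2
    have h5 : e Q = ((2 : ℝ) ^ Q) ^ (-s) := by
      simp only [e]
      rw [← Real.rpow_natCast, ← Real.rpow_mul (by norm_num)]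
      congr 1; ring
    have h6 : e Q ≤ ((E / ε) ^ (1 / s)) ^ (-s) := by
      rw [h5]
      exact Real.rpow_le_rpow_of_nonpos hX hQ1 (by linarith)
    rw [← Real.rpow_mul (by positivity), show 1 / s * -s = -1 by field_simp, Real.rpow_neg_one,
      inv_div] at h6
    calc E * e Q ≤ E * (ε / E) := by gcongr
      _ = ε := by field_simp

end

section

variable {d K : ℕ} {J : Type*} {P : Problem d K J}

/-! ### Truncation of tensors supported in product sets -/

section Boxes

lemma exists_box [Nonempty J] (Λ : Fin d → Finset J) :
    ∃ F : Finset J, F.Nonempty ∧ Fintype.piFinset Λ ⊆ Bx d F := by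
  classical
  obtain ⟨l⟩ := ‹Nonempty J›
  refine ⟨insert l (Finset.univ.biUnion Λ), ⟨l, by simp⟩, fun x hx => ?_⟩
  rw [Fintype.mem_piFinset] at hx ⊢
  exact fun i => Finset.mem_insert_of_mem (Finset.mem_biUnion.2 ⟨i, Finset.mem_univ i, hx i⟩)

lemma econtr_eq_zero_of_support {Λ : Fin d → Finset J} {g : (Fin d → J) → ℝ}
    (hv : ∀ x ∉ Fintype.piFinset Λ, g x = 0) {j : Fin d} {l : J} (hl : l ∉ Λ j) :
    econtr j g l = 0 :=
  econtr_eq_zero_iff.2 fun x hx => hv x fun h => hl (hx ▸ Fintype.mem_piFinset.1 h j)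

variable [Nonempty J] {T : Finset (Finset (Fin d))} {v v' : L2 (Fin d → J)}
  {r : Finset (Fin d) → ℕ} {Λ : Fin d → Finset J}

lemma IsHOSVD.econtr_le' (hT : IsDimTree T) (hv : ∀ x ∉ Fintype.piFinset Λ, v x = 0)
    (h : IsHOSVD T v r v') (j : Fin d) (l : J) : econtr j v' l ≤ econtr j v l := by
  obtain ⟨F, hF, hsub⟩ := exists_box Λ
  exact h.econtr_le hT hF (fun x hx => hv x fun h => hx (hsub h)) j l

/-- Contractions do not grow under truncation, so those that vanish outside the one-dimensional sets
continue to vanish. -/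
lemma IsHOSVD.support (hT : IsDimTree T) (hv : ∀ x ∉ Fintype.piFinset Λ, v x = 0)
    (h : IsHOSVD T v r v') (x : Fin d → J) (hx : x ∉ Fintype.piFinset Λ) : v' x = 0 := by
  rw [Fintype.mem_piFinset] at hx
  push Not at hx
  obtain ⟨j, hj⟩ := hx
  have h1 := h.econtr_le' hT hv j (x j)
  rw [econtr_eq_zero_of_support hv hj, nonpos_iff_eq_zero, econtr_eq_zero_iff] at h1
  exact h1 x rfl

/-- The case of the weight w_j^{2t} in `nsq_foldProj_le`. Without it, truncation could destroy the
excess regularity of the iterates. -/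
lemma IsHOSVD.wBound (hT : IsDimTree T) (hv : ∀ x ∉ Fintype.piFinset Λ, v x = 0)
    (h : IsHOSVD T v r v') {t c : ℝ} (hw : P.WBound t c v) : P.WBound t c v' := by
  intro j X
  have hv'0 := h.support hT hv
  obtain ⟨F, hF, hsub⟩ := exists_box Λ
  have hv0 : ∀ x ∉ Bx d F, v x = 0 := fun x hx => hv x fun h => hx (hsub h)
  obtain ⟨nodes, R, U, hnd, hmem, hpw, hU, hv'⟩ := h
  have hl : ∀ α ∈ nodes, ∀ β ∈ nodes, α ⊆ β ∨ β ⊆ α ∨ Disjoint α β := fun α hα β hβ =>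
    hT.laminar α ((hmem α).1 hα).1 β ((hmem β).1 hβ).1
  rw [foldl_modeProj hv0 hU] at hv'
  have h1 := nsq_foldProj_le (r := r) hF hv0 hU hnd hpw hl j
    (φ := fun x => (P.w j (x j) ^ t) ^ 2) (fun x y hxy => by simp [hxy j rfl])
    (fun x => sq_nonneg _)
  have h2 : nsq F (fun x => (P.w j (x j) ^ t) ^ 2) v ≤ c ^ 2 := by
    refine le_trans (le_of_eq ?_) (hw j (Bx d F))
    exact Finset.sum_congr rfl fun x _ => (mul_pow _ _ _).symm
  refine le_trans ?_ (h1.trans h2)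
  calc ∑ x ∈ X, (P.w j (x j) ^ t * v' x) ^ 2
      ≤ ∑ x ∈ Bx d F, (P.w j (x j) ^ t * v' x) ^ 2 := by
        classical
        refine (Finset.sum_le_sum_of_subset_of_nonneg (Finset.subset_union_left (s₂ := Bx d F))
          fun _ _ _ => sq_nonneg _).trans (le_of_eq (Finset.sum_subset Finset.subset_union_right
            fun x _ hx => ?_).symm)
        rw [hv'0 x fun h => hx (hsub h)]; ring
    _ = _ := Finset.sum_congr rfl fun x _ => by rw [mul_pow, hv']

lemma IsHOSVD.htRank_le' (hT : IsDimTree T) (hd : 2 ≤ d)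
    (hv : ∀ x ∉ Fintype.piFinset Λ, v x = 0) (h : IsHOSVD T v r v') {N : ℕ}
    (hN : htRank T v ≤ N) : htRank T v' ≤ N := by
  obtain ⟨F, hF, hsub⟩ := exists_box Λ
  exact h.htRank_le hT hd hF (fun x hx => hv x fun h => hx (hsub h)) hN

end Boxes

/-! ### Coarsening and bulk chasing -/

section Coarsening

variable {v v' : L2 (Fin d → J)} {Λ Γ : Fin d → Finset J} {ε : ℝ}

lemma contrTail_eq_zero {g : (Fin d → J) → ℝ} (hv : ∀ x ∉ Fintype.piFinset Γ, g x = 0) :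
    contrTail g Γ = 0 := by
  rw [contrTail]
  refine Finset.sum_eq_zero fun j _ => ENNReal.tsum_eq_zero.2 fun l => ?_
  by_cases hl : l ∈ Γ j
  · simp [hl]
  · simp [econtr_eq_zero_of_support hv hl]

/-- A triangle inequality for tails in squared form. The factors (x+y)/y and (x+y)/x are those for
which the two contributions add up to (x+y)²; the factor d occurs because every direction sees the
whole perturbation. -/
lemma contrTail_le_of_close {x y : ℝ} (hx : 0 < x) (hy : 0 < y)
    (hv : contrTail v Λ ≤ ENNReal.ofReal (y ^ 2)) (hvv : d * ‖v - v'‖ ^ 2 ≤ x ^ 2) :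
    contrTail v' Λ ≤ ENNReal.ofReal ((x + y) ^ 2) := by
  have h1 : ∀ j, ∑' l, Set.indicator ((Λ j : Set J)ᶜ) (fun l => econtr j v' l ^ 2) l ≤
      ENNReal.ofReal ((x + y) / y) *
        ∑' l, Set.indicator ((Λ j : Set J)ᶜ) (fun l => econtr j v l ^ 2) l +
      ENNReal.ofReal ((x + y) / x) * ENNReal.ofReal (‖v - v'‖ ^ 2) := by
    intro j
    rw [tsum_econtr_sq, tsum_econtr_sq, ofReal_norm_sq, ← ENNReal.tsum_mul_left,
      ← ENNReal.tsum_mul_left, ← ENNReal.tsum_add]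
    refine ENNReal.tsum_le_tsum fun μ => ?_
    by_cases hμ : μ j ∈ Λ j
    · simp [hμ]
    · have hm : μ ∈ {μ : Fin d → J | μ j ∈ (Λ j : Set J)ᶜ} := by simpa using hμ
      rw [Set.indicator_of_mem hm, Set.indicator_of_mem hm]
      rw [← ENNReal.ofReal_mul (by positivity), ← ENNReal.ofReal_mul (by positivity),
        ← ENNReal.ofReal_add (by positivity) (by positivity)]
      refine ENNReal.ofReal_le_ofReal ?_
      rw [lp.coeFn_sub, Pi.sub_apply]
      set a := v μ
      set b := v' μ
      have h2 : (x + y) / y * a ^ 2 + (x + y) / x * (a - b) ^ 2 - b ^ 2 =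
          (x * a + y * (a - b)) ^ 2 / (x * y) := by
        field_simp; ring
      have h3 : 0 ≤ (x * a + y * (a - b)) ^ 2 / (x * y) := by positivity
      linarith
  calc contrTail v' Λ ≤ ∑ j, (ENNReal.ofReal ((x + y) / y) *
        ∑' l, Set.indicator ((Λ j : Set J)ᶜ) (fun l => econtr j v l ^ 2) l +
        ENNReal.ofReal ((x + y) / x) * ENNReal.ofReal (‖v - v'‖ ^ 2)) :=
        Finset.sum_le_sum fun j _ => h1 j
    _ = ENNReal.ofReal ((x + y) / y) * contrTail v Λ +
        ENNReal.ofReal ((x + y) / x) * ENNReal.ofReal (d * ‖v - v'‖ ^ 2) := by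
        rw [Finset.sum_add_distrib, ← Finset.mul_sum, Finset.sum_const, nsmul_eq_mul,
          Finset.card_univ, Fintype.card_fin, ENNReal.ofReal_mul (Nat.cast_nonneg d),
          ENNReal.ofReal_natCast]
        congr 1
        ring
    _ ≤ ENNReal.ofReal ((x + y) / y) * ENNReal.ofReal (y ^ 2) +
        ENNReal.ofReal ((x + y) / x) * ENNReal.ofReal (x ^ 2) := by
        gcongr
    _ = ENNReal.ofReal ((x + y) ^ 2) := by
        rw [← ENNReal.ofReal_mul (by positivity), ← ENNReal.ofReal_mul (by positivity),
          ← ENNReal.ofReal_add (by positivity) (by positivity)]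
        congr 1
        field_simp
        ring

lemma contrTail_mono {g g' : (Fin d → J) → ℝ} (h : ∀ j l, econtr j g l ≤ econtr j g' l) :
    contrTail g Λ ≤ contrTail g' Λ :=
  Finset.sum_le_sum fun j _ => ENNReal.tsum_le_tsum fun l =>
    Set.indicator_le_indicator (pow_le_pow_left' (h j l) 2)

lemma IsCoarse.norm_sub_le (hε : 0 ≤ ε) (h : IsCoarse v ε v') : ‖v - v'‖ ≤ ε := by
  obtain ⟨Λ, hΛ, rfl⟩ := h
  exact norm_sub_restr_le_of_tail hε hΛ.accurate

lemma IsCoarseSets.card_le_of_support (h : IsCoarseSets v ε Λ)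
    (hv : ∀ x ∉ Fintype.piFinset Γ, v x = 0) : ∑ j, (Λ j).card ≤ ∑ j, (Γ j).card :=
  h.minimal Γ (by rw [contrTail_eq_zero hv]; exact zero_le)

/-- The entries kept by coarsening are not too small. -/
lemma IsCoarseSets.sq_lt (h : IsCoarseSets v ε Λ) (hv : ∀ x ∉ Fintype.piFinset Γ, v x = 0)
    {j : Fin d} {l : J} (hl : l ∈ Λ j) :
    ENNReal.ofReal (ε ^ 2) < (∑ i, (Γ i).card + 1 : ℕ) * econtr j v l ^ 2 := by
  classical
  by_contra hle
  rw [not_lt] at hle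
  -- By minimality, giving up the index l must violate the tolerance. All discarded entries are at
  -- most the one at l since the largest are kept, and at most one per index of Γ is nonzero, plus l
  -- itself.
  let Λ' : Fin d → Finset J := Function.update Λ j ((Λ j).erase l)
  have hcard : ∑ i, (Λ' i).card < ∑ i, (Λ i).card := by
    refine Finset.sum_lt_sum (fun i _ => ?_) ⟨j, Finset.mem_univ j, ?_⟩
    · by_cases hi : i = j
      · subst hi; simp only [Λ', Function.update_self]; exact Finset.card_erase_le
      · simp only [Λ', Function.update_of_ne hi]; exact le_rfl
    · simp only [Λ', Function.update_self]; exact Finset.card_erase_lt_of_mem hl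
  refine absurd (h.minimal Λ' (le_trans ?_ hle)) (not_le.2 hcard)
  have h1 : ∀ i m, Set.indicator ((Λ' i : Set J)ᶜ) (fun m => econtr i v m ^ 2) m ≤
      (if m ∈ Γ i then econtr j v l ^ 2 else 0) +
        if i = j ∧ m = l then econtr j v l ^ 2 else 0 := by
    intro i m
    by_cases hm : m ∈ Λ' i
    · simp [hm]
    · rw [Set.indicator_of_mem (by simpa using hm)]
      by_cases hg : m ∈ Γ i
      · by_cases hΛ : m ∈ Λ i
        · have hij : i = j := by
            by_contra hne
            exact hm (by simp only [Λ', Function.update_of_ne hne]; exact hΛ)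
          subst hij
          have hml : m = l := by
            by_contra hne
            exact hm (by simp only [Λ', Function.update_self]; exact Finset.mem_erase.2 ⟨hne, hΛ⟩)
          subst hml
          simp only [and_self, if_true]
          exact le_add_of_nonneg_left zero_le
        · rw [if_pos hg]
          exact le_add_of_le_of_nonneg (pow_le_pow_left' (h.sorted j l hl i m hΛ) 2) zero_le
      · rw [econtr_eq_zero_of_support hv hg]
        simp
  calc contrTail v Λ' ≤ ∑ i, ∑' m, ((if m ∈ Γ i then econtr j v l ^ 2 else 0) +
        if i = j ∧ m = l then econtr j v l ^ 2 else 0) :=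
        Finset.sum_le_sum fun i _ => ENNReal.tsum_le_tsum fun m => h1 i m
    _ = ∑ i, (((Γ i).card : ℝ≥0∞) * econtr j v l ^ 2 +
          if i = j then econtr j v l ^ 2 else 0) := by
        refine Finset.sum_congr rfl fun i _ => ?_
        rw [ENNReal.tsum_add]
        congr 1
        · rw [tsum_eq_sum (s := Γ i) fun m hm => if_neg hm,
            Finset.sum_congr rfl fun m hm => if_pos hm, Finset.sum_const, nsmul_eq_mul]
        · by_cases hi : i = j
          · simp [hi]
          · simp [hi]
    _ = _ := by
        rw [Finset.sum_add_distrib, ← Finset.sum_mul]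
        simp [add_mul]

lemma Problem.WBound.mul_econtr_le {t c : ℝ}
    (hw : P.WBound t c v) {j : Fin d} {l : J} :
    ENNReal.ofReal ((P.w j l ^ t) ^ 2) * econtr j v l ^ 2 ≤ ENNReal.ofReal (c ^ 2) := by
  classical
  rw [econtr_sq, ← ENNReal.tsum_mul_left]
  rw [ENNReal.tsum_eq_iSup_sum]
  refine iSup_le fun X => ?_
  refine le_trans (Finset.sum_le_sum fun x _ => ?_) (le_trans (le_of_eq
    (ENNReal.ofReal_sum_of_nonneg fun x _ => sq_nonneg _).symm)
    (ENNReal.ofReal_le_ofReal (hw j X)))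
  by_cases hx : x j = l
  · rw [Set.indicator_of_mem (by simpa using hx), ← ENNReal.ofReal_mul (sq_nonneg _), hx, mul_pow]
  · rw [Set.indicator_of_notMem (by simpa using hx), mul_zero]
    exact zero_le

/-- Bound for the weights of the indices kept by coarsening. -/
lemma IsCoarseSets.weight_le (hP : P.Standing) (h : IsCoarseSets v ε Λ)
    (hv : ∀ x ∉ Fintype.piFinset Γ, v x = 0) {t c : ℝ} (hc : 0 ≤ c) (hw : P.WBound t c v)
    {j : Fin d} {l : J} (hl : l ∈ Λ j) :
    P.w j l ^ t * ε ≤ c * (∑ i, (Γ i).card + 1 : ℕ) := by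
  have hwt : 0 ≤ P.w j l ^ t := Real.rpow_nonneg (hP.w_pos j l).le _
  have h1 := (h.sq_lt hv hl).le
  have hn : 1 ≤ ∑ i, (Γ i).card + 1 := Nat.le_add_left 1 _
  generalize ∑ i, (Γ i).card + 1 = n at h1 hn ⊢
  have h2 := hw.mul_econtr_le (j := j) (l := l)
  have h3 : ENNReal.ofReal ((P.w j l ^ t * ε) ^ 2) ≤ ENNReal.ofReal (n * c ^ 2) := by
    rw [mul_pow, ENNReal.ofReal_mul (sq_nonneg _), ENNReal.ofReal_mul (Nat.cast_nonneg n),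
      ENNReal.ofReal_natCast]
    calc _ ≤ ENNReal.ofReal ((P.w j l ^ t) ^ 2) * (n * econtr j v l ^ 2) := by gcongr
      _ = n * (ENNReal.ofReal ((P.w j l ^ t) ^ 2) * econtr j v l ^ 2) := by ring
      _ ≤ _ := by gcongr
  rw [ENNReal.ofReal_le_ofReal_iff (by positivity)] at h3
  refine (abs_le_of_sq_le_sq' (h3.trans ?_) (by positivity)).2
  have hn1 : (1 : ℝ) ≤ n := by exact_mod_cast hn
  nlinarith [mul_nonneg (sq_nonneg c) (sub_nonneg.2 hn1)]

lemma norm_restr_sq {ι : Type*} (X : Finset ι) (v : L2 ι) :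
    ‖restr X v‖ ^ 2 = ∑ x ∈ X, v x ^ 2 := norm_ofFinset_sq X v

lemma norm_sub_restr_sq {ι : Type*} (X : Finset ι) (v : L2 ι) :
    ‖v - restr X v‖ ^ 2 = ‖v‖ ^ 2 - ‖restr X v‖ ^ 2 := by
  rw [norm_sub_sq_real, restr, inner_ofFinset, norm_ofFinset_sq]
  simp only [← sq]
  ring

lemma norm_restr_le {ι : Type*} (X : Finset ι) (v : L2 ι) : ‖restr X v‖ ≤ ‖v‖ :=
  (abs_le_of_sq_le_sq' (by rw [norm_restr_sq]; exact sum_sq_le_norm_sq X v) (norm_nonneg _)).2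

/-- Bulk chasing. -/
lemma IsExpand.le_norm_restr {r : L2 (Fin d → J)} {a : ℝ} {Λ' : Fin d → Finset J} (ha : 0 ≤ a)
    (ha1 : a ≤ 1) (h : IsExpand Λ r a Λ') : a * ‖r‖ ≤ ‖restr (Fintype.piFinset Λ') r‖ := by
  obtain ⟨Λc, hc, hΛ'⟩ := h
  have hsub : Fintype.piFinset Λc ⊆ Fintype.piFinset Λ' := fun x hx => by
    rw [Fintype.mem_piFinset] at hx ⊢
    intro j
    have : x j ∈ (Λ' j : Set J) := by rw [hΛ' j]; exact Or.inr (hx j)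
    exact this
  have h1 := norm_sub_restr_le_of_tail (by positivity) hc.accurate
  have h2 := pow_le_pow_left₀ (norm_nonneg _) h1 2
  rw [norm_sub_restr_sq, mul_pow, Real.sq_sqrt (by nlinarith)] at h2
  refine (abs_le_of_sq_le_sq' (?_ : _ ≤ _) (norm_nonneg _)).2
  have h3 : ‖restr (Fintype.piFinset Λc) r‖ ^ 2 ≤ ‖restr (Fintype.piFinset Λ') r‖ ^ 2 := by
    rw [norm_restr_sq, norm_restr_sq]
    exact Finset.sum_le_sum_of_subset_of_nonneg hsub fun _ _ _ => sq_nonneg _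
  rw [mul_pow]
  linarith

end Coarsening

end

/-! ### The Galerkin solver under the standing assumptions -/

section

section Support

variable {ι : Type*}

/-- Square summable families supported in a finite set. -/
def suppIn (X : Finset ι) : Submodule ℝ (L2 ι) where
  carrier := {v | ∀ x ∉ X, v x = 0}
  add_mem' {v w} hv hw x hx := by
    rw [lp.coeFn_add, Pi.add_apply, hv x hx, hw x hx, add_zero]
  zero_mem' _ _ := rfl
  smul_mem' c v hv x hx := by
    rw [lp.coeFn_smul, Pi.smul_apply, hv x hx, smul_zero]

lemma mem_suppIn {X : Finset ι} {v : L2 ι} : v ∈ suppIn X ↔ ∀ x ∉ X, v x = 0 := Iff.rfl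

instance (X : Finset ι) : FiniteDimensional ℝ (suppIn X) := by
  have hfin : FiniteDimensional ℝ (Submodule.span ℝ (unitVec '' (X : Set ι))) :=
    FiniteDimensional.span_of_finite ℝ ((Finset.finite_toSet X).image _)
  refine Submodule.finiteDimensional_of_le
    (S₂ := Submodule.span ℝ (unitVec '' (X : Set ι))) fun v hv => ?_
  rw [eq_ofFinset (mem_suppIn.1 hv), ofFinset_eq_sum]
  exact Submodule.sum_mem _ fun i hi => Submodule.smul_mem _ _
    (Submodule.subset_span ⟨i, hi, rfl⟩)

lemma restr_mem_suppIn (X : Finset ι) (v : L2 ι) : restr X v ∈ suppIn X :=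
  fun _ hx => restr_of_notMem v hx

lemma inner_restr {X : Finset ι} (g : L2 ι) {y : L2 ι} (hy : y ∈ suppIn X) :
    inner ℝ (restr X g) y = inner ℝ y g := by
  rw [real_inner_comm, restr, inner_ofFinset, inner_eq_sum X g (mem_suppIn.1 hy)]

end Support

variable {d K : ℕ} {J : Type*} {P : Problem d K J}

/-- Standing assumptions of the convergence analysis, apart from those on ranks. -/
structure Setup (P : Problem d K J) (Q : Params) (T : Finset (Finset (Fin d)))
    (B : L2 (Fin d → J) →L[ℝ] L2 (Fin d → J)) (f u : L2 (Fin d → J)) (s sStar t : ℝ) : Prop where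
  two_le : 2 ≤ d
  tree : IsDimTree T
  standing : P.Standing
  scaled : P.IsScaledOp B
  spd : SpdBounds B Q.lamMin Q.lamMax
  norm_le : ‖B‖ ≤ Q.lamMax
  sol : B u = f
  outer : Q.OuterValid d ‖f‖
  cg : Q.CGValid
  s_pos : 0 < s
  s_lt : s < sStar
  t_pos : 0 < t
  sparse : ∀ j, asNorm s (contr j u) ≠ ⊤
  comp : ∀ i ν, IsCompressible sStar (P.scaledComp i ν)
  rhs : P.RhsApprox f Q.cf s
  excess : P.ExcessRegular t

variable {Q : Params} {T : Finset (Finset (Fin d))} {B : L2 (Fin d → J) →L[ℝ] L2 (Fin d → J)}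
  {f u : L2 (Fin d → J)} {s sStar t : ℝ}

namespace Setup

lemma lamMax_pos (S : Setup P Q T B f u s sStar t) : 0 < Q.lamMax :=
  CGRun.lamMax_pos S.spd S.cg

lemma isResidual (S : Setup P Q T B f u s sStar t) (Λ : Fin d → Finset J) (x : L2 (Fin d → J)) :
    IsResidual B (suppIn (Fintype.piFinset Λ)) (u - x) (galRes B f Λ x) := by
  refine ⟨restr_mem_suppIn _ _, fun y hy => ?_⟩
  rw [galRes, inner_restr _ hy, map_sub, S.sol]

/-- Bound for the norms of approximate residuals in weighted spaces. -/
lemma exists_wBound_approxRes (S : Setup P Q T B f u s sStar t) : ∃ C, 1 ≤ C ∧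
    ∀ (η : ℝ) (rows cols : Finset (Fin d → J)) (v : L2 (Fin d → J)) (c : ℝ), 0 ≤ c →
      P.WBound t c v → P.WBound t (C * (1 + c)) (P.approxRes η P.f rows cols v) ∧
        ∀ ε, 0 < ε → P.WBound t (C * (1 + c)) (P.approxRes η (P.fApp ε) rows cols v) := by
  have hP := S.standing
  obtain ⟨C₁, hC₁, h1⟩ := Problem.WBound.opApply hP S.two_le S.excess fun i ν => (S.comp i ν).1
  obtain ⟨C₂, hC₂, h2⟩ := S.excess.rhs_stable
  set c₀ := ∑ j, (P.weightedContr (-1 + t) j P.f).toReal with hc₀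
  have hc₀0 : 0 ≤ c₀ := Finset.sum_nonneg fun j _ => ENNReal.toReal_nonneg
  have h3 : ∀ j, P.weightedContr (-1 + t) j P.f ≤ ENNReal.ofReal c₀ := fun j => by
    rw [← ENNReal.ofReal_toReal (S.excess.rhs_finite j).ne]
    exact ENNReal.ofReal_le_ofReal (Finset.single_le_sum
      (f := fun j => (P.weightedContr (-1 + t) j P.f).toReal)
      (fun i _ => ENNReal.toReal_nonneg) (Finset.mem_univ j))
  have h4 : ∀ j ε, 0 < ε → P.weightedContr (-1 + t) j (P.fApp ε) ≤ ENNReal.ofReal (C₂ * c₀) :=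
    fun j ε hε => (h2 j ε hε).trans (by
      rw [ENNReal.ofReal_mul hC₂.le]; gcongr; exact h3 j)
  have hs := (Problem.sConst_pos hP).le
  have hS : ∀ n x, |P.sInvApp n x| ≤ P.sConst / √(P.weight x) := fun n x => by
    rw [abs_of_nonneg (Problem.sInvApp_nonneg hP n x)]
    exact Problem.sInvApp_le_const hP n (zero_lt_one.trans_le (hP.one_le_weight S.two_le x))
  set R := P.sConst * ((1 + C₂) * c₀) with hR
  have hR0 : 0 ≤ R := by positivity
  have key : ∀ (g : (Fin d → J) → ℝ) (η : ℝ) (rows cols : Finset (Fin d → J))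
      (v : L2 (Fin d → J)) (c : ℝ), 0 ≤ c → P.WBound t c v →
      (∀ j, P.weightedContr (-1 + t) j g ≤ ENNReal.ofReal ((1 + C₂) * c₀)) →
      P.WBound t ((2 * (R + C₁) + 1) * (1 + c)) (P.approxRes η g rows cols v) := by
    intro g η rows cols v c hc hv hg
    have h5 := Problem.WBound.of_weightedContr hP (by positivity) hg
      (hS (P.numTerms η rows))
    have h6 := (h1 _ _ (hS (P.numTerms η rows)) (hS (P.numTerms η rows)) cols c v hv).smul (-1)
    rw [abs_neg, abs_one, one_mul] at h6
    have h7 := h5.add hR0 (by positivity) h6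
    have h8 := h7.mono (by positivity) (show 2 * (R + C₁ * c) ≤ (2 * (R + C₁) + 1) * (1 + c) by
      nlinarith)
    refine h8.of_abs_le fun x => ?_
    rw [Problem.approxRes]
    by_cases hx : x ∈ rows
    · rw [ofFinset_of_mem _ hx]
      refine le_of_eq (congrArg _ ?_)
      ring
    · rw [ofFinset_of_notMem _ hx, abs_zero]
      exact abs_nonneg _
  refine ⟨2 * (R + C₁) + 1, by linarith, fun η rows cols v c hc hv => ⟨?_, fun ε hε => ?_⟩⟩
  · refine key _ η rows cols v c hc hv fun j => (h3 j).trans (ENNReal.ofReal_le_ofReal ?_)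
    nlinarith
  · refine key _ η rows cols v c hc hv fun j => (h4 j ε hε).trans (ENNReal.ofReal_le_ofReal ?_)
    nlinarith

end Setup

/-- Exponent in the growth of the number of terms of the scaling. -/
def Params.growthExp (Q : Params) : ℕ := if 0 < Q.stallMargin then 1 else 2

/-- A run of the truncated conjugate gradient method, with the Galerkin solution `w`. -/
structure PCGRun (P : Problem d K J) (Q : Params) (T : Finset (Finset (Fin d)))
    (B : L2 (Fin d → J) →L[ℝ] L2 (Fin d → J)) (f u : L2 (Fin d → J)) (Λ : Fin d → Finset J)
    (x0 : L2 (Fin d → J)) (ρ : ℝ) (xN w : L2 (Fin d → J)) (N : ℕ)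
    (x dir : ℕ → L2 (Fin d → J)) : Prop where
  run : CGRun B (suppIn (Fintype.piFinset Λ)) Q w N x dir fun i => galRes B f Λ (x i)
  orth : ∀ y ∈ suppIn (Fintype.piFinset Λ), inner ℝ y (B (u - w)) = 0
  first : x 0 = x0
  last : xN = x N
  lt_res : ∀ i < N, Q.ω2 * ρ < ‖galRes B f Λ (x i)‖
  res_le : ‖galRes B f Λ (x N)‖ ≤ Q.ω2 * ρ
  hosvd_zero : 0 < N → ∃ rk, IsHOSVD T (P.approxRes (etaOf P Q B f (Q.cPre * (Q.ω2 * ρ)) ‖x 0‖)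
    P.f (Fintype.piFinset Λ) (Fintype.piFinset Λ) (x 0)) rk (dir 0)
  hosvd_dir : ∀ i, i + 1 < N → ∃ rk, IsHOSVD T
    (P.approxRes (etaOf P Q B f (Q.cPre * (Q.ω2 * ρ)) ‖x (i + 1)‖) P.f
      (Fintype.piFinset Λ) (Fintype.piFinset Λ) (x (i + 1)) +
    (-(inner ℝ (galRes B f Λ (x (i + 1))) (B (dir i)) / inner ℝ (dir i) (B (dir i)))) • dir i)
    rk (dir (i + 1))
  hosvd_iter : ∀ i < N, ∃ rk, IsHOSVD T (x i + (inner ℝ (galRes B f Λ (x i)) (dir i) /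
    inner ℝ (dir i) (B (dir i))) • dir i) rk (x (i + 1))

lemma approxRes_mem (P : Problem d K J) (η : ℝ) (g : (Fin d → J) → ℝ)
    (X Y : Finset (Fin d → J)) (v : L2 (Fin d → J)) : P.approxRes η g X Y v ∈ suppIn X :=
  fun _ hx => ofFinset_of_notMem _ hx

variable {Λ : Fin d → Finset J} {x0 xN : L2 (Fin d → J)} {ρ : ℝ}

/-- Reduction to the abstract method on the space of vectors supported in the box: truncation keeps
supports inside product sets, so all iterates and directions stay in that space. Residuals before
the last step exceed the tolerance and are therefore nonzero. -/
lemma IsPCG.exists_run [Nonempty J] (S : Setup P Q T B f u s sStar t)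
    (h : IsPCG P Q T B f Λ x0 ρ xN) (hρ : 0 ≤ ρ) (hx0 : x0 ∈ suppIn (Fintype.piFinset Λ)) :
    ∃ w N x dir, PCGRun P Q T B f u Λ x0 ρ xN w N x dir := by
  obtain ⟨N, x, dir, hx, hN, hlt, hle, h0, hdir, hit⟩ := h
  obtain ⟨w, hw, horth⟩ := S.spd.exists_galerkin (V := suppIn (Fintype.piFinset Λ)) u
  have hmem : ∀ i ≤ N, x i ∈ suppIn (Fintype.piFinset Λ) ∧
      (i < N → dir i ∈ suppIn (Fintype.piFinset Λ)) := by
    intro i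
    induction i with
    | zero =>
      refine fun _ => ⟨by rw [hx]; exact hx0, fun hN => ?_⟩
      obtain ⟨⟨rk, hrk⟩, -⟩ := h0 hN
      exact mem_suppIn.2 (hrk.support S.tree (approxRes_mem _ _ _ _ _ _))
    | succ i ih =>
      intro hi
      obtain ⟨ih1, ih2⟩ := ih (by omega)
      obtain ⟨⟨rk, hrk⟩, -⟩ := hit i (by omega)
      refine ⟨mem_suppIn.2 (hrk.support S.tree (mem_suppIn.1 ((suppIn _).add_mem ih1
        ((suppIn _).smul_mem _ (ih2 (by omega)))))), fun hi' => ?_⟩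
      obtain ⟨⟨rk', hrk'⟩, -⟩ := hdir i hi'
      exact mem_suppIn.2 (hrk'.support S.tree (mem_suppIn.1 ((suppIn _).add_mem
        (approxRes_mem _ _ _ _ _ _) ((suppIn _).smul_mem _ (ih2 (by omega))))))
  refine ⟨w, N, x, dir, ⟨hw, fun i hi => (hmem i hi).1, fun i hi => (hmem i hi.le).2 hi,
    fun i _ => (S.isResidual Λ (x i)).galerkin horth, fun i hi h0 => ?_, fun hN => (h0 hN).2,
    fun i hi => (hdir i hi).2.1, fun i hi => (hit i hi).2⟩, horth, hx, hN, hlt, hle,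
    fun hN => (h0 hN).1, fun i hi => (hdir i hi).1, fun i hi => (hit i hi).1⟩
  have h1 := hlt i hi
  simp only [h0, norm_zero] at h1
  have := S.outer.ω2_pos
  exact absurd h1 (not_lt.2 (by positivity))

namespace PCGRun

variable {w : L2 (Fin d → J)} {N : ℕ} {x dir : ℕ → L2 (Fin d → J)}

/-- The distance of u to the Galerkin solution is common to all iterates, so monotonicity inside the
Galerkin space carries over by Pythagoras. -/
lemma energy_iter_le (S : Setup P Q T B f u s sStar t)
    (h : PCGRun P Q T B f u Λ x0 ρ xN w N x dir) {i : ℕ} (hi : i ≤ N) :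
    energy B (u - x i) ≤ energy B (u - x0) := by
  have p1 := S.spd.galerkin_pythagoras h.run.w_mem (h.run.x_mem i hi) h.orth
  have p2 := S.spd.galerkin_pythagoras h.run.w_mem (h.run.x_mem 0 (by omega)) h.orth
  have h1 := h.run.energy_le S.spd S.cg hi
  have h2 := pow_le_pow_left₀ (SpdBounds.energy_nonneg _) h1 2
  rw [← h.first]
  refine (abs_le_of_sq_le_sq' ?_ (SpdBounds.energy_nonneg _)).2
  linarith

lemma energy_last_le (S : Setup P Q T B f u s sStar t)
    (h : PCGRun P Q T B f u Λ x0 ρ xN w N x dir) : energy B (u - xN) ≤ energy B (u - x0) := by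
  rw [h.last]; exact h.energy_iter_le S le_rfl

lemma last_mem (h : PCGRun P Q T B f u Λ x0 ρ xN w N x dir) :
    xN ∈ suppIn (Fintype.piFinset Λ) := by
  rw [h.last]; exact h.run.x_mem N le_rfl

lemma norm_res_zero_le (h : PCGRun P Q T B f u Λ x0 ρ xN w N x dir)
    (S : Setup P Q T B f u s sStar t) (h0 : ‖B (u - x0)‖ ≤ (1 + Q.ω1) * ρ) :
    ‖galRes B f Λ (x 0)‖ ≤ (1 + Q.ω1) * ρ := by
  rw [h.first, galRes, ← S.sol, ← map_sub]
  exact (norm_restr_le _ _).trans h0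

/-- The balance between the two cases: where the number of terms may grow quadratically in the
logarithm, only half as many steps can occur. -/
lemma growthExp_mul_le (S : Setup P Q T B f u s sStar t)
    (h : PCGRun P Q T B f u Λ x0 ρ xN w N x dir) (h0 : ‖B (u - x0)‖ ≤ (1 + Q.ω1) * ρ) :
    Q.growthExp * N ≤ Q.IStar := by
  have h1 := h.norm_res_zero_le S h0
  rw [Params.growthExp]
  split_ifs with hst
  · rw [one_mul]; exact h.run.steps_le S.spd S.cg S.outer h1 h.lt_res
  · exact h.run.two_mul_steps_le S.spd S.cg S.outer h1 h.lt_res (not_lt.1 hst)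

/-- Error reduction by the Galerkin solver on an expanded index set. -/
lemma energy_last_le_rate (S : Setup P Q T B f u s sStar t)
    (h : PCGRun P Q T B f u Λ x0 ρ xN w N x dir) {r : L2 (Fin d → J)} (hr : ‖r‖ = ρ)
    (h0 : ‖B (u - x0) - r‖ ≤ Q.ω1 * ‖r‖) (hbulk : (Q.α - Q.ω1) * ρ ≤ ‖galRes B f Λ x0‖) :
    energy B (u - xN) ≤ Q.innerRate * energy B (u - x0) := by
  refine S.spd.adaptive_step S.cg.κ_gt S.outer h.run.w_mem ?_ h.last_mem h.orth h0
    (S.isResidual Λ x0) (by rw [hr]; exact hbulk) (S.isResidual Λ xN) ?_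
  · rw [← h.first]; exact h.run.x_mem 0 (by omega)
  · rw [hr, h.last]; exact h.res_le

/-- One approximate residual multiplies rank + `rf` by at most q = n²·`rA`. Directions accumulate
residuals and iterates accumulate directions; with Z = (4q)^i(X + `rf`) the induction keeps iterates
plus `rf` below Z and directions below 2qZ. Adding `rf` to the rank makes the recursion homogeneous.
-/
lemma exists_htRank_last_le [Nonempty J] (S : Setup P Q T B f u s sStar t)
    (h : PCGRun P Q T B f u Λ x0 ρ xN w N x dir) {rA rf n X : ℕ}
    (hA : htRank T P.opTensor ≤ rA) (hf : htRank T P.f ≤ rf) (hrA : 1 ≤ rA) (hn : 1 ≤ n)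
    (hnt : ∀ i < N, P.numTerms (etaOf P Q B f (Q.cPre * (Q.ω2 * ρ)) ‖x i‖)
      (Fintype.piFinset Λ) + P.nPlus + 1 ≤ n) (hX : htRank T x0 ≤ X) :
    ∃ Y : ℕ, htRank T xN ≤ Y ∧ Y + rf ≤ (4 * (n ^ 2 * rA)) ^ N * (X + rf) := by
  set q := n ^ 2 * rA with hq
  have hq1 : 1 ≤ q := Nat.one_le_iff_ne_zero.2 (by positivity)
  have happ : ∀ i < N, ∀ Y, htRank T (x i) ≤ (Y : ℕ) →
      htRank T (P.approxRes (etaOf P Q B f (Q.cPre * (Q.ω2 * ρ)) ‖x i‖) P.f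
        (Fintype.piFinset Λ) (Fintype.piFinset Λ) (x i)) ≤ (q * (Y + rf) : ℕ) := by
    intro i hi Y hY
    rw [htRank_le_iff] at *
    intro α hα
    refine (HasRank.approxRes P (hA α hα) (hf α hα) (hY α hα) _ Λ Λ).mono ?_
    have h1 := hnt i hi
    set n' := P.numTerms (etaOf P Q B f (Q.cPre * (Q.ω2 * ρ)) ‖x i‖)
      (Fintype.piFinset Λ) + P.nPlus + 1
    calc n' * (rf + rA * (n' * Y)) ≤ n * (rf + rA * (n * Y)) := by gcongr
      _ = n * 1 * 1 * rf + n ^ 2 * rA * Y := by ring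
      _ ≤ n * n * rA * rf + n ^ 2 * rA * Y := by gcongr
      _ = q * (Y + rf) := by rw [hq]; ring
  have hadd : ∀ (v v' : L2 (Fin d → J)) (c : ℝ) (a b : ℕ), htRank T v ≤ a → htRank T v' ≤ b →
      htRank T (v + c • v' : L2 (Fin d → J)) ≤ (a + b : ℕ) := by
    intro v v' c a b ha hb
    rw [htRank_le_iff] at *
    exact fun α hα => ((ha α hα).add ((hb α hα).smul c)).congr fun y => by
      rw [lp.coeFn_add, Pi.add_apply, lp.coeFn_smul, Pi.smul_apply, smul_eq_mul]
  have key : ∀ i ≤ N, ∃ Y : ℕ, htRank T (x i) ≤ Y ∧ Y + rf ≤ (4 * q) ^ i * (X + rf) ∧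
      (i < N → htRank T (dir i) ≤ (2 * q * ((4 * q) ^ i * (X + rf)) : ℕ)) := by
    intro i
    induction i with
    | zero =>
      refine fun _ => ⟨X, by rw [h.first]; exact hX, by simp, fun hN => ?_⟩
      obtain ⟨rk, hrk⟩ := h.hosvd_zero hN
      refine hrk.htRank_le' S.tree S.two_le (mem_suppIn.1 (approxRes_mem _ _ _ _ _ _))
        ((happ 0 hN X (by rw [h.first]; exact hX)).trans ?_)
      rw [pow_zero, one_mul]
      exact_mod_cast Nat.mul_le_mul_right _ (by omega)
    | succ i ih =>
      intro hi
      obtain ⟨Y, hY, hYle, hdir⟩ := ih (by omega)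
      obtain ⟨rk, hrk⟩ := h.hosvd_iter i (by omega)
      have hd' := hdir (by omega)
      set Z := (4 * q) ^ i * (X + rf) with hZ
      have hZs : (4 * q) ^ (i + 1) * (X + rf) = 4 * q * Z := by rw [hZ, pow_succ]; ring
      have hx1 := hrk.htRank_le' S.tree S.two_le (mem_suppIn.1 ((suppIn _).add_mem
        (h.run.x_mem i (by omega)) ((suppIn _).smul_mem _ (h.run.d_mem i (by omega)))))
        (hadd _ _ _ _ _ hY hd')
      have hqZ : Z ≤ q * Z := Nat.le_mul_of_pos_left _ hq1
      have hnew : Y + 2 * q * Z + rf ≤ 4 * q * Z := by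
        have : 2 * q * Z = 2 * (q * Z) := by ring
        have : 4 * q * Z = 4 * (q * Z) := by ring
        omega
      refine ⟨Y + 2 * q * Z, hx1, by rw [hZs]; exact hnew, fun hi' => ?_⟩
      obtain ⟨rk', hrk'⟩ := h.hosvd_dir i hi'
      refine hrk'.htRank_le' S.tree S.two_le (mem_suppIn.1 ((suppIn _).add_mem
        (approxRes_mem _ _ _ _ _ _) ((suppIn _).smul_mem _ (h.run.d_mem i (by omega)))))
        ((hadd _ _ _ _ _ (happ (i + 1) hi' _ hx1) hd').trans ?_)
      rw [hZs]
      have h1 : q * (Y + 2 * q * Z + rf) ≤ q * (4 * q * Z) := Nat.mul_le_mul_left _ hnew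
      have h2 : 2 * q * Z ≤ q * (4 * q * Z) := by
        have : q * (4 * q * Z) = q * (4 * (q * Z)) := by ring
        have h3 : q * (4 * Z) ≤ q * (4 * (q * Z)) := by gcongr
        have : q * (4 * Z) = 4 * (q * Z) := by ring
        have : 2 * q * Z = 2 * (q * Z) := by ring
        omega
      have h3 : q * (Y + 2 * q * Z + rf) + 2 * q * Z ≤ 2 * q * (4 * q * Z) := by
        have : 2 * q * (4 * q * Z) = 2 * (q * (4 * q * Z)) := by ring
        omega
      exact_mod_cast h3
  obtain ⟨Y, hY, hYle, -⟩ := key N le_rfl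
  exact ⟨Y, by rw [h.last]; exact hY, hYle⟩

end PCGRun

/-- Stability in weighted norms of the solver, unless it may stall. -/
lemma Setup.exists_wBound_pcg [Nonempty J] (S : Setup P Q T B f u s sStar t)
    (hst : 0 < Q.stallMargin) : ∃ C, 1 ≤ C ∧
    ∀ (Λ : Fin d → Finset J) (x0 : L2 (Fin d → J)) (ρ : ℝ) (xN w : L2 (Fin d → J)) (N : ℕ)
      (x dir : ℕ → L2 (Fin d → J)), PCGRun P Q T B f u Λ x0 ρ xN w N x dir →
      ‖B (u - x0)‖ ≤ (1 + Q.ω1) * ρ → ∀ c, 0 ≤ c → P.WBound t c x0 →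
      P.WBound t (C * (1 + c)) xN := by
  obtain ⟨Cr, hCr, hres⟩ := S.exists_wBound_approxRes
  have hb := S.lamMax_pos
  have ha := S.spd.pos
  have hp := S.cg.pert_nonneg
  -- `a` and `b` bound the step lengths and the conjugation coefficients. Both quotients have ⟨d,Bd⟩
  -- ≥ λ_min‖d‖² below the line, and the positive margin bounds one factor ‖d‖ from below by the
  -- residual.
  set a := (Q.lamMin * Q.stallMargin)⁻¹ with hadef
  set b := Q.lamMax * (√(Q.lamMax / Q.lamMin) * (1 + Q.pert)) / (Q.lamMin * Q.stallMargin) with hbdef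
  have ha0 : 0 < a := by positivity
  have hb0 : 0 ≤ b := by positivity
  set D := 2 * (Cr + b) with hD
  set D' := 2 * (1 + a * D) + D with hD'
  have hDn : 0 ≤ D := by positivity
  have hD'1 : 1 ≤ D' := by
    have := mul_nonneg ha0.le hDn
    linarith
  refine ⟨(2 * D') ^ Q.IStar, one_le_pow₀ (by linarith), fun Λ x0 ρ xN w N x dir h h0 c hc hw => ?_⟩
  have hN : N ≤ Q.IStar :=
    h.run.steps_le S.spd S.cg S.outer (h.norm_res_zero_le S h0) h.lt_res
  have hdn : ∀ i < N, Q.stallMargin * ‖galRes B f Λ (x i)‖ ≤ ‖dir i‖ := fun i hi =>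
    h.run.le_norm_dir S.spd S.cg S.outer (h.norm_res_zero_le S h0) h.lt_res hst hi
  have hrn : ∀ i < N, 0 < ‖galRes B f Λ (x i)‖ := fun i hi => norm_pos_iff.2 (h.run.res_ne i hi)
  have hdp : ∀ i < N, 0 < ‖dir i‖ := fun i hi =>
    lt_of_lt_of_le (mul_pos hst (hrn i hi)) (hdn i hi)
  have hdB : ∀ i < N, 0 < inner ℝ (dir i) (B (dir i)) ∧
      Q.lamMin * (Q.stallMargin * ‖galRes B f Λ (x i)‖) * ‖dir i‖ ≤
        inner ℝ (dir i) (B (dir i)) := fun i hi => by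
    have h1 := S.spd.lower (dir i)
    have h2 := hdp i hi
    have h3 : Q.lamMin * (Q.stallMargin * ‖galRes B f Λ (x i)‖) * ‖dir i‖ ≤
        Q.lamMin * ‖dir i‖ ^ 2 := by
      rw [sq, mul_assoc]
      exact mul_le_mul_of_nonneg_left (mul_le_mul_of_nonneg_right (hdn i hi) h2.le) ha.le
    exact ⟨lt_of_lt_of_le (by positivity) h1, h3.trans h1⟩
  have halpha : ∀ i < N, |inner ℝ (galRes B f Λ (x i)) (dir i) /
      inner ℝ (dir i) (B (dir i))| ≤ a := by
    intro i hi
    obtain ⟨h1, h2⟩ := hdB i hi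
    have h3 := hdp i hi
    have h4 := hrn i hi
    rw [abs_div, abs_of_pos h1, div_le_iff₀ h1]
    refine (abs_real_inner_le_norm _ _).trans ?_
    calc _ = a * (Q.lamMin * (Q.stallMargin * ‖galRes B f Λ (x i)‖) * ‖dir i‖) := by
          rw [hadef]; field_simp
      _ ≤ _ := by gcongr
  have hbeta : ∀ i, i + 1 ≤ N → |-(inner ℝ (galRes B f Λ (x (i + 1))) (B (dir i)) /
      inner ℝ (dir i) (B (dir i)))| ≤ b := by
    intro i hi
    obtain ⟨h1, h2⟩ := hdB i (by omega)
    have h3 := hdp i (by omega)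
    have h4 := hrn i (by omega)
    have h5 : ‖galRes B f Λ (x (i + 1))‖ ≤
        √(Q.lamMax / Q.lamMin) * (1 + Q.pert) * ‖galRes B f Λ (x i)‖ := by
      have e1 := S.spd.residual_sq_le hb.le (h.run.res (i + 1) hi)
      have e2 := S.spd.energy_le_residual ((suppIn _).sub_mem h.run.w_mem
        (h.run.x_mem i (by omega))) (h.run.res i (by omega))
      have e3 := h.run.energy_succ_le_crude S.spd S.cg (show i < N by omega)
      have e4 := pow_le_pow_left₀ (SpdBounds.energy_nonneg _) e3 2
      refine (abs_le_of_sq_le_sq' ?_ (by positivity)).2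
      rw [mul_pow, mul_pow, Real.sq_sqrt (by positivity)]
      refine e1.trans ?_
      calc Q.lamMax * energy B (w - x (i + 1)) ^ 2
          ≤ Q.lamMax * ((1 + Q.pert) * energy B (w - x i)) ^ 2 := by gcongr
        _ = Q.lamMax / Q.lamMin * (1 + Q.pert) ^ 2 * (Q.lamMin * energy B (w - x i) ^ 2) := by
            field_simp
        _ ≤ _ := by gcongr
    rw [abs_neg, abs_div, abs_of_pos h1, div_le_iff₀ h1]
    refine (abs_real_inner_le_norm _ _).trans ?_
    have h6 : ‖B (dir i)‖ ≤ Q.lamMax * ‖dir i‖ :=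
      (B.le_opNorm _).trans (mul_le_mul_of_nonneg_right S.norm_le (norm_nonneg _))
    calc _ ≤ √(Q.lamMax / Q.lamMin) * (1 + Q.pert) * ‖galRes B f Λ (x i)‖ *
          (Q.lamMax * ‖dir i‖) := by gcongr
      _ = b * (Q.lamMin * (Q.stallMargin * ‖galRes B f Λ (x i)‖) * ‖dir i‖) := by
          rw [hbdef]; field_simp
      _ ≤ _ := by gcongr
  have hcomb : ∀ (v v' : L2 (Fin d → J)) (e : ℝ) (c₁ c₂ e' : ℝ), 0 ≤ c₁ → 0 ≤ c₂ → |e| ≤ e' →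
      P.WBound t c₁ v → P.WBound t c₂ v' →
      P.WBound t (2 * (c₁ + e' * c₂)) (v + e • v' : L2 (Fin d → J)) := by
    intro v v' e c₁ c₂ e' h1 h2 he hv hv'
    have h3 := (hv.add h1 (by positivity) (hv'.smul e)).mono (by positivity)
      (show 2 * (c₁ + |e| * c₂) ≤ 2 * (c₁ + e' * c₂) by gcongr)
    exact h3
  have key : ∀ i ≤ N, ∃ c' : ℝ, 0 ≤ c' ∧ 1 + c' ≤ (2 * D') ^ i * (1 + c) ∧ P.WBound t c' (x i) ∧
      (i < N → P.WBound t (D * (1 + c')) (dir i)) := by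
    intro i
    induction i with
    | zero =>
      refine fun _ => ⟨c, hc, by simp, by rw [h.first]; exact hw, fun hN => ?_⟩
      obtain ⟨rk, hrk⟩ := h.hosvd_zero hN
      refine hrk.wBound S.tree (mem_suppIn.1 (approxRes_mem _ _ _ _ _ _)) ?_
      refine (hres _ _ _ _ c hc (by rw [h.first]; exact hw)).1.mono (by positivity) ?_
      gcongr
      linarith
    | succ i ih =>
      intro hi
      obtain ⟨c', hc', hc'le, hwx, hwd⟩ := ih (by omega)
      have hwd := hwd (by omega)
      obtain ⟨rk, hrk⟩ := h.hosvd_iter i (by omega)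
      have hxn : P.WBound t (D' * (1 + c')) (x (i + 1)) := by
        refine hrk.wBound S.tree (mem_suppIn.1 ((suppIn _).add_mem
          (h.run.x_mem i (by omega)) ((suppIn _).smul_mem _ (h.run.d_mem i (by omega))))) ?_
        refine (hcomb _ _ _ _ _ a hc' (by positivity) (halpha i (by omega)) hwx hwd).mono
          (by positivity) ?_
        rw [hD']
        have := mul_nonneg hDn (show 0 ≤ 1 + c' by linarith)
        nlinarith [mul_nonneg ha0.le this]
      refine ⟨D' * (1 + c'), by positivity, ?_, hxn, fun hi' => ?_⟩
      · rw [pow_succ]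
        nlinarith
      · obtain ⟨rk', hrk'⟩ := h.hosvd_dir i hi'
        refine hrk'.wBound S.tree (mem_suppIn.1 ((suppIn _).add_mem
          (approxRes_mem _ _ _ _ _ _) ((suppIn _).smul_mem _ (h.run.d_mem i (by omega))))) ?_
        refine (hcomb _ _ _ _ _ b (by positivity) (by positivity) (hbeta i (by omega))
          (hres _ _ _ _ _ (by positivity) hxn).1 hwd).mono (by positivity) ?_
        have h1 : D * (1 + c') ≤ 1 + D' * (1 + c') := by
          have : D ≤ D' := by rw [hD']; nlinarith [mul_nonneg ha0.le hDn]
          nlinarith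
        rw [hD]
        rw [hD] at h1
        nlinarith [mul_le_mul_of_nonneg_left h1 hb0]
  obtain ⟨c', hc', hc'le, hwx, -⟩ := key N le_rfl
  rw [h.last]
  refine hwx.mono hc' ?_
  have : (2 * D') ^ N ≤ (2 * D') ^ Q.IStar := pow_le_pow_right₀ (by linarith) hN
  nlinarith

end

/-! ### Error control along the inner and outer iteration -/

section

variable {d K : ℕ} {J : Type*} {P : Problem d K J}
  {Q : Params} {T : Finset (Finset (Fin d))} {B : L2 (Fin d → J) →L[ℝ] L2 (Fin d → J)}
  {f u : L2 (Fin d → J)} {s sStar t : ℝ}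

lemma restr_sub_restr {ι : Type*} (X : Finset ι) (v w : L2 ι) :
    restr X v - restr X w = restr X (v - w) := by
  ext x
  by_cases hx : x ∈ X
  · rw [lp.coeFn_sub, Pi.sub_apply, restr, restr, restr, ofFinset_of_mem _ hx,
      ofFinset_of_mem _ hx, ofFinset_of_mem _ hx, lp.coeFn_sub, Pi.sub_apply]
  · rw [lp.coeFn_sub, Pi.sub_apply, restr_of_notMem _ hx, restr_of_notMem _ hx,
      restr_of_notMem _ hx, sub_zero]

namespace Setup

/-- The upper bound on ω2 says precisely that the loss from inexact solving is smaller than the gain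
from bulk chasing. -/
lemma innerRate_lt_one (S : Setup P Q T B f u s sStar t) : Q.innerRate < 1 := by
  have hκ := S.cg.κ_gt
  have h1 := S.outer.ω1_pos
  have h2 := S.outer.ω1_lt
  have h3 := S.outer.α_lt
  have h4 := S.outer.ω2_pos
  have h5 : Q.ω2 / (1 - Q.ω1) < (Q.α - Q.ω1) / (1 + Q.ω1) * Q.κ⁻¹ := by
    rw [div_lt_iff₀ (by linarith)]
    refine S.outer.ω2_lt.trans_le (le_of_eq ?_)
    ring
  have h6 := pow_lt_pow_left₀ h5 (div_nonneg h4.le (by linarith)) two_ne_zero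
  have hκ0 : 0 < Q.κ := by linarith
  rw [Params.innerRate, ← Real.sqrt_one]
  refine Real.sqrt_lt_sqrt_iff_of_pos one_pos |>.2 ?_
  have h7 : (Q.ω2 / (1 - Q.ω1)) ^ 2 * Q.κ <
      ((Q.α - Q.ω1) / (1 + Q.ω1) * Q.κ⁻¹) ^ 2 * Q.κ := mul_lt_mul_of_pos_right h6 hκ0
  have h8 : ((Q.α - Q.ω1) / (1 + Q.ω1) * Q.κ⁻¹) ^ 2 * Q.κ =
      ((Q.α - Q.ω1) / (1 + Q.ω1)) ^ 2 * Q.κ⁻¹ := by field_simp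
  linarith

lemma innerRate_pos (S : Setup P Q T B f u s sStar t) : 0 < Q.innerRate := by
  have hκ := S.cg.κ_gt
  have h1 := S.outer.ω1_pos
  have h2 := S.outer.ω1_lt
  have h3 := S.outer.α_lt
  have hκ0 : 0 < Q.κ := by linarith
  have h4 : 0 ≤ (Q.α - Q.ω1) / (1 + Q.ω1) := div_nonneg (by linarith) (by linarith)
  have h5 : (Q.α - Q.ω1) / (1 + Q.ω1) ≤ 1 := (div_le_one (by linarith)).2 (by linarith)
  have h6 : Q.κ⁻¹ < 1 := inv_lt_one_of_one_lt₀ hκ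
  have h7 : ((Q.α - Q.ω1) / (1 + Q.ω1)) ^ 2 * Q.κ⁻¹ < 1 :=
    lt_of_le_of_lt (mul_le_of_le_one_left (by positivity) (pow_le_one₀ h4 h5)) h6
  have h8 : 0 ≤ (Q.ω2 / (1 - Q.ω1)) ^ 2 * Q.κ := by positivity
  exact Real.sqrt_pos.2 (by linarith)

lemma ω4_pos (S : Setup P Q T B f u s sStar t) : 0 < Q.ω4 :=
  lt_of_le_of_lt (mul_nonneg (Real.sqrt_nonneg _) S.outer.ω3_pos.le) S.outer.ω4_gt

lemma ω5_pos (S : Setup P Q T B f u s sStar t) : 0 < Q.ω5 :=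
  lt_of_le_of_lt (mul_nonneg (by positivity) S.outer.ω3_pos.le) S.outer.ω5_gt

lemma sum_pos (S : Setup P Q T B f u s sStar t) : 0 < Q.ω3 + Q.ω4 + Q.ω5 := by
  have := S.outer.ω3_pos; have := S.ω4_pos; have := S.ω5_pos; linarith

lemma base_pos (S : Setup P Q T B f u s sStar t) (k : ℕ) : 0 < Q.base k :=
  mul_pos (pow_pos S.sum_pos k) S.outer.ω0_pos

lemma base_le (S : Setup P Q T B f u s sStar t) (k : ℕ) : Q.base k ≤ Q.ω0 :=
  mul_le_of_le_one_left S.outer.ω0_pos.le (pow_le_one₀ S.sum_pos.le S.outer.sum_lt.le)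

lemma norm_mul_le (S : Setup P Q T B f u s sStar t) (v : L2 (Fin d → J)) :
    Q.lamMin * ‖v‖ ≤ ‖B v‖ := by
  have h1 := (S.spd.lower v).trans (real_inner_le_norm v (B v))
  rcases (norm_nonneg v).eq_or_lt with h | h
  · rw [← h, mul_zero]; exact norm_nonneg _
  · nlinarith

lemma energy_le_sqrt (S : Setup P Q T B f u s sStar t) (v : L2 (Fin d → J)) :
    energy B v ≤ √Q.lamMax * ‖v‖ := by
  refine (abs_le_of_sq_le_sq' ?_ (by positivity)).2
  rw [mul_pow, Real.sq_sqrt S.lamMax_pos.le]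
  exact S.spd.energy_sq_le v

lemma sqrt_le_energy (S : Setup P Q T B f u s sStar t) (v : L2 (Fin d → J)) :
    √Q.lamMin * ‖v‖ ≤ energy B v := by
  refine (abs_le_of_sq_le_sq' ?_ (SpdBounds.energy_nonneg _)).2
  rw [mul_pow, Real.sq_sqrt S.spd.pos.le]
  exact S.spd.le_energy_sq v

/-- Used to bound the computed residual norm, and with it the tolerance of the solver, from below by
the error. -/
lemma energy_le_norm (S : Setup P Q T B f u s sStar t) (v : L2 (Fin d → J)) :
    √Q.lamMin * energy B v ≤ ‖B v‖ := by
  have h1 := S.sqrt_le_energy v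
  have h2 : energy B v ^ 2 ≤ ‖v‖ * ‖B v‖ := by
    rw [S.spd.energy_sq]; exact real_inner_le_norm _ _
  have h3 := SpdBounds.energy_nonneg (B := B) v
  rcases h3.eq_or_lt with h | h
  · rw [← h, mul_zero]; exact norm_nonneg _
  · have h4 : √Q.lamMin * energy B v ^ 2 ≤ energy B v * ‖B v‖ := by
      calc √Q.lamMin * energy B v ^ 2 ≤ √Q.lamMin * (‖v‖ * ‖B v‖) := by gcongr
        _ = (√Q.lamMin * ‖v‖) * ‖B v‖ := by ring
        _ ≤ _ := by gcongr
    nlinarith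

end Setup

lemma mem_suppIn_of_contr {Λ : Fin d → Finset J} {v : L2 (Fin d → J)}
    (h : ∀ j, (Λ j : Set J) = Function.support (contr j v)) : v ∈ suppIn (Fintype.piFinset Λ) := by
  intro x hx
  rw [Fintype.mem_piFinset] at hx
  push Not at hx
  obtain ⟨j, hj⟩ := hx
  have h1 : x j ∉ (Λ j : Set J) := hj
  rw [h j, Function.notMem_support, contr, ENNReal.toReal_eq_zero_iff] at h1
  exact econtr_eq_zero_iff.1 (h1.resolve_right (econtr_ne_top j v _)) x rfl

/-- Error bounds at the beginning of an inner step. -/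
structure ErrorInv (Q : Params) (B : L2 (Fin d → J) →L[ℝ] L2 (Fin d → J))
    (f u : L2 (Fin d → J)) (k m : ℕ) (v : L2 (Fin d → J)) (Λ : Fin d → Finset J) (ρ : ℝ) :
    Prop where
  m_le : m ≤ Q.M
  mem : v ∈ suppIn (Fintype.piFinset Λ)
  rho_nonneg : 0 ≤ ρ
  res_le : ‖B (u - v)‖ ≤ (1 + Q.ω1) * ρ
  energy_le : energy B (u - v) ≤ Q.innerRate ^ (m - 1) * (√Q.lamMax * (Q.base k / Q.lamMin))
  bulk : 1 ≤ m → ∃ r, ‖r‖ = ρ ∧ ‖B (u - v) - r‖ ≤ Q.ω1 * ‖r‖ ∧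
    (Q.α - Q.ω1) * ρ ≤ ‖galRes B f Λ v‖

variable {k m : ℕ} {v v' xN r z : L2 (Fin d → J)} {Λ Λ' Λ0 : Fin d → Finset J} {ρ tol : ℝ}

lemma IsRes.norm_le (S : Setup P Q T B f u s sStar t) (h : IsRes P Q B f Λ v r) :
    ‖B (u - v) - r‖ ≤ Q.ω1 * ‖r‖ ∧ ‖B (u - v)‖ ≤ (1 + Q.ω1) * ‖r‖ := by
  obtain ⟨tol, ε, Λt, -, -, -, -, -, -, -, h1⟩ := h
  rw [← S.sol, ← map_sub] at h1
  refine ⟨h1, ?_⟩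
  have := norm_le_norm_add_norm_sub' (B (u - v)) r
  linarith

namespace ErrorInv

lemma exists_run [Nonempty J] (S : Setup P Q T B f u s sStar t) (h : ErrorInv Q B f u k m v Λ ρ)
    (hp : IsPCG P Q T B f Λ v ρ xN) :
    ∃ w N x dir, PCGRun P Q T B f u Λ v ρ xN w N x dir :=
  hp.exists_run S h.rho_nonneg h.mem

/-- The first solve after a restart takes place on a coarsened set without a bulk criterion, so it
is only known not to increase the error. This is the reason for the exponent m-1 at the beginning of
a step, with 0-1 = 0. -/
lemma energy_pcg_le [Nonempty J] (S : Setup P Q T B f u s sStar t)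
    (h : ErrorInv Q B f u k m v Λ ρ) (hp : IsPCG P Q T B f Λ v ρ xN) :
    energy B (u - xN) ≤ Q.innerRate ^ m * (√Q.lamMax * (Q.base k / Q.lamMin)) := by
  obtain ⟨w, N, x, dir, hrun⟩ := h.exists_run S hp
  rcases Nat.eq_zero_or_pos m with rfl | hm
  · exact (hrun.energy_last_le S).trans h.energy_le
  · obtain ⟨r, hr, h0, hb⟩ := h.bulk hm
    refine (hrun.energy_last_le_rate S hr h0 hb).trans ?_
    calc _ ≤ Q.innerRate * (Q.innerRate ^ (m - 1) * (√Q.lamMax * (Q.base k / Q.lamMin))) :=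
          mul_le_mul_of_nonneg_left h.energy_le S.innerRate_pos.le
      _ = Q.innerRate ^ (m - 1 + 1) * (√Q.lamMax * (Q.base k / Q.lamMin)) := by ring
      _ = _ := by rw [Nat.sub_add_cancel hm]

lemma pcg_mem [Nonempty J] (S : Setup P Q T B f u s sStar t)
    (h : ErrorInv Q B f u k m v Λ ρ) (hp : IsPCG P Q T B f Λ v ρ xN) :
    xN ∈ suppIn (Fintype.piFinset Λ) := by
  obtain ⟨w, N, x, dir, hrun⟩ := h.exists_run S hp
  exact hrun.last_mem

/-- Accuracy at the end of an inner loop. -/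
lemma norm_sub_le_of_leave [Nonempty J] (S : Setup P Q T B f u s sStar t)
    (h : ErrorInv Q B f u k m v Λ ρ) (hp : IsPCG P Q T B f Λ v ρ xN)
    (hr : IsRes P Q B f Λ xN r) (hl : LeaveInner Q k m r) :
    ‖u - xN‖ ≤ Q.ω3 * (Q.base k / Q.lamMin) := by
  have ha := S.spd.pos
  rcases hl with hl | rfl
  · have h1 := (S.norm_mul_le (u - xN)).trans ((hr.norm_le S).2.trans hl)
    rw [← mul_div_assoc, le_div_iff₀ ha]
    linarith
  -- When the loop ends at m = M, the inner rate to the power M ≥ M* is at most ω3 κ^{-1/2}; the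
  -- factor κ^{-1/2} pays for passing between energy and ℓ₂-norm.
  · have h1 := h.energy_pcg_le S hp
    have hω := S.outer.ω3_pos
    have hκ : 0 < Q.κ := by linarith [S.cg.κ_gt]
    have h2 : Q.innerRate ^ Q.M ≤ Q.ω3 * (√Q.κ)⁻¹ := by
      refine (pow_le_pow_of_le_one S.innerRate_pos.le S.innerRate_lt_one.le S.outer.M_ge).trans ?_
      rw [Params.MStar, Q.rpow_neg_half S.cg.κ_gt]
      exact Params.pow_ceil_log_le S.innerRate_pos S.innerRate_lt_one (by positivity)
    have h3 := S.sqrt_le_energy (u - xN)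
    have h4 : √Q.lamMax = √Q.κ * √Q.lamMin := by
      rw [← Real.sqrt_mul hκ.le, CGRun.lamMax_eq S.spd]
    have h5 : 0 < √Q.lamMin := Real.sqrt_pos.2 ha
    have h6 : 0 < √Q.κ := Real.sqrt_pos.2 hκ
    have h7 := S.base_pos k
    have h8 : √Q.lamMin * ‖u - xN‖ ≤ √Q.lamMin * (Q.ω3 * (Q.base k / Q.lamMin)) := by
      refine h3.trans (h1.trans ?_)
      calc _ ≤ Q.ω3 * (√Q.κ)⁻¹ * (√Q.lamMax * (Q.base k / Q.lamMin)) := by gcongr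
        _ = _ := by rw [h4]; field_simp
    exact le_of_mul_le_mul_left h8 h5

lemma start (S : Setup P Q T B f u s sStar t) (Λ0 : Fin d → Finset J) :
    ErrorInv Q B f u 0 0 0 Λ0 Q.ω0 := by
  have h0 := S.outer.ω0_pos
  have h1 := S.outer.ω1_pos
  have h2 : ‖B (u - 0)‖ ≤ Q.ω0 := by rw [sub_zero, S.sol]; exact S.outer.ω0_ge
  refine ⟨Nat.zero_le _, Submodule.zero_mem _, h0.le, h2.trans (by nlinarith), ?_, by simp⟩
  have h3 := (S.norm_mul_le (u - 0)).trans h2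
  refine (S.energy_le_sqrt _).trans ?_
  rw [Nat.zero_sub, pow_zero, one_mul, Params.base, pow_zero, one_mul]
  gcongr
  rw [le_div_iff₀ S.spd.pos]; linarith

/-- The expanded set carries the share α of the computed residual. Replacing the computed residual
by the exact one costs ω1, whence the share α - ω1 in the bulk criterion. -/
lemma inner [Nonempty J] (S : Setup P Q T B f u s sStar t) (h : ErrorInv Q B f u k m v Λ ρ)
    (hp : IsPCG P Q T B f Λ v ρ xN) (hr : IsRes P Q B f Λ xN r) (hl : ¬ LeaveInner Q k m r)
    (hΛ : IsExpand Λ r Q.α Λ') : ErrorInv Q B f u k (m + 1) xN Λ' ‖r‖ := by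
  have h1 := S.outer.ω1_lt
  have h2 := S.outer.ω1_pos
  have hm : m ≠ Q.M := fun hm => hl (Or.inr hm)
  have hsub : Fintype.piFinset Λ ⊆ Fintype.piFinset Λ' := by
    obtain ⟨Λc, -, hΛc⟩ := hΛ
    refine Fintype.piFinset_subset _ _ fun j l hl => ?_
    have : l ∈ (Λ' j : Set J) := by rw [hΛc j]; exact Or.inl hl
    exact this
  obtain ⟨h3, h4⟩ := hr.norm_le S
  refine ⟨by have := h.m_le; omega, fun x hx => h.pcg_mem S hp x fun h => hx (hsub h),
    norm_nonneg _, h4, by rw [Nat.add_sub_cancel]; exact h.energy_pcg_le S hp,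
    fun _ => ⟨r, rfl, h3, ?_⟩⟩
  have h5 := hΛ.le_norm_restr (by linarith) S.outer.α_lt.le
  have h6 : ‖restr (Fintype.piFinset Λ') r‖ ≤ ‖galRes B f Λ' xN‖ + Q.ω1 * ‖r‖ := by
    have h7 : restr (Fintype.piFinset Λ') r - galRes B f Λ' xN =
        restr (Fintype.piFinset Λ') (r - B (u - xN)) := by
      rw [galRes, ← S.sol, ← map_sub]
      exact restr_sub_restr _ _ _
    have h8 := norm_le_norm_add_norm_sub' (restr (Fintype.piFinset Λ') r) (galRes B f Λ' xN)
    rw [h7] at h8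
    have h9 := norm_restr_le (Fintype.piFinset Λ') (r - B (u - xN))
    rw [norm_sub_rev] at h9
    linarith
  linarith

end ErrorInv

/-- Data of a restart. -/
structure RestartData (P : Problem d K J) (Q : Params) (T : Finset (Finset (Fin d)))
    (B : L2 (Fin d → J) →L[ℝ] L2 (Fin d → J)) (f u : L2 (Fin d → J)) (k : ℕ)
    (v : L2 (Fin d → J)) (Λ : Fin d → Finset J) (ρ : ℝ) (v' xN z : L2 (Fin d → J)) : Prop where
  pcg : IsPCG P Q T B f Λ v ρ xN
  mem : xN ∈ suppIn (Fintype.piFinset Λ)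
  close : ‖u - xN‖ ≤ Q.ω3 * (Q.base k / Q.lamMin)
  trunc : IsTrunc T xN (Q.ω4 * Q.lamMin⁻¹ * Q.base k) z
  coarse : IsCoarse z (Q.ω5 * Q.lamMin⁻¹ * Q.base k) v'

lemma IsRestart.exists_data [Nonempty J] (S : Setup P Q T B f u s sStar t)
    (h : ErrorInv Q B f u k m v Λ ρ) (hr : IsRestart P Q T B f tol k m v Λ ρ v') :
    ∃ xN z, RestartData P Q T B f u k v Λ ρ v' xN z := by
  obtain ⟨u', r, z, hp, hr, -, hl, hT, hC⟩ := hr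
  exact ⟨u', z, hp, h.pcg_mem S hp, h.norm_sub_le_of_leave S hp hr hl, hT, hC⟩

namespace RestartData

lemma trunc_mem [Nonempty J] (S : Setup P Q T B f u s sStar t)
    (h : RestartData P Q T B f u k v Λ ρ v' xN z) : z ∈ suppIn (Fintype.piFinset Λ) := by
  obtain ⟨r, hr, -⟩ := h.trunc
  exact hr.support S.tree h.mem

lemma norm_sub_le (S : Setup P Q T B f u s sStar t)
    (h : RestartData P Q T B f u k v Λ ρ v' xN z) :
    ‖u - v'‖ ≤ Q.base (k + 1) / Q.lamMin := by
  have ha := S.spd.pos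
  have hb := S.base_pos k
  have h1 := h.close
  obtain ⟨r, -, h2, -⟩ := h.trunc
  have h3 := h.coarse.norm_sub_le (mul_nonneg (mul_nonneg S.ω5_pos.le (by positivity)) hb.le)
  have h4 : ‖u - v'‖ ≤ ‖u - xN‖ + ‖xN - z‖ + ‖z - v'‖ := by
    have : u - v' = (u - xN) + (xN - z) + (z - v') := by abel
    rw [this]; exact norm_add₃_le
  have h5 : Q.base (k + 1) / Q.lamMin = Q.ω3 * (Q.base k / Q.lamMin) +
      Q.ω4 * Q.lamMin⁻¹ * Q.base k + Q.ω5 * Q.lamMin⁻¹ * Q.base k := by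
    simp only [Params.base, pow_succ]; ring
  linarith

lemma energy_le (S : Setup P Q T B f u s sStar t)
    (h : RestartData P Q T B f u k v Λ ρ v' xN z) :
    energy B (u - v') ≤ √Q.lamMax * (Q.base (k + 1) / Q.lamMin) :=
  (S.energy_le_sqrt _).trans (mul_le_mul_of_nonneg_left (h.norm_sub_le S) (Real.sqrt_nonneg _))

lemma support_subset [Nonempty J] (S : Setup P Q T B f u s sStar t)
    (h : RestartData P Q T B f u k v Λ ρ v' xN z) {Γ : Fin d → Finset J}
    (hv' : v' = restr (Fintype.piFinset Γ) z)
    (hΛ' : ∀ j, (Λ' j : Set J) = Function.support (contr j v')) (j : Fin d) :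
    Λ' j ⊆ Γ j ∧ Λ' j ⊆ Λ j := by
  suffices h' : ∀ l ∈ Λ' j, l ∈ Γ j ∧ l ∈ Λ j from ⟨fun l hl => (h' l hl).1, fun l hl => (h' l hl).2⟩
  intro l hl
  have h1 : l ∈ Function.support (contr j v') := by rw [← hΛ' j]; exact hl
  have h2 : econtr j v' l ≠ 0 := fun h0 => h1 (by rw [contr, h0, ENNReal.toReal_zero])
  constructor
  · by_contra hne
    exact h2 (econtr_eq_zero_of_support (Λ := Γ) (by rw [hv']; exact restr_mem_suppIn _ _) hne)
  · by_contra hne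
    refine h2 (econtr_eq_zero_of_support (Λ := Λ) (fun x hx => ?_) hne)
    rw [hv']
    by_cases hxΓ : x ∈ Fintype.piFinset Γ
    · rw [restr, ofFinset_of_mem _ hxΓ]; exact h.trunc_mem S x hx
    · exact restr_of_notMem _ hxΓ

end RestartData

lemma Reach.errorInv [Nonempty J] (S : Setup P Q T B f u s sStar t)
    (h : Reach P Q T B f Λ0 tol k m v Λ ρ) : ErrorInv Q B f u k m v Λ ρ := by
  induction h with
  | start => exact .start S _
  | inner _ hp hr _ hl hΛ ih => exact ih.inner S hp hr hl hΛ
  | outer _ hr hΛ hres ih =>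
    obtain ⟨xN, z, hd⟩ := hr.exists_data S ih
    refine ⟨Nat.zero_le _, mem_suppIn_of_contr hΛ, norm_nonneg _, (hres.norm_le S).2, ?_, by simp⟩
    rw [Nat.zero_sub, pow_zero, one_mul]
    exact hd.energy_le S

end

section

variable {d K : ℕ} {J : Type*} {P : Problem d K J}
  {Q : Params} {T : Finset (Finset (Fin d))} {B : L2 (Fin d → J) →L[ℝ] L2 (Fin d → J)}
  {f u : L2 (Fin d → J)} {s sStar t : ℝ}
  {k m : ℕ} {v v' xN r z : L2 (Fin d → J)} {Λ Λ' Λ0 : Fin d → Finset J} {ρ tol : ℝ}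

/-! ### Cardinalities of the index sets -/

lemma Problem.sInv_pos (hP : P.Standing) {x : Fin d → J} (hx : 0 < P.weight x) :
    0 < P.sInv x := by
  rw [Problem.sInv_eq]
  refine (Problem.summable_expTerm hP hx).tsum_pos (fun k => ?_) 0 ?_
  · exact Set.indicator_nonneg (fun k _ => (Problem.expTerm_pos hP _ k).le) k
  · rw [Set.indicator_of_mem (by simp)]
    exact Problem.expTerm_pos hP _ 0

/-- Sum of the cardinalities of one-dimensional index sets. -/
def totalCard (Λ : Fin d → Finset J) : ℕ := ∑ j, (Λ j).card

namespace Setup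

/-- Bound for the norms of all iterates. -/
lemma exists_norm_bound (S : Setup P Q T B f u s sStar t) : ∃ V, 0 < V ∧
    ∀ (n k : ℕ) (v : L2 (Fin d → J)),
      energy B (u - v) ≤ Q.innerRate ^ n * (√Q.lamMax * (Q.base k / Q.lamMin)) → ‖v‖ ≤ V := by
  have ha := S.spd.pos
  have hb := S.lamMax_pos
  have h0 := S.outer.ω0_pos
  have h1 : 0 < √Q.lamMin := Real.sqrt_pos.2 ha
  refine ⟨‖u‖ + √Q.lamMax * (Q.ω0 / Q.lamMin) / √Q.lamMin + 1, by positivity,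
    fun n k v hv => ?_⟩
  have h2 : √Q.lamMin * ‖u - v‖ ≤ √Q.lamMax * (Q.ω0 / Q.lamMin) := by
    refine (S.sqrt_le_energy _).trans (hv.trans ?_)
    have h3 := pow_le_one₀ (n := n) S.innerRate_pos.le S.innerRate_lt_one.le
    have h4 := S.base_le k
    have h5 := S.base_pos k
    refine (mul_le_of_le_one_left (by positivity) h3).trans ?_
    gcongr
  have h3 : ‖u - v‖ ≤ √Q.lamMax * (Q.ω0 / Q.lamMin) / √Q.lamMin := by
    rw [le_div_iff₀ h1, mul_comm]; exact h2
  have h4 := norm_le_norm_add_norm_sub' v u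
  rw [norm_sub_rev] at h4
  linarith

/-- Negative powers of the tolerances grow at most exponentially. -/
lemma exists_pow_base_le (S : Setup P Q T B f u s sStar t) {c a b p : ℝ} (hc : 0 < c)
    (ha : 0 ≤ a) (hb : 0 ≤ b) (hp : p ≤ 0) : ∃ R, 1 ≤ R ∧ ∀ k, a * (c * Q.base k) ^ p + b ≤ R ^ (k + 1) := by
  have h0 := S.outer.ω0_pos
  have hq := S.sum_pos
  set q := Q.ω3 + Q.ω4 + Q.ω5 with hqd
  set g := q ^ p with hg
  set e := (c * Q.ω0) ^ p with he
  have he0 : 0 ≤ e := by positivity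
  have hg1 : 1 ≤ g := Real.one_le_rpow_of_pos_of_le_one_of_nonpos hq S.outer.sum_lt.le hp
  have hae := mul_nonneg ha he0
  refine ⟨a * e + b + g, by linarith, fun k => ?_⟩
  have h1 : (c * Q.base k) ^ p = e * g ^ k := by
    rw [Params.base, ← hqd, show c * (q ^ k * Q.ω0) = (c * Q.ω0) * q ^ k by ring,
      Real.mul_rpow (by positivity) (by positivity), ← Real.rpow_natCast, ← Real.rpow_natCast,
      ← Real.rpow_mul hq.le, hg, ← Real.rpow_mul hq.le, mul_comm p]
  rw [h1, pow_succ]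
  have h2 : 1 ≤ g ^ k := one_le_pow₀ hg1
  have h3 : g ^ k ≤ (a * e + b + g) ^ k := by gcongr; linarith
  calc a * (e * g ^ k) + b ≤ g ^ k * (a * e + b) := by nlinarith
    _ ≤ (a * e + b + g) ^ k * (a * e + b + g) :=
        mul_le_mul h3 (by linarith) (by linarith) (by positivity)

/-- Number of indices after coarsening. -/
lemma exists_totalCard_coarse_le [Nonempty J] (S : Setup P Q T B f u s sStar t) : ∃ R, 1 ≤ R ∧
    ∀ (k : ℕ) (v : L2 (Fin d → J)) (Λ : Fin d → Finset J) (ρ : ℝ) (v' xN z : L2 (Fin d → J))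
      (Γ : Fin d → Finset J), RestartData P Q T B f u k v Λ ρ v' xN z →
      IsCoarseSets z (Q.ω5 * Q.lamMin⁻¹ * Q.base k) Γ → (totalCard Γ : ℝ) ≤ R ^ (k + 1) := by
  obtain ⟨A, hA, hΛ⟩ := exists_restr_of_asNorm S.s_pos S.sparse
  have ha := S.spd.pos
  have hω3 := S.outer.ω3_pos
  have hd0 : (0 : ℝ) < d := by have := S.two_le; exact_mod_cast (by omega : 0 < d)
  have hsd : 0 < √(d : ℝ) := Real.sqrt_pos.2 hd0
  have hω5 : √d * Q.ω3 < Q.ω5 := by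
    refine lt_of_le_of_lt ?_ S.outer.ω5_gt
    have := mul_nonneg (mul_nonneg hsd.le (Real.sqrt_nonneg (2 * d - 3))) hω3.le
    linarith
  -- The coarsening tolerance is split: √d ω3 accounts for the distance of the solver's output to u,
  -- and the rest is available for the tails of u, where best N-term approximations are small. The
  -- resulting sets compete with the minimal ones; truncation in between does not enlarge
  -- contractions.
  set c := (Q.ω5 - √d * Q.ω3) / (Q.lamMin * √d) with hc
  have hc0 : 0 < c := div_pos (by linarith) (by positivity)
  obtain ⟨R, hR1, hR⟩ := S.exists_pow_base_le hc0 (a := d * A) (b := d) (by positivity) hd0.le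
    (show -1 / s ≤ 0 from div_nonpos_of_nonpos_of_nonneg (by norm_num) S.s_pos.le)
  refine ⟨R, hR1, fun k v Λ ρ v' xN z Γ h hΓ => ?_⟩
  have hb := S.base_pos k
  obtain ⟨Λs, hcard, htail⟩ := hΛ (c * Q.base k) (by positivity)
  have h1 : contrTail xN Λs ≤ ENNReal.ofReal ((√d * Q.ω3 * (Q.base k / Q.lamMin) +
      √d * (c * Q.base k)) ^ 2) := by
    refine contrTail_le_of_close (v := u) (by positivity) (by positivity) ?_ ?_
    · rw [mul_pow, Real.sq_sqrt hd0.le]; exact htail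
    · rw [mul_assoc (√(d : ℝ)), mul_pow, Real.sq_sqrt hd0.le]
      have := h.close
      gcongr
  have h2 : √d * Q.ω3 * (Q.base k / Q.lamMin) + √d * (c * Q.base k) =
      Q.ω5 * Q.lamMin⁻¹ * Q.base k := by
    rw [hc]; field_simp; ring
  rw [h2] at h1
  have h3 : contrTail z Λs ≤ contrTail xN Λs := by
    obtain ⟨rk, hrk, -⟩ := h.trunc
    exact contrTail_mono (hrk.econtr_le' S.tree h.mem)
  have h4 : (totalCard Γ : ℝ) ≤ totalCard Λs := by
    exact_mod_cast hΓ.minimal Λs (h3.trans h1)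
  refine h4.trans (le_trans ?_ (hR k))
  rw [totalCard, Nat.cast_sum]
  calc ∑ j, ((Λs j).card : ℝ) ≤ ∑ _j : Fin d, (A * (c * Q.base k) ^ (-1 / s) + 1) :=
        Finset.sum_le_sum fun j _ => hcard j
    _ = _ := by rw [Finset.sum_const, nsmul_eq_mul, Finset.card_univ, Fintype.card_fin]; ring

/-- One-dimensional index sets of the approximate right hand sides. -/
lemma exists_rhs_sets (S : Setup P Q T B f u s sStar t) : ∃ C, 0 ≤ C ∧ ∀ ε, 0 < ε →
    ∃ Φ : Fin d → Finset J, Function.support (P.fApp ε) ⊆ Fintype.piFinset Φ ∧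
      (totalCard Φ : ℝ) ≤ C * ε ^ (-1 / s) := by
  classical
  obtain ⟨C, hC, hsp⟩ := S.rhs.sparse
  -- Sparsity of the scaled right hand side follows from that of the solution, because f is its
  -- image under the compressible operator.
  have hsum : ∑ j, asNorm s (contr j f) ≠ ⊤ := by
    rw [← S.sol]
    exact ENNReal.sum_ne_top.2 fun j _ => S.scaled.asNorm_ne_top S.standing S.two_le S.s_pos
      S.s_lt S.comp S.sparse j
  set G := (∑ j, asNorm s (contr j f)) ^ (1 / s) with hG
  have hs := S.s_pos
  have hGt : G ≠ ⊤ := ENNReal.rpow_ne_top_of_nonneg (by positivity) hsum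
  refine ⟨C * G.toReal, by positivity, fun ε hε => ?_⟩
  have h1 := (hsp ε hε).1
  set g : (Fin d → J) → ℝ := fun x => P.sInv x * P.fApp ε x with hgd
  have hrt : ENNReal.ofReal (C * ε ^ (-1 / s)) * G ≠ ⊤ :=
    ENNReal.mul_ne_top ENNReal.ofReal_ne_top hGt
  have hfin : ∀ j, (Function.support fun l => contr j g l).Finite := by
    intro j
    have h2 := ENNReal.sum_ne_top.1 (ne_top_of_le_ne_top hrt h1) j (Finset.mem_univ j)
    rw [← Set.encard_ne_top_iff]
    intro h3
    exact h2 (by rw [h3]; rfl)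
  refine ⟨fun j => (hfin j).toFinset, fun x hx => ?_, ?_⟩
  · rw [Finset.mem_coe, Fintype.mem_piFinset]
    intro j
    rw [Set.Finite.mem_toFinset, Function.mem_support]
    have hgx : g x ≠ 0 := mul_ne_zero (Problem.sInv_pos S.standing
      (zero_lt_one.trans_le (S.standing.one_le_weight S.two_le x))).ne' hx
    have hfs := S.rhs.finite ε hε
    have hgL : g = ofFinset hfs.toFinset g := by
      funext y
      by_cases hy : y ∈ hfs.toFinset
      · rw [ofFinset_of_mem _ hy]
      · rw [ofFinset_of_notMem _ hy]
        rw [Set.Finite.mem_toFinset, Function.notMem_support] at hy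
        simp [hgd, hy]
    have h3 : econtr j g (x j) ≠ ⊤ := by rw [hgL]; exact econtr_ne_top j _ _
    rw [contr, ENNReal.toReal_ne_zero]
    exact ⟨fun h0 => hgx (econtr_eq_zero_iff.1 h0 x rfl), h3⟩
  · have h2 : ((totalCard (fun j => (hfin j).toFinset) : ℕ) : ℝ≥0∞) ≤
        ENNReal.ofReal (C * ε ^ (-1 / s)) * G := by
      refine le_trans (le_of_eq ?_) h1
      rw [totalCard, Nat.cast_sum]
      refine Finset.sum_congr rfl fun j _ => ?_
      rw [(hfin j).encard_eq_coe_toFinset_card]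
      rfl
    have h3 := ENNReal.toReal_mono hrt h2
    rw [ENNReal.toReal_natCast, ENNReal.toReal_mul, ENNReal.toReal_ofReal (by positivity)] at h3
    exact h3.trans (le_of_eq (by ring))

/-- Number of indices in the evaluation of residuals. -/
lemma exists_totalCard_res_le (S : Setup P Q T B f u s sStar t) {V : ℝ} (hV : 0 < V) :
    ∃ C, 1 ≤ C ∧ ∀ (Λ : Fin d → Finset J) (v r : L2 (Fin d → J)),
      v ∈ suppIn (Fintype.piFinset Λ) → ‖v‖ ≤ V → IsRes P Q B f Λ v r →
      0 < ‖r‖ ∧ ∃ (η ε : ℝ) (Λt : Fin d → Finset J), 0 < ε ∧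
        r = P.approxRes η (P.fApp ε) (Fintype.piFinset Λt) (Fintype.piFinset Λ) v ∧
        (totalCard Λt : ℝ) ≤ C * (1 + ‖r‖ ^ (-1 / s)) * (1 + totalCard Λ) := by
  classical
  obtain ⟨a, C₁, hasum, ha, hC₁, hcompr⟩ :=
    S.scaled.exists_compression S.standing S.two_le S.s_pos S.s_lt S.comp
  obtain ⟨C₂, hC₂, hrhs⟩ := S.exists_rhs_sets
  have hs := S.s_pos
  have hδ := S.standing.delta_pos
  have hω1 := S.outer.ω1_pos
  have hcR := S.outer.cRes_pos
  have hcS := S.outer.cSet_ge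
  set a₀ := ∑' p, a p with ha₀
  have ha₀0 : 0 ≤ a₀ := tsum_nonneg ha
  have hale : ∀ p, a p ≤ a₀ := fun p => hasum.le_tsum p fun i _ => ha i
  set W := ((C₁ + 1) * V) ^ (1 / s) with hW
  have hW0 : 0 ≤ W := by positivity
  set c := Q.cRes * Q.ω1 / (3 * (1 + P.delta) * (2 + P.delta)) with hc
  have hc0 : 0 < c := by positivity
  set D := 1 + a₀ + 2 * a₀ * W + C₂ with hD
  have haW := mul_nonneg ha₀0 hW0
  have hD1 : 1 ≤ D := by rw [hD]; linarith
  set E := 1 + c ^ (-1 / s) with hE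
  have hcs : 0 ≤ c ^ (-1 / s) := by positivity
  have hE1 : 1 ≤ E := by rw [hE]; linarith
  have hne : -1 / s ≤ 0 := div_nonpos_of_nonpos_of_nonneg (by norm_num) hs.le
  refine ⟨Q.cSet * D * E, one_le_mul_of_one_le_of_one_le
    (one_le_mul_of_one_le_of_one_le hcS hD1) hE1, fun Λ v r hv hvV h => ?_⟩
  obtain ⟨tol, ε, Λt, htol, hε, hsets, hmin, hr, htl, htu, -⟩ := h
  have hr0 : 0 < ‖r‖ := by
    by_contra h0
    nlinarith
  have hε0 : 0 < ε := by rw [hε]; positivity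
  refine ⟨hr0, _, ε, Λt, hε0, hr, ?_⟩
  have hεr : c * ‖r‖ ≤ ε := by
    rw [hε, hc, div_mul_eq_mul_div]
    gcongr
    linarith
  -- The compression level: 2^{sp} must reach the order of V/ε, and 2^p is then O(1 + ε^{-1/s}).
  obtain ⟨p, hp1, hp2⟩ := exists_two_pow_near (((C₁ + 1) * V / ε) ^ (1 / s))
  obtain ⟨Λ₁, hΛ₁, hcard₁, hacc₁⟩ := hcompr p Λ v hv
  obtain ⟨Φ, hΦ, hcardΦ⟩ := hrhs ε hε0
  have hX : ((C₁ + 1) * V / ε) ^ (1 / s) = W * ε ^ (-1 / s) := by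
    rw [div_eq_mul_inv, Real.mul_rpow (by positivity) (by positivity), Real.inv_rpow hε0.le,
      ← Real.rpow_neg hε0.le, ← neg_div]
  have hpow : C₁ * (2 : ℝ) ^ (-s * p) * ‖v‖ ≤ ε := by
    have h1 : (C₁ + 1) * V / ε ≤ (2 : ℝ) ^ (s * p) := by
      have h2 := Real.rpow_le_rpow (by positivity) hp1 hs.le
      rw [← Real.rpow_mul (by positivity), one_div_mul_cancel hs.ne', Real.rpow_one,
        ← Real.rpow_natCast, ← Real.rpow_mul (by norm_num), mul_comm (p : ℝ)] at h2
      exact h2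
    rw [div_le_iff₀ hε0] at h1
    have h3 : 0 < (2 : ℝ) ^ (s * p) := by positivity
    rw [neg_mul, Real.rpow_neg (by norm_num), mul_right_comm, ← div_eq_mul_inv,
      div_le_iff₀ h3, mul_comm ε]
    refine le_trans ?_ h1
    gcongr
    linarith
  have hres : ResSets P B Λ v ε fun j => Λ₁ j ∪ Φ j := by
    refine ⟨fun j => (hΛ₁ j).trans Finset.subset_union_left, hΦ.trans fun x hx => ?_, ?_⟩
    · rw [Finset.mem_coe, Fintype.mem_piFinset] at hx ⊢
      exact fun j => Finset.mem_union_right _ (hx j)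
    · have h1 : ‖B v - restr (Fintype.piFinset fun j => Λ₁ j ∪ Φ j) (B v)‖ ≤
          ‖B v - restr (Fintype.piFinset Λ₁) (B v)‖ := by
        refine norm_sub_restr_le _ _ fun x hx => restr_of_notMem _ fun hx' => hx ?_
        rw [Fintype.mem_piFinset] at hx' ⊢
        exact fun j => Finset.mem_union_left _ (hx' j)
      refine h1.trans (hacc₁.trans (hpow.trans ?_))
      exact le_mul_of_one_le_left hε0.le (one_le_pow₀ (by linarith))
  have h1 := hmin _ hres
  have hy0 : 0 ≤ ε ^ (-1 / s) := by positivity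
  set y := ε ^ (-1 / s) with hy
  have h2 : a p * 2 ^ p ≤ a₀ * (2 * (W * y) + 1) := by
    rw [hX, max_eq_left (by positivity)] at hp2
    have := ha p
    have := hale p
    gcongr
  have h3 : ((∑ j, (Λ₁ j ∪ Φ j).card : ℕ) : ℝ) ≤ D * (1 + y) * (1 + totalCard Λ) := by
    have h4 : ((∑ j, (Λ₁ j ∪ Φ j).card : ℕ) : ℝ) ≤
        (1 + a₀ * (2 * (W * y) + 1)) * totalCard Λ + C₂ * y := by
      refine le_trans ?_ (add_le_add_right hcardΦ _)
      rw [totalCard, totalCard, Nat.cast_sum, Nat.cast_sum, Nat.cast_sum, Finset.mul_sum,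
        ← Finset.sum_add_distrib]
      refine Finset.sum_le_sum fun j _ => ?_
      refine le_trans (by exact_mod_cast Finset.card_union_le _ _) (add_le_add_left
        ((hcard₁ j).trans (mul_le_mul_of_nonneg_right (by linarith) (Nat.cast_nonneg _))) _)
    refine h4.trans ?_
    have hn : (0 : ℝ) ≤ totalCard Λ := Nat.cast_nonneg _
    have hrest : 0 ≤ 1 + y + y * totalCard Λ + a₀ * (1 + y + y * totalCard Λ) +
        2 * (a₀ * W) * (1 + y + totalCard Λ) + C₂ * (1 + totalCard Λ + y * totalCard Λ) := by
      positivity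
    rw [hD]
    linarith
  have h4 : y ≤ c ^ (-1 / s) * ‖r‖ ^ (-1 / s) := by
    rw [← Real.mul_rpow hc0.le hr0.le]
    exact Real.rpow_le_rpow_of_nonpos (by positivity) hεr hne
  have h5 : 1 + y ≤ E * (1 + ‖r‖ ^ (-1 / s)) := by
    have : 0 ≤ ‖r‖ ^ (-1 / s) := by positivity
    rw [hE]; nlinarith
  calc (totalCard Λt : ℝ) ≤ Q.cSet * (D * (1 + y) * (1 + totalCard Λ)) := h1.trans (by gcongr)
    _ ≤ Q.cSet * (D * (E * (1 + ‖r‖ ^ (-1 / s))) * (1 + totalCard Λ)) := by gcongr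
    _ = _ := by ring

end Setup

/-- The index sets for the evaluation of the residual in the course of the inner iteration. -/
structure InnerData (P : Problem d K J) (Λ : Fin d → Finset J) (xN r : L2 (Fin d → J))
    (Λt : Fin d → Finset J) (b : ℝ) : Prop where
  eq : ∃ η ε, 0 < ε ∧ r = P.approxRes η (P.fApp ε) (Fintype.piFinset Λt) (Fintype.piFinset Λ) xN
  card_le : (totalCard Λt : ℝ) ≤ b

lemma InnerData.mem {Λt : Fin d → Finset J} {b : ℝ} (h : InnerData P Λ xN r Λt b) :
    r ∈ suppIn (Fintype.piFinset Λt) := by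
  obtain ⟨η, ε, -, rfl⟩ := h.eq
  exact approxRes_mem _ _ _ _ _ _

/-- Exponential bound for the number of indices. -/
lemma Setup.exists_totalCard_le [Nonempty J] (S : Setup P Q T B f u s sStar t)
    (Λ0 : Fin d → Finset J) : ∃ R : ℝ, 1 ≤ R ∧
    (∀ (tol : ℝ) (k m : ℕ) (v : L2 (Fin d → J)) (Λ : Fin d → Finset J) (ρ : ℝ),
      Reach P Q T B f Λ0 tol k m v Λ ρ → (totalCard Λ : ℝ) ≤ R ^ (k + 1)) ∧
    ∀ (tol : ℝ) (k m : ℕ) (v : L2 (Fin d → J)) (Λ : Fin d → Finset J) (ρ : ℝ)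
      (xN r : L2 (Fin d → J)), Reach P Q T B f Λ0 tol k m v Λ ρ →
      IsPCG P Q T B f Λ v ρ xN → IsRes P Q B f Λ xN r → ¬ LeaveInner Q k m r →
      ∃ Λt, InnerData P Λ xN r Λt (R ^ (k + 1)) := by
  classical
  obtain ⟨V, hV, hnorm⟩ := S.exists_norm_bound
  obtain ⟨C, hC, hres⟩ := S.exists_totalCard_res_le hV
  obtain ⟨R₁, hR₁, hcoarse⟩ := S.exists_totalCard_coarse_le
  have hω1 := S.outer.ω1_pos
  have hω3 := S.outer.ω3_pos
  have hs := S.s_pos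
  have hne : -1 / s ≤ 0 := div_nonpos_of_nonpos_of_nonneg (by norm_num) hs.le
  obtain ⟨R₂, hR₂, hpow⟩ := S.exists_pow_base_le (c := Q.ω3 / (1 + Q.ω1)) (a := 1) (b := 1)
    (by positivity) zero_le_one zero_le_one hne
  -- one inner step
  have hinner : ∀ (R : ℝ), 1 ≤ R → ∀ (tol : ℝ) (k m : ℕ) (v : L2 (Fin d → J))
      (Λ : Fin d → Finset J) (ρ : ℝ) (xN r : L2 (Fin d → J)),
      Reach P Q T B f Λ0 tol k m v Λ ρ → (totalCard Λ : ℝ) ≤ R ^ (k + 1) →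
      IsPCG P Q T B f Λ v ρ xN → IsRes P Q B f Λ xN r → ¬ LeaveInner Q k m r →
      ∃ Λt, InnerData P Λ xN r Λt ((2 * C * R₂ * R) ^ (k + 1)) := by
    intro R hR tol k m v Λ ρ xN r hreach hcard hp hr hl
    have hinv := hreach.errorInv S
    obtain ⟨hr0, η, ε, Λt, hε, hrt, hcardt⟩ := hres Λ xN r (hinv.pcg_mem S hp)
      (hnorm m k xN (hinv.energy_pcg_le S hp)) hr
    refine ⟨Λt, ⟨η, ε, hε, hrt⟩, hcardt.trans ?_⟩
    have h1 : Q.ω3 / (1 + Q.ω1) * Q.base k ≤ ‖r‖ := by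
      rw [LeaveInner, not_or, not_le] at hl
      rw [div_mul_eq_mul_div, div_le_iff₀ (by linarith)]
      linarith [hl.1]
    have h2 : 1 + ‖r‖ ^ (-1 / s) ≤ R₂ ^ (k + 1) := by
      refine le_trans ?_ (hpow k)
      have := Real.rpow_le_rpow_of_nonpos (by have := S.base_pos k; positivity) h1 hne
      linarith
    have h3 : 1 ≤ R ^ (k + 1) := one_le_pow₀ hR
    have h4 : 2 * C ≤ (2 * C) ^ (k + 1) := le_self_pow₀ (by linarith) (by omega)
    calc C * (1 + ‖r‖ ^ (-1 / s)) * (1 + totalCard Λ)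
        ≤ C * R₂ ^ (k + 1) * (2 * R ^ (k + 1)) := by gcongr; linarith
      _ = 2 * C * R₂ ^ (k + 1) * R ^ (k + 1) := by ring
      _ ≤ (2 * C) ^ (k + 1) * R₂ ^ (k + 1) * R ^ (k + 1) := by gcongr
      _ = _ := by rw [← mul_pow, ← mul_pow]
  -- Induction on the inner index only. At m = 0 coarsening bounds the sets irrespective of the
  -- past, so the base of the exponential grows with each of the at most M inner steps but never
  -- accumulates over k.
  have key : ∀ n : ℕ, ∃ R : ℝ, 1 ≤ R ∧ ∀ (tol : ℝ) (k m : ℕ) (v : L2 (Fin d → J))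
      (Λ : Fin d → Finset J) (ρ : ℝ), m ≤ n → Reach P Q T B f Λ0 tol k m v Λ ρ →
      (totalCard Λ : ℝ) ≤ R ^ (k + 1) := by
    intro n
    induction n with
    | zero =>
      refine ⟨R₁ + totalCard Λ0, le_add_of_le_of_nonneg hR₁ (Nat.cast_nonneg _),
        fun tol k m v Λ ρ hm h => ?_⟩
      have h0 : (0 : ℝ) ≤ totalCard Λ0 := Nat.cast_nonneg _
      cases h with
      | start => rw [zero_add, pow_one]; linarith
      | inner => omega
      | @outer k m w _ _ Λ₁ _ ρ₁ hreach hrs hΛ hr =>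
        obtain ⟨xN, z, hd⟩ := hrs.exists_data S (hreach.errorInv S)
        obtain ⟨Γ, hΓ, hv⟩ := hd.coarse
        have h1 := hcoarse k _ _ _ _ _ _ _ hd hΓ
        have h2 : (totalCard Λ : ℝ) ≤ totalCard Γ := by
          exact_mod_cast Finset.sum_le_sum fun j _ =>
            Finset.card_le_card (hd.support_subset S hv hΛ j).1
        refine h2.trans (h1.trans ?_)
        calc R₁ ^ (k + 1) ≤ R₁ ^ (k + 1 + 1) := pow_le_pow_right₀ hR₁ (by omega)
          _ ≤ _ := by gcongr; linarith
    | succ n ih =>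
      obtain ⟨R, hR, hn⟩ := ih
      have h21 : 1 ≤ 2 * C * R₂ := by nlinarith
      refine ⟨2 * (2 * C * R₂ * R), by nlinarith, fun tol k m v Λ ρ hm h => ?_⟩
      have hRle : R ≤ 2 * C * R₂ * R := le_mul_of_one_le_left (by linarith) h21
      have hmono : R ^ (k + 1) ≤ (2 * C * R₂ * R) ^ (k + 1) := by gcongr
      have h2 : 2 * (2 * C * R₂ * R) ^ (k + 1) ≤ (2 * (2 * C * R₂ * R)) ^ (k + 1) := by
        rw [mul_pow 2]
        gcongr
        exact le_self_pow₀ (by norm_num) (by omega)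
      have h3 : 0 ≤ (2 * C * R₂ * R) ^ (k + 1) := by positivity
      rcases hm.lt_or_eq with hm | rfl
      · have := hn tol k m v Λ ρ (by omega) h
        linarith
      · cases h with
        | @inner _ _ w _ r Λ₁ _ ρ₁ hreach hp hr ht hl hΛ =>
          have h4 := hn tol k n w Λ₁ ρ₁ le_rfl hreach
          obtain ⟨Λt, hΛt⟩ := hinner R hR tol k n w Λ₁ ρ₁ v r hreach h4 hp hr hl
          obtain ⟨Λc, hΛc, hun⟩ := hΛ
          have h5 : (totalCard Λc : ℝ) ≤ totalCard Λt := by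
            exact_mod_cast hΛc.card_le_of_support hΛt.mem
          have h6 : (totalCard Λ : ℝ) ≤ totalCard Λ₁ + totalCard Λc := by
            rw [totalCard, totalCard, totalCard, ← Nat.cast_add, ← Finset.sum_add_distrib]
            refine Nat.cast_le.2 (Finset.sum_le_sum fun j _ => ?_)
            have : Λ j = Λ₁ j ∪ Λc j := by
              rw [← Finset.coe_inj, Finset.coe_union]; exact hun j
            rw [this]; exact Finset.card_union_le _ _
          have := hΛt.card_le
          linarith
  obtain ⟨R, hR, hcard⟩ := key Q.M
  have h21 : 1 ≤ 2 * C * R₂ := by nlinarith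
  have hRle : R ≤ 2 * C * R₂ * R := le_mul_of_one_le_left (by linarith) h21
  have hall : ∀ (tol : ℝ) (k m : ℕ) (v : L2 (Fin d → J)) (Λ : Fin d → Finset J) (ρ : ℝ),
      Reach P Q T B f Λ0 tol k m v Λ ρ → (totalCard Λ : ℝ) ≤ R ^ (k + 1) :=
    fun tol k m v Λ ρ h => hcard tol k m v Λ ρ (h.errorInv S).m_le h
  refine ⟨2 * C * R₂ * R, by linarith, fun tol k m v Λ ρ h => ?_,
    fun tol k m v Λ ρ xN r h => hinner R hR tol k m v Λ ρ xN r h (hall tol k m v Λ ρ h)⟩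
  exact (hall tol k m v Λ ρ h).trans (by gcongr)

end

section

variable {d K : ℕ} {J : Type*} {P : Problem d K J}
  {Q : Params} {T : Finset (Finset (Fin d))} {B : L2 (Fin d → J) →L[ℝ] L2 (Fin d → J)}
  {f u : L2 (Fin d → J)} {s sStar t : ℝ}
  {k m : ℕ} {v v' xN r z : L2 (Fin d → J)} {Λ Λ' Λ0 : Fin d → Finset J} {ρ tol : ℝ}

/-! ### Weights of the index sets -/

lemma LeaveInner.le_norm (S : Setup P Q T B f u s sStar t) (hl : ¬ LeaveInner Q k m r) :
    Q.ω3 / (1 + Q.ω1) * Q.base k ≤ ‖r‖ := by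
  have hω1 := S.outer.ω1_pos
  rw [LeaveInner, not_or, not_le] at hl
  rw [div_mul_eq_mul_div, div_le_iff₀ (by linarith)]
  linarith [hl.1]

namespace Setup

/-- Weights of the indices added in an inner step. -/
lemma exists_weight_expand_le [Nonempty J] (S : Setup P Q T B f u s sStar t)
    (Λ0 : Fin d → Finset J) : ∃ R : ℝ, 1 ≤ R ∧
    ∀ (tol : ℝ) (k m : ℕ) (v : L2 (Fin d → J)) (Λ : Fin d → Finset J) (ρ : ℝ)
      (xN r : L2 (Fin d → J)) (Λ' : Fin d → Finset J), Reach P Q T B f Λ0 tol k m v Λ ρ →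
      IsPCG P Q T B f Λ v ρ xN → IsRes P Q B f Λ xN r → ¬ LeaveInner Q k m r →
      IsExpand Λ r Q.α Λ' → ∀ c, 1 ≤ c → P.WBound t c xN → ∀ j, ∀ l ∈ Λ' j,
      l ∈ Λ j ∨ P.w j l ^ t ≤ c * R ^ (k + 1) := by
  obtain ⟨R₁, hR₁, -, hres⟩ := S.exists_totalCard_le Λ0
  obtain ⟨C₁, hC₁, happ⟩ := S.exists_wBound_approxRes
  have hω1 := S.outer.ω1_pos
  have hω3 := S.outer.ω3_pos
  have hα : 0 < √(1 - Q.α ^ 2) := Real.sqrt_pos.2 (by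
    have := S.outer.α_lt; have := S.outer.ω1_lt; nlinarith)
  obtain ⟨R₂, hR₂, hpow⟩ := S.exists_pow_base_le
    (c := √(1 - Q.α ^ 2) * (Q.ω3 / (1 + Q.ω1))) (a := 4 * C₁) (b := 0)
    (by positivity) (by linarith) le_rfl (show (-1 : ℝ) ≤ 0 by norm_num)
  refine ⟨R₂ * R₁, one_le_mul_of_one_le_of_one_le hR₂ hR₁,
    fun tol k m v Λ ρ xN r Λ' hreach hp hr hl hΛ c hc hw j l hlj => ?_⟩
  obtain ⟨Λt, hΛt⟩ := hres tol k m v Λ ρ xN r hreach hp hr hl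
  obtain ⟨Λc, hΛc, hun⟩ := hΛ
  have hl' : l ∈ (Λ' j : Set J) := hlj
  rw [hun j] at hl'
  refine hl'.imp id fun hlc => ?_
  have hwr : P.WBound t (C₁ * (1 + c)) r := by
    obtain ⟨η, ε, hε, hre⟩ := hΛt.eq
    rw [hre]
    exact (happ η _ _ xN c (by linarith) hw).2 ε hε
  have h1 := hΛc.weight_le S.standing hΛt.mem (by positivity) hwr hlc
  have h2 := LeaveInner.le_norm S hl
  have hb := S.base_pos k
  have hwt : 0 ≤ P.w j l ^ t := Real.rpow_nonneg (S.standing.w_pos j l).le _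
  have hR1k : 1 ≤ R₁ ^ (k + 1) := one_le_pow₀ hR₁
  have h3 : ((∑ i, (Λt i).card + 1 : ℕ) : ℝ) ≤ 2 * R₁ ^ (k + 1) := by
    have := hΛt.card_le
    rw [totalCard] at this
    push_cast at this ⊢
    linarith
  have h4 : P.w j l ^ t * (√(1 - Q.α ^ 2) * (Q.ω3 / (1 + Q.ω1)) * Q.base k) ≤
      4 * C₁ * c * R₁ ^ (k + 1) := by
    calc _ ≤ P.w j l ^ t * (√(1 - Q.α ^ 2) * ‖r‖) := by
          rw [mul_assoc (√(1 - Q.α ^ 2))]; gcongr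
      _ ≤ C₁ * (1 + c) * (2 * R₁ ^ (k + 1)) := h1.trans (by gcongr)
      _ ≤ C₁ * (2 * c) * (2 * R₁ ^ (k + 1)) := by gcongr; linarith
      _ = _ := by ring
  have h5 := hpow k
  rw [Real.rpow_neg_one, add_zero] at h5
  rw [← le_div_iff₀ (by positivity)] at h4
  calc _ ≤ _ := h4
    _ = c * (4 * C₁ * (√(1 - Q.α ^ 2) * (Q.ω3 / (1 + Q.ω1)) * Q.base k)⁻¹ * R₁ ^ (k + 1)) := by
        rw [div_eq_mul_inv]; ring
    _ ≤ c * (R₂ ^ (k + 1) * R₁ ^ (k + 1)) := by gcongr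
    _ = _ := by rw [mul_pow]

/-- Weights of the indices kept by coarsening. -/
lemma exists_weight_coarse_le [Nonempty J] (S : Setup P Q T B f u s sStar t)
    (Λ0 : Fin d → Finset J) : ∃ R : ℝ, 1 ≤ R ∧
    ∀ (tol : ℝ) (k m : ℕ) (v : L2 (Fin d → J)) (Λ : Fin d → Finset J) (ρ : ℝ)
      (v' xN z : L2 (Fin d → J)) (Λ' : Fin d → Finset J), Reach P Q T B f Λ0 tol k m v Λ ρ →
      RestartData P Q T B f u k v Λ ρ v' xN z →
      (∀ j, (Λ' j : Set J) = Function.support (contr j v')) →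
      ∀ c, 1 ≤ c → P.WBound t c xN → ∀ j, ∀ l ∈ Λ' j, P.w j l ^ t ≤ c * R ^ (k + 1) := by
  obtain ⟨R₁, hR₁, hcard, -⟩ := S.exists_totalCard_le Λ0
  have ha := S.spd.pos
  have hω5 := S.ω5_pos
  obtain ⟨R₂, hR₂, hpow⟩ := S.exists_pow_base_le (c := Q.ω5 * Q.lamMin⁻¹) (a := 2) (b := 0)
    (by positivity) (by norm_num) le_rfl (show (-1 : ℝ) ≤ 0 by norm_num)
  refine ⟨R₂ * R₁, one_le_mul_of_one_le_of_one_le hR₂ hR₁,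
    fun tol k m v Λ ρ v' xN z Λ' hreach hd hΛ' c hc hw j l hlj => ?_⟩
  obtain ⟨Γ, hΓ, hv'⟩ := hd.coarse
  have hl := (hd.support_subset S hv' hΛ' j).1 hlj
  have hwz : P.WBound t c z := by
    obtain ⟨rk, hrk, -⟩ := hd.trunc
    exact hrk.wBound S.tree hd.mem hw
  have h1 := hΓ.weight_le S.standing (hd.trunc_mem S) (by linarith) hwz hl
  have hb := S.base_pos k
  have hR1k : 1 ≤ R₁ ^ (k + 1) := one_le_pow₀ hR₁
  have h3 : ((∑ i, (Λ i).card + 1 : ℕ) : ℝ) ≤ 2 * R₁ ^ (k + 1) := by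
    have := hcard _ _ _ _ _ _ hreach
    rw [totalCard] at this
    push_cast at this ⊢
    linarith
  have h4 := h1.trans (mul_le_mul_of_nonneg_left h3 (by linarith))
  have h5 := hpow k
  rw [Real.rpow_neg_one, add_zero] at h5
  rw [← le_div_iff₀ (by positivity)] at h4
  calc _ ≤ _ := h4
    _ = c * (2 * (Q.ω5 * Q.lamMin⁻¹ * Q.base k)⁻¹ * R₁ ^ (k + 1)) := by
        rw [div_eq_mul_inv]; ring
    _ ≤ c * (R₂ ^ (k + 1) * R₁ ^ (k + 1)) := by gcongr
    _ = _ := by rw [mul_pow]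

/-- The weighted norms of the iterates grow at most exponentially, unless the solver
may stall. -/
lemma exists_wBound_pow [Nonempty J] (S : Setup P Q T B f u s sStar t)
    (hst : 0 < Q.stallMargin) (Λ0 : Fin d → Finset J) : ∃ R : ℝ, 1 ≤ R ∧
    ∀ (tol : ℝ) (k m : ℕ) (v : L2 (Fin d → J)) (Λ : Fin d → Finset J) (ρ : ℝ)
      (xN : L2 (Fin d → J)), Reach P Q T B f Λ0 tol k m v Λ ρ →
      IsPCG P Q T B f Λ v ρ xN → P.WBound t (R ^ (k + 1)) xN := by
  obtain ⟨C, hC, hpcg⟩ := S.exists_wBound_pcg hst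
  have h2C : 1 ≤ 2 * C := by linarith
  have hstep : ∀ (tol : ℝ) (k m : ℕ) (v : L2 (Fin d → J)) (Λ : Fin d → Finset J) (ρ : ℝ)
      (xN : L2 (Fin d → J)) (n : ℕ), Reach P Q T B f Λ0 tol k m v Λ ρ →
      IsPCG P Q T B f Λ v ρ xN → P.WBound t ((2 * C) ^ n) v →
      P.WBound t ((2 * C) ^ (n + 1)) xN := by
    intro tol k m v Λ ρ xN n h hp hw
    have hinv := h.errorInv S
    obtain ⟨w, N, x, dir, hrun⟩ := hinv.exists_run S hp
    have h1 : 1 ≤ (2 * C) ^ n := one_le_pow₀ h2C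
    refine (hpcg _ _ _ _ _ _ _ _ hrun hinv.res_le _ (by positivity) hw).mono (by positivity) ?_
    rw [pow_succ]; nlinarith
  have hv : ∀ (tol : ℝ) (k m : ℕ) (v : L2 (Fin d → J)) (Λ : Fin d → Finset J) (ρ : ℝ),
      Reach P Q T B f Λ0 tol k m v Λ ρ → P.WBound t ((2 * C) ^ (k * (Q.M + 1) + m)) v := by
    intro tol k m v Λ ρ h
    induction h with
    | start => exact (Problem.WBound.zero (P := P) (t := t)).mono le_rfl (by positivity)
    | inner h hp _ _ _ _ ih => exact hstep _ _ _ _ _ _ _ _ h hp ih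
    | @outer k m w _ _ Λ₁ _ ρ₁ h hrs hΛ hr ih =>
      have hinv := h.errorInv S
      obtain ⟨xN, z, hd⟩ := hrs.exists_data S hinv
      have h1 := hstep _ _ _ _ _ _ _ _ h hd.pcg ih
      have h2 : P.WBound t ((2 * C) ^ ((k + 1) * (Q.M + 1) + 0)) xN := by
        refine h1.mono (by positivity) (pow_le_pow_right₀ h2C ?_)
        have := hinv.m_le
        rw [add_mul, one_mul]
        omega
      obtain ⟨rk, hrk, -⟩ := hd.trunc
      obtain ⟨Γ, hΓ, hv'⟩ := hd.coarse
      refine (hrk.wBound S.tree hd.mem h2).of_abs_le fun x => ?_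
      rw [hv']
      by_cases hx : x ∈ Fintype.piFinset Γ
      · rw [restr, ofFinset_of_mem _ hx]
      · rw [restr_of_notMem _ hx, abs_zero]; exact abs_nonneg _
  refine ⟨(2 * C) ^ (Q.M + 1), one_le_pow₀ h2C, fun tol k m v Λ ρ xN h hp => ?_⟩
  refine (hstep _ _ _ _ _ _ _ _ h hp (hv _ _ _ _ _ _ h)).mono (by positivity) ?_
  rw [← pow_mul]
  refine pow_le_pow_right₀ h2C ?_
  have := (h.errorInv S).m_le
  nlinarith

lemma log_w_le (S : Setup P Q T B f u s sStar t) {j : Fin d} {l : J} {R : ℝ} {n : ℕ}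
    (h : P.w j l ^ t ≤ R ^ n) : Real.log (P.w j l) ≤ Real.log R / t * n := by
  have hw := S.standing.w_pos j l
  have ht := S.t_pos
  have h1 := Real.log_le_log (by positivity) h
  rw [Real.log_rpow hw, Real.log_pow] at h1
  rw [div_mul_eq_mul_div, le_div_iff₀ ht]
  linarith

lemma exists_initial_weight (P : Problem d K J) (Λ0 : Fin d → Finset J) :
    ∃ L : ℝ, 0 ≤ L ∧ ∀ j, ∀ l ∈ Λ0 j, Real.log (P.w j l) ≤ L := by
  refine ⟨∑ j, ∑ l ∈ Λ0 j, |Real.log (P.w j l)|, by positivity, fun j l hl => ?_⟩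
  refine (le_abs_self _).trans ?_
  refine (Finset.single_le_sum (f := fun l => |Real.log (P.w j l)|)
    (fun _ _ => abs_nonneg _) hl).trans ?_
  exact Finset.single_le_sum (f := fun j => ∑ l ∈ Λ0 j, |Real.log (P.w j l)|)
    (fun _ _ => Finset.sum_nonneg fun _ _ => abs_nonneg _) (Finset.mem_univ j)

/-- Growth of the logarithms of the weights of the indices. -/
lemma exists_log_w_le [Nonempty J] (S : Setup P Q T B f u s sStar t) (Λ0 : Fin d → Finset J) :
    ∃ C : ℝ, 0 ≤ C ∧ ∀ (tol : ℝ) (k m : ℕ) (v : L2 (Fin d → J)) (Λ : Fin d → Finset J) (ρ : ℝ),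
      Reach P Q T B f Λ0 tol k m v Λ ρ → ∀ j, ∀ l ∈ Λ j,
      Real.log (P.w j l) ≤ C * (k + 1) ^ Q.growthExp := by
  obtain ⟨L, hL, hL0⟩ := exists_initial_weight P Λ0
  obtain ⟨R, hR, hexp⟩ := S.exists_weight_expand_le Λ0
  have ht := S.t_pos
  -- With a positive margin the weighted norms are exponential in k, so every newly added index has
  -- a logarithmic weight linear in k, independently of the indices already present.
  by_cases hst : 0 < Q.stallMargin
  · obtain ⟨E, hE, hw⟩ := S.exists_wBound_pow hst Λ0
    obtain ⟨R', hR', hcoa⟩ := S.exists_weight_coarse_le Λ0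
    have hER : 1 ≤ E * R := one_le_mul_of_one_le_of_one_le hE hR
    have hER' : 1 ≤ E * R' := one_le_mul_of_one_le_of_one_le hE hR'
    have h1 : 0 ≤ Real.log (E * R) / t := div_nonneg (Real.log_nonneg hER) ht.le
    have h2 : 0 ≤ Real.log (E * R') / t := div_nonneg (Real.log_nonneg hER') ht.le
    refine ⟨L + Real.log (E * R) / t + Real.log (E * R') / t, by positivity,
      fun tol k m v Λ ρ h => ?_⟩
    rw [Params.growthExp, if_pos hst]
    simp only [pow_one]
    induction h with
    | start =>
      intro j l hl
      have := hL0 j l hl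
      push_cast
      linarith
    | @inner k m w _ _ Λ₁ _ ρ₁ h hp hr _ hle hΛ ih =>
      intro j l hl
      have hk : (0 : ℝ) ≤ k := Nat.cast_nonneg k
      rcases hexp _ _ _ _ _ _ _ _ _ h hp hr hle hΛ _ (one_le_pow₀ hE)
        (hw _ _ _ _ _ _ _ h hp) j l hl with h3 | h3
      · exact ih j l h3
      · rw [← mul_pow] at h3
        refine (S.log_w_le h3).trans ?_
        push_cast
        gcongr
        linarith
    | @outer k m w _ _ Λ₁ _ ρ₁ h hrs hΛ hr ih =>
      intro j l hl
      obtain ⟨xN, z, hd⟩ := hrs.exists_data S (h.errorInv S)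
      have h3 := hcoa _ _ _ _ _ _ _ _ _ _ h hd hΛ _ (one_le_pow₀ hE)
        (hw _ _ _ _ _ _ _ h hd.pcg) j l hl
      rw [← mul_pow] at h3
      refine (S.log_w_le h3).trans ?_
      have hk : (0 : ℝ) ≤ k := Nat.cast_nonneg k
      push_cast
      gcongr <;> linarith
  · obtain ⟨V, hV, hnorm⟩ := S.exists_norm_bound
    have hVR : 1 ≤ (1 + V) * R := one_le_mul_of_one_le_of_one_le (by linarith) hR
    set c := Real.log ((1 + V) * R) / t with hc
    have hc0 : 0 ≤ c := div_nonneg (Real.log_nonneg hVR) ht.le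
    -- Without a stable solver the weighted norm is estimated by the largest weight present. Each
    -- inner step then adds O(k+1) to the logarithm, coarsening adds no indices, and the number of
    -- inner steps so far is itself O(k+1).
    have key : ∀ (tol : ℝ) (k m : ℕ) (v : L2 (Fin d → J)) (Λ : Fin d → Finset J) (ρ : ℝ),
        Reach P Q T B f Λ0 tol k m v Λ ρ → ∀ j, ∀ l ∈ Λ j,
        Real.log (P.w j l) ≤ L + c * ((k * (Q.M + 1) + m : ℕ) * (k + 1)) := by
      intro tol k m v Λ ρ h
      induction h with
      | start => intro j l hl; simpa using hL0 j l hl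
      | @inner k m w xN _ Λ₁ _ ρ₁ h hp hr _ hle hΛ ih =>
        intro j l hl
        have hinv := h.errorInv S
        set Y := L + c * ((k * (Q.M + 1) + m : ℕ) * (k + 1)) with hY
        have hY0 : 0 ≤ Y := by positivity
        have hW : P.WBound t (Real.exp Y ^ t * ‖xN‖) xN :=
          Problem.WBound.of_norm S.standing ht.le (hinv.pcg_mem S hp) fun x hx i => by
            rw [Fintype.mem_piFinset] at hx
            exact (Real.log_le_iff_le_exp (S.standing.w_pos _ _)).1 (ih i (x i) (hx i))
        have he1 : 1 ≤ Real.exp Y ^ t :=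
          Real.one_le_rpow (Real.one_le_exp hY0) ht.le
        have hW' : P.WBound t (Real.exp Y ^ t * (1 + V)) xN := by
          refine hW.mono (by positivity) ?_
          have := hnorm m k xN (hinv.energy_pcg_le S hp)
          gcongr
          linarith
        have hcast : ((k * (Q.M + 1) + (m + 1) : ℕ) : ℝ) = (k * (Q.M + 1) + m : ℕ) + 1 := by
          push_cast; ring
        rw [hcast, show L + c * ((((k * (Q.M + 1) + m : ℕ) : ℝ) + 1) * (k + 1)) =
          Y + c * (k + 1) by rw [hY]; ring]
        rcases hexp _ _ _ _ _ _ _ _ _ h hp hr hle hΛ _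
          (one_le_mul_of_one_le_of_one_le he1 (by linarith)) hW' j l hl with h3 | h3
        · have := ih j l h3
          have : 0 ≤ c * ((k : ℝ) + 1) := by positivity
          linarith
        · have hwp := S.standing.w_pos j l
          have h4 : P.w j l ^ t ≤ Real.exp (Y * t) * ((1 + V) * R) ^ (k + 1) := by
            refine h3.trans ?_
            rw [← Real.exp_mul, mul_pow, mul_assoc]
            have : 1 + V ≤ (1 + V) ^ (k + 1) := le_self_pow₀ (by linarith) (by omega)
            gcongr
          have h5 := Real.log_le_log (by positivity) h4
          rw [Real.log_rpow hwp, Real.log_mul (Real.exp_pos _).ne' (by positivity),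
            Real.log_exp, Real.log_pow] at h5
          have h6 : c * t = Real.log ((1 + V) * R) := by rw [hc]; field_simp
          rw [← h6] at h5
          push_cast at h5
          refine le_of_mul_le_mul_left ?_ ht
          linarith
      | @outer k m w _ _ Λ₁ _ ρ₁ h hrs hΛ hr ih =>
        intro j l hl
        have hinv := h.errorInv S
        obtain ⟨xN, z, hd⟩ := hrs.exists_data S hinv
        obtain ⟨Γ, hΓ, hv'⟩ := hd.coarse
        refine (ih j l ((hd.support_subset S hv' hΛ j).2 hl)).trans ?_
        have h7 : k * (Q.M + 1) + m ≤ (k + 1) * (Q.M + 1) + 0 := by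
          have := hinv.m_le
          rw [add_mul, one_mul]; omega
        have h8 : ((k * (Q.M + 1) + m : ℕ) : ℝ) ≤ ((k + 1) * (Q.M + 1) + 0 : ℕ) := by
          exact_mod_cast h7
        have h9 : (k : ℝ) + 1 ≤ (k + 1 : ℕ) + 1 := by push_cast; linarith
        gcongr
    refine ⟨L + c * (Q.M + 1), by positivity, fun tol k m v Λ ρ h j l hl => ?_⟩
    rw [Params.growthExp, if_neg hst]
    refine (key _ _ _ _ _ _ h j l hl).trans ?_
    have hm : (m : ℝ) ≤ Q.M := by exact_mod_cast (h.errorInv S).m_le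
    have hk : (0 : ℝ) ≤ k := Nat.cast_nonneg k
    have hM : (0 : ℝ) ≤ Q.M := Nat.cast_nonneg _
    have h1 : ((k * (Q.M + 1) + m : ℕ) : ℝ) ≤ (Q.M + 1) * (k + 1) := by push_cast; nlinarith
    have h2 : (1 : ℝ) ≤ (k + 1) ^ 2 := one_le_pow₀ (by linarith)
    calc L + c * (((k * (Q.M + 1) + m : ℕ) : ℝ) * (k + 1))
        ≤ L * (k + 1) ^ 2 + c * ((Q.M + 1) * (k + 1) * (k + 1)) := by
          gcongr
          exact le_mul_of_one_le_right hL h2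
      _ = _ := by ring

end Setup

end

section

variable {d K : ℕ} {J : Type*} {P : Problem d K J}
  {Q : Params} {T : Finset (Finset (Fin d))} {B : L2 (Fin d → J) →L[ℝ] L2 (Fin d → J)}
  {f u : L2 (Fin d → J)} {s sStar t : ℝ}
  {k m : ℕ} {v v' xN r z : L2 (Fin d → J)} {Λ Λ' Λ0 : Fin d → Finset J} {ρ tol : ℝ}

/-! ### Ranks of the iterates -/

lemma Params.one_le_growthExp (Q : Params) : 1 ≤ Q.growthExp := by
  rw [Params.growthExp]; split_ifs <;> norm_num

/-- The accuracy of the scaling is not too small, or zero. -/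
lemma abs_log_etaOf_le (hδ : P.delta < 1) (hδ0 : 0 < P.delta) {τ x D c X : ℝ} (hc : 0 < c)
    (hD : 0 < D) (hτ : c * D ≤ τ) (hx : x ≤ X) (hx0 : 0 ≤ x) (hcf : 0 ≤ Q.cf) :
    |Real.log (etaOf P Q B f τ x)| ≤ |Real.log ((1 - P.delta) / 2)| +
      |Real.log (c * (1 - P.delta) / (3 * (Q.cf * ‖f‖ + 2 * ‖B‖ * X) + 1))| + |Real.log D| := by
  have hδ' : 0 < 1 - P.delta := by linarith
  set a := (1 - P.delta) / 2 with ha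
  have ha0 : 0 < a := by positivity
  have hX0 : 0 ≤ X := hx0.trans hx
  set den := 3 * (Q.cf * ‖f‖ + 2 * ‖B‖ * x) with hden
  set den' := 3 * (Q.cf * ‖f‖ + 2 * ‖B‖ * X) + 1 with hden'
  have hd0 : 0 ≤ den := by positivity
  have hd1 : 0 < den' := by positivity
  have hle : den ≤ den' := by
    rw [hden, hden']
    have : Q.cf * ‖f‖ + 2 * ‖B‖ * x ≤ Q.cf * ‖f‖ + 2 * ‖B‖ * X := by gcongr
    linarith
  set e := c * (1 - P.delta) / den' with he
  have he0 : 0 < e := by positivity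
  have hτ0 : 0 < τ := lt_of_lt_of_le (by positivity) hτ
  rw [etaOf, ← ha, ← hden]
  -- A zero denominator makes the quotient, hence the minimum and its logarithm, equal to zero by
  -- convention.
  rcases hd0.eq_or_lt with h0 | h0
  · rw [← h0, div_zero, min_eq_right ha0.le, Real.log_zero, abs_zero]
    positivity
  · have h1 : e * D ≤ τ * (1 - P.delta) / den := by
      rw [he, div_mul_eq_mul_div]
      calc c * (1 - P.delta) * D / den' ≤ c * (1 - P.delta) * D / den := by gcongr
        _ = c * D * (1 - P.delta) / den := by ring
        _ ≤ _ := by gcongr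
    have h2 : Real.log (e * D) = Real.log e + Real.log D := Real.log_mul he0.ne' hD.ne'
    have ea := neg_abs_le (Real.log a)
    have ee := neg_abs_le (Real.log e)
    have eD := neg_abs_le (Real.log D)
    have ea' := abs_nonneg (Real.log a)
    have ee' := abs_nonneg (Real.log e)
    have eD' := abs_nonneg (Real.log D)
    have hmin : 0 < min a (τ * (1 - P.delta) / den) := lt_min ha0 (by positivity)
    rw [abs_le]
    constructor
    · rcases min_choice a (τ * (1 - P.delta) / den) with h | h <;> rw [h]
      · linarith
      · have h3 := Real.log_le_log (by positivity) h1
        linarith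
    · have h3 := Real.log_le_log hmin (min_le_left _ _)
      have := le_abs_self (Real.log a)
      linarith

namespace Setup

/-- The outer index is at most logarithmic in the error. -/
lemma exists_index_le (S : Setup P Q T B f u s sStar t) : ∃ C : ℝ, 0 ≤ C ∧
    ∀ (k : ℕ) (D : ℝ), 0 < D → D ≤ √Q.lamMax * (Q.base k / Q.lamMin) →
      (k : ℝ) + 1 ≤ C * (1 + |Real.log D|) := by
  have hq := S.sum_pos
  have hq1 := S.outer.sum_lt
  have ha := S.spd.pos
  have hb := S.lamMax_pos
  have h0 := S.outer.ω0_pos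
  set q := Q.ω3 + Q.ω4 + Q.ω5 with hqd
  have hl : 0 < -Real.log q := by have := Real.log_neg hq hq1; linarith
  set c := √Q.lamMax * (Q.ω0 / Q.lamMin) with hc
  have hc0 : 0 < c := by
    have := Real.sqrt_pos.2 hb
    positivity
  refine ⟨(1 + |Real.log c|) / (-Real.log q) + 1, by positivity, fun k D hD hle => ?_⟩
  have h1 : √Q.lamMax * (Q.base k / Q.lamMin) = c * q ^ k := by
    rw [hc, Params.base]; ring
  rw [h1] at hle
  have h2 := Real.log_le_log hD hle
  rw [Real.log_mul hc0.ne' (by positivity), Real.log_pow] at h2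
  have h3 := le_abs_self (Real.log c)
  have h4 := neg_abs_le (Real.log D)
  have h5 : (k : ℝ) * (-Real.log q) ≤ (1 + |Real.log c|) * (1 + |Real.log D|) := by
    nlinarith [mul_nonneg (abs_nonneg (Real.log c)) (abs_nonneg (Real.log D))]
  rw [← le_div_iff₀ hl] at h5
  have h6 := abs_nonneg (Real.log D)
  calc (k : ℝ) + 1 ≤ (1 + |Real.log c|) * (1 + |Real.log D|) / (-Real.log q) +
        (1 + |Real.log D|) := add_le_add h5 (by linarith)
    _ = _ := by ring

/-- Number of terms of the scaling in the Galerkin solver. -/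
lemma exists_numTerms_le [Nonempty J] (S : Setup P Q T B f u s sStar t)
    (Λ0 : Fin d → Finset J) : ∃ C : ℝ, 1 ≤ C ∧
    ∀ (tol : ℝ) (k m : ℕ) (v : L2 (Fin d → J)) (Λ : Fin d → Finset J) (ρ : ℝ)
      (xN w : L2 (Fin d → J)) (N : ℕ) (x dir : ℕ → L2 (Fin d → J)),
      Reach P Q T B f Λ0 tol k m v Λ ρ → PCGRun P Q T B f u Λ v ρ xN w N x dir →
      ∀ D, 0 < D → D ≤ energy B (u - v) → ∀ i < N,
      ((P.numTerms (etaOf P Q B f (Q.cPre * (Q.ω2 * ρ)) ‖x i‖) (Fintype.piFinset Λ) +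
        P.nPlus + 1 : ℕ) : ℝ) ≤ C * (1 + |Real.log D|) ^ Q.growthExp := by
  have hP := S.standing
  obtain ⟨V, hV, hnorm⟩ := S.exists_norm_bound
  obtain ⟨C₁, hC₁, hw⟩ := S.exists_log_w_le Λ0
  obtain ⟨C₂, hC₂, hk⟩ := S.exists_index_le
  have ha := S.spd.pos
  have hsa := Real.sqrt_pos.2 ha
  have hω1 := S.outer.ω1_pos
  have hω2 := S.outer.ω2_pos
  have hpre := S.outer.cPre_pos
  have hh := hP.h_pos
  have hd1 : (1 : ℝ) ≤ d := by have := S.two_le; exact_mod_cast (by omega : 1 ≤ d)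
  set c := Q.cPre * (Q.ω2 * (√Q.lamMin / (1 + Q.ω1))) with hc
  have hc0 : 0 < c := by positivity
  set E := |Real.log ((1 - P.delta) / 2)| +
      |Real.log (c * (1 - P.delta) / (3 * (Q.cf * ‖f‖ + 2 * ‖B‖ * V) + 1))| with hE
  have hE0 : 0 ≤ E := by positivity
  set F := |Real.log (2 / √Real.pi)| + (|Real.log (P.delta / 2)| + E) + 1 / 2 * Real.log d with hF
  have hld : 0 ≤ Real.log d := Real.log_nonneg hd1
  have hF0 : 0 ≤ F := by positivity
  set G := C₁ * C₂ ^ Q.growthExp with hG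
  have hG0 : 0 ≤ G := by positivity
  refine ⟨P.h⁻¹ * (F + 1 + G) + 1 + P.nPlus + 1, ?_,
    fun tol k m v Λ ρ xN w N x dir hreach h D hD hDle i hi => ?_⟩
  · have : 0 ≤ P.h⁻¹ * (F + 1 + G) := by positivity
    have : (0 : ℝ) ≤ P.nPlus := Nat.cast_nonneg _
    linarith
  have hinv := hreach.errorInv S
  have hρ : √Q.lamMin / (1 + Q.ω1) * D ≤ ρ := by
    rw [div_mul_eq_mul_div, div_le_iff₀ (by linarith)]
    calc _ ≤ √Q.lamMin * energy B (u - v) := by gcongr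
      _ ≤ ‖B (u - v)‖ := S.energy_le_norm _
      _ ≤ _ := hinv.res_le.trans (le_of_eq (mul_comm _ _))
  have hxV : ‖x i‖ ≤ V := hnorm (m - 1) k (x i) ((h.energy_iter_le S hi.le).trans hinv.energy_le)
  have hη := abs_log_etaOf_le (P := P) (Q := Q) (B := B) (f := f) hP.delta_lt hP.delta_pos hc0 hD
    (show c * D ≤ Q.cPre * (Q.ω2 * ρ) by rw [hc]; rw [mul_assoc, mul_assoc]; gcongr)
    hxV (norm_nonneg _) (by linarith [S.outer.cf_ge])
  rw [← hE] at hη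
  set η := etaOf P Q B f (Q.cPre * (Q.ω2 * ρ)) ‖x i‖
  set L := C₁ * ((k : ℝ) + 1) ^ Q.growthExp with hL
  have hL0 : 0 ≤ L := by positivity
  have hnum := Problem.numTerms_le hP (η := η) (W := d * Real.exp (2 * L))
    (X := Fintype.piFinset Λ)
    (one_le_mul_of_one_le_of_one_le hd1 (Real.one_le_exp (by positivity))) fun y hy => by
      rw [Fintype.mem_piFinset] at hy
      rw [Problem.weight]
      calc ∑ j, P.w j (y j) ^ 2 ≤ ∑ _j : Fin d, Real.exp (2 * L) := by
            refine Finset.sum_le_sum fun j _ => ?_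
            have h1 := (Real.log_le_iff_le_exp (hP.w_pos _ _)).1
              (hw _ _ _ _ _ _ hreach j (y j) (hy j))
            have h2 := pow_le_pow_left₀ (hP.w_pos _ _).le h1 2
            refine h2.trans (le_of_eq ?_)
            rw [← Real.exp_nat_mul]; norm_num [hL]
        _ = _ := by rw [Finset.sum_const, nsmul_eq_mul, Finset.card_univ, Fintype.card_fin]
  rw [Real.log_mul (by positivity) (Real.exp_pos _).ne', Real.log_exp] at hnum
  set ℓ := 1 + |Real.log D| with hℓ
  have hℓ1 : 1 ≤ ℓ := by rw [hℓ]; linarith [abs_nonneg (Real.log D)]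
  have hDk : D ≤ √Q.lamMax * (Q.base k / Q.lamMin) := by
    refine hDle.trans (hinv.energy_le.trans (mul_le_of_le_one_left ?_
      (pow_le_one₀ S.innerRate_pos.le S.innerRate_lt_one.le)))
    have := S.base_pos k
    positivity
  have hLle : L ≤ G * ℓ ^ Q.growthExp := by
    rw [hL, hG, mul_assoc, ← mul_pow]
    have := hk k D hD hDk
    gcongr
  have hℓe : ℓ ≤ ℓ ^ Q.growthExp :=
    le_self_pow₀ hℓ1 (by have := Q.one_le_growthExp; omega)
  set y := ℓ ^ Q.growthExp
  have hy1 : 1 ≤ y := hℓ1.trans hℓe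
  have h1 : Real.log (2 / √Real.pi) + (|Real.log (P.delta / 2)| + |Real.log η|) +
      1 / 2 * (Real.log d + 2 * L) ≤ (F + 1 + G) * y := by
    have h2 := le_abs_self (Real.log (2 / √Real.pi))
    have h3 : F ≤ F * y := le_mul_of_one_le_right hF0 hy1
    have h4 : |Real.log D| ≤ y := by rw [hℓ] at hℓe; linarith
    rw [add_mul, add_mul, one_mul]
    rw [hF] at h3 ⊢
    linarith
  have h2 := mul_le_mul_of_nonneg_left h1 (inv_nonneg.2 hh.le)
  have hn0 : (0 : ℝ) ≤ P.nPlus := Nat.cast_nonneg _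
  push_cast
  calc _ ≤ P.h⁻¹ * ((F + 1 + G) * y) + 1 + P.nPlus + 1 := by linarith
    _ ≤ P.h⁻¹ * ((F + 1 + G) * y) + 1 * y + P.nPlus * y + 1 * y := by
        gcongr
        · linarith
        · exact le_mul_of_one_le_right hn0 hy1
        · linarith
    _ = _ := by ring

/-- Growth of the ranks in the Galerkin solver. -/
lemma exists_htRank_pcg_le [Nonempty J] (S : Setup P Q T B f u s sStar t)
    (Λ0 : Fin d → Finset J) {rA rf : ℕ} (hA : htRank T P.opTensor ≤ rA) (hf : htRank T P.f ≤ rf)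
    (hrA : 1 ≤ rA) : ∃ C : ℝ, 1 ≤ C ∧
    ∀ (tol : ℝ) (k m : ℕ) (v : L2 (Fin d → J)) (Λ : Fin d → Finset J) (ρ : ℝ)
      (xN : L2 (Fin d → J)), Reach P Q T B f Λ0 tol k m v Λ ρ → IsPCG P Q T B f Λ v ρ xN →
      energy B (u - xN) ≤ energy B (u - v) ∧
      ∀ D, 0 < D → D ≤ energy B (u - v) → ∀ X : ℕ, htRank T v ≤ X → ∃ Y : ℕ, htRank T xN ≤ Y ∧
        ((Y : ℝ) + rf) ≤ (C * rA * (1 + |Real.log D|) ^ 2) ^ Q.IStar * (X + rf) := by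
  obtain ⟨C, hC, hnum⟩ := S.exists_numTerms_le Λ0
  refine ⟨16 * C ^ 2, by nlinarith, fun tol k m v Λ ρ xN hreach hp => ?_⟩
  have hinv := hreach.errorInv S
  obtain ⟨w, N, x, dir, h⟩ := hinv.exists_run S hp
  refine ⟨h.energy_last_le S, fun D hD hDle X hX => ?_⟩
  set ℓ := 1 + |Real.log D| with hℓ
  have hℓ1 : 1 ≤ ℓ := by rw [hℓ]; linarith [abs_nonneg (Real.log D)]
  have hy1 : 1 ≤ ℓ ^ Q.growthExp := one_le_pow₀ hℓ1
  have hCy : 1 ≤ C * ℓ ^ Q.growthExp := one_le_mul_of_one_le_of_one_le hC hy1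
  set n := ⌊C * ℓ ^ Q.growthExp⌋₊ with hn
  have hn1 : 1 ≤ n := (Nat.one_le_floor_iff _).2 hCy
  have hnle : (n : ℝ) ≤ C * ℓ ^ Q.growthExp := Nat.floor_le (by linarith)
  obtain ⟨Y, hY, hYle⟩ := h.exists_htRank_last_le S hA hf hrA hn1
    (fun i hi => Nat.le_floor (hnum _ _ _ _ _ _ _ _ _ _ _ hreach h D hD hDle i hi)) hX
  refine ⟨Y, hY, ?_⟩
  have hYle' : ((Y : ℝ) + rf) ≤ (4 * (n ^ 2 * rA)) ^ N * (X + rf) := by exact_mod_cast hYle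
  refine hYle'.trans (mul_le_mul_of_nonneg_right ?_ (by positivity))
  have hrA' : (1 : ℝ) ≤ rA := by exact_mod_cast hrA
  have hN := h.growthExp_mul_le S hinv.res_le
  have hN' : N ≤ Q.IStar := le_trans (Nat.le_mul_of_pos_left _ Q.one_le_growthExp) hN
  have hbase : 1 ≤ 16 * C ^ 2 * (rA : ℝ) := by nlinarith
  calc ((4 : ℝ) * (n ^ 2 * rA)) ^ N ≤ (4 * ((C * ℓ ^ Q.growthExp) ^ 2 * rA)) ^ N := by gcongr
    _ ≤ (16 * C ^ 2 * rA * (ℓ ^ Q.growthExp) ^ 2) ^ N := by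
        refine pow_le_pow_left₀ (by positivity) ?_ N
        rw [mul_pow]
        have : 0 ≤ C ^ 2 * (ℓ ^ Q.growthExp) ^ 2 * rA := by positivity
        linarith
    _ = (16 * C ^ 2 * rA) ^ N * ℓ ^ (2 * (Q.growthExp * N)) := by
        rw [mul_pow, ← pow_mul, ← pow_mul]; congr 2; ring
    -- Both exponents are enlarged: N ≤ I* for the constant, and `growthExp`·N ≤ I* for the
    -- logarithm.
    _ ≤ (16 * C ^ 2 * rA) ^ Q.IStar * ℓ ^ (2 * Q.IStar) := by
        gcongr
    _ = _ := by rw [mul_pow _ (ℓ ^ 2), ← pow_mul ℓ 2]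

end Setup

/-! ### Ranks after truncation -/

/-- If all tensors of rank at most N had distance at least c from u, the N-th term of the supremum
alone would be at least γ(N) c. -/
lemma exists_htRank_le_of_lowRankNorm {γ : ℕ → ℝ} (hu : lowRankNorm T γ u ≠ ⊤) {N : ℕ} {c : ℝ}
    (hγ : 0 ≤ γ N) (hlt : (lowRankNorm T γ u).toReal < γ N * c) :
    ∃ w : L2 (Fin d → J), htRank T w ≤ N ∧ ‖u - w‖ < c := by
  by_contra hne
  push Not at hne
  refine absurd hlt (not_lt.2 ?_)
  rw [← ENNReal.ofReal_le_iff_le_toReal hu, ENNReal.ofReal_mul hγ, lowRankNorm]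
  refine le_add_of_nonneg_of_le zero_le (le_trans ?_ (le_iSup _ N))
  gcongr
  exact le_iInf fun w => le_iInf fun hw => ENNReal.ofReal_le_ofReal (hne w hw)

section Growth

variable {γ : ℕ → ℝ} (hγ : Filter.Tendsto γ Filter.atTop Filter.atTop)

include hγ

lemma bddAbove_growth (x : ℝ) : BddAbove {n : ℕ | γ n ≤ x} := by
  obtain ⟨N, hN⟩ := Filter.eventually_atTop.1 (hγ.eventually_gt_atTop x)
  refine ⟨N, fun n hn => ?_⟩
  by_contra h
  exact absurd hn (not_le.2 (hN n (by omega)))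

lemma growthInv_mono {x y : ℝ} (hxy : x ≤ y) : growthInv γ x ≤ growthInv γ y := by
  rcases Set.eq_empty_or_nonempty {n : ℕ | γ n ≤ x} with h | h
  · rw [growthInv, h]; simp
  · exact csSup_le_csSup (bddAbove_growth hγ y) h fun n hn => le_trans hn hxy

/-- There is an index at which the sequence exceeds `x`, and which is not much larger than
necessary. -/
lemma exists_lt_growth {q x : ℝ} (hpos : ∀ n, 0 < γ n) (hq : ∀ n, γ (n + 1) / γ n ≤ q) :
    ∃ N, x < γ N ∧ N ≤ growthInv γ (q * x) := by
  classical
  have hex : ∃ N, x < γ N := (hγ.eventually_gt_atTop x).exists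
  refine ⟨Nat.find hex, Nat.find_spec hex, ?_⟩
  rcases Nat.eq_zero_or_pos (Nat.find hex) with h | h
  · rw [h]; exact Nat.zero_le _
  · obtain ⟨n, hn⟩ := Nat.exists_eq_succ_of_ne_zero h.ne'
    have h1 : γ n ≤ x := not_lt.1 (Nat.find_min hex (by omega))
    have hq0 : 0 ≤ q := (div_pos (hpos 1) (hpos 0)).le.trans (hq 0)
    rw [hn]
    refine le_csSup (bddAbove_growth hγ _) (show γ (n + 1) ≤ q * x from ?_)
    have h2 := (div_le_iff₀ (hpos n)).1 (hq n)
    exact h2.trans (by gcongr)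

end Growth

/-- Ranks after truncation and coarsening. -/
lemma Setup.exists_htRank_restart_le [Nonempty J] (S : Setup P Q T B f u s sStar t) {γ : ℕ → ℝ}
    (hγ : Filter.Tendsto γ Filter.atTop Filter.atTop) (hpos : ∀ n, 0 < γ n) {q : ℝ}
    (hq : ∀ n, γ (n + 1) / γ n ≤ q) (hu : lowRankNorm T γ u ≠ ⊤) :
    ∃ C : ℝ, 0 ≤ C ∧ ∀ (k : ℕ) (v : L2 (Fin d → J)) (Λ : Fin d → Finset J) (ρ : ℝ)
      (v' xN z : L2 (Fin d → J)), RestartData P Q T B f u k v Λ ρ v' xN z →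
      ∀ D, 0 < D → D ≤ energy B (u - v') →
      htRank T v' ≤ growthInv γ (C * (lowRankNorm T γ u).toReal / D) := by
  have ha := S.spd.pos
  have hb := Real.sqrt_pos.2 S.lamMax_pos
  have hs := S.sum_pos
  have hω4 := S.outer.ω4_gt
  have hω3 := S.outer.ω3_pos
  set g := √(2 * (d : ℝ) - 3) with hg
  have hg0 : 0 < g := Real.sqrt_pos.2 (by
    have : (2 : ℝ) ≤ d := by exact_mod_cast S.two_le
    linarith)
  -- The accuracy demanded of a low-rank competitor w: together with the error ω3 of the solver, ‖xN
  -- - w‖ times √(2d-3) exhausts the truncation tolerance exactly.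
  set c := (Q.ω4 / g - Q.ω3) / Q.lamMin with hc
  have hc0 : 0 < c := by
    refine div_pos (sub_pos.2 ?_) ha
    rw [lt_div_iff₀ hg0]; linarith
  have hq0 : 0 ≤ q := (div_pos (hpos 1) (hpos 0)).le.trans (hq 0)
  set G := (lowRankNorm T γ u).toReal with hG
  have hG0 : 0 ≤ G := ENNReal.toReal_nonneg
  refine ⟨q * (√Q.lamMax * (Q.ω3 + Q.ω4 + Q.ω5) / (Q.lamMin * c)), by positivity,
    fun k v Λ ρ v' xN z h D hD hDle => ?_⟩
  have hbk := S.base_pos k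
  obtain ⟨N, hN, hNle⟩ := exists_lt_growth hγ (x := G / (c * Q.base k)) hpos hq
  rw [div_lt_iff₀ (by positivity)] at hN
  obtain ⟨w, hw, hwlt⟩ := exists_htRank_le_of_lowRankNorm hu (hpos N).le hN
  have hclose : g * ‖xN - w‖ ≤ Q.ω4 * Q.lamMin⁻¹ * Q.base k := by
    have h1 : ‖xN - w‖ ≤ Q.ω3 * (Q.base k / Q.lamMin) + c * Q.base k := by
      have h2 := norm_sub_le_norm_sub_add_norm_sub xN u w
      rw [norm_sub_rev xN u] at h2
      have h3 := h.close
      linarith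
    calc g * ‖xN - w‖ ≤ g * (Q.ω3 * (Q.base k / Q.lamMin) + c * Q.base k) := by gcongr
      _ = _ := by rw [hc]; field_simp; ring
  have hz : htRank T z ≤ N := by
    obtain ⟨F, hF, hsub⟩ := exists_box Λ
    exact h.trunc.htRank_le S.tree S.two_le hF (fun x hx => h.mem x fun h => hx (hsub h)) hw hclose
  have hv : htRank T v' ≤ N := by
    obtain ⟨Γ, -, hv'⟩ := h.coarse
    rw [htRank_le_iff] at hz ⊢
    intro α hα
    rw [hv']
    exact (hz α hα).ofFinset Γ
  refine hv.trans ?_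
  have hmono : q * (G / (c * Q.base k)) ≤
      q * (√Q.lamMax * (Q.ω3 + Q.ω4 + Q.ω5) / (Q.lamMin * c)) * G / D := by
    have h1 := hDle.trans (h.energy_le S)
    rw [Params.base, pow_succ, show (Q.ω3 + Q.ω4 + Q.ω5) ^ k * (Q.ω3 + Q.ω4 + Q.ω5) * Q.ω0 =
      Q.base k * (Q.ω3 + Q.ω4 + Q.ω5) by rw [Params.base]; ring] at h1
    rw [mul_assoc, mul_div_assoc]
    refine mul_le_mul_of_nonneg_left ?_ hq0
    rw [div_le_div_iff₀ (by positivity) hD]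
    calc G * D ≤ G * (√Q.lamMax * (Q.base k * (Q.ω3 + Q.ω4 + Q.ω5) / Q.lamMin)) := by gcongr
      _ = _ := by field_simp
  exact_mod_cast hNle.trans (growthInv_mono hγ hmono)

end

/-! ### Assembly of the rank bound -/

section

variable {d K : ℕ} {J : Type*} {P : Problem d K J}
  {Q : Params} {T : Finset (Finset (Fin d))} {B : L2 (Fin d → J) →L[ℝ] L2 (Fin d → J)}
  {f u : L2 (Fin d → J)} {s sStar t : ℝ}
  {k m : ℕ} {v v' xN r z : L2 (Fin d → J)} {Λ Λ' Λ0 : Fin d → Finset J} {ρ tol : ℝ}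

/-- A positive definite operator has positive rank. -/
lemma Setup.one_le_htRank_opTensor [Nonempty J] (S : Setup P Q T B f u s sStar t) {rA : ℕ}
    (hA : htRank T P.opTensor ≤ rA) : 1 ≤ rA := by
  by_contra hlt
  obtain rfl : rA = 0 := by omega
  have h0 := (htRank_le_iff.1 hA) _ S.tree.root
  obtain ⟨l⟩ := ‹Nonempty J›
  let x : Fin d → J := fun _ => l
  have hAz : ∀ y z, P.A y z = 0 := fun y z => h0.eq_zero fun j => (y j, z j)
  have hB : B (unitVec x) = 0 := by
    ext y
    rw [S.scaled y x, hAz, mul_zero, zero_mul]; rfl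
  have h1 := S.spd.lower (unitVec x)
  rw [hB, inner_zero_right] at h1
  have h2 : inner ℝ (unitVec x) (unitVec x) = (1 : ℝ) := by
    rw [inner_unitVec, unitVec]
    simp
  rw [real_inner_self_eq_norm_sq] at h2
  rw [h2, mul_one] at h1
  exact absurd h1 (not_le.2 S.spd.pos)

/-- Rank bound in terms of a lower bound `D` for the error in the energy norm. -/
lemma Setup.exists_htRank_le [Nonempty J] (S : Setup P Q T B f u s sStar t) {γ : ℕ → ℝ}
    (hγ : Filter.Tendsto γ Filter.atTop Filter.atTop) (hpos : ∀ n, 0 < γ n) {q : ℝ}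
    (hq : ∀ n, γ (n + 1) / γ n ≤ q) (hu : lowRankNorm T γ u ≠ ⊤) (Λ0 : Fin d → Finset J)
    {rA rf : ℕ} (hA : htRank T P.opTensor ≤ rA) (hf : htRank T P.f ≤ rf) :
    ∃ C : ℝ, 1 ≤ C ∧ ∀ (tol : ℝ) (k m : ℕ) (v : L2 (Fin d → J)),
      IsIterate P Q T B f Λ0 tol k m v → m ≤ Q.M + 1 ∧
      ∀ D, 0 < D → D ≤ energy B (u - v) → ∃ X : ℕ, htRank T v ≤ X ∧
        ((X : ℝ) + rf) ≤ (C * rA * (1 + |Real.log D|) ^ 2) ^ (m * Q.IStar) *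
          (growthInv γ (C * (lowRankNorm T γ u).toReal / D) + rf) := by
  obtain ⟨C₁, hC₁, hpcg⟩ := S.exists_htRank_pcg_le Λ0 hA hf (S.one_le_htRank_opTensor hA)
  obtain ⟨C₂, hC₂, hrestart⟩ := S.exists_htRank_restart_le hγ hpos hq hu
  set G := (lowRankNorm T γ u).toReal
  have hG0 : 0 ≤ G := ENNReal.toReal_nonneg
  set C := C₁ + C₂ with hC
  have hCC : 1 ≤ C := by linarith
  -- The bound is stated for every D below the error, so that the D belonging to the final iterate
  -- can be used at all earlier iterates of the same inner loop. Restarts prove it afresh with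
  -- exponent zero.
  let bound : ℕ → L2 (Fin d → J) → Prop := fun m v =>
    ∀ D, 0 < D → D ≤ energy B (u - v) → ∃ X : ℕ, htRank T v ≤ X ∧
      ((X : ℝ) + rf) ≤ (C * rA * (1 + |Real.log D|) ^ 2) ^ (m * Q.IStar) *
        (growthInv γ (C * G / D) + rf)
  have hzero : bound 0 0 := fun D hD _ => by
    refine ⟨0, ?_, ?_⟩
    · rw [htRank_le_iff]
      exact fun α _ => (HasRank.zero 0).congr fun _ => rfl
    · rw [zero_mul, pow_zero, one_mul, Nat.cast_zero]
      gcongr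
      exact Nat.cast_nonneg _
  have hsolve : ∀ (tol : ℝ) (k m : ℕ) (v : L2 (Fin d → J)) (Λ : Fin d → Finset J) (ρ : ℝ)
      (xN : L2 (Fin d → J)), Reach P Q T B f Λ0 tol k m v Λ ρ → IsPCG P Q T B f Λ v ρ xN →
      bound m v → bound (m + 1) xN := by
    intro tol k m v Λ ρ xN h hp hb D hD hDle
    obtain ⟨hmono, hstep⟩ := hpcg _ _ _ _ _ _ _ h hp
    obtain ⟨X, hX, hXle⟩ := hb D hD (hDle.trans hmono)
    obtain ⟨Y, hY, hYle⟩ := hstep D hD (hDle.trans hmono) X hX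
    refine ⟨Y, hY, hYle.trans ?_⟩
    have hle : C₁ ≤ C := by linarith
    calc _ ≤ (C * rA * (1 + |Real.log D|) ^ 2) ^ Q.IStar *
          ((C * rA * (1 + |Real.log D|) ^ 2) ^ (m * Q.IStar) *
            (growthInv γ (C * G / D) + rf)) := by gcongr
      _ = _ := by rw [add_mul m 1, one_mul, pow_add]; ring
  have hre : ∀ (tol : ℝ) (k m : ℕ) (v : L2 (Fin d → J)) (Λ : Fin d → Finset J) (ρ : ℝ)
      (v' : L2 (Fin d → J)), Reach P Q T B f Λ0 tol k m v Λ ρ →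
      IsRestart P Q T B f tol k m v Λ ρ v' → bound 0 v' := by
    intro tol k m v Λ ρ v' h hr D hD hDle
    obtain ⟨xN, z, hd⟩ := hr.exists_data S (h.errorInv S)
    refine ⟨_, hrestart _ _ _ _ _ _ _ hd D hD hDle, ?_⟩
    rw [zero_mul, pow_zero, one_mul]
    gcongr
    refine growthInv_mono hγ ?_
    gcongr
    linarith
  have hreach : ∀ (tol : ℝ) (k m : ℕ) (v : L2 (Fin d → J)) (Λ : Fin d → Finset J) (ρ : ℝ),
      Reach P Q T B f Λ0 tol k m v Λ ρ → bound m v := by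
    intro tol k m v Λ ρ h
    induction h with
    | start => exact hzero
    | inner h hp _ _ _ _ ih => exact hsolve _ _ _ _ _ _ _ h hp ih
    | outer h hr _ _ _ => exact hre _ _ _ _ _ _ _ h hr
  refine ⟨C, hCC, fun tol k m v h => ?_⟩
  cases h with
  | start => exact ⟨Nat.zero_le _, hzero⟩
  | solve h hp =>
    exact ⟨Nat.succ_le_succ (h.errorInv S).m_le,
      hsolve _ _ _ _ _ _ _ h hp (hreach _ _ _ _ _ _ h)⟩
  | restart h hr => exact ⟨Nat.zero_le _, hre _ _ _ _ _ _ _ h hr⟩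

end

end HTAWGM

end

theorem proposition4 {d K : ℕ} (hd : 2 ≤ d) {J : Type*}
    -- dimension tree, discretized problem, parameters of the algorithm
    (T : Finset (Finset (Fin d))) (hT : HTAWGM.IsDimTree T)
    (P : HTAWGM.Problem d K J) (hP : P.Standing)
    (Q : HTAWGM.Params)
    -- the scaled equation `A^δ u^δ = f^δ` with symmetric positive definite `A^δ`
    (Aδ : HTAWGM.L2 (Fin d → J) →L[ℝ] HTAWGM.L2 (Fin d → J)) (hA : P.IsScaledOp Aδ)
    (hAmin : ∀ v, Q.lamMin * ‖v‖ ^ 2 ≤ inner ℝ v (Aδ v)) (hAmax : ‖Aδ‖ ≤ Q.lamMax)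
    (fδ uδ : HTAWGM.L2 (Fin d → J)) (hf : ∀ lam, fδ lam = P.sInv lam * P.f lam)
    (hu : Aδ uδ = fδ)
    -- finite ranks of the operator and of the right hand side
    (hrA : HTAWGM.htRank T P.opTensor ≠ ⊤) (hrf : HTAWGM.htRank T P.f ≠ ⊤)
    -- conditions on the parameters
    (hQ : Q.OuterValid d ‖fδ‖) (hCG : Q.CGValid)
    -- approximability of the solution in rank
    (γ : ℕ → ℝ) (hγ0 : γ 0 = 1) (hγmono : StrictMono γ)
    (hγtop : Filter.Tendsto γ Filter.atTop Filter.atTop)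
    (hγadm : ∃ ρ : ℝ, ∀ n, γ (n + 1) / γ n ≤ ρ)
    (huγ : HTAWGM.lowRankNorm T γ uδ ≠ ⊤)
    -- sparse approximability, compressibility and excess regularity
    (s sStar t : ℝ) (hs : 0 < s) (hsStar : s < sStar) (ht : 0 < t)
    (hus : ∀ j, HTAWGM.asNorm s (HTAWGM.contr j uδ) ≠ ⊤)
    (hcomp : P.CompressibleComps sStar)
    (hrhs : P.RhsApprox fδ Q.cf s) (hexc : P.ExcessRegular t)
    -- initial index set
    (Λ0 : Fin d → Finset J) (hΛ0 : ∀ j, (Λ0 j).Nonempty) :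
    ∃ C : ℝ, 0 < C ∧ ∀ (ε : ℝ) (_ : 0 < ε) (k m : ℕ) (v : HTAWGM.L2 (Fin d → J)),
      HTAWGM.IsIterate P Q T Aδ fδ Λ0 ε k m v → v ≠ uδ →
      (HTAWGM.htRank T v : ℝ≥0∞) ≤ ENNReal.ofReal
        (C * ((HTAWGM.htRank T P.opTensor).toNat : ℝ) ^ (m * Q.IStar) *
          (1 + |Real.log ‖uδ - v‖| +
            max 0 (Real.log (∑ j, HTAWGM.asNorm s (HTAWGM.contr j uδ)).toReal))
              ^ (2 * m * Q.IStar) *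
          ((HTAWGM.growthInv γ
              (C * (HTAWGM.lowRankNorm T γ uδ).toReal / ‖uδ - v‖) : ℝ) +
            ((HTAWGM.htRank T P.f).toNat : ℝ))) := by
  have : Nonempty J := ⟨(hΛ0 ⟨0, by omega⟩).choose⟩
  have S : HTAWGM.Setup P Q T Aδ fδ uδ s sStar t :=
    ⟨hd, hT, hP, hA, hA.spdBounds hP hQ.lamMin_pos hAmin hAmax, hAmax, hu, hQ, hCG, hs, hsStar,
      ht, hus, hcomp, hrhs, hexc⟩
  obtain ⟨q, hq⟩ := hγadm
  have hpos : ∀ n, 0 < γ n := fun n =>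
    lt_of_lt_of_le (by rw [hγ0]; exact one_pos) (hγmono.monotone (Nat.zero_le n))
  obtain ⟨C₀, hC₀, hrank⟩ := S.exists_htRank_le hγtop hpos hq huγ Λ0
    (ENat.natCast_toNat hrA).ge (ENat.natCast_toNat hrf).ge
  set rA := (HTAWGM.htRank T P.opTensor).toNat
  set rf := (HTAWGM.htRank T P.f).toNat
  set G := (HTAWGM.lowRankNorm T γ uδ).toReal
  have hG0 : 0 ≤ G := ENNReal.toReal_nonneg
  -- C may depend on the solution, so from here on this summand enters only through its
  -- nonnegativity.
  set Y := max 0 (Real.log (∑ j, HTAWGM.asNorm s (HTAWGM.contr j uδ)).toReal)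
  have hY0 : 0 ≤ Y := le_max_left _ _
  set a := √Q.lamMin with ha
  have ha0 : 0 < a := Real.sqrt_pos.2 hQ.lamMin_pos
  set b := C₀ * (1 + |Real.log a|) ^ 2 with hb
  have hb1 : 1 ≤ b := by
    have : 1 ≤ (1 + |Real.log a|) ^ 2 := one_le_pow₀ (by linarith [abs_nonneg (Real.log a)])
    nlinarith
  -- The first summand collects the constants of all solves, as m never exceeds M+1; the second
  -- converts the energy error in the argument of γ⁻¹ to the ℓ₂-error, with a = √λ_min.
  set C := b ^ ((Q.M + 1) * Q.IStar) + C₀ / a with hC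
  have hC0 : 0 < C := by positivity
  refine ⟨C, hC0, fun ε _ k m v hv hne => ?_⟩
  obtain ⟨hm, hbound⟩ := hrank ε k m v hv
  have hpos' : 0 < ‖uδ - v‖ := norm_pos_iff.2 (sub_ne_zero.2 hne.symm)
  obtain ⟨X, hX, hXle⟩ := hbound (a * ‖uδ - v‖) (by positivity) (S.sqrt_le_energy _)
  have hXr : (X : ℝ) ≤ C * (rA : ℝ) ^ (m * Q.IStar) *
      (1 + |Real.log ‖uδ - v‖| + Y) ^ (2 * m * Q.IStar) *
        ((HTAWGM.growthInv γ (C * G / ‖uδ - v‖) : ℝ) + rf) := by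
    have hlog : 1 + |Real.log (a * ‖uδ - v‖)| ≤
        (1 + |Real.log a|) * (1 + |Real.log ‖uδ - v‖| + Y) := by
      rw [Real.log_mul ha0.ne' hpos'.ne']
      have h1 := abs_add_le (Real.log a) (Real.log ‖uδ - v‖)
      have h2 := mul_nonneg (abs_nonneg (Real.log a))
        (add_nonneg (abs_nonneg (Real.log ‖uδ - v‖)) hY0)
      linarith
    have hgrow : HTAWGM.growthInv γ (C₀ * G / (a * ‖uδ - v‖)) ≤
        HTAWGM.growthInv γ (C * G / ‖uδ - v‖) := by
      refine HTAWGM.growthInv_mono hγtop ?_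
      rw [show C₀ * G / (a * ‖uδ - v‖) = C₀ / a * G / ‖uδ - v‖ by field_simp]
      gcongr
      rw [hC]
      exact le_add_of_nonneg_left (by positivity)
    have hfac : (C₀ * rA * (1 + |Real.log (a * ‖uδ - v‖)|) ^ 2) ^ (m * Q.IStar) ≤
        C * (rA : ℝ) ^ (m * Q.IStar) *
          (1 + |Real.log ‖uδ - v‖| + Y) ^ (2 * m * Q.IStar) := by
      calc _ ≤ (C₀ * rA * ((1 + |Real.log a|) * (1 + |Real.log ‖uδ - v‖| + Y)) ^ 2) ^
            (m * Q.IStar) := by gcongr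
        _ = b ^ (m * Q.IStar) * (rA : ℝ) ^ (m * Q.IStar) *
            (1 + |Real.log ‖uδ - v‖| + Y) ^ (2 * m * Q.IStar) := by
          rw [mul_assoc 2, pow_mul _ 2, ← mul_pow, ← mul_pow, hb]
          congr 1
          ring
        _ ≤ _ := by
          gcongr
          refine (pow_le_pow_right₀ hb1 (Nat.mul_le_mul_right _ hm)).trans ?_
          rw [hC]
          exact le_add_of_nonneg_right (by positivity)
    have hrf0 : (0 : ℝ) ≤ rf := Nat.cast_nonneg _
    calc (X : ℝ) ≤ X + rf := le_add_of_nonneg_right hrf0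
      _ ≤ _ := hXle
      _ ≤ _ := by gcongr
  calc (HTAWGM.htRank T v : ℝ≥0∞) ≤ ((X : ℕ∞) : ℝ≥0∞) := ENat.toENNReal_le.2 hX
    _ = ENNReal.ofReal (X : ℝ) := by rw [ENat.toENNReal_coe, ENNReal.ofReal_natCast]
    _ ≤ _ := ENNReal.ofReal_le_ofReal hXr
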